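/- Let $p$ be a prime, let $S$ be a finite $p$-group, let $\mathcal F$ be a saturated fusion system over $S$, and let $\mathcal R$ be a commutative ring with unit that is $p$-local, that is, in which every prime number other than $p$ is invertible. Let $\mu_{\mathcal R}(\mathcal F)$ be the Mackey algebra of $\mathcal F$: the extension of scalars to $\mathcal R$ of the Grothendieck ring of the semiring generated, under disjoint union and composition of bisets, by the isomorphism classes of bisets $I_H^K=(K\times H)/\Delta(H,\mathrm{id})$, $R_H^K=(H\times K)/\Delta(H,\mathrm{id})$ for $H\le K\le S$, and $c_\varphi=(\varphi(H)\times H)/\Delta(H,\varphi)$ for isomorphisms $\varphi\colon H\to\varphi(H)$ in $\mathcal F$, where $\Delta(H,\varphi)=\{(\varphi(x),x):x\in H\}$. A Mackey functor over $\mathcal F$ on $\mathcal R$ is a finitely generated left $\mu_{\mathcal R}(\mathcal F)$-module. If $\mathcal G$ is a saturated fusion system over a finite $p$-group $T\ge S$ with $\mathcal F\subseteq\mathcal G$, such an $M$ is called $\mathcal G$-centric if $I_K^K\cdot M=0$ for every $K\le S$ that is not $\mathcal G$-centric; it is called centric if it is $\mathcal F$-centric. For an $\mathcal F$-centric subgroup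 $H\le S$ let $\mathcal F_H(H)$ be the fusion system over $H$ given by conjugation in $H$, put $1_H=\sum_{K\le H}I_K^K$, which is the unit of $\mu_{\mathcal R}(\mathcal F_H(H))\subseteq\mu_{\mathcal R}(\mathcal F)$, and let $M_H=\mu_{\mathcal R}(\mathcal F)1_H\otimes_{\mu_{\mathcal R}(\mathcal F_H(H))}1_HM$. For a set $\mathcal X$ of $\mathcal F$-centric subgroups of $S$, $M$ is called $\mathcal X$-projective if the morphism $\bigoplus_{H\in\mathcal X}M_H\to M$, $y\otimes x\mapsto yx$, of $\mu_{\mathcal R}(\mathcal F)$-modules is split surjective. Such a set $\mathcal X$ is called closed under $\mathcal F$-subconjugacy if $H\in\mathcal X$ whenever $H$ is an $\mathcal F$-centric subgroup of $S$ that is $\mathcal F$-isomorphic to a subgroup of some $K\in\mathcal X$. (1) For every centric Mackey functor $M$ over $\mathcal F$ on $\mathcal R$ there is a unique minimal set $\mathcal X_M$ (the defect set of $M$) among the sets $\mathcal X$ of $\mathcal F$-centric subgroups of $S$ that are closed under $\mathcal F$-subconjugacy and such that $M$ is $\mathcal X$-projective. (2) Suppose in addition that $\mathcal R$ is a complete local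 principal ideal domain. Let $\mathcal G$ be a saturated fusion system over a finite $p$-group $T\ge S$ with $\mathcal F\subseteq\mathcal G$, and let $M$ be an indecomposable $\mathcal G$-centric Mackey functor over $\mathcal F$ on $\mathcal R$. Then $M$ admits a vertex: the maximal elements of $\mathcal X_M$ with respect to $\mathcal F$-subconjugacy form exactly one $\mathcal F$-isomorphism class, and this class contains a fully $\mathcal F$-normalized subgroup; any such subgroup is called a vertex $V_M$ of $M$. Moreover every vertex $V_M$ is $\mathcal G$-centric, and $V_M\in\mathcal X_N$ for every centric Mackey functor $N$ over $\mathcal F$ on $\mathcal R$ that has $M$ as a direct summand. -/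

import Mathlib

open scoped TensorProduct DirectSum

universe u v w

/-! ### The semiring of matrices of bisets -/

/-- A family, indexed by the pairs `(H, K)` of subgroups of a group `P`, of finite
`(H, K)`-bisets.  As usual an `(H, K)`-biset is regarded as an `(H × K)`-set, with
`h · x · k = (h, k⁻¹) • x`.  For finite `P` such a family is the formal sum of its members. -/
structure BisetMatrix (P : Type u) [Group P] where
  X : Subgroup P → Subgroup P → Type u
  fin : ∀ H K, Finite (X H K)
  act : ∀ H K : Subgroup P, MulAction (H × K) (X H K)

attribute [instance] BisetMatrix.fin BisetMatrix.act

namespace BisetMatrix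

variable {P : Type u} [Group P]

/-- Two families are isomorphic if their members are isomorphic bisets. -/
structure Iso (X Y : BisetMatrix P) where
  e : ∀ H K, X.X H K ≃ Y.X H K
  map_smul : ∀ (H K : Subgroup P) (g : H × K) (x : X.X H K), e H K (g • x) = g • e H K x

def Iso.refl (X : BisetMatrix P) : Iso X X := ⟨fun _ _ => Equiv.refl _, fun _ _ _ _ => rfl⟩

def Iso.symm {X Y : BisetMatrix P} (f : Iso X Y) : Iso Y X :=
  ⟨fun H K => (f.e H K).symm, fun H K g x => by
    rw [Equiv.symm_apply_eq, f.map_smul, Equiv.apply_symm_apply]⟩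

def Iso.trans {X Y Z : BisetMatrix P} (f : Iso X Y) (g : Iso Y Z) : Iso X Z :=
  ⟨fun H K => (f.e H K).trans (g.e H K), fun H K a x => by
    simp [f.map_smul, g.map_smul]⟩

instance setoid (P : Type u) [Group P] : Setoid (BisetMatrix P) where
  r X Y := Nonempty (Iso X Y)
  iseqv := ⟨fun X => ⟨Iso.refl X⟩, fun ⟨f⟩ => ⟨f.symm⟩, fun ⟨f⟩ ⟨g⟩ => ⟨f.trans g⟩⟩

/-- The empty family. -/
def empty (P : Type u) [Group P] : BisetMatrix P where
  X _ _ := PEmpty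
  fin _ _ := inferInstance
  act _ _ :=
    { smul := fun _ x => x
      one_smul := fun x => x.elim
      mul_smul := fun _ _ x => x.elim }

/-- Disjoint union. -/
def add (X Y : BisetMatrix P) : BisetMatrix P where
  X H K := X.X H K ⊕ Y.X H K
  fin _ _ := inferInstance
  act _ _ := inferInstance

/-- The relation `(x · j, y) ∼ (x, j · y)` that defines the product of bisets over `J`. -/
inductive Rel (X Y : BisetMatrix P) (H K : Subgroup P) :
    (Σ J : Subgroup P, X.X H J × Y.X J K) → (Σ J : Subgroup P, X.X H J × Y.X J K) → Prop
  | mk (J : Subgroup P) (j : J) (x : X.X H J) (y : Y.X J K) :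
      Rel X Y H K ⟨J, ((1 : H), j⁻¹) • x, y⟩ ⟨J, x, (j, (1 : K)) • y⟩

/-- The `(H, K)`-component `⨆_J X(H, J) ×_J Y(J, K)` of the product of two families. -/
def Comp (X Y : BisetMatrix P) (H K : Subgroup P) : Type u := Quot (Rel X Y H K)

namespace Comp

variable {X Y : BisetMatrix P} {H K : Subgroup P}

def mk (J : Subgroup P) (x : X.X H J) (y : Y.X J K) : Comp X Y H K := Quot.mk _ ⟨J, x, y⟩

theorem sound (J : Subgroup P) (j : J) (x : X.X H J) (y : Y.X J K) :
    mk J (((1 : H), j⁻¹) • x) y = mk J x ((j, (1 : K)) • y) := Quot.sound (Rel.mk J j x y)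

def lift {α : Sort*} (f : ∀ J, X.X H J → Y.X J K → α)
    (hf : ∀ (J : Subgroup P) (j : J) x y, f J (((1 : H), j⁻¹) • x) y = f J x ((j, (1 : K)) • y)) :
    Comp X Y H K → α :=
  Quot.lift (fun q => f q.1 q.2.1 q.2.2) (by rintro _ _ ⟨J, j, x, y⟩; exact hf J j x y)

theorem ind {p : Comp X Y H K → Prop} (h : ∀ J x y, p (mk J x y)) (q) : p q := by
  obtain ⟨⟨J, x, y⟩⟩ := q
  exact h J x y

@[simp] theorem lift_mk {α : Sort*} (f : ∀ J, X.X H J → Y.X J K → α) (hf) (J x y) :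
    lift f hf (mk J x y) = f J x y := rfl

instance : MulAction (H × K) (Comp X Y H K) where
  smul g := lift (fun J x y => mk J ((g.1, (1 : J)) • x) (((1 : J), g.2) • y)) (by
    intro J j x y
    have h1 : ((g.1, (1 : J)) • ((1 : H), j⁻¹) • x) = ((1 : H), j⁻¹) • (g.1, (1 : J)) • x := by
      simp [smul_smul]
    have h2 : (((1 : J), g.2) • (j, (1 : K)) • y) = (j, (1 : K)) • ((1 : J), g.2) • y := by
      simp [smul_smul]
    rw [h1, h2, sound])
  one_smul := ind fun J x y => by
    change mk J (((1 : H), (1 : J)) • x) (((1 : J), (1 : K)) • y) = _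
    rw [← Prod.one_eq_mk, ← Prod.one_eq_mk, one_smul, one_smul]
  mul_smul g g' := ind fun J x y => by
    change mk J ((g.1 * g'.1, (1 : J)) • x) (((1 : J), g.2 * g'.2) • y) =
      mk J ((g.1, (1 : J)) • (g'.1, (1 : J)) • x) (((1 : J), g.2) • ((1 : J), g'.2) • y)
    simp [smul_smul]

theorem smul_mk (g : H × K) (J : Subgroup P) (x : X.X H J) (y : Y.X J K) :
    g • mk J x y = mk J ((g.1, (1 : J)) • x) (((1 : J), g.2) • y) := rfl

end Comp

/-- The product of two families. -/
def mul [Finite P] (X Y : BisetMatrix P) : BisetMatrix P where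
  X := Comp X Y
  fin H K := by unfold Comp; infer_instance
  act _ _ := inferInstance

def addIso {X X' Y Y' : BisetMatrix P} (f : Iso X X') (g : Iso Y Y') :
    Iso (add X Y) (add X' Y') where
  e H K := Equiv.sumCongr (f.e H K) (g.e H K)
  map_smul H K a := by
    rintro (x | y)
    · exact congrArg Sum.inl (f.map_smul H K a x)
    · exact congrArg Sum.inr (g.map_smul H K a y)

def mulIsoFun {X X' Y Y' : BisetMatrix P} (f : Iso X X') (g : Iso Y Y') (H K : Subgroup P) :
    Comp X Y H K → Comp X' Y' H K :=
  Comp.lift (fun J x y => Comp.mk J (f.e H J x) (g.e J K y)) (by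
    intro J j x y
    rw [f.map_smul, g.map_smul, Comp.sound])

def mulIso [Finite P] {X X' Y Y' : BisetMatrix P} (f : Iso X X') (g : Iso Y Y') :
    Iso (mul X Y) (mul X' Y') where
  e H K :=
    { toFun := mulIsoFun f g H K
      invFun := mulIsoFun f.symm g.symm H K
      left_inv := Comp.ind fun J x y => by
        simp only [mulIsoFun, Iso.symm, Comp.lift_mk, Equiv.symm_apply_apply]
        rfl
      right_inv := Comp.ind fun J x y => by
        simp only [mulIsoFun, Iso.symm, Comp.lift_mk, Equiv.apply_symm_apply]
        rfl }
  map_smul H K a := Comp.ind fun J x y => by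
    change Comp.mk J (f.e H J ((a.1, (1 : J)) • x)) (g.e J K (((1 : J), a.2) • y)) =
      Comp.mk J ((a.1, (1 : J)) • f.e H J x) (((1 : J), a.2) • g.e J K y)
    rw [f.map_smul, g.map_smul]

def mulAssocIso [Finite P] (X Y Z : BisetMatrix P) :
    Iso (mul (mul X Y) Z) (mul X (mul Y Z)) where
  e H K :=
    { toFun := Comp.lift (X := mul X Y) (Y := Z) (fun J q z =>
        Comp.lift (fun I x y => (Comp.mk I x (Comp.mk J y z : (mul Y Z).X I K) :
          (mul X (mul Y Z)).X H K)) (by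
            intro I i x y
            refine (Comp.sound (Y := mul Y Z) I i x _).trans ?_
            change Comp.mk (Y := mul Y Z) I x
              (Comp.mk J ((i, (1 : J)) • y) (((1 : J), (1 : K)) • z)) = _
            rw [← Prod.one_eq_mk, one_smul]) q) (by
          intro J j q z
          induction q using Comp.ind with | _ I x y
          change Comp.mk (Y := mul Y Z) I (((1 : H), (1 : I)) • x)
              (Comp.mk J (((1 : I), j⁻¹) • y) z) =
            Comp.mk (Y := mul Y Z) I x (Comp.mk J y ((j, (1 : K)) • z))
          rw [← Prod.one_eq_mk, one_smul, Comp.sound])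
      invFun := Comp.lift (X := X) (Y := mul Y Z) (fun I x q =>
        Comp.lift (fun J y z => (Comp.mk J (Comp.mk I x y : (mul X Y).X H J) z :
          (mul (mul X Y) Z).X H K)) (by
            intro J j y z
            refine Eq.trans ?_ (Comp.sound (X := mul X Y) J j _ z)
            change _ = Comp.mk (X := mul X Y) J
              (Comp.mk I (((1 : H), (1 : I)) • x) (((1 : I), j⁻¹) • y)) z
            rw [← Prod.one_eq_mk, one_smul]) q) (by
          intro I i x q
          induction q using Comp.ind with | _ J y z
          change Comp.mk (X := mul X Y) J (Comp.mk I (((1 : H), i⁻¹) • x) y) z =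
            Comp.mk (X := mul X Y) J (Comp.mk I x ((i, (1 : J)) • y)) (((1 : J), (1 : K)) • z)
          rw [← Prod.one_eq_mk, one_smul, Comp.sound])
      left_inv := Comp.ind fun J q z => by
        induction q using Comp.ind with | _ I x y
        rfl
      right_inv := Comp.ind fun I x q => by
        induction q using Comp.ind with | _ J y z
        rfl }
  map_smul H K a := Comp.ind fun J q z => by
    induction q using Comp.ind with | _ I x y
    rfl

def addCommIso (X Y : BisetMatrix P) : Iso (add X Y) (add Y X) where
  e _ _ := Equiv.sumComm _ _
  map_smul H K a := by rintro (x | y) <;> rfl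

def addAssocIso (X Y Z : BisetMatrix P) : Iso (add (add X Y) Z) (add X (add Y Z)) where
  e _ _ := Equiv.sumAssoc _ _ _
  map_smul H K a := by rintro ((x | y) | z) <;> rfl

def emptyAddIso (X : BisetMatrix P) : Iso (add (empty P) X) X where
  e _ _ := Equiv.emptySum PEmpty _
  map_smul H K a := by
    rintro (x | x)
    · exact PEmpty.elim x
    · rfl

def emptyIso {X Y : BisetMatrix P} (hX : ∀ H K, IsEmpty (X.X H K)) (hY : ∀ H K, IsEmpty (Y.X H K)) :
    Iso X Y where
  e _ _ := Equiv.equivOfIsEmpty _ _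
  map_smul H K _ x := ((hX H K).false x).elim

def mulAddIso [Finite P] (X Y Z : BisetMatrix P) :
    Iso (mul X (add Y Z)) (add (mul X Y) (mul X Z)) where
  e H K :=
    { toFun := Comp.lift (X := X) (Y := add Y Z) (fun J x (q : Y.X J K ⊕ Z.X J K) =>
        (q.elim (fun y => Sum.inl (Comp.mk J x y)) (fun z => Sum.inr (Comp.mk J x z)) :
          Comp X Y H K ⊕ Comp X Z H K)) (by
            rintro J j x (y | z)
            · exact congrArg Sum.inl (Comp.sound J j x y)
            · exact congrArg Sum.inr (Comp.sound J j x z))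
      invFun := Sum.elim
        (Comp.lift (fun J x y => Comp.mk (Y := add Y Z) J x (Sum.inl y))
          fun J j x y => Comp.sound (Y := add Y Z) J j x (Sum.inl y))
        (Comp.lift (fun J x y => Comp.mk (Y := add Y Z) J x (Sum.inr y))
          fun J j x y => Comp.sound (Y := add Y Z) J j x (Sum.inr y))
      left_inv := Comp.ind fun J x q => by rcases q with y | z <;> rfl
      right_inv := by
        rintro (q | q) <;> induction q using Comp.ind <;> rfl }
  map_smul H K a := Comp.ind fun J x q => by rcases q with y | z <;> rfl

def addMulIso [Finite P] (X Y Z : BisetMatrix P) :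
    Iso (mul (add X Y) Z) (add (mul X Z) (mul Y Z)) where
  e H K :=
    { toFun := Comp.lift (X := add X Y) (Y := Z) (fun J (q : X.X H J ⊕ Y.X H J) z =>
        (q.elim (fun x => Sum.inl (Comp.mk J x z)) (fun y => Sum.inr (Comp.mk J y z)) :
          Comp X Z H K ⊕ Comp Y Z H K)) (by
            rintro J j (x | y) z
            · exact congrArg Sum.inl (Comp.sound J j x z)
            · exact congrArg Sum.inr (Comp.sound J j y z))
      invFun := Sum.elim
        (Comp.lift (fun J x z => Comp.mk (X := add X Y) J (Sum.inl x) z)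
          fun J j x z => Comp.sound (X := add X Y) J j (Sum.inl x) z)
        (Comp.lift (fun J x z => Comp.mk (X := add X Y) J (Sum.inr x) z)
          fun J j x z => Comp.sound (X := add X Y) J j (Sum.inr x) z)
      left_inv := Comp.ind fun J q z => by rcases q with x | y <;> rfl
      right_inv := by
        rintro (q | q) <;> induction q using Comp.ind <;> rfl }
  map_smul H K a := Comp.ind fun J q z => by rcases q with x | y <;> rfl

theorem isEmpty_mul_left [Finite P] (X Y : BisetMatrix P) (h : ∀ H K, IsEmpty (X.X H K)) (H K) :
    IsEmpty ((mul X Y).X H K) := ⟨Comp.ind fun J x _ => (h H J).false x⟩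

theorem isEmpty_mul_right [Finite P] (X Y : BisetMatrix P) (h : ∀ H K, IsEmpty (Y.X H K)) (H K) :
    IsEmpty ((mul X Y).X H K) := ⟨Comp.ind fun J _ y => (h J K).false y⟩

theorem isEmpty_empty (H K : Subgroup P) : IsEmpty ((empty P).X H K) :=
  ⟨fun x => PEmpty.elim x⟩

end BisetMatrix

/-- Isomorphism classes of families of finite bisets: the commutative monoid generated by the
isomorphism classes of finite `(H, K)`-bisets, for all subgroups `H`, `K` of `P`, with the
relations `[X] + [Y] = [X ⊔ Y]`. -/
def BisetSemiring (P : Type u) [Group P] : Type (u + 1) := Quotient (BisetMatrix.setoid P)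

namespace BisetSemiring

open BisetMatrix

variable {P : Type u} [Group P]

/-- The class of a family of bisets. -/
def cls (X : BisetMatrix P) : BisetSemiring P := Quotient.mk _ X

theorem cls_eq {X Y : BisetMatrix P} (f : Iso X Y) : cls X = cls Y := Quotient.sound ⟨f⟩

instance : Zero (BisetSemiring P) := ⟨cls (empty P)⟩

instance : Add (BisetSemiring P) :=
  ⟨Quotient.map₂ add fun _ _ ⟨f⟩ _ _ ⟨g⟩ => ⟨addIso f g⟩⟩

/-- Addition is disjoint union, and multiplication is the product of bisets; the product of an
`(H, J)`-biset and a `(J', K)`-biset is zero when `J ≠ J'`. -/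
instance [Finite P] : Mul (BisetSemiring P) :=
  ⟨Quotient.map₂ mul fun _ _ ⟨f⟩ _ _ ⟨g⟩ => ⟨mulIso f g⟩⟩

instance [Finite P] : NonUnitalSemiring (BisetSemiring P) where
  zero_add := by rintro ⟨X⟩; exact cls_eq (emptyAddIso X)
  add_zero := by rintro ⟨X⟩; exact cls_eq ((addCommIso _ _).trans (emptyAddIso X))
  add_assoc := by rintro ⟨X⟩ ⟨Y⟩ ⟨Z⟩; exact cls_eq (addAssocIso X Y Z)
  add_comm := by rintro ⟨X⟩ ⟨Y⟩; exact cls_eq (addCommIso X Y)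
  mul_assoc := by rintro ⟨X⟩ ⟨Y⟩ ⟨Z⟩; exact cls_eq (mulAssocIso X Y Z)
  left_distrib := by rintro ⟨X⟩ ⟨Y⟩ ⟨Z⟩; exact cls_eq (mulAddIso X Y Z)
  right_distrib := by rintro ⟨X⟩ ⟨Y⟩ ⟨Z⟩; exact cls_eq (addMulIso X Y Z)
  zero_mul := by
    rintro ⟨X⟩
    exact cls_eq (emptyIso (isEmpty_mul_left _ _ isEmpty_empty) isEmpty_empty)
  mul_zero := by
    rintro ⟨X⟩
    exact cls_eq (emptyIso (isEmpty_mul_right _ _ isEmpty_empty) isEmpty_empty)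
  nsmul := nsmulRec

end BisetSemiring

/-! ### Fusion systems -/

/-- A fusion system (not necessarily saturated) over a subgroup `S` of an ambient group `P`. Its
objects are the subgroups of `S`. -/
structure FusionSystem {P : Type u} [Group P] (S : Subgroup P) where
  Hom : ∀ H K : Subgroup P, Set (H →* K)
  le_left : ∀ {H K : Subgroup P} {φ : H →* K}, φ ∈ Hom H K → H ≤ S
  le_right : ∀ {H K : Subgroup P} {φ : H →* K}, φ ∈ Hom H K → K ≤ S
  injective : ∀ {H K : Subgroup P} {φ : H →* K}, φ ∈ Hom H K → Function.Injective φ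
  comp_mem : ∀ {H K L : Subgroup P} {φ : H →* K} {ψ : K →* L},
    φ ∈ Hom H K → ψ ∈ Hom K L → ψ.comp φ ∈ Hom H L
  /-- Conjugation by an element of `S`, followed by inclusion, is a morphism. -/
  conj_mem : ∀ {H K : Subgroup P} (φ : H →* K), H ≤ S → K ≤ S →
    (∃ s ∈ S, ∀ x : H, (φ x : P) = s * x * s⁻¹) → φ ∈ Hom H K
  /-- The corestriction `e` of a morphism to its image `L`, and its inverse, are morphisms. -/
  image_mem : ∀ {H K L : Subgroup P} {φ : H →* K} (e : H ≃* L), φ ∈ Hom H K →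
    (∀ x : H, (e x : P) = φ x) → e.toMonoidHom ∈ Hom H L ∧ e.symm.toMonoidHom ∈ Hom L H

namespace FusionSystem

variable {P : Type u} [Group P] {S T : Subgroup P}

/-- The fusion system `𝓕_H(H)`: the morphisms are conjugations by elements of `H`, followed by
inclusion. -/
def inner (H : Subgroup P) : FusionSystem H where
  Hom A B := {φ | A ≤ H ∧ B ≤ H ∧ ∃ s ∈ H, ∀ x : A, (φ x : P) = s * x * s⁻¹}
  le_left h := h.1
  le_right h := h.2.1
  injective := by
    rintro A B φ ⟨-, -, s, -, hs⟩ x y hxy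
    have h := hs x
    rw [hxy, hs y] at h
    exact Subtype.ext (by simpa using h.symm)
  comp_mem := by
    rintro A B C φ ψ ⟨hA, -, s, hs, hs'⟩ ⟨-, hC, t, ht, ht'⟩
    refine ⟨hA, hC, t * s, mul_mem ht hs, fun x => ?_⟩
    simp [ht', hs', mul_assoc]
  conj_mem φ hA hB h := ⟨hA, hB, h⟩
  image_mem := by
    rintro A B L φ e ⟨hA, -, s, hs, hs'⟩ he
    have hL : L ≤ H := by
      intro y hy
      obtain ⟨x, hx⟩ := e.surjective ⟨y, hy⟩
      have : y = s * x * s⁻¹ := by rw [← hs', ← he, hx]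
      rw [this]
      exact mul_mem (mul_mem hs (hA x.2)) (inv_mem hs)
    refine ⟨⟨hA, hL, s, hs, fun x => (he x).trans (hs' x)⟩, ⟨hL, hA, s⁻¹, inv_mem hs, fun y => ?_⟩⟩
    obtain ⟨x, rfl⟩ := e.surjective y
    have h1 : ((e.symm.toMonoidHom (e x) : A) : P) = x := by simp
    rw [h1, he, hs']
    group

/-- `E ⊆ F`. -/
def IsSub (E : FusionSystem T) (F : FusionSystem S) : Prop := ∀ H K, E.Hom H K ⊆ F.Hom H K

theorem inner_isSub (F : FusionSystem S) {H : Subgroup P} (hH : H ≤ S) : (inner H).IsSub F :=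
  fun _ _ φ h => F.conj_mem φ (h.1.trans hH) (h.2.1.trans hH)
    ⟨h.2.2.choose, hH h.2.2.choose_spec.1, h.2.2.choose_spec.2⟩

theorem IsSub.le {E : FusionSystem T} {F : FusionSystem S} (h : E.IsSub F) : T ≤ S :=
  F.le_left (h T T (E.conj_mem (MonoidHom.id T) le_rfl le_rfl ⟨1, one_mem T, by simp⟩))

variable (F : FusionSystem S)

/-- `H =_F K`. -/
def IsConj (H K : Subgroup P) : Prop := ∃ φ ∈ F.Hom H K, Function.Bijective φ

/-- `H ≤_F K`. -/
def IsSubconj (H K : Subgroup P) : Prop := ∃ J ≤ K, F.IsConj H J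

/-- `F`-centric subgroups of `S`. -/
def IsCentric (H : Subgroup P) : Prop :=
  H ≤ S ∧ ∀ K, F.IsConj H K → S ⊓ Subgroup.centralizer (K : Set P) ≤ K

/-- The type of `F`-centric subgroups of `S`. -/
abbrev Centric : Type u := {H : Subgroup P // F.IsCentric H}

/-- `H ≤ S` is fully `F`-normalized if `|N_S(K)| ≤ |N_S(H)|` whenever `K =_F H`. -/
def IsFullyNormalized (H : Subgroup P) : Prop :=
  H ≤ S ∧ ∀ K, F.IsConj H K →
    Nat.card ↥(S ⊓ Subgroup.normalizer (K : Set P)) ≤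
      Nat.card ↥(S ⊓ Subgroup.normalizer (H : Set P))

/-- The image of a homomorphism between subgroups of `P`, as a subgroup of `P`. -/
def image {H K : Subgroup P} (φ : H →* K) : Subgroup P := (K.subtype.comp φ).range

/-- The subgroup `N_φ` of `N_S(H)`, consisting of the `x` such that some `z ∈ N_S(φ(H))` satisfies
`φ(x h x⁻¹) = z φ(h) z⁻¹` for all `h ∈ H`. -/
def phiNormalizer (S : Subgroup P) {H K : Subgroup P} (φ : H →* K) : Subgroup P where
  carrier := {x | x ∈ S ⊓ Subgroup.normalizer (H : Set P) ∧
    ∃ z ∈ S ⊓ Subgroup.normalizer (image φ : Set P),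
      ∀ h h' : H, (h' : P) = x * h * x⁻¹ → (φ h' : P) = z * φ h * z⁻¹}
  one_mem' := ⟨one_mem _, 1, one_mem _, fun h h' e => by
    have : h' = h := Subtype.ext (by simpa using e)
    simp [this]⟩
  mul_mem' := by
    rintro x y ⟨hx, z, hz, hxz⟩ ⟨hy, w, hw, hyw⟩
    refine ⟨mul_mem hx hy, z * w, mul_mem hz hw, fun h h' e => ?_⟩
    have hm : y * h * y⁻¹ ∈ H := (Subgroup.mem_normalizer_iff.1 hy.2 h).1 h.2
    rw [hxz ⟨_, hm⟩ h' (by rw [e]; simp [mul_assoc]), hyw h ⟨_, hm⟩ rfl]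
    simp [mul_assoc]
  inv_mem' := by
    rintro x ⟨hx, z, hz, hxz⟩
    refine ⟨inv_mem hx, z⁻¹, inv_mem hz, fun h h' e => ?_⟩
    rw [hxz h' h (by rw [e]; simp [mul_assoc])]
    simp [mul_assoc]

/-- `Aut_F(S)`. -/
def autTop : Subgroup (MulAut S) where
  carrier := {α | α.toMonoidHom ∈ F.Hom S S}
  one_mem' := F.conj_mem _ le_rfl le_rfl ⟨1, one_mem S, fun x => by simp⟩
  mul_mem' {a b} ha hb := F.comp_mem (φ := b.toMonoidHom) (ψ := a.toMonoidHom) hb ha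
  inv_mem' {a} ha := (F.image_mem (φ := a.toMonoidHom) a ha fun _ => rfl).2

/-- Saturation: `Aut_S(S)` is a Sylow `p`-subgroup of `Aut_F(S)`, and each `φ : H → S` in `F` with
fully `F`-normalized image extends to a morphism `N_φ → S` in `F`. -/
structure IsSaturated (p : ℕ) (F : FusionSystem S) : Prop where
  sylow : ∃ Q : Sylow p F.autTop,
    (Q : Subgroup F.autTop) = (MulAut.conj : S →* MulAut S).range.subgroupOf F.autTop
  extend : ∀ (H : Subgroup P) (φ : H →* S), φ ∈ F.Hom H S → F.IsFullyNormalized (image φ) →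
    ∃ ψ ∈ F.Hom (phiNormalizer S φ) S,
      ∀ (x : H) (y : phiNormalizer S φ), (x : P) = y → ψ y = φ x

end FusionSystem

/-! ### The Mackey algebra -/

namespace BisetMatrix

variable {P : Type u} [Group P]

/-- The `(B, A)`-biset `(B × A) / D`, as a family with only one nonempty member. -/
def transitive [Finite P] (B A : Subgroup P) (D : Subgroup (P × P)) : BisetMatrix P where
  X H K := {_q : (H × K) ⧸ D.comap (H.subtype.prodMap K.subtype) // H = B ∧ K = A}
  fin _ _ := inferInstance
  act _ _ :=
    { smul := fun g q => ⟨g • q.1, q.2⟩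
      one_smul := fun q => Subtype.ext (one_smul _ q.1)
      mul_smul := fun a b q => Subtype.ext (mul_smul a b q.1) }

/-- The twisted diagonal `{(φ(x), x) | x ∈ H}`, as a subgroup of `P × P`. -/
def twistedDiagonal {H K : Subgroup P} (φ : H →* K) : Subgroup (P × P) :=
  ((K.subtype.comp φ).prod H.subtype).range

end BisetMatrix

namespace BisetSemiring

open BisetMatrix

variable {P : Type u} [Group P] [Finite P]

/-- The induction `I_H^K`, the class of the `(K, H)`-biset `(K × H) / Δ(H, id)`, for `H ≤ K`. -/
def ind (H K : Subgroup P) : BisetSemiring P :=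
  cls (transitive K H (twistedDiagonal (MonoidHom.id H)))

/-- The restriction `R_H^K`, the class of the `(H, K)`-biset `(H × K) / Δ(H, id)`, for `H ≤ K`. -/
def res (H K : Subgroup P) : BisetSemiring P :=
  cls (transitive H K (twistedDiagonal (MonoidHom.id H)))

/-- The conjugation `c_φ`, the class of the `(K, H)`-biset `(K × H) / Δ(H, φ)`, for an isomorphism
`φ : H → K`. -/
def conj {H K : Subgroup P} (φ : H →* K) : BisetSemiring P :=
  cls (transitive K H (twistedDiagonal φ))

end BisetSemiring

namespace BisetMatrix

variable {P : Type u} [Group P]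

theorem mem_twistedDiagonal_id {H : Subgroup P} {x : P × P} :
    x ∈ twistedDiagonal (MonoidHom.id H) ↔ x.1 ∈ H ∧ x.1 = x.2 := by
  constructor
  · rintro ⟨y, rfl⟩
    exact ⟨y.2, rfl⟩
  · rintro ⟨h, e⟩
    exact ⟨⟨x.1, h⟩, Prod.ext rfl e⟩

variable [Finite P]

def unitMulFun {B A : Subgroup P} (D : Subgroup (P × P)) {H J K : Subgroup P}
    (q : (transitive B B (twistedDiagonal (MonoidHom.id B))).X H J)
    (r : (transitive B A D).X J K) : (transitive B A D).X H K :=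
  ⟨Quotient.map₂ (sa := QuotientGroup.leftRel _) (sb := QuotientGroup.leftRel _)
      (sc := QuotientGroup.leftRel _)
    (fun (a : H × J) (b : J × K) => ((⟨a.1 * (a.2 : P)⁻¹ * b.1,
      mul_mem (mul_mem a.1.2 (inv_mem ((q.2.1.trans q.2.2.symm).ge a.2.2)))
        ((q.2.1.trans q.2.2.symm).ge b.1.2)⟩ : H), b.2)) (by
      intro a a' haa' b b' hbb'
      replace haa' := Subgroup.mem_comap.1 (QuotientGroup.leftRel_apply.1 haa')
      replace hbb' := Subgroup.mem_comap.1 (QuotientGroup.leftRel_apply.1 hbb')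
      refine QuotientGroup.leftRel_apply.2 (Subgroup.mem_comap.2 ?_)
      have h1 : (a.1 : P)⁻¹ * a'.1 = (a.2 : P)⁻¹ * a'.2 := (mem_twistedDiagonal_id.1 haa').2
      have hD : ((b.1 : P)⁻¹ * b'.1, (b.2 : P)⁻¹ * b'.2) ∈ D := hbb'
      change (((a.1 : P) * (a.2 : P)⁻¹ * b.1)⁻¹ * ((a'.1 : P) * (a'.2 : P)⁻¹ * b'.1),
        (b.2 : P)⁻¹ * b'.2) ∈ D
      convert hD using 2
      have h2 : (a'.1 : P) = a.1 * ((a.2 : P)⁻¹ * a'.2) := by rw [← h1]; group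
      rw [h2]
      group) q.1 r.1, q.2.1, r.2.2⟩

def unitMulIso (B A : Subgroup P) (D : Subgroup (P × P)) :
    Iso (mul (transitive B B (twistedDiagonal (MonoidHom.id B))) (transitive B A D))
      (transitive B A D) where
  e H K :=
    { toFun := Comp.lift (fun _ q r => unitMulFun D q r) (by
        rintro J j ⟨⟨a⟩, ha⟩ ⟨⟨b⟩, hb⟩
        refine Subtype.ext (QuotientGroup.eq.2 ?_)
        rw [Subgroup.mem_comap]
        convert one_mem D
        refine Prod.ext ?_ ?_ <;> simp [mul_assoc])
      invFun := fun r => Comp.mk (X := transitive B B (twistedDiagonal (MonoidHom.id B))) H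
        ⟨((1 : H × H) : (H × H) ⧸ _), r.2.1, r.2.1⟩ r
      left_inv := Comp.ind (by
        rintro J ⟨⟨a⟩, hH, hJ⟩ ⟨⟨b⟩, hJ', hK⟩
        subst hH
        subst hJ
        have h := Comp.sound (X := transitive J J (twistedDiagonal (MonoidHom.id J)))
          (Y := transitive J A D) (H := J) (K := K) J (a.1 * a.2⁻¹)
          ⟨((1 : J × J) : (J × J) ⧸ _), rfl, rfl⟩ ⟨(b : (J × K) ⧸ _), rfl, hK⟩
        refine Eq.trans ?_ (h.symm.trans ?_)
        · refine congrArg _ (Subtype.ext (QuotientGroup.eq.2 ?_))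
          rw [Subgroup.mem_comap]
          convert one_mem D
          refine Prod.ext ?_ ?_ <;> simp [mul_assoc]
        · refine congrFun (congrArg _ (Subtype.ext (QuotientGroup.eq.2 ?_))) _
          rw [Subgroup.mem_comap, mem_twistedDiagonal_id]
          simp)
      right_inv := by
        rintro ⟨⟨b⟩, hH, hK⟩
        refine Subtype.ext (QuotientGroup.eq.2 ?_)
        rw [Subgroup.mem_comap]
        convert one_mem D
        refine Prod.ext ?_ ?_ <;> simp }
  map_smul H K g := Comp.ind (by
    rintro J ⟨⟨a⟩, ha⟩ ⟨⟨b⟩, hb⟩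
    refine Subtype.ext (QuotientGroup.eq.2 ?_)
    rw [Subgroup.mem_comap]
    convert one_mem D
    refine Prod.ext ?_ ?_ <;> simp [mul_assoc])

def mulUnitFun {B A : Subgroup P} (D : Subgroup (P × P)) {H J K : Subgroup P}
    (q : (transitive B A D).X H J)
    (r : (transitive A A (twistedDiagonal (MonoidHom.id A))).X J K) : (transitive B A D).X H K :=
  ⟨Quotient.map₂ (sa := QuotientGroup.leftRel _) (sb := QuotientGroup.leftRel _)
      (sc := QuotientGroup.leftRel _)
    (fun (a : H × J) (b : J × K) => (a.1, (⟨b.2 * (b.1 : P)⁻¹ * a.2,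
      mul_mem (mul_mem b.2.2 (inv_mem ((r.2.1.trans r.2.2.symm).le b.1.2)))
        ((r.2.1.trans r.2.2.symm).le a.2.2)⟩ : K))) (by
      intro a a' haa' b b' hbb'
      replace haa' := Subgroup.mem_comap.1 (QuotientGroup.leftRel_apply.1 haa')
      replace hbb' := Subgroup.mem_comap.1 (QuotientGroup.leftRel_apply.1 hbb')
      refine QuotientGroup.leftRel_apply.2 (Subgroup.mem_comap.2 ?_)
      have h1 : (b.1 : P)⁻¹ * b'.1 = (b.2 : P)⁻¹ * b'.2 := (mem_twistedDiagonal_id.1 hbb').2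
      have hD : ((a.1 : P)⁻¹ * a'.1, (a.2 : P)⁻¹ * a'.2) ∈ D := haa'
      change ((a.1 : P)⁻¹ * a'.1, ((b.2 : P) * (b.1 : P)⁻¹ * a.2)⁻¹ *
        ((b'.2 : P) * (b'.1 : P)⁻¹ * a'.2)) ∈ D
      convert hD using 2
      have h2 : (b'.2 : P) = b.2 * ((b.1 : P)⁻¹ * b'.1) := by rw [h1]; group
      rw [h2]
      group) q.1 r.1, q.2.1, r.2.2⟩

def mulUnitIso (B A : Subgroup P) (D : Subgroup (P × P)) :
    Iso (mul (transitive B A D) (transitive A A (twistedDiagonal (MonoidHom.id A))))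
      (transitive B A D) where
  e H K :=
    { toFun := Comp.lift (fun _ q r => mulUnitFun D q r) (by
        rintro J j ⟨⟨a⟩, ha⟩ ⟨⟨b⟩, hb⟩
        refine Subtype.ext (QuotientGroup.eq.2 ?_)
        rw [Subgroup.mem_comap]
        convert one_mem D
        refine Prod.ext ?_ ?_ <;> simp [mul_assoc])
      invFun := fun q => Comp.mk (Y := transitive A A (twistedDiagonal (MonoidHom.id A))) K
        q ⟨((1 : K × K) : (K × K) ⧸ _), q.2.2, q.2.2⟩
      left_inv := Comp.ind (by
        rintro J ⟨⟨a⟩, hH, hJ'⟩ ⟨⟨b⟩, hJ, hK⟩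
        subst hK
        subst hJ
        have h := Comp.sound (X := transitive B J D)
          (Y := transitive J J (twistedDiagonal (MonoidHom.id J))) (H := H) (K := J) J
          (b.1 * b.2⁻¹) ⟨(a : (H × J) ⧸ _), hH, rfl⟩ ⟨((1 : J × J) : (J × J) ⧸ _), rfl, rfl⟩
        refine Eq.trans ?_ (h.trans ?_)
        · refine congrFun (congrArg _ (Subtype.ext (QuotientGroup.eq.2 ?_))) _
          rw [Subgroup.mem_comap]
          convert one_mem D
          refine Prod.ext ?_ ?_ <;> simp [mul_assoc]
        · refine congrArg _ (Subtype.ext (QuotientGroup.eq.2 ?_))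
          rw [Subgroup.mem_comap, mem_twistedDiagonal_id]
          simp)
      right_inv := by
        rintro ⟨⟨b⟩, hH, hK⟩
        refine Subtype.ext (QuotientGroup.eq.2 ?_)
        rw [Subgroup.mem_comap]
        convert one_mem D
        refine Prod.ext ?_ ?_ <;> simp }
  map_smul H K g := Comp.ind (by
    rintro J ⟨⟨a⟩, ha⟩ ⟨⟨b⟩, hb⟩
    refine Subtype.ext (QuotientGroup.eq.2 ?_)
    rw [Subgroup.mem_comap]
    convert one_mem D
    refine Prod.ext ?_ ?_ <;> simp [mul_assoc])

theorem isEmpty_mul_transitive {B A B' A' : Subgroup P} {D D' : Subgroup (P × P)} (h : A ≠ B')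
    (H K : Subgroup P) : IsEmpty ((mul (transitive B A D) (transitive B' A' D')).X H K) :=
  ⟨Comp.ind fun _ q r => h (q.2.2.symm.trans r.2.1)⟩

end BisetMatrix

namespace BisetSemiring

open BisetMatrix

variable {P : Type u} [Group P] [Finite P]

/-- The element `∑_{K ≤ S} I_K^K`. -/
noncomputable def unit (S : Subgroup P) : BisetSemiring P :=
  ∑ K ∈ (Set.toFinite {K : Subgroup P | K ≤ S}).toFinset, ind K K

theorem unit_mul_transitive {S B : Subgroup P} (hB : B ≤ S) (A : Subgroup P)
    (D : Subgroup (P × P)) : unit S * cls (transitive B A D) = cls (transitive B A D) := by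
  rw [unit, Finset.sum_mul, Finset.sum_eq_single B]
  · exact cls_eq (unitMulIso B A D)
  · intro K _ hK
    exact cls_eq (emptyIso (isEmpty_mul_transitive hK) isEmpty_empty)
  · intro h
    simp [hB] at h

theorem transitive_mul_unit {S A : Subgroup P} (hA : A ≤ S) (B : Subgroup P)
    (D : Subgroup (P × P)) : cls (transitive B A D) * unit S = cls (transitive B A D) := by
  rw [unit, Finset.mul_sum, Finset.sum_eq_single A]
  · exact cls_eq (mulUnitIso B A D)
  · intro K _ hK
    exact cls_eq (emptyIso (isEmpty_mul_transitive (Ne.symm hK)) isEmpty_empty)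
  · intro h
    simp [hA] at h

end BisetSemiring

namespace FusionSystem

open BisetSemiring

variable {P : Type u} [Group P] [Finite P] {S T : Subgroup P}

/-- The elements `I_H^K`, `R_H^K` and `c_φ`, for `H ≤ K ≤ S` and isomorphisms `φ` in `F`. -/
def mackeyGenerators (F : FusionSystem S) : Set (BisetSemiring P) :=
  {x | ∃ H K : Subgroup P, H ≤ K ∧ K ≤ S ∧ x = ind H K} ∪
  {x | ∃ H K : Subgroup P, H ≤ K ∧ K ≤ S ∧ x = res H K} ∪
  {x | ∃ (H K : Subgroup P) (φ : H →* K), φ ∈ F.Hom H K ∧ Function.Bijective φ ∧ x = conj φ}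

/-- The subsemiring generated by the elements `I_H^K`, `R_H^K` and `c_φ`. -/
def mackeySemiring (F : FusionSystem S) : NonUnitalSubsemiring (BisetSemiring P) :=
  NonUnitalSubsemiring.closure F.mackeyGenerators

theorem ind_mem (F : FusionSystem S) {H K : Subgroup P} (h : H ≤ K) (hK : K ≤ S) :
    ind H K ∈ F.mackeySemiring :=
  NonUnitalSubsemiring.subset_closure (Or.inl (Or.inl ⟨H, K, h, hK, rfl⟩))

theorem unit_mem (F : FusionSystem S) : unit S ∈ F.mackeySemiring :=
  sum_mem fun K hK => F.ind_mem le_rfl (by simpa using hK)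

theorem unit_mul_mul_unit (F : FusionSystem S) {x : BisetSemiring P} (hx : x ∈ F.mackeySemiring) :
    unit S * x = x ∧ x * unit S = x := by
  induction hx using NonUnitalSubsemiring.closure_induction with
  | mem x hx =>
    obtain ((⟨H, K, h, hK, rfl⟩ | ⟨H, K, h, hK, rfl⟩) | ⟨H, K, φ, hφ, -, rfl⟩) := hx
    · exact ⟨unit_mul_transitive hK _ _, transitive_mul_unit (h.trans hK) _ _⟩
    · exact ⟨unit_mul_transitive (h.trans hK) _ _, transitive_mul_unit hK _ _⟩
    · exact ⟨unit_mul_transitive (F.le_right hφ) _ _, transitive_mul_unit (F.le_left hφ) _ _⟩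
  | zero => simp
  | add x y _ _ hx hy => simp [mul_add, add_mul, hx, hy]
  | mul x y _ _ hx hy => exact ⟨by rw [← mul_assoc, hx.1], by rw [mul_assoc, hy.2]⟩

/-- The semiring generated by the `I_H^K`, `R_H^K` and `c_φ`; its unit is `∑_{K ≤ S} I_K^K`. -/
def MackeySemiring (F : FusionSystem S) : Type (u + 1) := F.mackeySemiring

instance (F : FusionSystem S) : NonUnitalSemiring F.MackeySemiring :=
  inferInstanceAs (NonUnitalSemiring F.mackeySemiring)

noncomputable instance (F : FusionSystem S) : Semiring F.MackeySemiring :=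
  { (inferInstance : NonUnitalSemiring F.MackeySemiring) with
    one := ⟨unit S, F.unit_mem⟩
    one_mul := fun x => Subtype.ext (F.unit_mul_mul_unit x.2).1
    mul_one := fun x => Subtype.ext (F.unit_mul_mul_unit x.2).2 }

theorem IsSub.mackeySemiring_le {E : FusionSystem T} {F : FusionSystem S} (h : E.IsSub F) :
    E.mackeySemiring ≤ F.mackeySemiring := by
  refine NonUnitalSubsemiring.closure_mono ?_
  rintro x ((⟨H, K, hHK, hK, rfl⟩ | ⟨H, K, hHK, hK, rfl⟩) | ⟨H, K, φ, hφ, hb, rfl⟩)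
  · exact Or.inl (Or.inl ⟨H, K, hHK, hK.trans h.le, rfl⟩)
  · exact Or.inl (Or.inr ⟨H, K, hHK, hK.trans h.le, rfl⟩)
  · exact Or.inr ⟨H, K, φ, h H K hφ, hb, rfl⟩

/-- The inclusion of semirings for `E ⊆ F`. -/
def IsSub.inclSemiring {E : FusionSystem T} {F : FusionSystem S} (h : E.IsSub F) :
    E.MackeySemiring →ₙ+* F.MackeySemiring :=
  NonUnitalSubsemiring.inclusion h.mackeySemiring_le

end FusionSystem

section MackeyAlgebra

open FusionSystem

variable {P : Type u} [Group P] [Finite P] {S T : Subgroup P}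

/-- The Mackey algebra `μ_R(F) = R ⊗_ℤ μ_ℤ(F)`, where `μ_ℤ(F)` is the Grothendieck ring of the
semiring generated by the `I_H^K`, `R_H^K` and `c_φ`.  Tensoring a semiring with `R` over `ℕ` is the
same as passing to its Grothendieck ring and then tensoring with `R` over `ℤ`. -/
def MackeyAlgebra (R : Type w) [CommRing R] (F : FusionSystem S) : Type (max w (u + 1)) :=
  R ⊗[ℕ] F.MackeySemiring

noncomputable instance (R : Type w) [CommRing R] (F : FusionSystem S) :
    Ring (MackeyAlgebra R F) :=
  inferInstanceAs (Ring (R ⊗[ℕ] F.MackeySemiring))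

noncomputable instance (R : Type w) [CommRing R] (F : FusionSystem S) :
    Algebra R (MackeyAlgebra R F) :=
  inferInstanceAs (Algebra R (R ⊗[ℕ] F.MackeySemiring))

namespace MackeyAlgebra

variable {R : Type w} [CommRing R]

/-- The image in `μ_R(F)` of an element of the semiring. -/
noncomputable def of (R : Type w) [CommRing R] (F : FusionSystem S) (x : F.MackeySemiring) :
    MackeyAlgebra R F :=
  (1 : R) ⊗ₜ[ℕ] x

/-- The idempotent `I_K^K` of `μ_R(F)`. -/
noncomputable def idem (R : Type w) [CommRing R] (F : FusionSystem S) (K : Subgroup P)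
    (hK : K ≤ S) : MackeyAlgebra R F :=
  of R F ⟨BisetSemiring.ind K K, F.ind_mem le_rfl hK⟩

/-- The natural map `R ⊗ μ(E) → R ⊗ μ(F)` for `E ⊆ F`. -/
noncomputable def inclAux (R : Type w) [CommRing R] {E : FusionSystem T} {F : FusionSystem S}
    (h : E.IsSub F) : R ⊗[ℕ] E.MackeySemiring →ₗ[ℕ] R ⊗[ℕ] F.MackeySemiring :=
  TensorProduct.map LinearMap.id h.inclSemiring.toAddMonoidHom.toNatLinearMap

theorem inclAux_mul {E : FusionSystem T} {F : FusionSystem S} (h : E.IsSub F)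
    (x y : R ⊗[ℕ] E.MackeySemiring) :
    inclAux R h (x * y) = inclAux R h x * inclAux R h y := by
  induction x using TensorProduct.induction_on with
  | zero => rw [zero_mul, map_zero, zero_mul]
  | add a b ha hb => rw [add_mul, map_add, map_add, add_mul, ha, hb]
  | tmul r a =>
    induction y using TensorProduct.induction_on with
    | zero => rw [mul_zero, map_zero, mul_zero]
    | add a b ha hb => rw [mul_add, map_add, map_add, mul_add, ha, hb]
    | tmul s b =>
      have key : ∀ (t : R) (c : E.MackeySemiring),
          inclAux R h (t ⊗ₜ[ℕ] c) = t ⊗ₜ[ℕ] h.inclSemiring c := fun _ _ => rfl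
      rw [Algebra.TensorProduct.tmul_mul_tmul, key, key, key,
        Algebra.TensorProduct.tmul_mul_tmul, map_mul]

/-- For `E ⊆ F`, the natural (not necessarily unital) homomorphism `μ_R(E) → μ_R(F)`. -/
noncomputable def incl (R : Type w) [CommRing R] {E : FusionSystem T} {F : FusionSystem S}
    (h : E.IsSub F) : MackeyAlgebra R E →ₙ+* MackeyAlgebra R F where
  toFun := inclAux R h
  map_zero' := map_zero (inclAux R h)
  map_add' := map_add (inclAux R h)
  map_mul' := inclAux_mul h

end MackeyAlgebra

/-! ### Mackey functors, restriction and induction -/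

variable (R : Type w) [CommRing R] {E : FusionSystem T} {F : FusionSystem S}

/-- A Mackey functor over `F` on `R` is a finitely generated `μ_R(F)`-module `M`.  It is
`G`-centric if `I_K^K · M = 0` for all `K ≤ S` that are not `G`-centric. -/
structure IsCentricMackeyFunctor (G : FusionSystem T) (F : FusionSystem S) (M : Type v)
    [AddCommGroup M] [Module (MackeyAlgebra R F) M] : Prop where
  finite : Module.Finite (MackeyAlgebra R F) M
  centric : ∀ (K : Subgroup P) (hK : K ≤ S), ¬ G.IsCentric K →
    ∀ m : M, MackeyAlgebra.idem R F K hK • m = 0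

/-- The restriction `M↓ = 1_{μ_R(E)} · M` to a fusion subsystem `E ⊆ F`. -/
def Restriction (h : E.IsSub F) (M : Type v) [AddCommGroup M] [Module (MackeyAlgebra R F) M] :
    Type v :=
  (DistribSMul.toAddMonoidHom M (MackeyAlgebra.incl R h 1)).range

namespace Restriction

variable (h : E.IsSub F) (M : Type v) [AddCommGroup M] [Module (MackeyAlgebra R F) M]

noncomputable instance : AddCommGroup (Restriction R h M) :=
  inferInstanceAs (AddCommGroup (DistribSMul.toAddMonoidHom M (MackeyAlgebra.incl R h 1)).range)

/-- The inclusion of `M↓` in `M`. -/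
noncomputable def subtype : Restriction R h M →+ M :=
  (DistribSMul.toAddMonoidHom M (MackeyAlgebra.incl R h 1)).range.subtype

theorem subtype_injective : Function.Injective (subtype R h M) := Subtype.val_injective

/-- The module structure over `μ_R(E) ⊆ μ_R(F)`. -/
noncomputable instance : SMul (MackeyAlgebra R E) (Restriction R h M) where
  smul a x := ⟨MackeyAlgebra.incl R h a • subtype R h M x, by
    refine ⟨MackeyAlgebra.incl R h a • subtype R h M x, ?_⟩
    change MackeyAlgebra.incl R h 1 • MackeyAlgebra.incl R h a • subtype R h M x = _
    rw [smul_smul, ← map_mul, one_mul]⟩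

theorem subtype_smul (a : MackeyAlgebra R E) (x : Restriction R h M) :
    subtype R h M (a • x) = MackeyAlgebra.incl R h a • subtype R h M x := rfl

noncomputable instance : Module (MackeyAlgebra R E) (Restriction R h M) where
  one_smul := by
    intro x
    obtain ⟨m, hm⟩ := x.2
    replace hm : MackeyAlgebra.incl R h 1 • m = subtype R h M x := hm
    apply subtype_injective
    rw [subtype_smul, ← hm, smul_smul, ← map_mul, one_mul]
  mul_smul a b x := by
    apply subtype_injective
    rw [subtype_smul, subtype_smul, subtype_smul, map_mul, mul_smul]
  smul_zero a := by
    apply subtype_injective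
    rw [subtype_smul, map_zero, smul_zero]
  smul_add a x y := by
    apply subtype_injective
    rw [subtype_smul, map_add, map_add, smul_add, subtype_smul, subtype_smul]
  add_smul a b x := by
    apply subtype_injective
    rw [subtype_smul, map_add, map_add, add_smul, subtype_smul, subtype_smul]
  zero_smul x := by
    apply subtype_injective
    rw [subtype_smul, map_zero, map_zero, zero_smul]

end Restriction

namespace Induction

/-- The left ideal `μ_R(F) · 1_{μ_R(E)}`. -/
noncomputable def leftIdeal (h : E.IsSub F) : Submodule (MackeyAlgebra R F) (MackeyAlgebra R F) :=
  LinearMap.range (LinearMap.toSpanSingleton (MackeyAlgebra R F) (MackeyAlgebra R F)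
    (MackeyAlgebra.incl R h 1))

theorem mul_incl_mem (h : E.IsSub F) (y : MackeyAlgebra R F) (a : MackeyAlgebra R E) :
    y * MackeyAlgebra.incl R h a ∈ leftIdeal R h :=
  ⟨y * MackeyAlgebra.incl R h a, by
    rw [LinearMap.toSpanSingleton_apply, smul_eq_mul, mul_assoc, ← map_mul, mul_one]⟩

variable (h : E.IsSub F) (N : Type v) [AddCommGroup N] [Module (MackeyAlgebra R E) N]

/-- The relations `y a ⊗ x = y ⊗ a x`, for `a` in `μ_R(E)`, that define the tensor product over
`μ_R(E)` as a quotient of the tensor product over `ℤ`. -/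
noncomputable def relations : Submodule (MackeyAlgebra R F) (leftIdeal R h ⊗[ℤ] N) :=
  Submodule.span _ {t | ∃ (y : leftIdeal R h) (a : MackeyAlgebra R E) (x : N),
    t = (⟨y.1 * MackeyAlgebra.incl R h a, mul_incl_mem R h y.1 a⟩ : leftIdeal R h) ⊗ₜ[ℤ] x -
      y ⊗ₜ[ℤ] (a • x)}

end Induction

/-- The induction `N↑ = μ_R(F) 1_{μ_R(E)} ⊗_{μ_R(E)} N` to `F` of a module `N` over `μ_R(E)`. -/
def Induction (h : E.IsSub F) (N : Type v) [AddCommGroup N] [Module (MackeyAlgebra R E) N] :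
    Type (max v w (u + 1)) :=
  (Induction.leftIdeal R h ⊗[ℤ] N) ⧸ Induction.relations R h N

namespace Induction

variable (h : E.IsSub F) (N : Type v) [AddCommGroup N] [Module (MackeyAlgebra R E) N]

noncomputable instance : AddCommGroup (Induction R h N) :=
  inferInstanceAs (AddCommGroup (_ ⧸ relations R h N))

noncomputable instance : Module (MackeyAlgebra R F) (Induction R h N) :=
  inferInstanceAs (Module _ (_ ⧸ relations R h N))

end Induction

/-! ### Relative projectivity -/

section Projectivity

variable (F) (M : Type v) [AddCommGroup M] [Module (MackeyAlgebra R F) M]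

/-- The Mackey functor `M_H = M↓↑`, obtained by restriction to `𝓕_H(H)` and induction back to
`F`. -/
abbrev IndRes (H : F.Centric) : Type (max v w (u + 1)) :=
  Induction R (F.inner_isSub H.2.1) (Restriction R (F.inner_isSub H.2.1) M)

/-- The map `(y, x) ↦ y · x` on `μ_R(F) 1 ⊗_ℤ M↓`. -/
noncomputable def thetaAux (H : F.Centric) :
    Induction.leftIdeal R (F.inner_isSub H.2.1) ⊗[ℤ] Restriction R (F.inner_isSub H.2.1) M
      →ₗ[MackeyAlgebra R F] M :=
  TensorProduct.AlgebraTensorModule.lift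
    { toFun := fun y =>
        ((DistribSMul.toAddMonoidHom M (y : MackeyAlgebra R F)).comp
          (Restriction.subtype R (F.inner_isSub H.2.1) M)).toIntLinearMap
      map_add' := fun y z => by
        ext x
        exact add_smul (y : MackeyAlgebra R F) z _
      map_smul' := fun a y => by
        ext x
        exact mul_smul a (y : MackeyAlgebra R F) _ }

/-- The morphism `θ_H : M_H → M`, `y ⊗ x ↦ y · x`. -/
noncomputable def theta (H : F.Centric) : IndRes R F M H →ₗ[MackeyAlgebra R F] M :=
  Submodule.liftQ _ (thetaAux R F M H) (by
    rw [Induction.relations, Submodule.span_le]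
    rintro _ ⟨y, a, x, rfl⟩
    rw [SetLike.mem_coe, LinearMap.mem_ker, map_sub, sub_eq_zero]
    exact mul_smul (y : MackeyAlgebra R F) (MackeyAlgebra.incl R _ a) _)

open Classical in
/-- The morphism `θ_X : ⨁_{H ∈ X} M_H → M`. -/
noncomputable def thetaFamily (X : Set F.Centric) :
    (⨁ H : X, IndRes R F M H.1) →ₗ[MackeyAlgebra R F] M :=
  DirectSum.toModule _ _ _ fun H => theta R F M H.1

/-- `M` is projective relative to the family `X` if `θ_X` is split surjective. -/
def IsRelProjective (X : Set F.Centric) : Prop :=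
  ∃ u : M →ₗ[MackeyAlgebra R F] (⨁ H : X, IndRes R F M H.1),
    thetaFamily R F M X ∘ₗ u = LinearMap.id

end Projectivity

/-- A family of `F`-centric subgroups is closed under `F`-subconjugacy. -/
def IsSubconjClosed (F : FusionSystem S) (X : Set F.Centric) : Prop :=
  ∀ H K : F.Centric, K ∈ X → F.IsSubconj H.1 K.1 → H ∈ X

/-- `X` is a defect set of `M`: it is minimal among the families of `F`-centric subgroups that are
closed under `F`-subconjugacy and relative to which `M` is projective. -/
def IsDefectSet (F : FusionSystem S) (M : Type v) [AddCommGroup M] [Module (MackeyAlgebra R F) M]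
    (X : Set F.Centric) : Prop :=
  Minimal (fun Y => IsSubconjClosed F Y ∧ IsRelProjective R F M Y) X

/-- `V` is a defect group of `M`: a maximal element, for `≤_F`, of a defect set of `M`. -/
def IsDefectGroup (F : FusionSystem S) (M : Type v) [AddCommGroup M]
    [Module (MackeyAlgebra R F) M] (V : F.Centric) : Prop :=
  ∃ X, IsDefectSet R F M X ∧ V ∈ X ∧ ∀ W ∈ X, F.IsSubconj V.1 W.1 → F.IsSubconj W.1 V.1

/-- `M` admits a vertex: its defect groups form exactly one `F`-isomorphism class. -/
def AdmitsVertex (F : FusionSystem S) (M : Type v) [AddCommGroup M]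
    [Module (MackeyAlgebra R F) M] : Prop :=
  (∃ V, IsDefectGroup R F M V) ∧
    ∀ V W, IsDefectGroup R F M V → IsDefectGroup R F M W → F.IsConj V.1 W.1

/-- `V` is a vertex of `M`: `M` admits a vertex, and `V` is a fully `F`-normalized defect group. -/
def IsVertex (F : FusionSystem S) (M : Type v) [AddCommGroup M]
    [Module (MackeyAlgebra R F) M] (V : F.Centric) : Prop :=
  AdmitsVertex R F M ∧ IsDefectGroup R F M V ∧ F.IsFullyNormalized V.1

end MackeyAlgebra

/-- All prime numbers other than `p` are invertible in `R`. -/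
def IsPLocal (p : ℕ) (R : Type w) [CommRing R] : Prop :=
  ∀ q : ℕ, q.Prime → q ≠ p → IsUnit (q : R)

/-- A nonzero module that is not the direct sum of two nonzero submodules. -/
def IsIndecomposableModule (A : Type w) [Ring A] (M : Type v) [AddCommGroup M] [Module A M] : Prop :=
  Nontrivial M ∧ ∀ N L : Submodule A M, IsCompl N L → N = ⊥ ∨ L = ⊥

/-- `M` is isomorphic to a direct summand of `N`. -/
def IsSummand (A : Type w) [Ring A] (M N : Type v) [AddCommGroup M] [Module A M] [AddCommGroup N]
    [Module A N] : Prop :=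
  ∃ M' L : Submodule A N, IsCompl M' L ∧ Nonempty (M ≃ₗ[A] M')

/-! The argument is Green's theory of vertices, carried out with endomorphisms. A section of `θ_X`
exists exactly when the identity of `M` is a sum of endomorphisms that factor through the maps `θ_H
: M_H → M` with `H ∈ X` (`isRelProjective_iff`). For groups such endomorphisms are relative traces,
sums over cosets. Here the cosets are replaced by the points of a `CentricBiset`, the product of `S`
with itself in the category of formal sums of `F`-centric subgroups. For `K, H ≤ S` a `K × H`-orbit
of points is a partially defined morphism from a subgroup `src` of `H` onto a subgroup `dst` of `K`.
The trace of `f` from `H` sends `m` at `K` to the sum over these orbits of: restrict to `dst`,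
transport to `src`, apply `f`, transport back, induce to `K`.

The product exists because of saturation: every morphism on a centric subgroup has a maximal
extension, unique up to conjugation with a central element of its image (`centerConj_of_maximal`,
`nonempty_centricBiset`). This rests on the Sylow property of automizers (`sylowProperty`) and on
the extension axiom for centric domains (`IsSaturated.exists_extension`). The product property holds
only on centric subgroups. That is enough, since the orbits with a non-centric source contribute
zero to a trace on a centric functor, and so traces are `μ_R(F)`-linear (`pairSum_smul`).

Three facts about traces give the first claim. The endomorphisms that factor through `θ_H` are
exactly the traces from `H` (`theta_pairMap`, `exists_relTrace_eq`). A product of traces from `H`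
and `K` is a sum of traces from subgroups of `H` that are `F`-isomorphic to subgroups of `K`
(`relTrace_comp_relTrace`), so two closed families relative to which `M` is projective can be
intersected (`isRelProjective_inter`). Finally the trace of the identity from `S` is an automorphism
of `M`: modulo terms induced from smaller subgroups it is multiplication by a number congruent to
`|Out_F(S)|` modulo `p`, and such a number is invertible in `R` (`relTrace_id_surjective`,
`isRelProjective_univ`). Hence the closed families relative to which `M` is projective have a least
member.

For the second claim the endomorphism ring of an indecomposable `M` is local, so the identity is
already a trace from a single `H`, and the defect set is the family of all centric subgroups that
are `F`-subconjugate to `H`. If `H` were not `G`-centric, neither would be its subgroups, and traces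
from `H` would vanish on `M`. Traces pass to direct summands, so the defect set of `M` is contained
in that of every `N` of which `M` is a summand. -/

set_option linter.unusedSectionVars false

/-! ### Relations on a group that are subgroups of `P × P` -/

namespace GroupRel

variable {P : Type u} [Group P]

/-- The projection of a subgroup of `P × P` to the second factor. -/
def dom (D : Subgroup (P × P)) : Subgroup P := D.map (MonoidHom.snd P P)

/-- The projection of a subgroup of `P × P` to the first factor. -/
def ran (D : Subgroup (P × P)) : Subgroup P := D.map (MonoidHom.fst P P)

/-- The opposite relation. -/
def op (D : Subgroup (P × P)) : Subgroup (P × P) :=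
  D.comap (MulEquiv.prodComm : P × P ≃* P × P).toMonoidHom

/-- The conjugate `g D g⁻¹`. -/
def conjBy (g : P × P) (D : Subgroup (P × P)) : Subgroup (P × P) :=
  D.comap (MulAut.conj g⁻¹).toMonoidHom

/-- The graph of the conjugation by `h`. -/
def conjGraph (h : P) : Subgroup (P × P) where
  carrier := {x | x.1 = h * x.2 * h⁻¹}
  one_mem' := by simp
  mul_mem' {x y} hx hy := by
    simp only [Set.mem_ofPred_eq, Prod.fst_mul, Prod.snd_mul] at *
    rw [hx, hy]; group
  inv_mem' {x} hx := by
    simp only [Set.mem_ofPred_eq, Prod.fst_inv, Prod.snd_inv] at *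
    rw [hx]; group

/-- The composition of two relations. -/
def comp (D E : Subgroup (P × P)) : Subgroup (P × P) where
  carrier := {x | ∃ l, (x.1, l) ∈ D ∧ (l, x.2) ∈ E}
  one_mem' := ⟨1, D.one_mem, E.one_mem⟩
  mul_mem' := by
    rintro x y ⟨l, h1, h2⟩ ⟨m, h3, h4⟩
    exact ⟨l * m, D.mul_mem h1 h3, E.mul_mem h2 h4⟩
  inv_mem' := by
    rintro x ⟨l, h1, h2⟩
    exact ⟨l⁻¹, D.inv_mem h1, E.inv_mem h2⟩

variable {D E : Subgroup (P × P)} {a b : P}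

theorem mem_dom : b ∈ dom D ↔ ∃ a, (a, b) ∈ D := by
  constructor
  · rintro ⟨⟨x, y⟩, h, rfl⟩; exact ⟨x, h⟩
  · rintro ⟨a, h⟩; exact ⟨(a, b), h, rfl⟩

theorem mem_ran : a ∈ ran D ↔ ∃ b, (a, b) ∈ D := by
  constructor
  · rintro ⟨⟨x, y⟩, h, rfl⟩; exact ⟨y, h⟩
  · rintro ⟨b, h⟩; exact ⟨(a, b), h, rfl⟩

theorem mem_dom_of (h : (a, b) ∈ D) : b ∈ dom D := mem_dom.2 ⟨a, h⟩

theorem mem_ran_of (h : (a, b) ∈ D) : a ∈ ran D := mem_ran.2 ⟨b, h⟩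

theorem mem_op : (a, b) ∈ op D ↔ (b, a) ∈ D := Iff.rfl

theorem mem_conjBy {g x : P × P} : x ∈ conjBy g D ↔ g⁻¹ * x * g ∈ D := by
  simp [conjBy]

theorem mem_conjBy_mk {x y : P} : (a, b) ∈ conjBy (x, y) D ↔ (x⁻¹ * a * x, y⁻¹ * b * y) ∈ D :=
  mem_conjBy

theorem conj_mem_conjBy {x y : P} : (x * a * x⁻¹, y * b * y⁻¹) ∈ conjBy (x, y) D ↔ (a, b) ∈ D := by
  rw [mem_conjBy_mk]
  simp [mul_assoc]

theorem conjBy_conjBy (g h : P × P) (D : Subgroup (P × P)) :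
    conjBy g (conjBy h D) = conjBy (g * h) D := by
  ext x
  simp only [mem_conjBy, mul_inv_rev, mul_assoc]

theorem conjBy_one (D : Subgroup (P × P)) : conjBy 1 D = D := by
  ext x
  simp [mem_conjBy]

theorem conjBy_mono {g : P × P} (h : D ≤ E) : conjBy g D ≤ conjBy g E :=
  Subgroup.comap_mono h

theorem mem_conjGraph {h : P} : (a, b) ∈ conjGraph h ↔ a = h * b * h⁻¹ := Iff.rfl

theorem mem_comp : (a, b) ∈ comp D E ↔ ∃ l, (a, l) ∈ D ∧ (l, b) ∈ E := Iff.rfl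

theorem dom_mono (h : D ≤ E) : dom D ≤ dom E := Subgroup.map_mono h

theorem ran_mono (h : D ≤ E) : ran D ≤ ran E := Subgroup.map_mono h

theorem dom_op (D : Subgroup (P × P)) : dom (op D) = ran D := by
  ext x; rw [mem_dom, mem_ran]; rfl

theorem ran_op (D : Subgroup (P × P)) : ran (op D) = dom D := by
  ext x; rw [mem_dom, mem_ran]; rfl

theorem mem_dom_conjBy {x y : P} : b ∈ dom (conjBy (x, y) D) ↔ y⁻¹ * b * y ∈ dom D := by
  constructor
  · intro h
    obtain ⟨a, h⟩ := mem_dom.1 h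
    exact mem_dom_of (mem_conjBy_mk.1 h)
  · intro h
    obtain ⟨a, h⟩ := mem_dom.1 h
    exact mem_dom.2 ⟨x * a * x⁻¹, mem_conjBy_mk.2 (by simpa [mul_assoc] using h)⟩

theorem mem_ran_conjBy {x y : P} : a ∈ ran (conjBy (x, y) D) ↔ x⁻¹ * a * x ∈ ran D := by
  constructor
  · intro h
    obtain ⟨a, h⟩ := mem_ran.1 h
    exact mem_ran_of (mem_conjBy_mk.1 h)
  · intro h
    obtain ⟨b, h⟩ := mem_ran.1 h
    exact mem_ran.2 ⟨y * b * y⁻¹, mem_conjBy_mk.2 (by simpa [mul_assoc] using h)⟩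

theorem mem_twistedDiagonal {H K : Subgroup P} {φ : H →* K} :
    (a, b) ∈ BisetMatrix.twistedDiagonal φ ↔ ∃ h : b ∈ H, (φ ⟨b, h⟩ : P) = a := by
  constructor
  · rintro ⟨y, hy⟩
    obtain ⟨rfl, rfl⟩ := Prod.ext_iff.1 hy
    exact ⟨y.2, rfl⟩
  · rintro ⟨h, rfl⟩
    exact ⟨⟨b, h⟩, rfl⟩

end GroupRel

/-! ### Morphisms of a fusion system as subgroups of `P × P` -/

namespace FusionSystem

open GroupRel BisetMatrix

variable {P : Type u} [Group P] {S : Subgroup P}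

/-- The graphs `{(φ(x), x)}` of morphisms of `F`. -/
def IsGraph (F : FusionSystem S) (D : Subgroup (P × P)) : Prop :=
  ∃ (E : Subgroup P) (φ : E →* S), φ ∈ F.Hom E S ∧ D = twistedDiagonal φ

variable {F : FusionSystem S} {D D' : Subgroup (P × P)}

/-- A morphism is its corestriction to the image followed by an inclusion, and both are morphisms of
`F`. So membership depends on the values only, and graphs, which forget the codomain, lose nothing.
-/
theorem hom_congr {H K K' : Subgroup P} {φ : H →* K} (hφ : φ ∈ F.Hom H K) (ψ : H →* K')
    (hK : K' ≤ S) (h : ∀ x, (ψ x : P) = φ x) : ψ ∈ F.Hom H K' := by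
  have hinj : Function.Injective (K.subtype.comp φ) :=
    (Subgroup.subtype_injective K).comp (F.injective hφ)
  have he := (F.image_mem (MonoidHom.ofInjective hinj) hφ fun x => rfl).1
  have hle : (K.subtype.comp φ).range ≤ K' := by
    rintro _ ⟨x, rfl⟩
    have := (ψ x).2
    rwa [h x] at this
  have hi := F.conj_mem (Subgroup.inclusion hle) (F.le_right he) hK ⟨1, one_mem S, fun x => by simp⟩
  have := F.comp_mem he hi
  convert this using 1
  ext x
  exact h x

theorem hom_restrict {H H' K : Subgroup P} {φ : H →* K} (hφ : φ ∈ F.Hom H K) (h : H' ≤ H) :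
    φ.comp (Subgroup.inclusion h) ∈ F.Hom H' K :=
  F.comp_mem (F.conj_mem (Subgroup.inclusion h) (h.trans (F.le_left hφ)) (F.le_left hφ)
    ⟨1, one_mem S, fun x => by simp⟩) hφ

theorem isGraph_of_hom {H K : Subgroup P} {φ : H →* K} (hφ : φ ∈ F.Hom H K) :
    F.IsGraph (twistedDiagonal φ) := by
  refine ⟨H, (Subgroup.inclusion (F.le_right hφ)).comp φ,
    hom_congr hφ _ le_rfl fun x => rfl, ?_⟩
  ext ⟨a, b⟩
  rw [mem_twistedDiagonal, mem_twistedDiagonal]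
  rfl

theorem isGraph_conjGraph (F : FusionSystem S) {A : Subgroup P} (hA : A ≤ S) {s : P} (hs : s ∈ S) :
    F.IsGraph (conjGraph s ⊓ Subgroup.prod ⊤ A) := by
  let φ : A →* S := (((MulAut.conj s).toMonoidHom.comp A.subtype).codRestrict S fun x =>
    mul_mem (mul_mem hs (hA x.2)) (inv_mem hs))
  refine ⟨A, φ, F.conj_mem φ hA le_rfl ⟨s, hs, fun x => rfl⟩, ?_⟩
  ext ⟨a, b⟩
  rw [mem_twistedDiagonal, Subgroup.mem_inf, Subgroup.mem_prod, mem_conjGraph]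
  constructor
  · rintro ⟨h, -, hb⟩
    exact ⟨hb, h.symm⟩
  · rintro ⟨hb, h⟩
    exact ⟨h.symm, trivial, hb⟩

namespace IsGraph

theorem mem_left (hD : F.IsGraph D) {a b : P} (h : (a, b) ∈ D) : a ∈ S := by
  obtain ⟨E, φ, hφ, rfl⟩ := hD
  obtain ⟨hb, rfl⟩ := mem_twistedDiagonal.1 h
  exact (φ _).2

theorem mem_right (hD : F.IsGraph D) {a b : P} (h : (a, b) ∈ D) : b ∈ S := by
  obtain ⟨E, φ, hφ, rfl⟩ := hD
  obtain ⟨hb, rfl⟩ := mem_twistedDiagonal.1 h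
  exact F.le_left hφ hb

theorem dom_le (hD : F.IsGraph D) : dom D ≤ S := fun _ h => by
  obtain ⟨a, h⟩ := mem_dom.1 h
  exact hD.mem_right h

theorem ran_le (hD : F.IsGraph D) : ran D ≤ S := fun _ h => by
  obtain ⟨a, h⟩ := mem_ran.1 h
  exact hD.mem_left h

theorem left_unique (hD : F.IsGraph D) {a a' b : P} (h : (a, b) ∈ D) (h' : (a', b) ∈ D) :
    a = a' := by
  obtain ⟨E, φ, hφ, rfl⟩ := hD
  obtain ⟨hb, rfl⟩ := mem_twistedDiagonal.1 h
  obtain ⟨hb, rfl⟩ := mem_twistedDiagonal.1 h'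
  rfl

theorem right_unique (hD : F.IsGraph D) {a b b' : P} (h : (a, b) ∈ D) (h' : (a, b') ∈ D) :
    b = b' := by
  obtain ⟨E, φ, hφ, rfl⟩ := hD
  obtain ⟨hb, h1⟩ := mem_twistedDiagonal.1 h
  obtain ⟨hb', h2⟩ := mem_twistedDiagonal.1 h'
  have := F.injective hφ (Subtype.ext (h1.trans h2.symm))
  exact congrArg Subtype.val this

theorem mono (hD : F.IsGraph D) (h : D' ≤ D) : F.IsGraph D' := by
  obtain ⟨E, φ, hφ, rfl⟩ := hD
  have hE : dom D' ≤ E := by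
    intro b hb
    obtain ⟨a, ha⟩ := mem_dom.1 hb
    exact (mem_twistedDiagonal.1 (h ha)).1
  refine ⟨dom D', φ.comp (Subgroup.inclusion hE), hom_restrict hφ hE, ?_⟩
  ext ⟨a, b⟩
  rw [mem_twistedDiagonal]
  constructor
  · intro hab
    exact ⟨mem_dom_of hab, (mem_twistedDiagonal.1 (h hab)).2⟩
  · rintro ⟨hb, rfl⟩
    obtain ⟨a, ha⟩ := mem_dom.1 hb
    obtain ⟨_, h2⟩ := mem_twistedDiagonal.1 (h ha)
    exact h2 ▸ ha

theorem op (hD : F.IsGraph D) : F.IsGraph (op D) := by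
  obtain ⟨E, φ, hφ, rfl⟩ := hD
  have hinj : Function.Injective (S.subtype.comp φ) :=
    (Subgroup.subtype_injective S).comp (F.injective hφ)
  have he := (F.image_mem (MonoidHom.ofInjective hinj) hφ fun x => rfl).2
  convert isGraph_of_hom he using 1
  ext ⟨a, b⟩
  rw [mem_op, mem_twistedDiagonal, mem_twistedDiagonal]
  constructor
  · rintro ⟨ha, rfl⟩
    refine ⟨⟨⟨a, ha⟩, rfl⟩, ?_⟩
    have : (MonoidHom.ofInjective hinj).symm ⟨(φ ⟨a, ha⟩ : P), ⟨⟨a, ha⟩, rfl⟩⟩ = ⟨a, ha⟩ := by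
      rw [MulEquiv.symm_apply_eq]; rfl
    exact congrArg Subtype.val this
  · rintro ⟨⟨x, hx⟩, h⟩
    have : (MonoidHom.ofInjective hinj).symm ⟨b, ⟨x, hx⟩⟩ = x := by
      rw [MulEquiv.symm_apply_eq]; exact Subtype.ext hx.symm
    have h2 : (x : P) = a := by rw [← h]; exact congrArg Subtype.val this.symm
    subst h2
    exact ⟨x.2, hx⟩

/-- The composite is taken where it is defined, on the elements that the inner morphism sends into
the domain of the outer one. Partial composites of this kind are what the Mackey formula produces.
-/
theorem comp (hD : F.IsGraph D) (hD' : F.IsGraph D') : F.IsGraph (comp D D') := by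
  obtain ⟨E, φ, hφ, rfl⟩ := hD
  obtain ⟨E', ψ, hψ, rfl⟩ := hD'
  set C := GroupRel.comp (twistedDiagonal φ) (twistedDiagonal ψ) with hC
  have key : ∀ b ∈ dom C, ∃ h : b ∈ E', (ψ ⟨b, h⟩ : P) ∈ E := by
    intro b hb
    obtain ⟨a, l, h1, h2⟩ := mem_dom.1 hb
    obtain ⟨hb', rfl⟩ := mem_twistedDiagonal.1 h2
    exact ⟨hb', (mem_twistedDiagonal.1 h1).1⟩
  have hE' : dom C ≤ E' := fun b hb => (key b hb).1
  let ψ' : dom C →* E := (S.subtype.comp (ψ.comp (Subgroup.inclusion hE'))).codRestrict E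
    fun x => (key x x.2).2
  refine ⟨dom C, φ.comp ψ', F.comp_mem (hom_congr (hom_restrict hψ hE') ψ' (F.le_left hφ)
    fun x => rfl) hφ, ?_⟩
  ext ⟨a, b⟩
  rw [mem_twistedDiagonal]
  constructor
  · intro hab
    refine ⟨mem_dom_of hab, ?_⟩
    obtain ⟨l, h1, h2⟩ := hab
    obtain ⟨hb', rfl⟩ := mem_twistedDiagonal.1 h2
    exact (mem_twistedDiagonal.1 h1).2
  · rintro ⟨hb, rfl⟩
    exact ⟨(ψ' ⟨b, hb⟩ : E), mem_twistedDiagonal.2 ⟨(ψ' ⟨b, hb⟩).2, rfl⟩,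
      mem_twistedDiagonal.2 ⟨hE' hb, rfl⟩⟩

theorem conjBy (hD : F.IsGraph D) {x y : P} (hx : x ∈ S) (hy : y ∈ S) :
    F.IsGraph (conjBy (x, y) D) := by
  refine mono ((F.isGraph_conjGraph le_rfl hx).comp
    (hD.comp (F.isGraph_conjGraph le_rfl (inv_mem hy)))) ?_
  rintro ⟨a, b⟩ h
  have h := mem_conjBy_mk.1 h
  have hb := hD.mem_right h
  have ha := hD.mem_left h
  have hb' : b ∈ S := by simpa [mul_assoc] using mul_mem (mul_mem hy hb) (inv_mem hy)
  refine ⟨_, ⟨?_, trivial, ha⟩, _, h, ?_, trivial, hb'⟩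
  · change a = x * (x⁻¹ * a * x) * x⁻¹
    group
  · change y⁻¹ * b * y = y⁻¹ * b * y⁻¹⁻¹
    group

end IsGraph

theorem isConj_iff {H K : Subgroup P} :
    F.IsConj H K ↔ ∃ D, F.IsGraph D ∧ dom D = H ∧ ran D = K := by
  constructor
  · rintro ⟨φ, hφ, hb⟩
    refine ⟨_, isGraph_of_hom hφ, ?_, ?_⟩
    · ext b
      rw [mem_dom]
      constructor
      · rintro ⟨a, h⟩
        exact (mem_twistedDiagonal.1 h).1
      · intro h
        exact ⟨_, mem_twistedDiagonal.2 ⟨h, rfl⟩⟩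
    · ext a
      rw [mem_ran]
      constructor
      · rintro ⟨b, h⟩
        obtain ⟨hb, rfl⟩ := mem_twistedDiagonal.1 h
        exact (φ _).2
      · intro h
        obtain ⟨x, hx⟩ := hb.2 ⟨a, h⟩
        exact ⟨x, mem_twistedDiagonal.2 ⟨x.2, congrArg Subtype.val hx⟩⟩
  · rintro ⟨D, ⟨E, φ, hφ, rfl⟩, rfl, rfl⟩
    have hE : dom (twistedDiagonal φ) = E := by
      ext b
      rw [mem_dom]
      constructor
      · rintro ⟨a, h⟩
        exact (mem_twistedDiagonal.1 h).1
      · intro h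
        exact ⟨_, mem_twistedDiagonal.2 ⟨h, rfl⟩⟩
    have hr : ran (twistedDiagonal φ) ≤ S := (isGraph_of_hom hφ).ran_le
    have hm : ∀ x : E, (φ x : P) ∈ ran (twistedDiagonal φ) := fun x =>
      mem_ran_of (mem_twistedDiagonal.2 ⟨x.2, rfl⟩)
    rw [hE]
    refine ⟨(S.subtype.comp φ).codRestrict _ hm, hom_congr hφ _ hr fun x => rfl, ?_, ?_⟩
    · intro x y h
      exact F.injective hφ (Subtype.ext (Subtype.ext_iff.1 h :))
    · rintro ⟨a, ha⟩
      obtain ⟨b, h⟩ := mem_ran.1 ha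
      obtain ⟨hb, rfl⟩ := mem_twistedDiagonal.1 h
      exact ⟨⟨b, hb⟩, rfl⟩

theorem IsGraph.isConj (hD : F.IsGraph D) : F.IsConj (dom D) (ran D) :=
  isConj_iff.2 ⟨D, hD, rfl, rfl⟩

theorem IsConj.symm {H K : Subgroup P} (h : F.IsConj H K) : F.IsConj K H := by
  obtain ⟨D, hD, rfl, rfl⟩ := isConj_iff.1 h
  exact isConj_iff.2 ⟨_, hD.op, dom_op D, ran_op D⟩

theorem IsConj.trans {H K L : Subgroup P} (h : F.IsConj H K) (h' : F.IsConj K L) :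
    F.IsConj H L := by
  obtain ⟨φ, hφ, hb⟩ := h
  obtain ⟨ψ, hψ, hb'⟩ := h'
  exact ⟨_, F.comp_mem hφ hψ, hb'.comp hb⟩

theorem isConj_refl (F : FusionSystem S) {H : Subgroup P} (h : H ≤ S) : F.IsConj H H :=
  ⟨MonoidHom.id H, F.conj_mem _ h h ⟨1, one_mem S, fun x => by simp⟩, Function.bijective_id⟩

theorem IsConj.le_right {H K : Subgroup P} (h : F.IsConj H K) : K ≤ S :=
  F.le_right h.choose_spec.1

theorem IsConj.card_eq {H K : Subgroup P} (h : F.IsConj H K) : Nat.card H = Nat.card K := by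
  obtain ⟨φ, -, hb⟩ := h
  exact Nat.card_congr (Equiv.ofBijective φ hb)

theorem IsCentric.isConj {H K : Subgroup P} (hH : F.IsCentric H) (h : F.IsConj H K) :
    F.IsCentric K :=
  ⟨h.le_right, fun L hL => hH.2 L (h.trans hL)⟩

/-- Overgroups of centric subgroups are centric. -/
theorem IsCentric.of_le {H K : Subgroup P} (hH : F.IsCentric H) (h : H ≤ K) (hK : K ≤ S) :
    F.IsCentric K := by
  refine ⟨hK, fun L hL => ?_⟩
  obtain ⟨D, hD, rfl, rfl⟩ := isConj_iff.1 hL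
  have hD' : F.IsGraph (D ⊓ Subgroup.prod ⊤ H) := hD.mono inf_le_left
  have h1 : dom (D ⊓ Subgroup.prod ⊤ H) = H := by
    ext b
    rw [mem_dom]
    constructor
    · rintro ⟨a, -, -, hb⟩
      exact hb
    · intro hb
      obtain ⟨a, ha⟩ := mem_dom.1 (h hb)
      exact ⟨a, ha, trivial, hb⟩
  have h2 : ran (D ⊓ Subgroup.prod ⊤ H) ≤ ran D := ran_mono inf_le_left
  have h3 := hH.2 _ (isConj_iff.2 ⟨_, hD', h1, rfl⟩)
  refine le_trans ?_ (h3.trans h2)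
  exact inf_le_inf_left _ (Subgroup.centralizer_le h2)

theorem isCentric_top (F : FusionSystem S) [Finite P] : F.IsCentric S := by
  refine ⟨le_rfl, fun K hK => ?_⟩
  have : K = S := Subgroup.eq_of_le_of_card_ge hK.le_right hK.card_eq.le
  rw [this]
  exact inf_le_left

end FusionSystem

/-! ### The extension axiom for graphs, and automizers -/

namespace FusionSystem

open GroupRel BisetMatrix

variable {P : Type u} [Group P] {S : Subgroup P} {F : FusionSystem S} {D D' : Subgroup (P × P)}

/-- By finiteness an injective map from `H` to itself is onto. -/
theorem mem_normalizer_of_forall [Finite P] {H : Subgroup P} {x : P}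
    (h : ∀ y ∈ H, x * y * x⁻¹ ∈ H) : x ∈ Subgroup.normalizer (H : Set P) := by
  have hle : H.map (MulAut.conj x).toMonoidHom ≤ H := by
    rintro _ ⟨y, hy, rfl⟩
    exact h y hy
  have hcard : Nat.card (H.map (MulAut.conj x).toMonoidHom) = Nat.card H :=
    Subgroup.card_map_of_injective (MulAut.conj x).injective
  have heq := Subgroup.eq_of_le_of_card_ge hle hcard.ge
  rw [Subgroup.mem_normalizer_iff]
  refine fun y => ⟨h y, fun hy => ?_⟩
  rw [← heq] at hy
  obtain ⟨z, hz, hzy⟩ := hy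
  have : z = y := (MulAut.conj x).injective hzy
  exact this ▸ hz

/-- `(z, x)` normalizes `D`. -/
def Normalizes (z x : P) (D : Subgroup (P × P)) : Prop :=
  ∀ a b, (a, b) ∈ D → (z * a * z⁻¹, x * b * x⁻¹) ∈ D

/-- The extension axiom in terms of graphs. -/
theorem IsSaturated.exists_extension_of_isFullyNormalized [Finite P] {p : ℕ}
    (hF : F.IsSaturated p) (hD : F.IsGraph D) (hn : F.IsFullyNormalized (ran D)) :
    ∃ D', F.IsGraph D' ∧ D ≤ D' ∧ ∀ z ∈ S, ∀ x ∈ S, Normalizes z x D → x ∈ dom D' := by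
  obtain ⟨E, φ, hφ, rfl⟩ := hD
  have him : image φ = ran (twistedDiagonal φ) := by
    ext a
    rw [mem_ran]
    constructor
    · rintro ⟨x, rfl⟩
      exact ⟨x, mem_twistedDiagonal.2 ⟨x.2, rfl⟩⟩
    · rintro ⟨b, h⟩
      obtain ⟨hb, rfl⟩ := mem_twistedDiagonal.1 h
      exact ⟨_, rfl⟩
  rw [← him] at hn
  obtain ⟨ψ, hψ, h⟩ := hF.extend E φ hφ hn
  have hmem : ∀ z ∈ S, ∀ x ∈ S, Normalizes z x (twistedDiagonal φ) → x ∈ phiNormalizer S φ := by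
    intro z hz x hx hzx
    refine ⟨⟨hx, mem_normalizer_of_forall fun y hy => ?_⟩, z,
      ⟨hz, mem_normalizer_of_forall fun y hy => ?_⟩, fun h h' e => ?_⟩
    · exact (mem_twistedDiagonal.1 (hzx _ _ (mem_twistedDiagonal.2 ⟨hy, rfl⟩))).1
    · rw [him] at hy ⊢
      obtain ⟨b, hb⟩ := mem_ran.1 hy
      exact mem_ran_of (hzx _ _ hb)
    · obtain ⟨_, h2⟩ := mem_twistedDiagonal.1 (hzx _ _ (mem_twistedDiagonal.2 ⟨h.2, rfl⟩))
      rw [← h2]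
      congr 2
      exact Subtype.ext e
  refine ⟨_, isGraph_of_hom hψ, ?_, fun z hz x hx hzx =>
    mem_dom.2 ⟨_, mem_twistedDiagonal.2 ⟨hmem z hz x hx hzx, rfl⟩⟩⟩
  rintro ⟨a, b⟩ hab
  obtain ⟨hb, rfl⟩ := mem_twistedDiagonal.1 hab
  -- A pair in the graph normalizes the graph, so the domain of `φ` is contained in `N_φ`.
  have hb' : b ∈ phiNormalizer S φ := by
    refine hmem (φ ⟨b, hb⟩) (φ _).2 b (F.le_left hφ hb) fun c d hcd => ?_
    have h1 := mul_mem (mul_mem hab hcd) (inv_mem hab)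
    exact h1
  exact mem_twistedDiagonal.2 ⟨hb', congrArg Subtype.val (h ⟨b, hb⟩ ⟨b, hb'⟩ rfl)⟩

theorem exists_isFullyNormalized [Finite P] (F : FusionSystem S) {Q : Subgroup P} (hQ : Q ≤ S) :
    ∃ C, F.IsConj Q C ∧ F.IsFullyNormalized C := by
  obtain ⟨C, hC, hmax⟩ := Set.exists_max_image {K | F.IsConj Q K}
    (fun K : Subgroup P => Nat.card ↥(S ⊓ Subgroup.normalizer (K : Set P))) (Set.toFinite _)
    ⟨Q, F.isConj_refl hQ⟩
  exact ⟨C, hC, IsConj.le_right hC, fun K hK => hmax K (IsConj.trans hC hK)⟩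

/-- The automorphisms of `C` in `F`. -/
def autF (F : FusionSystem S) (C : Subgroup P) (hC : C ≤ S) : Subgroup (MulAut C) where
  carrier := {α | α.toMonoidHom ∈ F.Hom C C}
  one_mem' := F.conj_mem _ hC hC ⟨1, one_mem S, fun x => by simp⟩
  mul_mem' {a b} ha hb := F.comp_mem (φ := b.toMonoidHom) (ψ := a.toMonoidHom) hb ha
  inv_mem' {a} ha := (F.image_mem (φ := a.toMonoidHom) a ha fun _ => rfl).2

/-- The automorphisms of `C` induced by conjugation with elements of `S`. -/
def autS (S C : Subgroup P) : Subgroup (MulAut C) where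
  carrier := {α | ∃ s ∈ S, ∀ c : C, (α c : P) = s * c * s⁻¹}
  one_mem' := ⟨1, one_mem S, by simp⟩
  mul_mem' := by
    rintro a b ⟨s, hs, h⟩ ⟨t, ht, h'⟩
    exact ⟨s * t, mul_mem hs ht, fun c => by simp [h, h', mul_assoc]⟩
  inv_mem' := by
    rintro a ⟨s, hs, h⟩
    refine ⟨s⁻¹, inv_mem hs, fun c => ?_⟩
    have := h (a⁻¹ c)
    rw [MulAut.apply_inv_self] at this
    rw [this]; group

theorem autS_le_autF (F : FusionSystem S) {C : Subgroup P} (hC : C ≤ S) :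
    autS S C ≤ F.autF C hC := fun _ ⟨s, hs, h⟩ => F.conj_mem _ hC hC ⟨s, hs, h⟩

theorem isPGroup_autS {p : ℕ} (hS : IsPGroup p S) (C : Subgroup P) : IsPGroup p (autS S C) := by
  rintro ⟨α, s, hs, h⟩
  obtain ⟨k, hk⟩ := hS ⟨s, hs⟩
  refine ⟨k, Subtype.ext ?_⟩
  have key : ∀ (n : ℕ) (c : C), ((α ^ n) c : P) = s ^ n * c * (s ^ n)⁻¹ := by
    intro n
    induction n with
    | zero => simp
    | succ n ih =>
      intro c
      rw [pow_succ', MulAut.mul_apply, h, ih, pow_succ']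
      group
  ext c
  have h1 : s ^ p ^ k = 1 := congrArg Subtype.val hk
  change ((α ^ p ^ k) c : P) = c
  rw [key, h1]
  simp

/-- A graph is the graph of an isomorphism. -/
theorem IsGraph.exists_mulEquiv (hD : F.IsGraph D) {H K : Subgroup P} (hH : dom D = H)
    (hK : ran D = K) : ∃ e : H ≃* K, e.toMonoidHom ∈ F.Hom H K ∧ ∀ x, ((e x : P), (x : P)) ∈ D := by
  obtain ⟨φ, hφ, hb⟩ : ∃ φ : H →* K, φ ∈ F.Hom H K ∧ ∀ x, ((φ x : P), (x : P)) ∈ D := by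
    obtain ⟨E, φ, hφ, rfl⟩ := hD
    have hE : H ≤ E := by
      rintro b hb
      rw [← hH] at hb
      obtain ⟨a, ha⟩ := mem_dom.1 hb
      exact (mem_twistedDiagonal.1 ha).1
    have hKS : K ≤ S := hK ▸ (isGraph_of_hom hφ).ran_le
    refine ⟨(S.subtype.comp (φ.comp (Subgroup.inclusion hE))).codRestrict K fun x => ?_,
      hom_congr (hom_restrict hφ hE) _ hKS fun x => rfl, fun x => ?_⟩
    · rw [← hK]
      exact mem_ran_of (mem_twistedDiagonal.2 ⟨hE x.2, rfl⟩)
    · exact mem_twistedDiagonal.2 ⟨hE x.2, rfl⟩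
  refine ⟨MulEquiv.ofBijective φ ⟨F.injective hφ, fun y => ?_⟩, hφ, hb⟩
  have hy : (y : P) ∈ ran D := hK ▸ y.2
  obtain ⟨b, h⟩ := mem_ran.1 hy
  have hb' : b ∈ H := hH ▸ mem_dom_of h
  exact ⟨⟨b, hb'⟩, Subtype.ext (hD.left_unique (hb ⟨b, hb'⟩) h)⟩

/-- Finite `p`-groups are nilpotent, and a proper subgroup of a nilpotent group is smaller than its
normalizer. -/
theorem exists_mem_normalizer_notMem [Finite P] {p : ℕ} [Fact p.Prime] (hS : IsPGroup p S)
    {C E : Subgroup P} (h : C < E) (hE : E ≤ S) :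
    ∃ x ∈ E, x ∉ C ∧ x ∈ Subgroup.normalizer (C : Set P) := by
  have hp : IsPGroup p E := hS.to_le hE
  have hnil := hp.isNilpotent
  have hlt : C.subgroupOf E < ⊤ := by
    rw [lt_top_iff_ne_top, Ne, Subgroup.subgroupOf_eq_top]
    exact h.not_ge
  obtain ⟨x, hx, hx'⟩ := SetLike.exists_of_lt
    (Group.normalizerCondition_of_isNilpotent (C.subgroupOf E) hlt)
  refine ⟨x, x.2, fun hc => hx' (Subgroup.mem_subgroupOf.2 hc),
    mem_normalizer_of_forall fun y hy => ?_⟩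
  have := (Subgroup.mem_normalizer_iff.1 hx ⟨y, h.le hy⟩).1 (Subgroup.mem_subgroupOf.2 hy)
  exact Subgroup.mem_subgroupOf.1 this

/-- Restriction of a graph to a subgroup of its domain. -/
def restr (D : Subgroup (P × P)) (A : Subgroup P) : Subgroup (P × P) := D ⊓ Subgroup.prod ⊤ A

theorem mem_restr {A : Subgroup P} {a b : P} : (a, b) ∈ restr D A ↔ (a, b) ∈ D ∧ b ∈ A := by
  rw [restr, Subgroup.mem_inf, Subgroup.mem_prod]
  simp

theorem restr_le (D : Subgroup (P × P)) (A : Subgroup P) : restr D A ≤ D := inf_le_left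

theorem dom_restr {A : Subgroup P} (h : A ≤ dom D) : dom (restr D A) = A := by
  ext b
  rw [mem_dom]
  constructor
  · rintro ⟨a, h⟩
    exact (mem_restr.1 h).2
  · intro hb
    obtain ⟨a, ha⟩ := mem_dom.1 (h hb)
    exact ⟨a, mem_restr.2 ⟨ha, hb⟩⟩

theorem IsGraph.eq_of_le (hD' : F.IsGraph D') (h : D ≤ D') (hd : dom D' ≤ dom D) : D = D' := by
  refine le_antisymm h ?_
  rintro ⟨a, b⟩ hab
  obtain ⟨a', h'⟩ := mem_dom.1 (hd (mem_dom_of hab))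
  rwa [hD'.left_unique hab (h h')]

/-- The property that `p`-subgroups of `Aut_F(Q)` are conjugate to subgroups of `Aut_S(C)` for
some fully normalized `C`. -/
def SylowProperty (F : FusionSystem S) (p : ℕ) (Q : Subgroup P) : Prop :=
  ∀ U : Subgroup (MulAut Q), IsPGroup p U → (∀ α ∈ U, α.toMonoidHom ∈ F.Hom Q Q) →
    ∃ X, F.IsGraph X ∧ dom X = Q ∧ F.IsFullyNormalized (ran X) ∧
      ∀ α ∈ U, ∃ s ∈ S, ∀ (q : Q) (a : P), (a, (q : P)) ∈ X → (s * a * s⁻¹, (α q : P)) ∈ X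

/-- The transport of `U` to `C` is a `p`-subgroup of `Aut_F(C)`. By Sylow's theorem some `g` in
`Aut_F(C)` conjugates it into `Aut_S(C)`. The required graph is that of the given isomorphism from
`Q` to `C` followed by `g`. -/
theorem sylowProperty_of_isSylow [Finite P] {p : ℕ} [Fact p.Prime] {Q C : Subgroup P}
    (hQC : F.IsConj Q C) (hC : F.IsFullyNormalized C)
    (hA : ∃ A : Sylow p (F.autF C hC.1), (A : Subgroup (F.autF C hC.1)) =
      (autS S C).subgroupOf (F.autF C hC.1)) : F.SylowProperty p Q := by
  obtain ⟨A, hA⟩ := hA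
  intro U hU hUF
  obtain ⟨φ, hφ, hb⟩ := hQC
  let τ : Q ≃* C := MulEquiv.ofBijective φ hb
  have hτ' : τ.symm.toMonoidHom ∈ F.Hom C Q := (F.image_mem τ hφ fun _ => rfl).2
  let U' : Subgroup (MulAut C) := U.map (MulAut.congr τ).toMonoidHom
  have hU' : U' ≤ F.autF C hC.1 := by
    rintro _ ⟨α, hα, rfl⟩
    exact F.comp_mem (F.comp_mem hτ' (hUF α hα)) hφ
  have hpU' : IsPGroup p U' := hU.map _
  obtain ⟨B, hB⟩ := (hpU'.comap_subtype (K := F.autF C hC.1)).exists_le_sylow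
  obtain ⟨g, hg⟩ := MulAction.exists_smul_eq (F.autF C hC.1) B A
  let σ : Q ≃* C := τ.trans (g : MulAut C)
  have hσ : σ.toMonoidHom ∈ F.Hom Q C := F.comp_mem hφ g.2
  refine ⟨twistedDiagonal σ.toMonoidHom, isGraph_of_hom hσ, ?_, ?_, fun α hα => ?_⟩
  · ext b
    rw [mem_dom]
    constructor
    · rintro ⟨a, h⟩
      exact (mem_twistedDiagonal.1 h).1
    · intro h
      exact ⟨_, mem_twistedDiagonal.2 ⟨h, rfl⟩⟩
  · convert hC
    ext a
    rw [mem_ran]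
    constructor
    · rintro ⟨b, h⟩
      obtain ⟨hb, rfl⟩ := mem_twistedDiagonal.1 h
      exact (σ _).2
    · intro h
      exact ⟨σ.symm ⟨a, h⟩, mem_twistedDiagonal.2 ⟨(σ.symm ⟨a, h⟩).2, by simp⟩⟩
  · have h1 : (⟨MulAut.congr τ α, hU' ⟨α, hα, rfl⟩⟩ : F.autF C hC.1) ∈
        (B : Subgroup (F.autF C hC.1)) := by
      apply hB
      rw [Subgroup.mem_comap]
      exact ⟨α, hα, rfl⟩
    have h2 := Subgroup.smul_mem_pointwise_smul _ (MulAut.conj g) _ h1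
    have h3 : g * ⟨MulAut.congr τ α, hU' ⟨α, hα, rfl⟩⟩ * g⁻¹ ∈ (A : Subgroup (F.autF C hC.1)) := by
      rw [← hg]
      exact h2
    rw [hA, Subgroup.mem_subgroupOf] at h3
    obtain ⟨s, hs, h⟩ := h3
    refine ⟨s, hs, fun q a hqa => ?_⟩
    obtain ⟨_, rfl⟩ := mem_twistedDiagonal.1 hqa
    refine mem_twistedDiagonal.2 ⟨(α q).2, ?_⟩
    have h4 := h (σ q)
    refine Eq.trans ?_ h4
    congr 1
    simp [σ, MulAut.congr]

end FusionSystem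

/-! ### Sylow automizers and the extension axiom on centric subgroups -/

namespace FusionSystem

open GroupRel BisetMatrix

variable {P : Type u} [Group P] [Finite P] {S : Subgroup P} {F : FusionSystem S}
  {D D' : Subgroup (P × P)} {p : ℕ} [Fact p.Prime]

theorem dom_restr_isConj {X : Subgroup (P × P)} (hX : F.IsGraph X) {C : Subgroup P}
    (hC : C ≤ dom X) : F.IsConj C (ran (restr X C)) :=
  isConj_iff.2 ⟨_, hX.mono (restr_le X C), dom_restr hC, rfl⟩

/-- `N_S(C)`. -/
abbrev nor (S C : Subgroup P) : Subgroup P := S ⊓ Subgroup.normalizer (C : Set P)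

theorem le_nor {C : Subgroup P} (hC : C ≤ S) : C ≤ nor S C := le_inf hC Subgroup.le_normalizer

theorem conj_mem_of_mem_nor {C : Subgroup P} {x c : P} (hx : x ∈ nor S C) (hc : c ∈ C) :
    x * c * x⁻¹ ∈ C := (Subgroup.mem_normalizer_iff.1 hx.2 c).1 hc

/-- An automorphism of a fully normalized subgroup `C` that normalizes `Aut_S(C)` extends to an
automorphism of `N_S(C)`. -/
theorem exists_extension_nor (hF : F.IsSaturated p) {C : Subgroup P} (hC : F.IsFullyNormalized C)
    {φ : MulAut C} (hφ : φ ∈ F.autF C hC.1) (hn : ∀ α ∈ autS S C, φ * α * φ⁻¹ ∈ autS S C) :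
    ∃ ψ ∈ F.autF (nor S C) inf_le_left, ∀ (c : C) (n : nor S C), (c : P) = n →
      (ψ n : P) = φ c := by
  set D := twistedDiagonal φ.toMonoidHom with hDdef
  have hD : F.IsGraph D := isGraph_of_hom hφ
  have hmem : ∀ c : C, ((φ c : P), (c : P)) ∈ D := fun c => mem_twistedDiagonal.2 ⟨c.2, rfl⟩
  have hran : ran D = C := by
    ext a
    rw [mem_ran]
    constructor
    · rintro ⟨b, h⟩
      obtain ⟨hb, rfl⟩ := mem_twistedDiagonal.1 h
      exact (φ.toMonoidHom _).2
    · intro h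
      refine ⟨φ.symm ⟨a, h⟩, ?_⟩
      have := hmem (φ.symm ⟨a, h⟩)
      rwa [MulEquiv.apply_symm_apply] at this
  obtain ⟨D', hD', hle, h⟩ := hF.exists_extension_of_isFullyNormalized hD (hran.symm ▸ hC)
  -- For `x` in `N_S(C)`, the conjugate by `φ` of conjugation with `x` is conjugation with some `z`
  -- in `S`. The pair `(z, x)` then normalizes the graph of `φ`, so the extension is defined at `x`.
  have hdom : nor S C ≤ dom D' := by
    intro x hx
    let α : MulAut C := Subgroup.normalizerMonoidHom C ⟨x, hx.2⟩
    have hα : α ∈ autS S C := ⟨x, hx.1, fun c => rfl⟩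
    obtain ⟨z, hz, hzα⟩ := hn α hα
    refine h z hz x hx.1 ?_
    intro a b hab
    obtain ⟨hb, rfl⟩ := mem_twistedDiagonal.1 hab
    have h1 := hzα (φ ⟨b, hb⟩)
    rw [MulAut.mul_apply, MulAut.mul_apply, MulAut.inv_apply_self] at h1
    change (_ : P) = z * (φ ⟨b, hb⟩ : P) * z⁻¹ at h1
    refine mem_twistedDiagonal.2 ⟨conj_mem_of_mem_nor hx hb, ?_⟩
    exact h1
  have hr : ran (restr D' (nor S C)) ≤ nor S C := by
    intro a ha
    obtain ⟨n, han⟩ := mem_ran.1 ha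
    obtain ⟨han, hn⟩ := mem_restr.1 han
    refine ⟨hD'.mem_left han, mem_normalizer_of_forall fun c hc => ?_⟩
    have h1 := hmem (φ.symm ⟨c, hc⟩)
    rw [MulEquiv.apply_symm_apply] at h1
    have h2 := mul_mem (mul_mem han (hle h1)) (inv_mem han)
    have h3 : n * (φ.symm ⟨c, hc⟩ : P) * n⁻¹ ∈ C := conj_mem_of_mem_nor hn (φ.symm ⟨c, hc⟩).2
    have h4 := hle (hmem ⟨_, h3⟩)
    have h5 : a * c * a⁻¹ = (φ ⟨_, h3⟩ : P) := hD'.left_unique h2 h4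
    rw [h5]
    exact (φ _).2
  have hG := hD'.mono (restr_le D' (nor S C))
  have hr' : ran (restr D' (nor S C)) = nor S C :=
    Subgroup.eq_of_le_of_card_ge hr (by
      rw [← hG.isConj.card_eq, dom_restr hdom])
  obtain ⟨e, he, hemem⟩ := hG.exists_mulEquiv (dom_restr hdom) hr'
  refine ⟨e, he, fun c n hcn => ?_⟩
  have h1 := (mem_restr.1 (hemem n)).1
  have h2 := hle (hmem c)
  rw [hcn] at h2
  exact hD'.left_unique h1 h2

/-- The order of `g` is a power of `p`, hence prime to `m`, and `g` is a power of `g ^ m`. -/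
theorem mem_of_pow_mem {G : Type*} [Group G] {A : Subgroup G} {g : G} {m k : ℕ}
    (hm : ¬ p ∣ m) (hk : g ^ p ^ k = 1) (h : g ^ m ∈ A) : g ∈ A := by
  have hc : m.Coprime (orderOf g) :=
    Nat.Coprime.coprime_dvd_right (orderOf_dvd_of_pow_eq_one hk)
      (Nat.Coprime.pow_right k ((Nat.Prime.coprime_iff_not_dvd (Fact.out : p.Prime)).2 hm).symm)
  obtain ⟨n, hn⟩ := exists_pow_eq_self_of_coprime hc
  rw [← hn]
  exact pow_mem h n

/-- For fully normalized `C`, the group `Aut_S(C)` is a Sylow subgroup of `Aut_F(C)`. -/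
theorem exists_sylow_autS (hS : IsPGroup p S) (hF : F.IsSaturated p) {C : Subgroup P}
    (hC : F.IsFullyNormalized C)
    (ih : C < nor S C → F.SylowProperty p (nor S C)) :
    ∃ A : Sylow p (F.autF C hC.1), (A : Subgroup (F.autF C hC.1)) =
      (autS S C).subgroupOf (F.autF C hC.1) := by
  rcases eq_or_ne C S with rfl | hne
  · obtain ⟨Q, hQ⟩ := hF.sylow
    refine ⟨Q, hQ.trans ?_⟩
    congr 1
    ext α
    constructor
    · rintro ⟨s, rfl⟩
      exact ⟨s, s.2, fun c => rfl⟩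
    · rintro ⟨s, hs, h⟩
      exact ⟨⟨s, hs⟩, by ext c; exact (h c).symm⟩
  have hlt : C < nor S C := by
    obtain ⟨x, hx, hxC, hx'⟩ := exists_mem_normalizer_notMem hS (lt_of_le_of_ne hC.1 hne) le_rfl
    exact lt_of_le_of_ne (le_nor hC.1) fun h => hxC (h ▸ ⟨hx, hx'⟩)
  set A := (autS S C).subgroupOf (F.autF C hC.1) with hAdef
  have hA : IsPGroup p A := (isPGroup_autS hS C).comap_subtype
  obtain ⟨B, hB⟩ := hA.exists_le_sylow
  refine ⟨B, ?_⟩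
  -- Otherwise `Aut_S(C)` has a larger normalizer in the `p`-group `B`, which yields a `p`-element
  -- `φ` that normalizes `Aut_S(C)` without belonging to it. It extends to an automorphism `ψ` of
  -- `N_S(C)`, and the Sylow property of `N_S(C)` will show that a power of `φ` with exponent prime
  -- to `p` is induced by `S`.
  by_contra hBA
  have hltB : A < (B : Subgroup _) := lt_of_le_of_ne hB (Ne.symm hBA)
  have hnil : Group.IsNilpotent B := B.2.isNilpotent
  obtain ⟨φ, hφ, hφ'⟩ := SetLike.exists_of_lt
    (Group.normalizerCondition_of_isNilpotent (A.subgroupOf B) (by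
      rw [lt_top_iff_ne_top, Ne, Subgroup.subgroupOf_eq_top]
      exact hltB.not_ge))
  obtain ⟨k, hk⟩ := B.2 φ
  have hk' : (φ : F.autF C hC.1) ^ p ^ k = 1 := congrArg Subtype.val hk
  have hφA : (φ : F.autF C hC.1) ∉ A := fun h => hφ' (Subgroup.mem_subgroupOf.2 h)
  obtain ⟨ψ, hψ, hψφ⟩ := exists_extension_nor hF hC (φ : F.autF C hC.1).2 (by
    intro α hα
    have h1 : (⟨α, autS_le_autF F hC.1 hα⟩ : F.autF C hC.1) ∈ A := Subgroup.mem_subgroupOf.2 hα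
    have h2 := (Subgroup.mem_normalizer_iff.1 hφ ⟨_, hB h1⟩).1 (Subgroup.mem_subgroupOf.2 h1)
    exact Subgroup.mem_subgroupOf.1 (Subgroup.mem_subgroupOf.1 h2))
  -- The order of `ψ` need not be a power of `p`. The power `ψ ^ m`, with `m` the part of the order
  -- prime to `p`, is a `p`-element, and passing to it loses nothing on `C` by `mem_of_pow_mem`.
  obtain ⟨b, m, hm, hord⟩ := Nat.exists_eq_pow_mul_and_not_dvd
    (orderOf_pos ψ).ne' p (Fact.out : p.Prime).ne_one
  have hU : IsPGroup p (Subgroup.zpowers (ψ ^ m)) := by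
    rw [IsPGroup.iff_card]
    have : (ψ ^ m) ^ p ^ b = 1 := by
      rw [← pow_mul, mul_comm, ← hord, pow_orderOf_eq_one]
    obtain ⟨c, -, hc⟩ := (Nat.dvd_prime_pow Fact.out).1 (orderOf_dvd_of_pow_eq_one this)
    exact ⟨c, by rw [Nat.card_zpowers, hc]⟩
  obtain ⟨X, hX, hXdom, hXn, hXU⟩ := ih hlt _ hU (by
    intro α hα
    exact (Subgroup.zpowers_le.2 (pow_mem hψ m) : _ ≤ F.autF (nor S C) inf_le_left) hα)
  obtain ⟨s, hs, hsX⟩ := hXU _ (Subgroup.mem_zpowers _)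
  have hpow : ∀ (n : ℕ) (c : C) (x : nor S C), (c : P) = x →
      ((ψ ^ n) x : P) = ((φ : F.autF C hC.1) ^ n : F.autF C hC.1).1 c := by
    intro n
    induction n with
    | zero => intro c x h; simpa using h.symm
    | succ n ih =>
      intro c x h
      rw [pow_succ', pow_succ', MulAut.mul_apply]
      exact hψφ _ _ (ih c x h).symm
  have hCle : C ≤ dom X := by rw [hXdom]; exact hlt.le
  have hC1 := dom_restr_isConj hX hCle
  set C1 := ran (restr X C) with hC1def
  have hXle : ran X ≤ nor S C1 := by
    intro a ha
    refine ⟨hX.ran_le ha, mem_normalizer_of_forall fun c1 hc1 => ?_⟩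
    obtain ⟨n, han⟩ := mem_ran.1 ha
    obtain ⟨c, hc⟩ := mem_ran.1 hc1
    obtain ⟨hc, hcC⟩ := mem_restr.1 hc
    have hn : n ∈ nor S C := hXdom ▸ mem_dom_of han
    exact mem_ran_of (mem_restr.2 ⟨mul_mem (mul_mem han hc) (inv_mem han),
      conj_mem_of_mem_nor hn hcC⟩)
  -- Full normalization of `C` bounds `|N_S(C1)|` by `|N_S(C)| = |ran X|`. Hence `s`, which
  -- normalizes `C1`, lies in the range of `X` and can be pulled back to an element `w` that induces
  -- `φ ^ m` on `C`.
  have hXeq : ran X = nor S C1 := by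
    refine Subgroup.eq_of_le_of_card_ge hXle ((hC.2 _ hC1).trans ?_)
    rw [← hX.isConj.card_eq, hXdom]
  have hs1 : s ∈ ran X := by
    rw [hXeq]
    refine ⟨hs, mem_normalizer_of_forall fun c1 hc1 => ?_⟩
    obtain ⟨c, hc⟩ := mem_ran.1 hc1
    obtain ⟨hc, hcC⟩ := mem_restr.1 hc
    refine mem_ran_of (mem_restr.2 ⟨hsX ⟨c, hlt.le hcC⟩ c1 hc, ?_⟩)
    rw [hpow m ⟨c, hcC⟩ ⟨c, hlt.le hcC⟩ rfl]
    exact (_ : C).2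
  obtain ⟨w, hw⟩ := mem_ran.1 hs1
  refine hφA (mem_of_pow_mem hm hk' (Subgroup.mem_subgroupOf.2 ⟨w, hX.mem_right hw, fun c => ?_⟩))
  obtain ⟨a, ha⟩ := mem_dom.1 (hCle c.2)
  have h1 := hsX ⟨c, hlt.le c.2⟩ a ha
  rw [hpow m c ⟨c, hlt.le c.2⟩ rfl] at h1
  exact hX.right_unique h1 (mul_mem (mul_mem hw ha) (inv_mem hw))

/-- Downward induction on the order of `Q`. A fully normalized conjugate `C` of `Q` is either `S`,
where the Sylow axiom applies, or properly contained in `N_S(C)`, for which the property is known by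
induction. -/
theorem sylowProperty (hS : IsPGroup p S) (hF : F.IsSaturated p) {Q : Subgroup P} (hQ : Q ≤ S) :
    F.SylowProperty p Q := by
  induction h : Nat.card S - Nat.card Q using Nat.strong_induction_on generalizing Q with
  | _ n ih =>
    obtain ⟨C, hQC, hC⟩ := F.exists_isFullyNormalized hQ
    refine sylowProperty_of_isSylow hQC hC (exists_sylow_autS hS hF hC fun hlt => ?_)
    refine ih _ ?_ inf_le_left rfl
    have h1 : Nat.card C < Nat.card (nor S C) := Set.ncard_lt_ncard hlt (Set.toFinite _)
    have h2 : Nat.card (nor S C) ≤ Nat.card S := Subgroup.card_le_of_le inf_le_left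
    have h3 := hQC.card_eq
    omega

/-- Morphisms defined on a centric subgroup satisfy the extension axiom. -/
theorem IsSaturated.exists_extension (hS : IsPGroup p S) (hF : F.IsSaturated p)
    (hD : F.IsGraph D) (hc : F.IsCentric (dom D)) :
    ∃ D', F.IsGraph D' ∧ D ≤ D' ∧ ∀ z ∈ S, ∀ x ∈ S, Normalizes z x D → x ∈ dom D' := by
  -- `X` moves the range of `D` to a fully normalized subgroup and carries `Aut_S(ran D)` into
  -- `Aut_S(ran X)`. The axiom then extends both `X` and `X ∘ D`, to `X'` and `Y`, and `X'⁻¹ ∘ Y` is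
  -- the desired extension of `D`.
  obtain ⟨X, hX, hXd, hXn, hXU⟩ := sylowProperty hS hF hD.ran_le (autS S (ran D))
    (isPGroup_autS hS _) (autS_le_autF F hD.ran_le)
  obtain ⟨X', hX', hXX', hX'2⟩ := hF.exists_extension_of_isFullyNormalized hX hXn
  have hr : ran (comp X D) = ran X := by
    ext a
    rw [mem_ran, mem_ran]
    constructor
    · rintro ⟨b, l, h1, h2⟩
      exact ⟨l, h1⟩
    · rintro ⟨l, h⟩
      obtain ⟨b, hb⟩ := mem_ran.1 (hXd ▸ mem_dom_of h : l ∈ ran D)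
      exact ⟨b, l, h, hb⟩
  obtain ⟨Y, hY, hYle, hY2⟩ := hF.exists_extension_of_isFullyNormalized (hX.comp hD) (hr ▸ hXn)
  have hXc : F.IsCentric (ran X) := by
    refine (hc.isConj hD.isConj).isConj ?_
    rw [← hXd]
    exact hX.isConj
  have hsel : ∀ a b, (a, b) ∈ D → ∃ c, (c, a) ∈ X := by
    intro a b h
    exact mem_dom.1 (hXd.symm ▸ mem_ran_of h)
  refine ⟨comp (op X') Y, hX'.op.comp hY, ?_, ?_⟩
  · rintro ⟨a, b⟩ h
    obtain ⟨c, hc⟩ := hsel a b h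
    exact ⟨c, hXX' hc, hYle ⟨a, hc, h⟩⟩
  · intro z hz x hx hzx
    have hzn : z ∈ nor S (ran D) := by
      refine ⟨hz, mem_normalizer_of_forall fun a ha => ?_⟩
      obtain ⟨b, hb⟩ := mem_ran.1 ha
      exact mem_ran_of (hzx _ _ hb)
    obtain ⟨s, hs, hsX⟩ := hXU (Subgroup.normalizerMonoidHom (ran D) ⟨z, hzn.2⟩)
      ⟨z, hz, fun c => rfl⟩
    have hsX' : Normalizes s z X := by
      intro a b h
      exact hsX ⟨b, hXd ▸ mem_dom_of h⟩ a h
    obtain ⟨s', hs'⟩ := mem_dom.1 (hX'2 s hs z hz hsX')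
    obtain ⟨y, hy⟩ := mem_dom.1 (hY2 s hs x hx (by
      rintro a b ⟨l, h1, h2⟩
      exact ⟨_, hsX' _ _ h1, hzx _ _ h2⟩))
    -- The value `y` of `Y` at `x` must be shown to lie in the range of `X'`. It acts on `ran X` as
    -- the value `s'` of `X'` at `z` does, so the two differ by an element that centralizes the
    -- centric subgroup `ran X` and therefore belongs to it.
    have hcent : y⁻¹ * s' ∈ ran X := by
      refine hXc.2 _ (F.isConj_refl hXc.1) ⟨S.mul_mem (S.inv_mem (hY.mem_left hy)) (hX'.mem_left hs'),
        Subgroup.mem_centralizer_iff.2 fun c hcX => ?_⟩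
      obtain ⟨a, hca⟩ := mem_ran.1 hcX
      obtain ⟨b, hab⟩ := mem_ran.1 (hXd ▸ mem_dom_of hca : a ∈ ran D)
      have h1 := mul_mem (mul_mem hy (hYle (mem_comp.2 ⟨a, hca, hab⟩))) (inv_mem hy)
      have h2 := mul_mem (mul_mem hs' (hXX' hca)) (inv_mem hs')
      have h3 := hzx _ _ hab
      obtain ⟨c', hc'⟩ := hsel _ _ h3
      have h4 : y * c * y⁻¹ = c' := hY.left_unique h1 (hYle (mem_comp.2 ⟨_, hc', h3⟩))
      have h5 : s' * c * s'⁻¹ = c' := hX'.left_unique h2 (hXX' hc')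
      have h6 : y * c * y⁻¹ = s' * c * s'⁻¹ := h4.trans h5.symm
      calc c * (y⁻¹ * s') = y⁻¹ * (y * c * y⁻¹) * s' := by group
        _ = y⁻¹ * (s' * c * s'⁻¹) * s' := by rw [h6]
        _ = y⁻¹ * s' * c := by group
    obtain ⟨b, hb⟩ := mem_ran.1 hcent
    have h1 := mul_mem hs' (inv_mem (hXX' hb))
    refine mem_dom.2 ⟨z * b⁻¹, y, ?_, hy⟩
    have h2 : s' * (y⁻¹ * s')⁻¹ = y := by group
    have h3 : (s', z) * ((y⁻¹ * s'), b)⁻¹ = (y, z * b⁻¹) := Prod.ext h2 rfl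
    rw [h3] at h1
    exact h1

end FusionSystem

/-! ### Uniqueness of maximal extensions, and the centric biset -/

namespace FusionSystem

open GroupRel BisetMatrix

variable {P : Type u} [Group P] [Finite P] {S : Subgroup P} {F : FusionSystem S}
  {D D0 D1 D2 : Subgroup (P × P)} {p : ℕ} [Fact p.Prime]

/-- `D` is the graph of a morphism defined on a centric subgroup. -/
def IsCentricGraph (F : FusionSystem S) (D : Subgroup (P × P)) : Prop :=
  F.IsGraph D ∧ F.IsCentric (dom D)

/-- `D2 = (z, 1) D1 (z, 1)⁻¹` for some `z` in the center of the range of `D0`. -/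
def CenterConj (D0 D1 D2 : Subgroup (P × P)) : Prop :=
  ∃ z ∈ ran D0, (∀ b ∈ ran D0, z * b = b * z) ∧ D2 = conjBy (z, 1) D1

theorem IsCentricGraph.isCentric_ran (h : F.IsCentricGraph D) : F.IsCentric (ran D) :=
  h.2.isConj h.1.isConj

theorem IsCentricGraph.of_le (h : F.IsCentricGraph D) (hle : D ≤ D1) (h1 : F.IsGraph D1) :
    F.IsCentricGraph D1 :=
  ⟨h1, h.2.of_le (dom_mono hle) h1.dom_le⟩

/-- This is how centricity enters the uniqueness proofs: `ran D` contains its centralizer in `S`. -/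
theorem IsCentricGraph.mem_ran_of_comm (h : F.IsCentricGraph D) {z : P} (hz : z ∈ S)
    (hc : ∀ b ∈ ran D, z * b = b * z) : z ∈ ran D :=
  h.isCentric_ran.2 _ (F.isConj_refl h.1.ran_le)
    ⟨hz, Subgroup.mem_centralizer_iff.2 fun b hb => (hc b hb).symm⟩

theorem IsCentricGraph.conjBy (h : F.IsCentricGraph D) {x y : P} (hx : x ∈ S) (hy : y ∈ S) :
    F.IsCentricGraph (conjBy (x, y) D) := by
  refine ⟨h.1.conjBy hx hy, h.2.isConj (isConj_iff.2
    ⟨_, F.isGraph_conjGraph h.1.dom_le hy, ?_, ?_⟩)⟩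
  · ext b
    rw [mem_dom]
    exact ⟨fun ⟨a, ha⟩ => ha.2.2, fun hb => ⟨y * b * y⁻¹, rfl, trivial, hb⟩⟩
  · ext a
    rw [mem_dom_conjBy, mem_ran]
    constructor
    · rintro ⟨b, h1, -, hb⟩
      replace h1 : a = y * b * y⁻¹ := h1
      rw [h1]
      simpa [mul_assoc] using hb
    · intro ha
      exact ⟨_, by change a = y * (y⁻¹ * a * y) * y⁻¹; group, trivial, ha⟩

/-- An element that centralizes the range of the larger graph centralizes the range of `D0`, and it
lies in that range because the latter is centric. So centers shrink when centric graphs grow, and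
corrections found for larger graphs are admissible for smaller ones. -/
theorem CenterConj.of_le {D0' : Subgroup (P × P)} (h0 : F.IsCentricGraph D0) (hle : D0 ≤ D0')
    (hD : F.IsGraph D0') (h : CenterConj D0' D1 D2) : CenterConj D0 D1 D2 := by
  obtain ⟨z, hz, hc, h⟩ := h
  have hc' : ∀ b ∈ ran D0, z * b = b * z := fun b hb => hc b (ran_mono hle hb)
  exact ⟨z, h0.mem_ran_of_comm (hD.ran_le hz) hc', hc', h⟩

theorem CenterConj.symm (h : CenterConj D0 D1 D2) : CenterConj D0 D2 D1 := by
  obtain ⟨z, hz, hc, rfl⟩ := h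
  refine ⟨z⁻¹, inv_mem hz, fun b hb => ?_, ?_⟩
  · have := hc b hb
    calc z⁻¹ * b = z⁻¹ * (b * z) * z⁻¹ := by group
      _ = z⁻¹ * (z * b) * z⁻¹ := by rw [this]
      _ = b * z⁻¹ := by group
  · rw [conjBy_conjBy, Prod.mk_mul_mk]
    simp only [inv_mul_cancel, one_mul]
    exact (conjBy_one D1).symm

theorem CenterConj.trans {D3 : Subgroup (P × P)} (h : CenterConj D0 D1 D2)
    (h' : CenterConj D0 D2 D3) : CenterConj D0 D1 D3 := by
  obtain ⟨z, hz, hc, rfl⟩ := h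
  obtain ⟨z', hz', hc', rfl⟩ := h'
  refine ⟨z' * z, mul_mem hz' hz, fun b hb => ?_, ?_⟩
  · rw [mul_assoc, hc b hb, ← mul_assoc, hc' b hb, mul_assoc]
  · rw [conjBy_conjBy, Prod.mk_mul_mk, one_mul]

theorem CenterConj.refl (D0 D1 : Subgroup (P × P)) : CenterConj D0 D1 D1 :=
  ⟨1, one_mem _, by simp, (conjBy_one D1).symm⟩

/-- Two extensions of a morphism on a centric normal subgroup differ by conjugation with an element
of its center. -/
theorem centerConj_of_normal (hS : IsPGroup p S) (hF : F.IsSaturated p) (h0 : F.IsCentricGraph D0)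
    (h1 : F.IsGraph D1) (h2 : F.IsGraph D2) (h01 : D0 ≤ D1) (h02 : D0 ≤ D2)
    (hd : dom D1 = dom D2) (hn : ∀ d ∈ dom D1, ∀ e ∈ dom D0, d * e * d⁻¹ ∈ dom D0) :
    CenterConj D0 D1 D2 := by
  -- The discrepancy `θ = D1⁻¹ ∘ D2` is an automorphism of `dom D1` that fixes `dom D0` pointwise.
  -- By normality and centricity of `dom D0` it multiplies each `y` by an element of the center of
  -- `dom D0`.
  have hθ : F.IsGraph (comp (op D1) D2) := h1.op.comp h2
  have key : ∀ y ∈ dom D1, ∃ e ∈ dom D0, (∀ c ∈ dom D0, e * c = c * e) ∧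
      (y * e, y) ∈ comp (op D1) D2 := by
    intro y hy
    obtain ⟨l', hl'⟩ := mem_dom.1 hy
    obtain ⟨l, hl⟩ := mem_dom.1 (hd ▸ hy : y ∈ dom D2)
    have hc : ∀ b ∈ ran D0, (l'⁻¹ * l) * b = b * (l'⁻¹ * l) := by
      intro b hb
      obtain ⟨e, he⟩ := mem_ran.1 hb
      have a1 := mul_mem (mul_mem hl' (h01 he)) (inv_mem hl')
      have a2 := mul_mem (mul_mem hl (h02 he)) (inv_mem hl)
      obtain ⟨b', hb'⟩ := mem_dom.1 (hn y hy e (mem_dom_of he))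
      have a3 : l' * b * l'⁻¹ = b' := h1.left_unique a1 (h01 hb')
      have a4 : l * b * l⁻¹ = b' := h2.left_unique a2 (h02 hb')
      have a5 : l' * b * l'⁻¹ = l * b * l⁻¹ := a3.trans a4.symm
      calc l'⁻¹ * l * b = l'⁻¹ * (l * b * l⁻¹) * l := by group
        _ = l'⁻¹ * (l' * b * l'⁻¹) * l := by rw [a5]
        _ = b * (l'⁻¹ * l) := by group
    have hm := h0.mem_ran_of_comm (S.mul_mem (S.inv_mem (h1.mem_left hl')) (h2.mem_left hl)) hc
    obtain ⟨e, he⟩ := mem_ran.1 hm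
    refine ⟨e, mem_dom_of he, fun c hc' => ?_, l, ?_, hl⟩
    · obtain ⟨b, hb⟩ := mem_dom.1 hc'
      have a1 := mul_mem he hb
      have a2 := mul_mem hb he
      have a3 : ((l'⁻¹ * l, e) * (b, c) : P × P) = (b * (l'⁻¹ * l), e * c) :=
        Prod.ext (hc b (mem_ran_of hb)) rfl
      rw [a3] at a1
      exact h0.1.right_unique a1 a2
    · have a1 := mul_mem hl' (h01 he)
      have a2 : ((l', y) * (l'⁻¹ * l, e) : P × P) = (l, y * e) := Prod.ext (by simp) rfl
      rw [a2] at a1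
      exact a1
  have hdom : dom (comp (op D1) D2) = dom D1 := by
    refine le_antisymm (fun y hy => ?_) fun y hy => ?_
    · obtain ⟨a, l, -, h⟩ := mem_dom.1 hy
      rw [hd]
      exact mem_dom_of h
    · obtain ⟨e, -, -, h⟩ := key y hy
      exact mem_dom_of h
  have hran : ran (comp (op D1) D2) = dom D1 := by
    refine Subgroup.eq_of_le_of_card_ge (fun y hy => ?_) ?_
    · obtain ⟨b, l, h, -⟩ := mem_ran.1 hy
      exact mem_dom_of (mem_op.1 h)
    · rw [← hθ.isConj.card_eq, hdom]
  obtain ⟨θ, hθF, hθm⟩ := hθ.exists_mulEquiv hdom hran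
  have hid : ∀ e : dom D1, (e : P) ∈ dom D0 → θ e = e := by
    intro e he
    obtain ⟨b, hb⟩ := mem_dom.1 he
    exact Subtype.ext (hθ.left_unique (hθm e) ⟨b, h01 hb, h02 hb⟩)
  have hle0 : dom D0 ≤ dom D1 := dom_mono h01
  obtain ⟨k, hk⟩ := (IsPGroup.iff_card).1 hS
  have hpow : ∀ (y e : dom D1), (e : P) ∈ dom D0 → θ y = y * e →
      ∀ n : ℕ, (θ ^ n : MulAut (dom D1)) y = y * e ^ n := by
    intro y e he hy n
    induction n with
    | zero => simp
    | succ n ih =>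
      rw [pow_succ', MulAut.mul_apply, ih, map_mul, map_pow, hy, hid e he, pow_succ', mul_assoc]
  -- The `n`-th power of `θ` multiplies `y` by `e ^ n`, so `|S|`, a power of `p`, annihilates `θ`.
  -- This permits the Sylow property to be applied to the group that `θ` generates.
  have hord : (θ : MulAut (dom D1)) ^ p ^ k = 1 := by
    ext1 y
    obtain ⟨e, he, -, h⟩ := key y y.2
    have h3 : θ y = y * ⟨e, hle0 he⟩ := Subtype.ext (hθ.left_unique (hθm y) h)
    rw [hpow y _ he h3]
    have h4 : (⟨e, h0.1.dom_le he⟩ : S) ^ p ^ k = 1 := by rw [← hk, pow_card_eq_one']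
    have h5 : (⟨e, hle0 he⟩ : dom D1) ^ p ^ k = 1 := Subtype.ext (congrArg Subtype.val h4 :)
    rw [h5, mul_one]
    rfl
  have hU : IsPGroup p (Subgroup.zpowers (θ : MulAut (dom D1))) := by
    rw [IsPGroup.iff_card]
    obtain ⟨c, -, hc⟩ := (Nat.dvd_prime_pow Fact.out).1 (orderOf_dvd_of_pow_eq_one hord)
    exact ⟨c, by rw [Nat.card_zpowers, hc]⟩
  obtain ⟨X, hX, hXd, -, hXU⟩ := sylowProperty hS hF h1.dom_le _ hU fun α hα =>
    (Subgroup.zpowers_le.2 hθF : _ ≤ F.autF (dom D1) h1.dom_le) hα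
  obtain ⟨s, hs, hsX⟩ := hXU _ (Subgroup.mem_zpowers _)
  have hXr : F.IsCentricGraph (restr X (dom D0)) :=
    ⟨hX.mono (restr_le _ _), by rw [dom_restr (hXd.symm ▸ hle0)]; exact h0.2⟩
  -- Since `θ` is trivial on `dom D0`, the element `s` centralizes the image of `dom D0` under `X`,
  -- a centric subgroup, and so belongs to it. Pulled back along `X`, it shows that `θ` is
  -- conjugation with some `w` in `dom D0`.
  have hsr := hXr.mem_ran_of_comm hs (by
    intro a ha
    obtain ⟨e, hae⟩ := mem_ran.1 ha
    obtain ⟨hae, he⟩ := mem_restr.1 hae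
    have h3 := hsX ⟨e, hle0 he⟩ a hae
    rw [hid _ he] at h3
    have h4 : s * a * s⁻¹ = a := hX.left_unique h3 hae
    exact mul_inv_eq_iff_eq_mul.1 h4)
  obtain ⟨w, hw⟩ := mem_ran.1 hsr
  obtain ⟨hw, hw0⟩ := mem_restr.1 hw
  have hθw : ∀ y : dom D1, (θ y : P) = w * y * w⁻¹ := by
    intro y
    obtain ⟨a, ha⟩ := mem_dom.1 (hXd.symm ▸ y.2 : (y : P) ∈ dom X)
    exact hX.right_unique (hsX y a ha) (mul_mem (mul_mem hw ha) (inv_mem hw))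
  obtain ⟨c, hc⟩ := mem_dom.1 hw0
  refine ⟨c, mem_ran_of hc, fun b hb => ?_, ?_⟩
  · obtain ⟨e, he⟩ := mem_ran.1 hb
    have h3 := hθw ⟨e, hle0 (mem_dom_of he)⟩
    rw [hid _ (mem_dom_of he)] at h3
    have h4 := mul_mem (mul_mem hc he) (inv_mem hc)
    have h5 : (c, w) * (b, e) * (c, w)⁻¹ = (c * b * c⁻¹, e) := Prod.ext rfl h3.symm
    rw [h5] at h4
    exact mul_inv_eq_iff_eq_mul.1 (h0.1.left_unique h4 he)
  · refine (h1.conjBy (h0.1.mem_left hc) (one_mem S)).eq_of_le ?_ ?_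
    · rintro ⟨l, y⟩ hly
      have hy : y ∈ dom D1 := hd ▸ mem_dom_of hly
      obtain ⟨l2, h3, h4⟩ := hθm ⟨y, hy⟩
      rw [h2.left_unique h4 hly, hθw] at h3
      have h5 := mul_mem (mul_mem (inv_mem (h01 hc)) h3) (h01 hc)
      rw [mem_conjBy_mk]
      convert h5 using 1
      refine Prod.ext (by simp [mul_assoc]) (by simp [mul_assoc])
    · intro y hy
      rw [mem_dom_conjBy] at hy
      rw [← hd]
      simpa using hy

theorem dom_conjBy_one (z : P) (D : Subgroup (P × P)) : dom (GroupRel.conjBy (z, 1) D) = dom D := by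
  ext b
  rw [mem_dom_conjBy]
  simp

theorem le_restr {A : Subgroup P} (h : D ≤ D1) (hA : dom D ≤ A) : D ≤ restr D1 A := by
  rintro ⟨a, b⟩ hab
  exact mem_restr.2 ⟨h hab, hA (mem_dom_of hab)⟩

theorem card_lt_of_lt {A B : Subgroup P} (h : A < B) : Nat.card A < Nat.card B :=
  Set.ncard_lt_ncard h (Set.toFinite _)

/-- Two extensions of a morphism on a centric subgroup to the same subgroup differ by conjugation
with an element of its center. -/
theorem centerConj_of_dom_eq (hS : IsPGroup p S) (hF : F.IsSaturated p) (h0 : F.IsCentricGraph D0)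
    (h1 : F.IsGraph D1) (h2 : F.IsGraph D2) (h01 : D0 ≤ D1) (h02 : D0 ≤ D2)
    (hd : dom D1 = dom D2) : CenterConj D0 D1 D2 := by
  induction h : Nat.card (dom D1) - Nat.card (dom D0) using Nat.strong_induction_on
    generalizing D0 D1 with
  | _ n ih =>
    rcases (dom_mono h01).eq_or_lt with heq | hlt
    · rw [← h1.eq_of_le h01 heq.ge, ← h2.eq_of_le h02 (hd ▸ heq.ge)]
      exact CenterConj.refl _ _
    obtain ⟨x, hx, hx0, hxn⟩ := exists_mem_normalizer_notMem hS hlt h1.dom_le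
    set N := dom D1 ⊓ Subgroup.normalizer (dom D0 : Set P) with hN
    have hN0 : dom D0 ≤ N := le_inf hlt.le Subgroup.le_normalizer
    have hNlt : dom D0 < N := lt_of_le_of_ne hN0 fun e => hx0 (e ▸ ⟨hx, hxn⟩)
    have hd1 : dom (restr D1 N) = N := dom_restr inf_le_left
    have hd2 : dom (restr D2 N) = N := dom_restr (hd ▸ inf_le_left)
    have h02' : D0 ≤ restr D2 N := le_restr h02 hN0
    have hg2 : F.IsGraph (restr D2 N) := h2.mono (restr_le _ _)
    -- On the normalizer `N` of `dom D0` in `dom D1` the normal case applies. After the correction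
    -- of `D1` by `z` the two graphs agree on `N`, which is strictly larger than `dom D0`, and the
    -- induction hypothesis finishes with the restriction to `N` in place of `D0`.
    obtain ⟨z, hz, hc, heq⟩ := centerConj_of_normal hS hF h0 (h1.mono (restr_le _ _)) hg2
      (le_restr h01 hN0) h02' (hd1.trans hd2.symm) (by
        intro d hd e he
        rw [hd1] at hd
        exact (Subgroup.mem_normalizer_iff.1 hd.2 e).1 he)
    have h3 : CenterConj D0 D1 (conjBy (z, 1) D1) := ⟨z, hz, hc, rfl⟩
    have h4 : CenterConj (restr D2 N) (conjBy (z, 1) D1) D2 := by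
      refine ih _ ?_ (h0.of_le h02' hg2) (h1.conjBy (h0.1.ran_le hz) (one_mem S)) ?_
        (restr_le _ _) (by rw [dom_conjBy_one, hd]) rfl
      · rw [dom_conjBy_one, hd2]
        have := card_lt_of_lt hNlt
        have : Nat.card N ≤ Nat.card (dom D1) := Subgroup.card_le_of_le inf_le_left
        omega
      · rw [heq]
        exact conjBy_mono (restr_le _ _)
    exact h3.trans (h4.of_le h0 h02' hg2)

/-- The graphs of morphisms that do not extend. -/
def IsMaxGraph (F : FusionSystem S) (D : Subgroup (P × P)) : Prop :=
  F.IsGraph D ∧ ∀ D', F.IsGraph D' → D ≤ D' → D' = D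

theorem IsMaxGraph.conjBy {x y : P} (h : F.IsMaxGraph D) (hx : x ∈ S) (hy : y ∈ S) :
    F.IsMaxGraph (conjBy (x, y) D) := by
  refine ⟨h.1.conjBy hx hy, fun D' hD' hle => ?_⟩
  have h1 := h.2 _ (hD'.conjBy (inv_mem hx) (inv_mem hy)) (by
    have := conjBy_mono (g := (x⁻¹, y⁻¹)) hle
    rw [conjBy_conjBy] at this
    simpa [← Prod.one_eq_mk, conjBy_one] using this)
  rw [← h1, conjBy_conjBy]
  simp [← Prod.one_eq_mk, conjBy_one]

theorem IsGraph.exists_maximal (h : F.IsGraph D) : ∃ M, F.IsMaxGraph M ∧ D ≤ M := by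
  obtain ⟨M, hle, hM⟩ := Set.Finite.exists_le_maximal (Set.toFinite {D | F.IsGraph D}) h
  exact ⟨M, ⟨hM.1, fun D' hD' hl => le_antisymm (hM.2 hD' hl) hl⟩, hle⟩

/-- The maximal extensions of a morphism on a centric subgroup are unique up to conjugation with an
element of its center. -/
theorem centerConj_of_maximal (hS : IsPGroup p S) (hF : F.IsSaturated p) (h0 : F.IsCentricGraph D0)
    (h1 : F.IsMaxGraph D1) (h2 : F.IsMaxGraph D2) (h01 : D0 ≤ D1) (h02 : D0 ≤ D2) :
    CenterConj D0 D1 D2 := by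
  induction h : Nat.card S - Nat.card (dom D0) using Nat.strong_induction_on
    generalizing D0 D1 D2 with
  | _ n ih =>
    rcases eq_or_ne D0 D1 with rfl | hne1
    · rw [h1.2 _ h2.1 h02]
      exact CenterConj.refl _ _
    rcases eq_or_ne D0 D2 with rfl | hne2
    · rw [h2.2 _ h1.1 h01]
      exact CenterConj.refl _ _
    -- A maximal graph `M` above `D'` serves as a common reference. By the extension property its
    -- domain contains the normalizer of `dom D0` in the domain of any graph that extends `D0`, so
    -- `M` can be compared with each of `D1` and `D2` on a subgroup larger than `dom D0`.
    obtain ⟨D', hD', hle, hext⟩ := IsSaturated.exists_extension hS hF h0.1 h0.2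
    obtain ⟨M, hM, hD'M⟩ := hD'.exists_maximal
    have key : ∀ D1, F.IsMaxGraph D1 → D0 ≤ D1 → D0 ≠ D1 → CenterConj D0 M D1 := by
      intro D1 h1 h01 hne
      have hlt : dom D0 < dom D1 := lt_of_le_of_ne (dom_mono h01) fun e =>
        hne (h1.1.eq_of_le h01 e.ge)
      obtain ⟨x, hx, hx0, hxn⟩ := exists_mem_normalizer_notMem hS hlt h1.1.dom_le
      set N := dom D1 ⊓ Subgroup.normalizer (dom D0 : Set P) with hN
      have hN0 : dom D0 ≤ N := le_inf hlt.le Subgroup.le_normalizer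
      have hNlt : dom D0 < N := lt_of_le_of_ne hN0 fun e => hx0 (e ▸ ⟨hx, hxn⟩)
      have hNM : N ≤ dom M := by
        rintro y ⟨hy, hyn⟩
        obtain ⟨z, hz⟩ := mem_dom.1 hy
        refine dom_mono hD'M (hext z (h1.1.mem_left hz) y (h1.1.mem_right hz) fun a b hab => ?_)
        obtain ⟨a', ha'⟩ := mem_dom.1
          ((Subgroup.mem_normalizer_iff.1 hyn b).1 (mem_dom_of hab))
        have h5 := mul_mem (mul_mem hz (h01 hab)) (inv_mem hz)
        have h6 : z * a * z⁻¹ = a' := h1.1.left_unique h5 (h01 ha')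
        rw [h6]
        exact ha'
      have hdM : dom (restr M N) = N := dom_restr hNM
      have hd1 : dom (restr D1 N) = N := dom_restr inf_le_left
      have hg1 : F.IsGraph (restr D1 N) := h1.1.mono (restr_le _ _)
      have h01' : D0 ≤ restr D1 N := le_restr h01 hN0
      obtain ⟨z, hz, hc, heq⟩ := centerConj_of_dom_eq hS hF h0 (hM.1.mono (restr_le _ _)) hg1
        (le_restr (hle.trans hD'M) hN0) h01' (hdM.trans hd1.symm)
      have h3 : CenterConj D0 M (conjBy (z, 1) M) := ⟨z, hz, hc, rfl⟩
      refine h3.trans (CenterConj.of_le h0 h01' hg1 ?_)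
      refine ih _ ?_ (h0.of_le h01' hg1) (hM.conjBy (h0.1.ran_le hz) (one_mem S)) h1 ?_
        (restr_le _ _) rfl
      · rw [hd1]
        have := card_lt_of_lt hNlt
        have : Nat.card N ≤ Nat.card S := Subgroup.card_le_of_le (inf_le_left.trans h1.1.dom_le)
        omega
      · rw [heq]
        exact conjBy_mono (restr_le _ _)
    exact (key D1 h1 h01 hne1).symm.trans (key D2 h2 h02 hne2)

/-- Maximality and the extension axiom force `h` into the domain of `D`. If `D` sends `h` to `k'`,
then `k` and `k'` act alike on the range, so `k * k'⁻¹` is central there. Thus the normalizer of a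
maximal graph in `S × S` is the graph times the center of its range, which settles uniqueness among
the cosets of one graph. -/
theorem IsMaxGraph.normalizer_eq (hS : IsPGroup p S) (hF : F.IsSaturated p) (hM : F.IsMaxGraph D)
    (hc : F.IsCentric (dom D)) {k h : P} (hk : k ∈ S) (hh : h ∈ S) (he : GroupRel.conjBy (k, h) D = D) :
    ∃ z ∈ ran D, (∀ b ∈ ran D, z * b = b * z) ∧ (z⁻¹ * k, h) ∈ D := by
  obtain ⟨D', hD', hle, hext⟩ := IsSaturated.exists_extension hS hF hM.1 hc
  have hn : Normalizes k h D := fun a b hab => by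
    rw [← he]
    exact conj_mem_conjBy.2 hab
  have hd : h ∈ dom D := by
    rw [← hM.2 _ hD' hle]
    exact hext k hk h hh hn
  obtain ⟨k', hk'⟩ := mem_dom.1 hd
  have hz : ∀ b ∈ ran D, k * k'⁻¹ * b = b * (k * k'⁻¹) := by
    intro b hb
    obtain ⟨c, hc⟩ := mem_ran.1 hb
    have h1 := mul_mem (mul_mem (inv_mem hk') hc) hk'
    have h2 := hn _ _ h1
    have h3 : h * (h⁻¹ * c * h) * h⁻¹ = c := by group
    change (k * (k'⁻¹ * b * k') * k⁻¹, h * (h⁻¹ * c * h) * h⁻¹) ∈ D at h2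
    rw [h3] at h2
    have h4 := hM.1.left_unique h2 hc
    calc k * k'⁻¹ * b = k * (k'⁻¹ * b * k') * k⁻¹ * (k * k'⁻¹) := by group
      _ = b * (k * k'⁻¹) := by rw [h4]
  refine ⟨k * k'⁻¹, IsCentricGraph.mem_ran_of_comm ⟨hM.1, hc⟩
    (mul_mem hk (inv_mem (hM.1.mem_left hk'))) hz, hz, ?_⟩
  simpa using hk'

/-- A set with an action of `P × P` and an `S × S`-stable subset, the points of which represent the
morphisms of `F` that do not extend: it is the product of `S` with itself in the category of formal
sums of `F`-centric subgroups. -/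
structure CentricBiset (F : FusionSystem S) where
  W : Type u
  fin : Finite W
  act : MulAction (P × P) W
  carrier : Set W
  smul_mem : ∀ {x y : P}, x ∈ S → y ∈ S → ∀ {w}, w ∈ carrier → (x, y) • w ∈ carrier
  isGraph : ∀ {w}, w ∈ carrier → F.IsGraph (MulAction.stabilizer (P × P) w)
  exists_le : ∀ {D}, F.IsCentricGraph D → ∃ w ∈ carrier, D ≤ MulAction.stabilizer (P × P) w
  exists_smul : ∀ {D}, F.IsCentricGraph D → ∀ {w w'}, w ∈ carrier → w' ∈ carrier →
    D ≤ MulAction.stabilizer (P × P) w → D ≤ MulAction.stabilizer (P × P) w' →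
    ∃ z ∈ ran D, (∀ b ∈ ran D, z * b = b * z) ∧ w' = (z, (1 : P)) • w

attribute [instance] CentricBiset.fin CentricBiset.act

/-- The maximal graphs on centric subgroups, up to conjugation. -/
def maxGraphSetoid (F : FusionSystem S) :
    Setoid {D : Subgroup (P × P) // F.IsMaxGraph D ∧ F.IsCentric (dom D)} where
  r D D' := ∃ g ∈ S.prod S, D'.1 = conjBy g D.1
  iseqv := by
    refine ⟨fun D => ⟨1, one_mem _, (conjBy_one _).symm⟩, ?_, ?_⟩
    · rintro D D' ⟨g, hg, h⟩
      refine ⟨g⁻¹, inv_mem hg, ?_⟩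
      rw [h, conjBy_conjBy, inv_mul_cancel, conjBy_one]
    · rintro D D' D'' ⟨g, hg, h⟩ ⟨g', hg', h'⟩
      exact ⟨g' * g, mul_mem hg' hg, by rw [h', h, conjBy_conjBy]⟩

/-- `W` is the disjoint union of the coset spaces of representatives of the maximal graphs on
centric subgroups, taken up to conjugation in `S × S`, and the carrier consists of the cosets of
elements of `S × S`. Stabilizers are conjugates of the representatives, so every centric graph lies
in one of them. Uniqueness up to the center is `centerConj_of_maximal`, which identifies the
representatives, combined with `normalizer_eq`, which compares the cosets. -/
theorem nonempty_centricBiset (hS : IsPGroup p S) (hF : F.IsSaturated p) :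
    Nonempty F.CentricBiset := by
  let O : Quotient F.maxGraphSetoid → Subgroup (P × P) := fun q => q.out.1
  have hO : ∀ q, F.IsMaxGraph (O q) := fun q => q.out.2.1
  have hOc : ∀ q, F.IsCentric (dom (O q)) := fun q => q.out.2.2
  have hstab : ∀ q (g : P × P), MulAction.stabilizer (P × P)
      (⟨q, (g : (P × P) ⧸ O q)⟩ : Σ q, (P × P) ⧸ O q) = conjBy g (O q) := by
    intro q g
    ext k
    rw [MulAction.mem_stabilizer_iff, Sigma.smul_mk, mem_conjBy, MulAction.Quotient.smul_coe]
    rw [Sigma.mk.injEq]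
    simp only [heq_eq_eq, true_and, smul_eq_mul]
    rw [eq_comm, QuotientGroup.eq, mul_assoc]
  refine ⟨{
    W := Σ q, (P × P) ⧸ O q
    fin := inferInstance
    act := inferInstance
    carrier := {w | ∃ q, ∃ g ∈ S.prod S, w = ⟨q, (g : (P × P) ⧸ O q)⟩}
    smul_mem := ?_
    isGraph := ?_
    exists_le := ?_
    exists_smul := ?_ }⟩
  · rintro x y hx hy _ ⟨q, g, hg, rfl⟩
    exact ⟨q, (x, y) * g, mul_mem ⟨hx, hy⟩ hg, rfl⟩
  · rintro _ ⟨q, g, hg, rfl⟩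
    rw [hstab]
    exact (hO q).1.conjBy hg.1 hg.2
  · intro D hD
    obtain ⟨M, hM, hle⟩ := hD.1.exists_maximal
    let M' : {D : Subgroup (P × P) // F.IsMaxGraph D ∧ F.IsCentric (dom D)} :=
      ⟨M, hM, (hD.of_le hle hM.1).2⟩
    obtain ⟨g, hg, h⟩ : (F.maxGraphSetoid) (Quotient.mk F.maxGraphSetoid M').out M' :=
      Quotient.mk_out M'
    refine ⟨_, ⟨Quotient.mk F.maxGraphSetoid M', g, hg, rfl⟩, ?_⟩
    rw [hstab]
    exact hle.trans h.le
  · rintro D hD _ _ ⟨q, g, hg, rfl⟩ ⟨q', g', hg', rfl⟩ h1 h2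
    rw [hstab] at h1 h2
    obtain ⟨z, hz, hc, heq⟩ := centerConj_of_maximal hS hF hD ((hO q).conjBy hg.1 hg.2)
      ((hO q').conjBy hg'.1 hg'.2) h1 h2
    have hzS := hD.1.ran_le hz
    rw [conjBy_conjBy] at heq
    have heq' : O q' = conjBy (g'⁻¹ * ((z, 1) * g)) (O q) := by
      rw [← conjBy_conjBy, ← heq, conjBy_conjBy]
      simp [conjBy_one]
    have hmem : g'⁻¹ * ((z, 1) * g) ∈ S.prod S :=
      mul_mem (inv_mem hg') (mul_mem ⟨hzS, one_mem S⟩ hg)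
    obtain rfl : q = q' := by
      rw [← Quotient.out_eq q, ← Quotient.out_eq q']
      exact Quotient.sound ⟨_, hmem, heq'⟩
    -- Both points are now cosets of the same maximal graph, and the element of `S × S` that relates
    -- them normalizes it. The central element `y` corrects `z`, so that the points themselves agree
    -- and not only their stabilizers.
    obtain ⟨y, hy, hyc, hyd⟩ := (hO q).normalizer_eq hS hF (hOc q) hmem.1 hmem.2 heq'.symm
    have hy2 : ∀ b ∈ ran D, (g'.1 * y * g'.1⁻¹)⁻¹ * z * b = b * ((g'.1 * y * g'.1⁻¹)⁻¹ * z) := by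
      intro b hb
      have h3 : g'.1⁻¹ * b * g'.1 ∈ ran (O q) := mem_ran_conjBy.1 (ran_mono h2 hb)
      have h4 := hyc _ h3
      have h5 := hc b hb
      have h6 : (g'.1 * y * g'.1⁻¹) * b = b * (g'.1 * y * g'.1⁻¹) := by
        calc (g'.1 * y * g'.1⁻¹) * b = g'.1 * (y * (g'.1⁻¹ * b * g'.1)) * g'.1⁻¹ := by group
          _ = _ := by rw [h4]; group
      rw [mul_assoc, h5, ← mul_assoc, ← mul_assoc]
      congr 1
      rw [inv_mul_eq_iff_eq_mul, ← mul_assoc, h6]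
      group
    have hyS : (g'.1 * y * g'.1⁻¹)⁻¹ * z ∈ S :=
      mul_mem (inv_mem (mul_mem (mul_mem hg'.1 ((hO q).1.ran_le hy)) (inv_mem hg'.1))) hzS
    refine ⟨_, hD.mem_ran_of_comm hyS hy2, hy2, ?_⟩
    rw [Sigma.smul_mk, MulAction.Quotient.smul_coe]
    congr 1
    rw [QuotientGroup.eq]
    convert hyd using 1
    refine Prod.ext ?_ ?_
    · simp [mul_assoc]
    · simp

end FusionSystem

/-! ### Sums over the classes of an equivalence relation -/

section orbSum

variable {X Y B V W : Type*} [Finite X] [Finite Y] [Finite B] [AddCommMonoid V] [AddCommMonoid W]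

/-- The sum of the values of `τ` at representatives of the equivalence classes. -/
noncomputable def orbSum (r : Setoid X) (τ : X → V) : V :=
  letI := Fintype.ofFinite (Quotient r)
  ∑ q : Quotient r, τ q.out

theorem orbSum_congr {r : Setoid X} {τ σ : X → V} (h : ∀ x, τ x = σ x) :
    orbSum r τ = orbSum r σ := by
  rw [funext h]

theorem map_orbSum (r : Setoid X) (τ : X → V) {A : Type*} [FunLike A V W] [AddMonoidHomClass A V W]
    (f : A) : f (orbSum r τ) = orbSum r fun x => f (τ x) := map_sum f _ _

theorem orbSum_add (r : Setoid X) (τ σ : X → V) :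
    (orbSum r fun x => τ x + σ x) = orbSum r τ + orbSum r σ := Finset.sum_add_distrib

theorem orbSum_zero (r : Setoid X) : orbSum r (fun _ => (0 : V)) = 0 := Finset.sum_const_zero

theorem orbSum_comm (r : Setoid X) (s : Setoid Y) (τ : X → Y → V) :
    (orbSum r fun x => orbSum s fun y => τ x y) = orbSum s fun y => orbSum r fun x => τ x y :=
  Finset.sum_comm

theorem orbSum_finsetSum {ι : Type*} (r : Setoid X) (t : Finset ι) (τ : ι → X → V) :
    (orbSum r fun x => ∑ i ∈ t, τ i x) = ∑ i ∈ t, orbSum r (τ i) :=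
  Finset.sum_comm

theorem orbSum_mem {A : Type*} [SetLike A V] [AddSubmonoidClass A V] (s : A) (r : Setoid X)
    (τ : X → V) (h : ∀ x, τ x ∈ s) : orbSum r τ ∈ s := sum_mem fun _ _ => h _

/-- The relation `R` has to be defined only where the summands are nonzero. This matters because
points can be transported along an isomorphism of `F` only when their sources are centric. -/
theorem orbSum_eq_of_corr {r : Setoid X} {s : Setoid Y} {τ : X → V} {σ : Y → V}
    (hτ : ∀ x x', r x x' → τ x = τ x') (hσ : ∀ y y', s y y' → σ y = σ y') (R : X → Y → Prop)
    (h1 : ∀ x, τ x ≠ 0 → ∃ y, R x y) (h2 : ∀ y, σ y ≠ 0 → ∃ x, R x y)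
    (h3 : ∀ x y, R x y → τ x = σ y)
    (h4 : ∀ x y x' y', R x y → R x' y' → (r x x' ↔ s y y')) : orbSum r τ = orbSum s σ := by
  choose f hf using h1
  let _ := Fintype.ofFinite (Quotient r)
  let _ := Fintype.ofFinite (Quotient s)
  refine Finset.sum_bij_ne_zero (fun q _ hq => Quotient.mk s (f q.out hq))
    (fun _ _ _ => Finset.mem_univ _) ?_ ?_ ?_
  · intro q _ hq q' _ hq' h
    rw [← Quotient.out_eq q, ← Quotient.out_eq q']
    exact Quotient.sound ((h4 _ _ _ _ (hf _ hq) (hf _ hq')).2 (Quotient.exact h))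
  · intro c _ hc
    obtain ⟨x, hx⟩ := h2 _ hc
    have hr : r (Quotient.mk r x).out x := Quotient.mk_out x
    have hne : τ (Quotient.mk r x).out ≠ 0 := by
      rw [hτ _ _ hr, h3 _ _ hx]
      exact hc
    refine ⟨Quotient.mk r x, Finset.mem_univ _, hne, ?_⟩
    rw [← Quotient.out_eq c]
    exact Quotient.sound ((h4 _ _ _ _ (hf _ hne) hx).1 hr)
  · intro q _ hq
    have hs : s (Quotient.mk s (f q.out hq)).out (f q.out hq) := Quotient.mk_out _
    rw [hσ _ _ hs]
    exact h3 _ _ (hf _ hq)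

theorem orbSum_eq_single {r : Setoid X} {τ : X → V} (hτ : ∀ x x', r x x' → τ x = τ x') (x0 : X)
    (h : ∀ x, τ x ≠ 0 → r x0 x) : orbSum r τ = τ x0 := by
  have hr : r (Quotient.mk r x0).out x0 := Quotient.mk_out x0
  rw [← hτ _ _ hr]
  let _ := Fintype.ofFinite (Quotient r)
  refine Finset.sum_eq_single_of_mem (Quotient.mk r x0) (Finset.mem_univ _) fun q _ hq => ?_
  by_contra hne
  refine hq ?_
  rw [← Quotient.out_eq q]
  exact Quotient.sound (r.symm (h _ hne))

/-- A sum over the classes of a fine relation is computed over the classes of a coarser one: `Z b`,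
through `e b`, parametrizes the fine classes over the class of `b`. It is applied to double cosets
inside the orbits of a larger group. -/
theorem orbSum_fiber {r : Setoid X} {s : Setoid B} {τ : X → V} (hτ : ∀ x x', r x x' → τ x = τ x')
    {Z : B → Type*} [∀ b, Finite (Z b)] (rz : ∀ b, Setoid (Z b)) (e : ∀ b, Z b → X) (π : X → B)
    (hπ : ∀ x x', r x x' → s (π x) (π x')) (he1 : ∀ b z, s (π (e b z)) b)
    (he2 : ∀ b z z', rz b z z' ↔ r (e b z) (e b z'))
    (he3 : ∀ b x, s (π x) b → ∃ z, r (e b z) x) :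
    orbSum r τ = orbSum s fun b => orbSum (rz b) fun z => τ (e b z) := by
  let _ := Fintype.ofFinite (Quotient r)
  let _ := Fintype.ofFinite (Quotient s)
  let _ := fun b => Fintype.ofFinite (Quotient (rz b))
  have key : (∑ q : Quotient r, τ q.out) =
      ∑ w : Σ c : Quotient s, Quotient (rz c.out), τ (e w.1.out w.2.out) := by
    symm
    refine Fintype.sum_bijective (fun w => Quotient.mk r (e w.1.out w.2.out)) ⟨?_, ?_⟩ _ _ ?_
    · rintro ⟨c, w⟩ ⟨c', w'⟩ h
      have h1 : r (e c.out w.out) (e c'.out w'.out) := Quotient.exact h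
      obtain rfl : c = c' := by
        rw [← Quotient.out_eq c, ← Quotient.out_eq c']
        exact Quotient.sound (s.trans (s.symm (he1 _ _)) (s.trans (hπ _ _ h1) (he1 _ _)))
      congr 1
      rw [← Quotient.out_eq w, ← Quotient.out_eq w']
      exact Quotient.sound ((he2 _ _ _).2 h1)
    · intro q
      have hs : s (π q.out) (Quotient.mk s (π q.out)).out := s.symm (Quotient.mk_out _)
      obtain ⟨z, hz⟩ := he3 _ _ hs
      refine ⟨⟨Quotient.mk s (π q.out), Quotient.mk _ z⟩, ?_⟩
      refine Eq.trans ?_ (Quotient.out_eq q)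
      have hz' : rz _ (Quotient.mk (rz (Quotient.mk s (π q.out)).out) z).out z := Quotient.mk_out z
      exact Quotient.sound (r.trans ((he2 _ _ _).1 hz') hz)
    · rintro ⟨c, w⟩
      exact (hτ _ _ (Quotient.mk_out (e c.out w.out))).symm
  rw [Fintype.sum_sigma] at key
  exact key

end orbSum

/-! ### Points and stabilizers of bisets -/

namespace BisetMatrix

variable {P : Type u} [Group P]

/-- The generating relation is that of the orbits of `J` on the pairs. The predicate of lying in the
`J`-orbit of `(x, y)` is invariant under it, descends to the quotient, and there distinguishes the
classes. -/
theorem Comp.mk_eq_mk_iff {X Y : BisetMatrix P} {H K J : Subgroup P} {x x' : X.X H J}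
    {y y' : Y.X J K} : Comp.mk J x y = Comp.mk J x' y' ↔
      ∃ j : J, x' = ((1 : H), j) • x ∧ y' = (j, (1 : K)) • y := by
  constructor
  · intro h
    let f : Comp X Y H K → Prop := Comp.lift
      (fun I a b => ∃ j : J, (⟨I, a, b⟩ : Σ J : Subgroup P, X.X H J × Y.X J K) =
        ⟨J, ((1 : H), j) • x, (j, (1 : K)) • y⟩) (by
          intro I i a b
          refine propext ⟨?_, ?_⟩
          · rintro ⟨j, h⟩
            obtain ⟨rfl, h⟩ := Sigma.mk.inj_iff.1 h
            obtain ⟨h1, h2⟩ := Prod.mk_inj.1 (eq_of_heq h)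
            refine ⟨i * j, ?_⟩
            congr 2
            · have : a = ((1 : H), i) • ((1 : H), i⁻¹) • a := by
                simp [smul_smul, ← Prod.one_eq_mk]
              rw [this, h1, smul_smul]
              simp
            · rw [h2, smul_smul]
              simp
          · rintro ⟨j, h⟩
            obtain ⟨rfl, h⟩ := Sigma.mk.inj_iff.1 h
            obtain ⟨h1, h2⟩ := Prod.mk_inj.1 (eq_of_heq h)
            refine ⟨i⁻¹ * j, ?_⟩
            congr 2
            · rw [h1, smul_smul]
              simp
            · have : b = (i⁻¹, (1 : K)) • (i, (1 : K)) • b := by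
                simp [smul_smul, ← Prod.one_eq_mk]
              rw [this, h2, smul_smul]
              simp)
    have h1 : f (Comp.mk J x y) := ⟨1, by simp [← Prod.one_eq_mk]⟩
    rw [h] at h1
    obtain ⟨j, h2⟩ := h1
    obtain ⟨h3, h4⟩ := Prod.mk_inj.1 (eq_of_heq (Sigma.mk.inj_iff.1 h2).2)
    exact ⟨j, h3, h4⟩
  · rintro ⟨j, rfl, rfl⟩
    rw [← Comp.sound, smul_smul]
    simp [← Prod.one_eq_mk]

/-- The only nonempty member of the family `Z` has index `(K, J)`. -/
def Concentrated (Z : BisetMatrix P) (K J : Subgroup P) : Prop :=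
  ∀ H I, Z.X H I → H = K ∧ I = J

theorem concentrated_transitive [Finite P] (K J : Subgroup P) (D : Subgroup (P × P)) :
    (transitive K J D).Concentrated K J := fun _ _ z => z.2

theorem concentrated_mul [Finite P] {X Y : BisetMatrix P} {K J I L : Subgroup P}
    (hX : X.Concentrated K J) (hY : Y.Concentrated I L) : (mul X Y).Concentrated K L :=
  fun _ _ => Comp.ind fun _ x y => ⟨(hX _ _ x).1, (hY _ _ y).2⟩

open Classical in
/-- Concentrated families are isomorphic if their nonempty members are. -/
noncomputable def isoOfConcentrated {X Y : BisetMatrix P} {K J : Subgroup P}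
    (hX : X.Concentrated K J) (hY : Y.Concentrated K J) (e : X.X K J ≃ Y.X K J)
    (he : ∀ (g : K × J) x, e (g • x) = g • e x) : Iso X Y where
  e H I := if h : H = K ∧ I = J then
      (Equiv.cast (by rw [h.1, h.2])).trans (e.trans (Equiv.cast (by rw [h.1, h.2])))
    else
      haveI : IsEmpty (X.X H I) := ⟨fun x => h (hX _ _ x)⟩
      haveI : IsEmpty (Y.X H I) := ⟨fun x => h (hY _ _ x)⟩
      Equiv.equivOfIsEmpty _ _
  map_smul H I g x := by
    obtain ⟨rfl, rfl⟩ := hX _ _ x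
    simp [he]

/-- The disjoint union of a finite collection of families. -/
def sigma {ι : Type u} [Finite ι] (Z : ι → BisetMatrix P) : BisetMatrix P where
  X H K := Σ i, (Z i).X H K
  fin _ _ := inferInstance
  act _ _ := inferInstance

/-- The stabilizer of a point, as a subgroup of `P × P`. -/
def stab {Z : BisetMatrix P} {K J : Subgroup P} (z : Z.X K J) : Subgroup (P × P) :=
  (MulAction.stabilizer (K × J) z).map (K.subtype.prodMap J.subtype)

theorem mem_stab {Z : BisetMatrix P} {K J : Subgroup P} {z : Z.X K J} {a b : P} :
    (a, b) ∈ stab z ↔ ∃ (ha : a ∈ K) (hb : b ∈ J), ((⟨a, ha⟩, ⟨b, hb⟩) : K × J) • z = z := by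
  constructor
  · rintro ⟨⟨x, y⟩, h, he⟩
    obtain ⟨rfl, rfl⟩ := Prod.mk_inj.1 he
    exact ⟨x.2, y.2, h⟩
  · rintro ⟨ha, hb, h⟩
    exact ⟨_, h, rfl⟩

theorem comap_stab {Z : BisetMatrix P} {K J : Subgroup P} (z : Z.X K J) :
    (stab z).comap (K.subtype.prodMap J.subtype) = MulAction.stabilizer (K × J) z :=
  Subgroup.comap_map_eq_self_of_injective
    (Prod.map_injective.2 ⟨Subgroup.subtype_injective K, Subgroup.subtype_injective J⟩) _

theorem stab_map {X Y : BisetMatrix P} (f : Iso X Y) {K J : Subgroup P} (x : X.X K J) :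
    stab (f.e K J x) = stab x := by
  ext ⟨a, b⟩
  rw [mem_stab, mem_stab]
  refine exists_congr fun ha => exists_congr fun hb => ?_
  rw [← f.map_smul, (f.e K J).injective.eq_iff]

theorem stab_smul {Z : BisetMatrix P} {K J : Subgroup P} (g : K × J) (z : Z.X K J) :
    stab (Z := Z) (g • z) = GroupRel.conjBy ((g.1 : P), (g.2 : P)) (stab z) := by
  ext ⟨a, b⟩
  rw [GroupRel.mem_conjBy_mk, mem_stab, mem_stab]
  constructor
  · rintro ⟨ha, hb, h⟩
    refine ⟨mul_mem (mul_mem (inv_mem g.1.2) ha) g.1.2, mul_mem (mul_mem (inv_mem g.2.2) hb) g.2.2,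
      ?_⟩
    have h1 := congrArg (g⁻¹ • ·) h
    simp only [smul_smul, inv_mul_cancel, one_smul] at h1
    convert h1 using 2
    refine Prod.ext (Subtype.ext ?_) (Subtype.ext ?_) <;> simp [mul_assoc]
  · rintro ⟨ha, hb, h⟩
    have ha' : a ∈ K := by simpa [mul_assoc] using mul_mem (mul_mem g.1.2 ha) (inv_mem g.1.2)
    have hb' : b ∈ J := by simpa [mul_assoc] using mul_mem (mul_mem g.2.2 hb) (inv_mem g.2.2)
    refine ⟨ha', hb', ?_⟩
    have h1 := congrArg (g • ·) h
    simp only [smul_smul] at h1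
    rw [smul_smul]
    convert h1 using 2
    refine Prod.ext (Subtype.ext ?_) (Subtype.ext ?_) <;> simp [mul_assoc]

end BisetMatrix

/-! ### Transitive bisets and the Mackey formula -/

namespace BisetSemiring

open BisetMatrix GroupRel

variable {P : Type u} [Group P] [Finite P]

theorem cls_sigma {ι : Type u} [Fintype ι] (Z : ι → BisetMatrix P) :
    cls (sigma Z) = ∑ i, cls (Z i) := by
  revert Z
  refine Fintype.induction_empty_option
    (P := fun (ι : Type u) [Fintype ι] => ∀ Z : ι → BisetMatrix P,
      cls (sigma Z) = ∑ i, cls (Z i)) ?_ ?_ ?_ ι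
  · intro α β _ e ih Z
    let _ := Fintype.ofEquiv β e.symm
    rw [← Equiv.sum_comp e, ← ih (fun a => Z (e a))]
    refine (cls_eq
      { e := fun H K => Equiv.sigmaCongrLeft (β := fun b => (Z b).X H K) e
        map_smul := ?_ }).symm
    rintro H K g ⟨a, x⟩
    rfl
  · intro Z
    rw [Finset.univ_eq_empty, Finset.sum_empty]
    exact cls_eq (emptyIso (fun H K => ⟨fun x => x.1.elim⟩) isEmpty_empty)
  · intro α _ ih Z
    rw [Fintype.sum_option, ← ih]
    refine cls_eq (Y := add (Z none) (sigma fun a => Z (some a)))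
      { e := fun H K =>
          { toFun := fun x => match x with
              | ⟨none, x⟩ => Sum.inl x
              | ⟨some a, x⟩ => Sum.inr ⟨a, x⟩
            invFun := Sum.elim (fun x => ⟨none, x⟩) (fun x => ⟨some x.1, x.2⟩)
            left_inv := by rintro ⟨_ | a, x⟩ <;> rfl
            right_inv := by rintro (x | x) <;> rfl }
        map_smul := ?_ }
    rintro H K g ⟨_ | a, x⟩ <;> rfl

/-- The class of the `(K, L)`-biset `(K × L) / D`. -/
def tw (K L : Subgroup P) (D : Subgroup (P × P)) : BisetSemiring P := cls (transitive K L D)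

/-- Right multiplication with `(k, l)⁻¹` identifies the coset spaces. The comparison is made only
inside `K × L`, because `D` enters through its intersection with `K × L`; this freedom lets
`conjGraph`, an unrestricted relation, describe inductions and restrictions. -/
theorem tw_eq_of_conj {K L : Subgroup P} {D D' : Subgroup (P × P)} (k : K) (l : L)
    (h : ∀ a ∈ K, ∀ b ∈ L, ((a, b) ∈ D ↔ (k * a * (k : P)⁻¹, l * b * (l : P)⁻¹) ∈ D')) :
    tw K L D = tw K L D' := by
  have hmem : ∀ x : K × L, x ∈ D.comap (K.subtype.prodMap L.subtype) ↔
      (k, l) * x * (k, l)⁻¹ ∈ D'.comap (K.subtype.prodMap L.subtype) := fun x =>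
    h x.1 x.1.2 x.2 x.2.2
  let f : (transitive K L D).X K L → (transitive K L D').X K L := fun z =>
    ⟨Quotient.map' (s₁ := QuotientGroup.leftRel _) (s₂ := QuotientGroup.leftRel _)
      (fun x => x * (k, l)⁻¹) (by
        intro x y hxy
        rw [QuotientGroup.leftRel_apply] at hxy ⊢
        have := (hmem _).1 hxy
        convert this using 1
        group) z.1, rfl, rfl⟩
  refine cls_eq (isoOfConcentrated (concentrated_transitive K L D) (concentrated_transitive K L D')
    (Equiv.ofBijective f ⟨?_, ?_⟩) ?_)
  · rintro ⟨⟨x⟩, hx⟩ ⟨⟨y⟩, hy⟩ hxy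
    refine Subtype.ext (QuotientGroup.eq.2 ((hmem _).2 ?_))
    have h1 := QuotientGroup.eq.1 (Subtype.ext_iff.1 hxy :)
    convert h1 using 1
    group
  · rintro ⟨⟨y⟩, hy⟩
    refine ⟨⟨QuotientGroup.mk (y * (k, l)), rfl, rfl⟩, Subtype.ext ?_⟩
    change QuotientGroup.mk (y * (k, l) * (k, l)⁻¹) = _
    rw [mul_inv_cancel_right]
    rfl
  · rintro g ⟨⟨x⟩, hx⟩
    refine Subtype.ext ?_
    change QuotientGroup.mk (g * x * (k, l)⁻¹) = QuotientGroup.mk (g * (x * (k, l)⁻¹))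
    rw [mul_assoc]

theorem tw_congr {K L : Subgroup P} {D D' : Subgroup (P × P)}
    (h : ∀ a ∈ K, ∀ b ∈ L, ((a, b) ∈ D ↔ (a, b) ∈ D')) : tw K L D = tw K L D' :=
  tw_eq_of_conj 1 1 (by simpa using h)

theorem tw_conjBy {K L : Subgroup P} {D : Subgroup (P × P)} {k l : P} (hk : k ∈ K) (hl : l ∈ L) :
    tw K L (conjBy (k, l) D) = tw K L D :=
  (tw_eq_of_conj ⟨k, hk⟩ ⟨l, hl⟩ fun _ _ _ _ => conj_mem_conjBy.symm).symm

/-- The decomposition of a biset into orbits. -/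
theorem cls_eq_orbSum {Z : BisetMatrix P} {K J : Subgroup P} (hZ : Z.Concentrated K J) :
    cls Z = orbSum (MulAction.orbitRel (K × J) (Z.X K J)) fun z => tw K J (stab z) := by
  let r := MulAction.orbitRel (K × J) (Z.X K J)
  let _ : Fintype (Quotient r) := Fintype.ofFinite (Quotient r)
  refine Eq.trans ?_ (cls_sigma fun q : Quotient r => transitive K J (stab q.out))
  refine (cls_eq (isoOfConcentrated (K := K) (J := J) ?_ hZ ?_ ?_)).symm
  · rintro H I ⟨q, x⟩
    exact x.2
  · let f : (sigma fun q : Quotient r => transitive K J (stab q.out)).X K J → Z.X K J := fun w =>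
      Quotient.liftOn' (s₁ := QuotientGroup.leftRel _) w.2.1 (fun g => g • w.1.out) (by
        intro x y hxy
        rw [QuotientGroup.leftRel_apply, comap_stab, MulAction.mem_stabilizer_iff, mul_smul,
          inv_smul_eq_iff] at hxy
        exact hxy.symm)
    refine Equiv.ofBijective f ⟨?_, ?_⟩
    · rintro ⟨q, ⟨x⟩, hx⟩ ⟨q', ⟨y⟩, hy⟩ h
      replace h : x • q.out = y • q'.out := h
      obtain rfl : q = q' := by
        rw [← Quotient.out_eq q, ← Quotient.out_eq q']
        refine Quotient.sound (?_ : MulAction.orbitRel _ _ _ _)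
        rw [MulAction.orbitRel_apply]
        exact ⟨x⁻¹ * y, by
          change (x⁻¹ * y) • q'.out = q.out
          rw [mul_smul, ← h, inv_smul_smul]⟩
      congr 1
      refine Subtype.ext (QuotientGroup.eq.2 ?_)
      rw [comap_stab, MulAction.mem_stabilizer_iff, mul_smul, ← h, inv_smul_smul]
    · intro z
      obtain ⟨g, hg⟩ := MulAction.orbitRel_apply.1
        (r.symm (Quotient.mk_out z) : MulAction.orbitRel (K × J) (Z.X K J) z (Quotient.mk r z).out)
      exact ⟨⟨Quotient.mk r z, QuotientGroup.mk g, rfl, rfl⟩, hg⟩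
  · rintro g ⟨q, ⟨x⟩, hx⟩
    exact mul_smul g x q.out

/-- The points of `(K × L) / D`. -/
def point (K L : Subgroup P) (D : Subgroup (P × P)) (x : K × L) : (transitive K L D).X K L :=
  ⟨QuotientGroup.mk x, rfl, rfl⟩

theorem point_eq_point {K L : Subgroup P} {D : Subgroup (P × P)} {x y : K × L} :
    point K L D x = point K L D y ↔ ((x.1 : P)⁻¹ * y.1, (x.2 : P)⁻¹ * y.2) ∈ D :=
  Subtype.ext_iff.trans QuotientGroup.eq

theorem smul_point {K L : Subgroup P} {D : Subgroup (P × P)} (g x : K × L) :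
    g • point K L D x = point K L D (g * x) := rfl

/-- The double cosets that index the orbits on `(K × L) / D ×_L (L × J) / D'`. -/
def dcSetoid (K L J : Subgroup P) (D D' : Subgroup (P × P)) : Setoid L where
  r l l' := ∃ k ∈ K, ∃ j ∈ J, ∃ a ∈ L, (k, a) ∈ D ∧ ((l' : P)⁻¹ * a * l, j) ∈ D'
  iseqv := by
    refine ⟨fun l => ⟨1, one_mem _, 1, one_mem _, 1, one_mem _, one_mem _, ?_⟩, ?_, ?_⟩
    · convert one_mem D' using 1
      exact Prod.ext (by simp) rfl
    · rintro l l' ⟨k, hk, j, hj, a, ha, h1, h2⟩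
      refine ⟨k⁻¹, inv_mem hk, j⁻¹, inv_mem hj, a⁻¹, inv_mem ha, inv_mem h1, ?_⟩
      convert inv_mem h2 using 1
      exact Prod.ext (by simp [mul_assoc]) rfl
    · rintro l l' l'' ⟨k, hk, j, hj, a, ha, h1, h2⟩ ⟨k', hk', j', hj', a', ha', h1', h2'⟩
      refine ⟨k' * k, mul_mem hk' hk, j' * j, mul_mem hj' hj, a' * a, mul_mem ha' ha,
        mul_mem h1' h1, ?_⟩
      convert mul_mem h2' h2 using 1
      exact Prod.ext (by simp [mul_assoc]) rfl

/-- The stabilizer of the point `[1, (l, 1)]` of `(K × L) / D ×_L (L × J) / D'`. -/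
def mulRel (L : Subgroup P) (D : Subgroup (P × P)) (l : P) (D' : Subgroup (P × P)) :
    Subgroup (P × P) where
  carrier := {x | ∃ a ∈ L, (x.1, a) ∈ D ∧ (l⁻¹ * a * l, x.2) ∈ D'}
  one_mem' := ⟨1, one_mem _, one_mem _, by
    convert one_mem D' using 1
    exact Prod.ext (by simp) rfl⟩
  mul_mem' := by
    rintro x y ⟨a, ha, h1, h2⟩ ⟨a', ha', h1', h2'⟩
    refine ⟨a * a', mul_mem ha ha', mul_mem h1 h1', ?_⟩
    convert mul_mem h2 h2' using 1
    exact Prod.ext (by simp [mul_assoc]) rfl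
  inv_mem' := by
    rintro x ⟨a, ha, h1, h2⟩
    refine ⟨a⁻¹, inv_mem ha, inv_mem h1, ?_⟩
    convert inv_mem h2 using 1
    exact Prod.ext (by simp [mul_assoc]) rfl

theorem mem_mulRel {L : Subgroup P} {D D' : Subgroup (P × P)} {l k j : P} :
    (k, j) ∈ mulRel L D l D' ↔ ∃ a ∈ L, (k, a) ∈ D ∧ (l⁻¹ * a * l, j) ∈ D' := Iff.rfl

/-- The Mackey formula. -/
theorem tw_mul_tw (K L J : Subgroup P) (D D' : Subgroup (P × P)) :
    tw K L D * tw L J D' = orbSum (dcSetoid K L J D D') fun l => tw K J (mulRel L D l D') := by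
  let Z := mul (transitive K L D) (transitive L J D')
  -- Every orbit on the product contains a point `[1, (l, 1)]`. Such points for `l` and `l'` are in
  -- one orbit exactly when `l` and `l'` are in one double coset, and `hpt` with `l = l'` describes
  -- the stabilizers.
  let pt : L → Z.X K J := fun l => Comp.mk L (point K L D 1) (point L J D' (l, 1))
  have hpt : ∀ (g : K × J) (l l' : L), g • pt l = pt l' ↔
      ∃ a ∈ L, ((g.1 : P), a) ∈ D ∧ ((l' : P)⁻¹ * a * l, (g.2 : P)) ∈ D' := by
    intro g l l'
    change Comp.mk (X := transitive K L D) (Y := transitive L J D') L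
      (point K L D ((g.1, 1) * 1)) (point L J D' ((1, g.2) * (l, 1))) = _ ↔ _
    refine Comp.mk_eq_mk_iff.trans ?_
    have e1 : ∀ a : L, point K L D 1 = ((1 : K), a) • point K L D ((g.1, 1) * 1) ↔
        ((g.1 : P), (a : P)) ∈ D := by
      intro a
      rw [smul_point, point_eq_point]
      simp
    have e2 : ∀ a : L, point L J D' (l', 1) =
        (a, (1 : J)) • point L J D' ((1, g.2) * (l, 1)) ↔
        ((l' : P)⁻¹ * a * l, (g.2 : P)) ∈ D' := by
      intro a
      rw [smul_point, point_eq_point]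
      simp [mul_assoc]
    constructor
    · rintro ⟨a, h1, h2⟩
      exact ⟨a, a.2, (e1 a).1 h1, (e2 a).1 h2⟩
    · rintro ⟨a, ha, h1, h2⟩
      exact ⟨⟨a, ha⟩, (e1 _).2 h1, (e2 _).2 h2⟩
  have hsurj : ∀ z : Z.X K J, ∃ (g : K × J) (l : L), z = g • pt l := by
    refine Comp.ind ?_
    rintro I ⟨⟨x⟩, h1, h2⟩ ⟨⟨y⟩, h3, h4⟩
    subst h2
    refine ⟨(x.1, y.2), x.2⁻¹ * y.1, ?_⟩
    symm
    refine Comp.mk_eq_mk_iff.2 ⟨x.2, ?_, ?_⟩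
    · change point K I D x = point K I D ((1, x.2) * ((x.1, 1) * 1))
      congr 1
      refine Prod.ext ?_ ?_ <;> simp
    · change point I J D' y = point I J D' ((x.2, 1) * ((1, y.2) * (x.2⁻¹ * y.1, 1)))
      congr 1
      refine Prod.ext ?_ ?_ <;> simp
  have hstab : ∀ l : L, tw K J (stab (pt l)) = tw K J (mulRel L D l D') := by
    intro l
    refine tw_congr fun a ha b hb => ?_
    rw [mem_stab, mem_mulRel]
    constructor
    · rintro ⟨h1, h2, h⟩
      exact (hpt _ _ _).1 h
    · intro h
      exact ⟨ha, hb, (hpt _ _ _).2 h⟩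
  have hinv : ∀ (g : K × J) (z : Z.X K J), tw K J (stab (g • z)) = tw K J (stab z) := by
    intro g z
    rw [stab_smul, tw_conjBy g.1.2 g.2.2]
  have hpt' : ∀ l l', dcSetoid K L J D D' l l' ↔ ∃ g : K × J, g • pt l = pt l' := by
    intro l l'
    constructor
    · rintro ⟨k, hk, j, hj, h⟩
      exact ⟨(⟨k, hk⟩, ⟨j, hj⟩), (hpt _ _ _).2 h⟩
    · rintro ⟨g, h⟩
      exact ⟨g.1, g.1.2, g.2, g.2.2, (hpt _ _ _).1 h⟩
  refine (cls_eq_orbSum (concentrated_mul (concentrated_transitive K L D)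
    (concentrated_transitive L J D'))).trans ?_
  refine orbSum_eq_of_corr ?_ ?_ (fun z l => ∃ g : K × J, z = g • pt l) ?_ ?_ ?_ ?_
  · intro z z' h
    obtain ⟨g, rfl⟩ := MulAction.orbitRel_apply.1 h
    exact hinv g z'
  · intro l l' h
    obtain ⟨g, hg⟩ := (hpt' l l').1 h
    rw [← hstab, ← hstab, ← hg, hinv]
  · intro z _
    obtain ⟨g, l, h⟩ := hsurj z
    exact ⟨l, g, h⟩
  · intro l _
    exact ⟨pt l, 1, (one_smul _ _).symm⟩
  · rintro _ l ⟨g, rfl⟩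
    rw [hinv, hstab]
  · rintro _ l _ l' ⟨g, rfl⟩ ⟨g', rfl⟩
    rw [hpt']
    constructor
    · intro h
      obtain ⟨x, hx⟩ := MulAction.orbitRel_apply.1 h
      refine ⟨g'⁻¹ * x⁻¹ * g, ?_⟩
      rw [mul_smul, mul_smul]
      replace hx : x • g' • pt l' = g • pt l := hx
      rw [← hx, inv_smul_smul, inv_smul_smul]
    · rintro ⟨x, hx⟩
      refine MulAction.orbitRel_apply.2 ⟨g * x⁻¹ * g'⁻¹, ?_⟩
      change (g * x⁻¹ * g'⁻¹) • g' • pt l' = g • pt l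
      rw [← hx, mul_smul, mul_smul, inv_smul_smul, inv_smul_smul]

theorem tw_mul_tw_of_ne {K L L' J : Subgroup P} (h : L ≠ L') (D D' : Subgroup (P × P)) :
    tw K L D * tw L' J D' = 0 :=
  cls_eq (emptyIso (isEmpty_mul_transitive h) isEmpty_empty)

end BisetSemiring

/-! ### Single double cosets, and the part of a biset that comes from `𝓕_H(H)` -/

namespace BisetSemiring

open BisetMatrix GroupRel

variable {P : Type u} [Group P] [Finite P]

theorem tw_mulRel_congr {K L J : Subgroup P} {D D' : Subgroup (P × P)} {l l' : L}
    (h : dcSetoid K L J D D' l l') : tw K J (mulRel L D l D') = tw K J (mulRel L D l' D') := by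
  obtain ⟨k, hk, j, hj, a, ha, h1, h2⟩ := h
  refine tw_eq_of_conj ⟨k, hk⟩ ⟨j, hj⟩ fun x hx y hy => ?_
  simp only [mem_mulRel]
  constructor
  · rintro ⟨b, hb, h3, h4⟩
    refine ⟨a * b * a⁻¹, mul_mem (mul_mem ha hb) (inv_mem ha),
      mul_mem (mul_mem h1 h3) (inv_mem h1), ?_⟩
    convert mul_mem (mul_mem h2 h4) (inv_mem h2) using 1
    exact Prod.ext (by simp [mul_assoc]) rfl
  · rintro ⟨b, hb, h3, h4⟩
    refine ⟨a⁻¹ * b * a, mul_mem (mul_mem (inv_mem ha) hb) ha, ?_, ?_⟩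
    · convert mul_mem (mul_mem (inv_mem h1) h3) h1 using 1
      exact Prod.ext (by simp [mul_assoc]) rfl
    · convert mul_mem (mul_mem (inv_mem h2) h4) h2 using 1
      exact Prod.ext (by simp [mul_assoc]) (by simp [mul_assoc])

/-- The Mackey formula for a single double coset. -/
theorem tw_mul_tw_eq {K L J : Subgroup P} {D D' D'' : Subgroup (P × P)}
    (hl : (∀ l ∈ L, ∃ k ∈ K, (k, l) ∈ D) ∨ ∀ l ∈ L, ∃ j ∈ J, (l, j) ∈ D')
    (h : ∀ k ∈ K, ∀ j ∈ J, ((k, j) ∈ D'' ↔ ∃ l ∈ L, (k, l) ∈ D ∧ (l, j) ∈ D')) :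
    tw K L D * tw L J D' = tw K J D'' := by
  rw [tw_mul_tw, orbSum_eq_single (fun _ _ => tw_mulRel_congr) 1]
  · refine tw_congr fun k hk j hj => ?_
    rw [h k hk j hj, mem_mulRel]
    simp
  · intro l _
    rcases hl with hl | hl
    · obtain ⟨k, hk, h1⟩ := hl l l.2
      refine ⟨k, hk, 1, one_mem _, l, l.2, h1, ?_⟩
      convert one_mem D' using 1
      exact Prod.ext (by simp) rfl
    · obtain ⟨j, hj, h1⟩ := hl (l : P)⁻¹ (inv_mem l.2)
      refine ⟨1, one_mem _, j, hj, 1, one_mem _, one_mem _, ?_⟩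
      simpa using h1

theorem ind_eq_tw {H K : Subgroup P} : ind H K = tw K H (conjGraph 1) :=
  tw_congr fun a _ b hb => by
    rw [mem_twistedDiagonal, mem_conjGraph]
    constructor
    · rintro ⟨h, rfl⟩
      simp
    · intro h
      exact ⟨hb, by simp [h]⟩

theorem res_eq_tw {H K : Subgroup P} : res H K = tw H K (conjGraph 1) :=
  tw_congr fun a ha b _ => by
    rw [mem_twistedDiagonal, mem_conjGraph]
    constructor
    · rintro ⟨h, rfl⟩
      simp
    · intro h
      have : a = b := by simpa using h
      subst this
      exact ⟨ha, rfl⟩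

/-- The part of a family formed by the points with a stabilizer contained in the graph of the
conjugation by an element of `H`. -/
def cutFamily (H : Subgroup P) (X : BisetMatrix P) : BisetMatrix P where
  X K L := {x : X.X K L // K ≤ H ∧ L ≤ H ∧ ∃ h ∈ H, stab x ≤ conjGraph h}
  fin _ _ := inferInstance
  act K L :=
    { smul := fun g x => ⟨g • x.1, x.2.1, x.2.2.1, by
        obtain ⟨hK, hL, h, hh, hx⟩ := x.2
        refine ⟨g.1 * h * (g.2 : P)⁻¹, mul_mem (mul_mem (hK g.1.2) hh) (inv_mem (hL g.2.2)), ?_⟩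
        rintro ⟨a, b⟩ hab
        rw [stab_smul, mem_conjBy_mk] at hab
        have := mem_conjGraph.1 (hx hab)
        rw [mem_conjGraph]
        calc a = g.1 * ((g.1 : P)⁻¹ * a * g.1) * (g.1 : P)⁻¹ := by group
          _ = _ := by rw [this]; group⟩
      one_smul := fun x => Subtype.ext (one_smul _ x.1)
      mul_smul := fun a b x => Subtype.ext (mul_smul a b x.1) }

/-- The additive endomorphism that takes the classes of the bisets over `𝓕_H(H)` to themselves and
those of the other transitive bisets to zero. -/
def cut (H : Subgroup P) : BisetSemiring P →+ BisetSemiring P where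
  toFun := Quotient.map (cutFamily H) (by
    rintro X Y ⟨f⟩
    exact ⟨{
      e := fun K L => (f.e K L).subtypeEquiv fun x => by rw [stab_map]
      map_smul := fun K L g x => Subtype.ext (f.map_smul K L g x.1) }⟩)
  map_zero' := cls_eq (emptyIso (fun _ _ => ⟨fun x => PEmpty.elim x.1⟩) isEmpty_empty)
  map_add' := by
    rintro ⟨X⟩ ⟨Y⟩
    have h1 : ∀ {K L} (x : X.X K L),
        stab (Z := add X Y) (Sum.inl x : X.X K L ⊕ Y.X K L) = stab x := by
      intro K L x
      ext ⟨a, b⟩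
      refine mem_stab.trans (Iff.trans ?_ mem_stab.symm)
      exact exists_congr fun ha => exists_congr fun hb => Sum.inl_injective.eq_iff
    have h2 : ∀ {K L} (x : Y.X K L),
        stab (Z := add X Y) (Sum.inr x : X.X K L ⊕ Y.X K L) = stab x := by
      intro K L x
      ext ⟨a, b⟩
      refine mem_stab.trans (Iff.trans ?_ mem_stab.symm)
      exact exists_congr fun ha => exists_congr fun hb => Sum.inr_injective.eq_iff
    refine cls_eq (X := cutFamily H (add X Y)) (Y := add (cutFamily H X) (cutFamily H Y))
      { e := fun K L =>
          { toFun := fun x => match x with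
              | ⟨Sum.inl x, hx⟩ => Sum.inl ⟨x, by rwa [h1] at hx⟩
              | ⟨Sum.inr x, hx⟩ => Sum.inr ⟨x, by rwa [h2] at hx⟩
            invFun := Sum.elim (fun x => ⟨Sum.inl x.1, by rw [h1]; exact x.2⟩)
              (fun x => ⟨Sum.inr x.1, by rw [h2]; exact x.2⟩)
            left_inv := by rintro ⟨x | x, hx⟩ <;> rfl
            right_inv := by rintro (x | x) <;> rfl }
        map_smul := ?_ }
    rintro K L g ⟨x | x, hx⟩ <;> rfl

theorem stab_point (K L : Subgroup P) (D : Subgroup (P × P)) (x : K × L) :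
    stab (point K L D x) = conjBy ((x.1 : P), (x.2 : P)) (D ⊓ K.prod L) := by
  have h : stab (point K L D 1) = D ⊓ K.prod L := by
    ext ⟨a, b⟩
    rw [mem_stab]
    constructor
    · rintro ⟨ha, hb, h⟩
      rw [smul_point, eq_comm, point_eq_point] at h
      exact ⟨by simpa using h, ha, hb⟩
    · rintro ⟨h, ha, hb⟩
      refine ⟨ha, hb, ?_⟩
      rw [smul_point, eq_comm, point_eq_point]
      simpa using h
  rw [← h, ← stab_smul, smul_point, mul_one]

theorem cut_tw {H K L : Subgroup P} {D : Subgroup (P × P)} (hK : K ≤ H) (hL : L ≤ H) {h : P}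
    (hh : h ∈ H) (hD : D ⊓ K.prod L ≤ conjGraph h) : cut H (tw K L D) = tw K L D := by
  refine cls_eq (X := cutFamily H (transitive K L D))
    { e := fun A B => Equiv.subtypeUnivEquiv ?_
      map_smul := fun _ _ _ _ => rfl }
  rintro ⟨⟨x⟩, rfl, rfl⟩
  refine ⟨hK, hL, x.1 * h * (x.2 : P)⁻¹, mul_mem (mul_mem (hK x.1.2) hh) (inv_mem (hL x.2.2)), ?_⟩
  change stab (point A B D x) ≤ _
  rintro ⟨a, b⟩ hab
  rw [stab_point, mem_conjBy_mk] at hab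
  have := mem_conjGraph.1 (hD hab)
  rw [mem_conjGraph]
  calc a = x.1 * ((x.1 : P)⁻¹ * a * x.1) * (x.1 : P)⁻¹ := by group
    _ = _ := by rw [this]; group

theorem cut_tw_of_not {H K L : Subgroup P} {D : Subgroup (P × P)}
    (hD : ¬ (K ≤ H ∧ L ≤ H ∧ ∃ h ∈ H, D ⊓ K.prod L ≤ conjGraph h)) : cut H (tw K L D) = 0 := by
  refine cls_eq (X := cutFamily H (transitive K L D)) (emptyIso ?_ isEmpty_empty)
  rintro A B
  refine ⟨?_⟩
  rintro ⟨⟨⟨x⟩, rfl, rfl⟩, hK, hL, h, hh, hx⟩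
  refine hD ⟨hK, hL, (x.1 : P)⁻¹ * h * x.2, mul_mem (mul_mem (inv_mem (hK x.1.2)) hh) (hL x.2.2), ?_⟩
  rintro ⟨a, b⟩ hab
  change stab (point A B D x) ≤ _ at hx
  rw [stab_point] at hx
  have := mem_conjGraph.1 (hx (conj_mem_conjBy.2 hab))
  rw [mem_conjGraph]
  calc a = (x.1 : P)⁻¹ * (x.1 * a * (x.1 : P)⁻¹) * x.1 := by group
    _ = _ := by rw [this]; group

end BisetSemiring

/-! ### Transitive bisets over `F` span the Mackey semiring -/

namespace FusionSystem

open BisetMatrix BisetSemiring GroupRel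

variable {P : Type u} [Group P] {S T : Subgroup P} {F : FusionSystem S}

/-- `D` defines a `(K, L)`-biset over `F`. -/
structure IsLocalGraph (F : FusionSystem S) (K L : Subgroup P) (D : Subgroup (P × P)) : Prop where
  left : K ≤ S
  right : L ≤ S
  graph : F.IsGraph (D ⊓ K.prod L)

namespace IsLocalGraph

variable {K L J : Subgroup P} {D D' : Subgroup (P × P)}

theorem of_isGraph (hD : F.IsGraph D) (hK : K ≤ S) (hL : L ≤ S) : F.IsLocalGraph K L D :=
  ⟨hK, hL, hD.mono inf_le_left⟩

theorem of_conjGraph (hK : K ≤ S) (hL : L ≤ S) {s : P} (hs : s ∈ S) :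
    F.IsLocalGraph K L (conjGraph s) :=
  ⟨hK, hL, (F.isGraph_conjGraph hL hs).mono fun _ h => ⟨h.1, trivial, h.2.2⟩⟩

theorem mulRel (h : F.IsLocalGraph K L D) (h' : F.IsLocalGraph L J D') {l : P} (hl : l ∈ L) :
    F.IsLocalGraph K J (mulRel L D l D') := by
  refine ⟨h.left, h'.right,
    (h.graph.comp (h'.graph.conjBy (h.right hl) (one_mem S))).mono ?_⟩
  rintro ⟨k, j⟩ ⟨⟨a, ha, h1, h2⟩, hk, hj⟩
  refine ⟨a, ⟨h1, hk, ha⟩, mem_conjBy_mk.2 ?_⟩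
  simp only [inv_one, one_mul, mul_one]
  exact ⟨h2, L.mul_mem (L.mul_mem (L.inv_mem hl) ha) hl, hj⟩

variable [Finite P]

/-- The biset is a restriction to the domain of the graph, followed by an isomorphism of `F` and by
the induction from its range. -/
theorem tw_mem (h : F.IsLocalGraph K L D) : tw K L D ∈ F.mackeySemiring := by
  obtain ⟨e, he, hmem⟩ := h.graph.exists_mulEquiv rfl rfl
  have hdom : ∀ b ∈ dom (D ⊓ K.prod L), b ∈ L := fun b hb => by
    obtain ⟨a, ha⟩ := mem_dom.1 hb
    exact ha.2.2
  have hran : ∀ a ∈ ran (D ⊓ K.prod L), a ∈ K := fun b hb => by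
    obtain ⟨a, ha⟩ := mem_ran.1 hb
    exact ha.2.1
  have key : ind (ran (D ⊓ K.prod L)) K * BisetSemiring.conj e.toMonoidHom *
      res (dom (D ⊓ K.prod L)) L = tw K L D := by
    rw [ind_eq_tw, res_eq_tw]
    have h1 : tw K (ran (D ⊓ K.prod L)) (GroupRel.conjGraph 1) * BisetSemiring.conj e.toMonoidHom =
        tw K (dom (D ⊓ K.prod L)) (D ⊓ K.prod L) := by
      refine tw_mul_tw_eq (Or.inl fun l hl => ⟨l, hran l hl, by simp [mem_conjGraph]⟩) ?_
      intro k hk j hj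
      constructor
      · intro h1
        refine ⟨k, mem_ran_of h1, by simp [mem_conjGraph], mem_twistedDiagonal.2 ⟨hj, ?_⟩⟩
        exact h.graph.left_unique (hmem ⟨j, hj⟩) h1
      · rintro ⟨l, -, h1, h2⟩
        obtain ⟨hj', rfl⟩ := mem_twistedDiagonal.1 h2
        obtain rfl : k = _ := by simpa [mem_conjGraph] using h1
        exact hmem ⟨j, hj'⟩
    rw [h1]
    refine tw_mul_tw_eq (Or.inr fun l hl => ⟨l, hdom l hl, by simp [mem_conjGraph]⟩) ?_
    intro k hk j hj
    constructor
    · intro h1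
      exact ⟨j, mem_dom_of (⟨h1, hk, hj⟩ : (k, j) ∈ D ⊓ K.prod L), ⟨h1, hk, hj⟩,
        by simp [mem_conjGraph]⟩
    · rintro ⟨l, -, h1, h2⟩
      obtain rfl : l = j := by simpa [mem_conjGraph] using h2
      exact h1.1
  rw [← key]
  refine mul_mem (mul_mem (F.ind_mem hran h.left) ?_) ?_
  · exact NonUnitalSubsemiring.subset_closure (Or.inr ⟨_, _, _, he, e.bijective, rfl⟩)
  · exact NonUnitalSubsemiring.subset_closure (Or.inl (Or.inr ⟨_, _, hdom, h.right, rfl⟩))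

end IsLocalGraph

variable [Finite P]

/-- The generators are transitive bisets over `F`, and by the Mackey formula a product of two of
these is a sum of such bisets. So the additive monoid that they generate is already the whole
semiring. -/
theorem mackeySemiring_induction {p : BisetSemiring P → Prop} (zero : p 0)
    (add : ∀ x ∈ F.mackeySemiring, ∀ y ∈ F.mackeySemiring, p x → p y → p (x + y))
    (tw : ∀ K L D, F.IsLocalGraph K L D → p (tw K L D)) {x : BisetSemiring P}
    (hx : x ∈ F.mackeySemiring) : p x := by
  have h1 : x ∈ AddSubmonoid.closure
      {x | ∃ K L D, F.IsLocalGraph K L D ∧ x = BisetSemiring.tw K L D} := by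
    induction hx using NonUnitalSubsemiring.closure_induction with
    | mem x hx =>
      refine AddSubmonoid.subset_closure ?_
      obtain ((⟨H, K, h, hK, rfl⟩ | ⟨H, K, h, hK, rfl⟩) | ⟨H, K, φ, hφ, -, rfl⟩) := hx
      · exact ⟨_, _, _, .of_conjGraph hK (h.trans hK) (one_mem S), ind_eq_tw⟩
      · exact ⟨_, _, _, .of_conjGraph (h.trans hK) hK (one_mem S), res_eq_tw⟩
      · exact ⟨_, _, _, .of_isGraph (isGraph_of_hom hφ) (F.le_right hφ) (F.le_left hφ), rfl⟩
    | zero => exact zero_mem _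
    | add x y _ _ hx hy => exact add_mem hx hy
    | mul x y h1 h2 hx hy =>
      clear h1 h2
      induction hx using AddSubmonoid.closure_induction with
      | zero => rw [zero_mul]; exact zero_mem _
      | add x x' _ _ hx hx' => rw [add_mul]; exact add_mem hx hx'
      | mem x hx =>
        induction hy using AddSubmonoid.closure_induction with
        | zero => rw [mul_zero]; exact zero_mem _
        | add y y' _ _ hy hy' => rw [mul_add]; exact add_mem hy hy'
        | mem y hy =>
          obtain ⟨K, L, D, hD, rfl⟩ := hx
          obtain ⟨L', J, D', hD', rfl⟩ := hy
          by_cases h : L = L'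
          · subst h
            rw [tw_mul_tw]
            exact orbSum_mem _ _ _ fun l =>
              AddSubmonoid.subset_closure ⟨_, _, _, hD.mulRel hD' l.2, rfl⟩
          · rw [tw_mul_tw_of_ne h]
            exact zero_mem _
  have h2 : x ∈ F.mackeySemiring ∧ p x := by
    clear hx
    induction h1 using AddSubmonoid.closure_induction with
    | zero => exact ⟨zero_mem _, zero⟩
    | add x y _ _ hx hy => exact ⟨add_mem hx.1 hy.1, add x hx.1 y hy.1 hx.2 hy.2⟩
    | mem x hx =>
      obtain ⟨K, L, D, hD, rfl⟩ := hx
      exact ⟨hD.tw_mem, tw K L D hD⟩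
  exact h2.2

theorem cut_mem (H : Subgroup P) {x : BisetSemiring P} (hx : x ∈ F.mackeySemiring) :
    cut H x ∈ F.mackeySemiring := by
  refine mackeySemiring_induction (p := fun x => cut H x ∈ F.mackeySemiring) ?_ ?_ ?_ hx
  · rw [map_zero]
    exact zero_mem _
  · intro x _ y _ h h'
    rw [map_add]
    exact add_mem h h'
  · intro K L D hD
    by_cases h : K ≤ H ∧ L ≤ H ∧ ∃ h ∈ H, D ⊓ K.prod L ≤ GroupRel.conjGraph h
    · obtain ⟨hK, hL, h, hh, hh'⟩ := h
      rw [cut_tw hK hL hh hh']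
      exact hD.tw_mem
    · rw [cut_tw_of_not h]
      exact zero_mem _

end FusionSystem

/-! ### The Mackey algebra in terms of transitive bisets -/

namespace MackeyAlgebra

open BisetSemiring GroupRel FusionSystem

variable {P : Type u} [Group P] [Finite P] {S T : Subgroup P}
  {R : Type w} [CommRing R] {F : FusionSystem S}

theorem of_add (x y : F.MackeySemiring) : of R F (x + y) = of R F x + of R F y :=
  TensorProduct.tmul_add _ _ _

theorem of_mul (x y : F.MackeySemiring) : of R F (x * y) = of R F x * of R F y := by
  refine Eq.trans ?_ (Algebra.TensorProduct.tmul_mul_tmul (R := ℕ) (1 : R) (1 : R) x y).symm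
  rw [mul_one]
  rfl

theorem of_zero : of R F 0 = 0 := TensorProduct.tmul_zero _ _

open Classical in
/-- The image in the Mackey algebra of an element of the semiring of all bisets, zero for an element
which is not in the Mackey semiring. -/
noncomputable def image (R : Type w) [CommRing R] (F : FusionSystem S) (x : BisetSemiring P) :
    MackeyAlgebra R F :=
  if h : x ∈ F.mackeySemiring then of R F ⟨x, h⟩ else 0

theorem image_of_mem {x : BisetSemiring P} (h : x ∈ F.mackeySemiring) :
    image R F x = of R F ⟨x, h⟩ := dif_pos h

theorem image_zero : image R F 0 = 0 := (image_of_mem (zero_mem _)).trans of_zero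

theorem image_add {x y : BisetSemiring P} (hx : x ∈ F.mackeySemiring)
    (hy : y ∈ F.mackeySemiring) : image R F (x + y) = image R F x + image R F y := by
  rw [image_of_mem hx, image_of_mem hy, image_of_mem (add_mem hx hy)]
  exact of_add (R := R) (F := F) ⟨x, hx⟩ ⟨y, hy⟩

theorem image_mul {x y : BisetSemiring P} (hx : x ∈ F.mackeySemiring)
    (hy : y ∈ F.mackeySemiring) : image R F (x * y) = image R F x * image R F y := by
  rw [image_of_mem hx, image_of_mem hy, image_of_mem (mul_mem hx hy)]
  exact of_mul (R := R) (F := F) ⟨x, hx⟩ ⟨y, hy⟩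

theorem image_sum {ι : Type*} (s : Finset ι) {x : ι → BisetSemiring P}
    (hx : ∀ i ∈ s, x i ∈ F.mackeySemiring) :
    image R F (∑ i ∈ s, x i) = ∑ i ∈ s, image R F (x i) := by
  classical
  induction s using Finset.induction_on with
  | empty => exact image_zero
  | insert a s ha ih =>
    rw [Finset.sum_insert ha, Finset.sum_insert ha, image_add (hx _ (Finset.mem_insert_self _ _))
      (sum_mem fun i hi => hx i (Finset.mem_insert_of_mem hi)),
      ih fun i hi => hx i (Finset.mem_insert_of_mem hi)]

variable (R F) in
/-- The class of the `(K, L)`-biset `(K × L) / D`. -/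
noncomputable def beta (K L : Subgroup P) (D : Subgroup (P × P)) : MackeyAlgebra R F :=
  image R F (tw K L D)

theorem beta_congr {K L : Subgroup P} {D D' : Subgroup (P × P)}
    (h : ∀ a ∈ K, ∀ b ∈ L, ((a, b) ∈ D ↔ (a, b) ∈ D')) : beta R F K L D = beta R F K L D' :=
  congrArg (image R F) (tw_congr h)

theorem beta_conjBy {K L : Subgroup P} {D : Subgroup (P × P)} {k l : P} (hk : k ∈ K)
    (hl : l ∈ L) : beta R F K L (conjBy (k, l) D) = beta R F K L D :=
  congrArg (image R F) (tw_conjBy hk hl)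

theorem beta_mul_beta {K L J : Subgroup P} {D D' : Subgroup (P × P)} (hD : F.IsLocalGraph K L D)
    (hD' : F.IsLocalGraph L J D') : beta R F K L D * beta R F L J D' =
      orbSum (dcSetoid K L J D D') fun l => beta R F K J (mulRel L D l D') := by
  rw [beta, beta, ← image_mul hD.tw_mem hD'.tw_mem, tw_mul_tw]
  exact image_sum _ fun q _ => (hD.mulRel hD' q.out.2).tw_mem

theorem beta_mulRel_congr {K L J : Subgroup P} {D D' : Subgroup (P × P)} {l l' : L}
    (h : dcSetoid K L J D D' l l') :
    beta R F K J (mulRel L D l D') = beta R F K J (mulRel L D l' D') :=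
  congrArg (image R F) (tw_mulRel_congr h)

theorem beta_mul_beta_of_ne {K L L' J : Subgroup P} {D D' : Subgroup (P × P)}
    (hD : F.IsLocalGraph K L D) (hD' : F.IsLocalGraph L' J D') (h : L ≠ L') :
    beta R F K L D * beta R F L' J D' = 0 := by
  rw [beta, beta, ← image_mul hD.tw_mem hD'.tw_mem, tw_mul_tw_of_ne h, image_zero]

theorem beta_mul_beta_eq {K L J : Subgroup P} {D D' D'' : Subgroup (P × P)}
    (hD : F.IsLocalGraph K L D) (hD' : F.IsLocalGraph L J D')
    (hl : (∀ l ∈ L, ∃ k ∈ K, (k, l) ∈ D) ∨ ∀ l ∈ L, ∃ j ∈ J, (l, j) ∈ D')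
    (h : ∀ k ∈ K, ∀ j ∈ J, ((k, j) ∈ D'' ↔ ∃ l ∈ L, (k, l) ∈ D ∧ (l, j) ∈ D')) :
    beta R F K L D * beta R F L J D' = beta R F K J D'' := by
  rw [beta, beta, ← image_mul hD.tw_mem hD'.tw_mem, tw_mul_tw_eq hl h, beta]

theorem smul_of (r : R) (x : F.MackeySemiring) :
    r • of R F x = (r ⊗ₜ[ℕ] x : R ⊗[ℕ] F.MackeySemiring) := by
  refine (TensorProduct.smul_tmul' r (1 : R) x).trans ?_
  rw [smul_eq_mul, mul_one]

@[elab_as_elim]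
theorem induction_beta {p : MackeyAlgebra R F → Prop} (zero : p 0)
    (add : ∀ a b, p a → p b → p (a + b))
    (smul_beta : ∀ (r : R) K L D, F.IsLocalGraph K L D → p (r • beta R F K L D))
    (a : MackeyAlgebra R F) : p a := by
  refine TensorProduct.induction_on (R := ℕ) (M := R) (N := F.MackeySemiring) a zero ?_ add
  rintro r ⟨x, hx⟩
  have h : p (r • image R F x) := by
    refine mackeySemiring_induction (p := fun x => p (r • image R F x)) ?_ ?_ ?_ hx
    · rw [image_zero, smul_zero]
      exact zero
    · intro x hx y hy h h'
      rw [image_add hx hy, smul_add]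
      exact add _ _ h h'
    · exact smul_beta r
  rw [image_of_mem hx] at h
  exact (smul_of r (⟨x, hx⟩ : F.MackeySemiring)) ▸ h

theorem span_beta : Submodule.span R
    (Set.range fun x : Subgroup P × Subgroup P × Subgroup (P × P) => beta R F x.1 x.2.1 x.2.2) =
      ⊤ := by
  refine eq_top_iff.2 fun a _ => ?_
  induction a using induction_beta with
  | zero => exact zero_mem _
  | add a b ha hb => exact add_mem (ha trivial) (hb trivial)
  | smul_beta r K L D hD => exact Submodule.smul_mem _ _ (Submodule.subset_span ⟨⟨K, L, D⟩, rfl⟩)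

/-- There are only finitely many triples of subgroups. As a consequence finitely generated modules
over the Mackey algebra are finitely generated over the commutative ring `R`, where surjective
endomorphisms are injective and Nakayama's lemma applies. -/
instance : Module.Finite R (MackeyAlgebra R F) :=
  ⟨⟨(Set.finite_range fun x : Subgroup P × Subgroup P × Subgroup (P × P) =>
    beta R F x.1 x.2.1 x.2.2).toFinset, by rw [Set.Finite.coe_toFinset, span_beta]⟩⟩

theorem one_eq_sum : (1 : MackeyAlgebra R F) =
    ∑ K ∈ (Set.toFinite {K : Subgroup P | K ≤ S}).toFinset, beta R F K K (conjGraph 1) := by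
  have h : (1 : MackeyAlgebra R F) = image R F (unit S) := (image_of_mem F.unit_mem).symm
  rw [h, unit, image_sum]
  · exact Finset.sum_congr rfl fun K _ => congrArg _ ind_eq_tw
  · intro K hK
    exact F.ind_mem le_rfl (by simpa using hK)

theorem idem_eq_beta {K : Subgroup P} (hK : K ≤ S) :
    idem R F K hK = beta R F K K (conjGraph 1) := by
  rw [beta, ← ind_eq_tw, image_of_mem (F.ind_mem le_rfl hK)]
  rfl

theorem incl_image {E : FusionSystem T} (h : E.IsSub F) {x : BisetSemiring P}
    (hx : x ∈ E.mackeySemiring) : incl R h (image R E x) = image R F x := by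
  rw [image_of_mem hx, image_of_mem (h.mackeySemiring_le hx)]
  rfl

theorem inclAux_smul {E : FusionSystem T} (h : E.IsSub F) (r : R) (a : R ⊗[ℕ] E.MackeySemiring) :
    inclAux R h (r • a) = r • inclAux R h a := by
  induction a using TensorProduct.induction_on with
  | zero => rw [smul_zero, map_zero, smul_zero]
  | add a b ha hb => rw [smul_add, map_add, map_add, smul_add, ha, hb]
  | tmul s x =>
    have key : ∀ (t : R) (c : E.MackeySemiring),
        inclAux R h (t ⊗ₜ[ℕ] c) = t ⊗ₜ[ℕ] h.inclSemiring c := fun _ _ => rfl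
    rw [TensorProduct.smul_tmul', key, key, TensorProduct.smul_tmul']

theorem incl_smul {E : FusionSystem T} (h : E.IsSub F) (r : R) (a : MackeyAlgebra R E) :
    incl R h (r • a) = r • incl R h a := inclAux_smul h r a

/-- The `R`-linear extension of `BisetSemiring.cut`. -/
noncomputable def cutAlg (R : Type w) [CommRing R] (F : FusionSystem S) (H : Subgroup P) :
    MackeyAlgebra R F →ₗ[R] MackeyAlgebra R F :=
  TensorProduct.AlgebraTensorModule.map (R := ℕ) (A := R) (LinearMap.id : R →ₗ[R] R)
    (AddMonoidHom.toNatLinearMap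
      { toFun := fun x : F.MackeySemiring => (⟨cut H x.1, cut_mem H x.2⟩ : F.MackeySemiring)
        map_zero' := Subtype.ext (map_zero (cut H))
        map_add' := fun x y => Subtype.ext (map_add (cut H) x.1 y.1) })

theorem cutAlg_image {H : Subgroup P} {x : BisetSemiring P} (hx : x ∈ F.mackeySemiring) :
    cutAlg R F H (image R F x) = image R F (cut H x) := by
  rw [image_of_mem hx, image_of_mem (cut_mem H hx)]
  rfl

theorem cutAlg_beta {H K L : Subgroup P} {D : Subgroup (P × P)} (hl : F.IsLocalGraph K L D)
    (hK : K ≤ H) (hL : L ≤ H) {h : P} (hh : h ∈ H) (hD : D ⊓ K.prod L ≤ conjGraph h) :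
    cutAlg R F H (beta R F K L D) = beta R F K L D := by
  rw [beta, cutAlg_image hl.tw_mem, cut_tw hK hL hh hD]

theorem cutAlg_beta_of_not {H K L : Subgroup P} {D : Subgroup (P × P)}
    (hl : F.IsLocalGraph K L D)
    (hD : ¬ (K ≤ H ∧ L ≤ H ∧ ∃ h ∈ H, D ⊓ K.prod L ≤ conjGraph h)) :
    cutAlg R F H (beta R F K L D) = 0 := by
  rw [beta, cutAlg_image hl.tw_mem, cut_tw_of_not hD, image_zero]

end MackeyAlgebra

/-! ### Points of the centric biset relative to two subgroups -/

namespace FusionSystem.CentricBiset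

open GroupRel

variable {P : Type u} [Group P] {S : Subgroup P} {F : FusionSystem S} (C : F.CentricBiset)

/-- The stabilizer of a point, the graph of a morphism of `F`. -/
def grp (x : C.carrier) : Subgroup (P × P) := MulAction.stabilizer (P × P) x.1

theorem isGraph_grp (x : C.carrier) : F.IsGraph (C.grp x) := C.isGraph x.2

/-- The action of `S × S` on the points. -/
def move {k h : P} (hk : k ∈ S) (hh : h ∈ S) (x : C.carrier) : C.carrier :=
  ⟨(k, h) • x.1, C.smul_mem hk hh x.2⟩

theorem mem_grp {x : C.carrier} {a b : P} : (a, b) ∈ C.grp x ↔ (a, b) • x.1 = x.1 := Iff.rfl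

theorem mem_grp_of_smul {x y : C.carrier} {k h a b : P} (hy : (k, h) • x.1 = y.1) :
    (a, b) ∈ C.grp y ↔ (k⁻¹ * a * k, h⁻¹ * b * h) ∈ C.grp x := by
  rw [mem_grp, mem_grp, ← hy, smul_smul, ← inv_smul_eq_iff, smul_smul]
  exact Iff.of_eq (by simp [mul_assoc])

theorem mem_grp_move {k h a b : P} (hk : k ∈ S) (hh : h ∈ S) {x : C.carrier} :
    (a, b) ∈ C.grp (C.move hk hh x) ↔ (k⁻¹ * a * k, h⁻¹ * b * h) ∈ C.grp x :=
  C.mem_grp_of_smul rfl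

/-- The largest subgroup of `H` that the graph of the point `x` maps to `K`. -/
def src (K H : Subgroup P) (x : C.carrier) : Subgroup P := dom (C.grp x ⊓ K.prod H)

theorem mem_src {K H : Subgroup P} {x : C.carrier} {e : P} :
    e ∈ C.src K H x ↔ e ∈ H ∧ ∃ k ∈ K, (k, e) ∈ C.grp x := by
  rw [src, mem_dom]
  constructor
  · rintro ⟨k, h, hk, he⟩
    exact ⟨he, k, hk, h⟩
  · rintro ⟨he, k, hk, h⟩
    exact ⟨k, h, hk, he⟩

theorem src_le (K H : Subgroup P) (x : C.carrier) : C.src K H x ≤ H := fun _ h => (C.mem_src.1 h).1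

/-- The orbits of `K × H`. -/
def rel (K H : Subgroup P) : Setoid C.carrier where
  r x y := ∃ k ∈ K, ∃ h ∈ H, (k, h) • x.1 = y.1
  iseqv := by
    refine ⟨fun x => ⟨1, one_mem _, 1, one_mem _, one_smul _ _⟩, ?_, ?_⟩
    · rintro x y ⟨k, hk, h, hh, e⟩
      refine ⟨k⁻¹, inv_mem hk, h⁻¹, inv_mem hh, ?_⟩
      rw [← e, smul_smul]
      simp [← Prod.one_eq_mk]
    · rintro x y z ⟨k, hk, h, hh, e⟩ ⟨k', hk', h', hh', e'⟩
      exact ⟨k' * k, mul_mem hk' hk, h' * h, mul_mem hh' hh, by rw [← e', ← e, smul_smul]; rfl⟩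

theorem isLocalGraph (x : C.carrier) {K L : Subgroup P} (hK : K ≤ S) (hL : L ≤ S) :
    F.IsLocalGraph K L (C.grp x) := .of_isGraph (C.isGraph_grp x) hK hL

theorem isLocalGraph_op (x : C.carrier) {K L : Subgroup P} (hK : K ≤ S) (hL : L ≤ S) :
    F.IsLocalGraph K L (op (C.grp x)) := .of_isGraph (C.isGraph_grp x).op hK hL

end FusionSystem.CentricBiset

/-! ### Relative traces: invariance, induction and restriction -/

namespace MackeyAlgebra

open BisetSemiring GroupRel FusionSystem

variable {P : Type u} [Group P] [Finite P] {S T : Subgroup P}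
  {R : Type w} [CommRing R] {F : FusionSystem S}

theorem beta_mul_one {K L : Subgroup P} {D : Subgroup (P × P)} (hD : F.IsLocalGraph K L D) :
    beta R F K L D * beta R F L L (conjGraph 1) = beta R F K L D :=
  beta_mul_beta_eq hD (.of_conjGraph hD.right hD.right (one_mem S))
    (Or.inr fun l hl => ⟨l, hl, by simp [mem_conjGraph]⟩) fun k _ j hj => by
      constructor
      · intro h
        exact ⟨j, hj, h, by simp [mem_conjGraph]⟩
      · rintro ⟨l, _, h, h'⟩
        obtain rfl : l = j := by simpa [mem_conjGraph] using h'
        exact h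

theorem one_mul_beta {K L : Subgroup P} {D : Subgroup (P × P)} (hD : F.IsLocalGraph K L D) :
    beta R F K K (conjGraph 1) * beta R F K L D = beta R F K L D :=
  beta_mul_beta_eq (.of_conjGraph hD.left hD.left (one_mem S)) hD
    (Or.inl fun l hl => ⟨l, hl, by simp [mem_conjGraph]⟩) fun k hk j hj => by
      constructor
      · intro h
        exact ⟨k, hk, by simp [mem_conjGraph], h⟩
      · rintro ⟨l, _, h', h⟩
        obtain rfl : k = l := by simpa [mem_conjGraph] using h'
        exact h

/-- Restriction of a graph on its domain along a conjugation. -/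
theorem beta_mul_conj {K E E' : Subgroup P} {D D' : Subgroup (P × P)} {h : P}
    (hD : F.IsLocalGraph K E D) (hE : ∀ e ∈ E, ∃ k ∈ K, (k, e) ∈ D) (hh : h ∈ S) (hE' : E' ≤ S)
    (hc : ∀ e ∈ E', h * e * h⁻¹ ∈ E)
    (hD' : ∀ k ∈ K, ∀ e ∈ E', ((k, e) ∈ D' ↔ (k, h * e * h⁻¹) ∈ D)) :
    beta R F K E D * beta R F E E' (conjGraph h) = beta R F K E' D' :=
  beta_mul_beta_eq hD (.of_conjGraph hD.right hE' hh) (Or.inl hE) fun k hk e he => by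
    rw [hD' k hk e he]
    constructor
    · intro h1
      exact ⟨_, hc e he, h1, rfl⟩
    · rintro ⟨l, _, h1, h2⟩
      rw [mem_conjGraph] at h2
      rwa [← h2]

theorem conj_mul_beta {K E E' : Subgroup P} {D D' : Subgroup (P × P)} {h : P}
    (hD : F.IsLocalGraph E K D) (hE : ∀ e ∈ E, ∃ k ∈ K, (e, k) ∈ D) (hh : h ∈ S) (hE' : E' ≤ S)
    (hc : ∀ e ∈ E', h⁻¹ * e * h ∈ E)
    (hD' : ∀ e ∈ E', ∀ k ∈ K, ((e, k) ∈ D' ↔ (h⁻¹ * e * h, k) ∈ D)) :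
    beta R F E' E (conjGraph h) * beta R F E K D = beta R F E' K D' :=
  beta_mul_beta_eq (.of_conjGraph hE' hD.left hh) hD (Or.inr hE) fun e he k hk => by
    rw [hD' e he k hk]
    constructor
    · intro h1
      exact ⟨_, hc e he, by rw [mem_conjGraph]; group, h1⟩
    · rintro ⟨l, _, h1, h2⟩
      rw [mem_conjGraph] at h1
      rw [h1]
      convert h2 using 2
      group

variable (R) (C : F.CentricBiset)

/-- The biset that restricts to `K` and transports to the source of `x`, and its opposite. -/
noncomputable def tIn (K H : Subgroup P) (x : C.carrier) : MackeyAlgebra R F :=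
  beta R F K (C.src K H x) (C.grp x)

/-- On a module, `tOut` restricts from `K` to the image of the source and transports to the source,
a subgroup of `H`; `tIn` transports back and induces to `K`. -/
noncomputable def tOut (K H : Subgroup P) (x : C.carrier) : MackeyAlgebra R F :=
  beta R F (C.src K H x) K (op (C.grp x))

variable {R} {C}
variable {M : Type v} [AddCommGroup M] [Module (MackeyAlgebra R F) M]

/-- `f` commutes with the Mackey functor operations over `𝓕_H(H)`. -/
structure IsInnerHom (R : Type w) [CommRing R] (F : FusionSystem S) {N : Type*} [AddCommGroup N]
    [Module (MackeyAlgebra R F) N] {M : Type v} [AddCommGroup M] [Module (MackeyAlgebra R F) M]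
    (H : Subgroup P) (f : N →+ M) : Prop where
  comm : ∀ {K L : Subgroup P} {h : P}, K ≤ H → L ≤ H → h ∈ H → ∀ m,
    f (beta R F K L (conjGraph h) • m) = beta R F K L (conjGraph h) • f m
  smul : ∀ (r : R) m, f (algebraMap R (MackeyAlgebra R F) r • m) =
    algebraMap R (MackeyAlgebra R F) r • f m

/-- `B` is `μ_R(F)`-linear on the left, and balanced over `𝓕_H(H)`. -/
structure IsBalanced {V : Type*} [AddCommGroup V] [Module (MackeyAlgebra R F) V] (H : Subgroup P)
    (B : MackeyAlgebra R F →+ M →+ V) : Prop where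
  left : ∀ c a m, B (c * a) m = c • B a m
  mid : ∀ {K L : Subgroup P} {h : P}, K ≤ H → L ≤ H → h ∈ H → ∀ a m,
    B (a * beta R F K L (conjGraph h)) m = B a (beta R F K L (conjGraph h) • m)
  smul : ∀ (r : R) a m, B (a * algebraMap R (MackeyAlgebra R F) r) m =
    B a (algebraMap R (MackeyAlgebra R F) r • m)

variable {V N : Type*} [AddCommGroup V] [Module (MackeyAlgebra R F) V] [AddCommGroup N]
  [Module (MackeyAlgebra R F) N]

/-- The contribution of the point `x` and the subgroup `K` to a relative trace. -/
noncomputable def pairTerm (C : F.CentricBiset) (B : MackeyAlgebra R F →+ M →+ V) (f : N →+ M)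
    (K H : Subgroup P) (m : N) (x : C.carrier) : V :=
  B (tIn R C K H x) (f (tOut R C K H x • m))

variable {H : Subgroup P} {B : MackeyAlgebra R F →+ M →+ V} {f : N →+ M}

/-- A move of the point by `(k, h)` multiplies `tIn` and `tOut` by mutually inverse conjugations
with `h`, which cancel across `f` because `f` commutes with them and `B` is balanced. The element
`k` of `K` does not change the classes of the bisets. The pairing `B` is left general so that one
argument serves both the product `a • m` and the tensor `a ⊗ m`. -/
theorem pairTerm_rel (hB : IsBalanced H B) (hf : IsInnerHom R F H f) (hH : H ≤ S)
    {K : Subgroup P} (hK : K ≤ S) (m : N) {x y : C.carrier} (hxy : C.rel K H x y) :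
    pairTerm C B f K H m x = pairTerm C B f K H m y := by
  obtain ⟨k, hk, h, hh, e⟩ := hxy
  have hmem : ∀ {a b}, (a, b) ∈ C.grp y ↔ (k⁻¹ * a * k, h⁻¹ * b * h) ∈ C.grp x :=
    fun {a b} => C.mem_grp_of_smul e
  have hEx : C.src K H x ≤ H := C.src_le K H x
  have hEy : C.src K H y ≤ H := C.src_le K H y
  have hh' := inv_mem hh
  have h1 : ∀ e ∈ C.src K H y, h⁻¹ * e * h ∈ C.src K H x := by
    intro e he
    obtain ⟨he, a, ha, hm⟩ := C.mem_src.1 he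
    exact C.mem_src.2 ⟨mul_mem (mul_mem hh' he) hh, _, mul_mem (mul_mem (inv_mem hk) ha) hk,
      hmem.1 hm⟩
  have h2 : ∀ e ∈ C.src K H x, h * e * h⁻¹ ∈ C.src K H y := by
    intro e he
    obtain ⟨he, a, ha, hm⟩ := C.mem_src.1 he
    refine C.mem_src.2 ⟨mul_mem (mul_mem hh he) hh', k * a * k⁻¹,
      mul_mem (mul_mem hk ha) (inv_mem hk), hmem.2 ?_⟩
    convert hm using 2 <;> group
  have hconj : conjBy (k, 1) (conjBy (1, h) (C.grp x)) = C.grp y := by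
    ext ⟨a, b⟩
    rw [mem_conjBy_mk, mem_conjBy_mk, hmem]
    simp
  have hly := C.isLocalGraph y hK (hEy.trans hH)
  have hlx := C.isLocalGraph x hK (hEx.trans hH)
  have ht : tIn R C K H y =
      tIn R C K H x * beta R F (C.src K H x) (C.src K H y) (conjGraph h⁻¹) := by
    rw [tIn, ← hconj, beta_conjBy hk (one_mem _)]
    refine (beta_mul_conj hlx (fun e he => (C.mem_src.1 he).2) (hH hh') (hEy.trans hH) ?_ ?_).symm
    · simpa using h1
    · intro a _ b _
      rw [mem_conjBy_mk]
      simp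
  have ht' : tIn R C K H x =
      tIn R C K H y * beta R F (C.src K H y) (C.src K H x) (conjGraph h) := by
    rw [tIn, tIn, ← beta_conjBy hk (one_mem _)]
    refine (beta_mul_conj hly (fun e he => (C.mem_src.1 he).2) (hH hh) (hEx.trans hH) h2 ?_).symm
    intro a _ b _
    rw [mem_conjBy_mk, hmem]
    simp [mul_assoc]
  have hr : tOut R C K H y =
      beta R F (C.src K H y) (C.src K H x) (conjGraph h) * tOut R C K H x := by
    have : op (C.grp y) = conjBy (1, k) (op (conjBy (1, h) (C.grp x))) := by
      rw [← hconj]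
      ext ⟨a, b⟩
      simp only [mem_op, mem_conjBy_mk]
    rw [tOut, this, beta_conjBy (one_mem _) hk]
    refine (conj_mul_beta (C.isLocalGraph_op x (hEx.trans hH) hK)
      (fun e he => (C.mem_src.1 he).2) (hH hh) (hEy.trans hH) h1 ?_).symm
    intro a _ b _
    rw [mem_op, mem_op, mem_conjBy_mk]
    simp
  rw [pairTerm, pairTerm, hr, mul_smul, hf.comm hEy hEx hh, ← hB.mid hEy hEx hh, ← ht']

/-- The component at `K` of a relative trace. -/
noncomputable def pairComp (C : F.CentricBiset) (B : MackeyAlgebra R F →+ M →+ V) (f : N →+ M)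
    (K H : Subgroup P) (m : N) : V := orbSum (C.rel K H) (pairTerm C B f K H m)

/-- For a point `x`, the Mackey formula splits `tOut` after induction from `A` into terms indexed by
double cosets. These double cosets index the `A × H`-orbits inside the `L × H`-orbit of `x`, with
`l` corresponding to the point `l⁻¹ x`. Term by term the inclusion of sources passes through `f`,
and the induction comes out on the left. -/
theorem pairComp_ind (hB : IsBalanced H B) (hf : IsInnerHom R F H f) (hH : H ≤ S)
    {A L : Subgroup P} (hA : A ≤ L) (hL : L ≤ S) (m : N) :
    pairComp C B f L H (beta R F L A (conjGraph 1) • m) =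
      beta R F L A (conjGraph 1) • pairComp C B f A H m := by
  have h1S := one_mem S
  have hloc := IsLocalGraph.of_conjGraph (F := F) hL (hA.trans hL) h1S
  have hinv : ∀ x x', C.rel A H x x' →
      beta R F L A (conjGraph 1) • pairTerm C B f A H m x =
        beta R F L A (conjGraph 1) • pairTerm C B f A H m x' := fun x x' h => by
    rw [pairTerm_rel hB hf hH (hA.trans hL) m h]
  have hmap := map_orbSum (C.rel A H) (pairTerm C B f A H m)
    (DistribSMul.toAddMonoidHom V (beta R F L A (conjGraph 1)))
  refine Eq.trans ?_ hmap.symm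
  refine Eq.trans ?_ (orbSum_fiber (s := C.rel L H) (Z := fun _ => L) hinv
    (fun x => dcSetoid (C.src L H x) L A (op (C.grp x)) (conjGraph 1))
    (fun x l => C.move (hL (inv_mem l.2)) h1S x) (fun x => x) ?_ ?_ ?_ ?_).symm
  · refine orbSum_congr fun x => ?_
    have hE : C.src L H x ≤ S := (C.src_le L H x).trans hH
    rw [pairTerm, smul_smul, tOut, beta_mul_beta (C.isLocalGraph_op x hE hL) hloc]
    have h2 := map_orbSum (dcSetoid (C.src L H x) L A (op (C.grp x)) (conjGraph 1))
      (fun l : L => beta R F (C.src L H x) A (mulRel L (op (C.grp x)) l (conjGraph 1)))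
      ((B (tIn R C L H x)).comp (f.comp ((smulAddHom (MackeyAlgebra R F) N).flip m)))
    refine h2.trans (orbSum_congr fun l => ?_)
    change B (tIn R C L H x) (f (beta R F (C.src L H x) A _ • m)) =
      beta R F L A (conjGraph 1) • pairTerm C B f A H m _
    set z := C.move (hL (inv_mem l.2)) h1S x with hz
    have hmem : ∀ {a b}, (a, b) ∈ C.grp z ↔ (l * a * (l : P)⁻¹, b) ∈ C.grp x := by
      intro a b
      rw [hz, C.mem_grp_move]
      simp
    have hzx : C.src A H z ≤ C.src L H x := by
      intro e he
      obtain ⟨he, a, ha, h⟩ := C.mem_src.1 he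
      exact C.mem_src.2 ⟨he, _, mul_mem (mul_mem l.2 (hA ha)) (inv_mem l.2), hmem.1 h⟩
    have e1 : beta R F (C.src L H x) A (mulRel L (op (C.grp x)) l (conjGraph 1)) =
        beta R F (C.src L H x) (C.src A H z) (conjGraph 1) * tOut R C A H z := by
      refine (beta_mul_beta_eq (.of_conjGraph hE (hzx.trans hE) h1S)
        (C.isLocalGraph_op z (hzx.trans hE) (hA.trans hL))
        (Or.inr fun e he => (C.mem_src.1 he).2) ?_).symm
      intro e he a ha
      rw [mem_mulRel]
      constructor
      · rintro ⟨b, hb, h1, h2⟩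
        have h3 : (a, e) ∈ C.grp z := by
          rw [hmem]
          convert mem_op.1 h1 using 2
          rw [mem_conjGraph] at h2
          have : a = (l : P)⁻¹ * b * l := by simpa using h2.symm
          rw [this]
          group
        exact ⟨e, C.mem_src.2 ⟨C.src_le _ _ _ he, a, ha, h3⟩, by simp [mem_conjGraph], h3⟩
      · rintro ⟨e', he', h1, h2⟩
        obtain rfl : e = e' := by simpa [mem_conjGraph] using h1
        exact ⟨_, mul_mem (mul_mem l.2 (hA ha)) (inv_mem l.2), hmem.1 h2, by
          rw [mem_conjGraph]; group⟩
    have e2 : tIn R C L H x * beta R F (C.src L H x) (C.src A H z) (conjGraph 1) =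
        beta R F L A (conjGraph 1) * tIn R C A H z := by
      have e3 : tIn R C L H x * beta R F (C.src L H x) (C.src A H z) (conjGraph 1) =
          beta R F L (C.src A H z) (C.grp x) :=
        beta_mul_conj (C.isLocalGraph x hL hE) (fun e he => (C.mem_src.1 he).2) h1S
          (hzx.trans hE) (fun e he => by simpa using hzx he) (by simp)
      rw [e3, ← beta_conjBy (inv_mem l.2) (one_mem _)]
      refine (beta_mul_beta_eq hloc (C.isLocalGraph z (hA.trans hL) (hzx.trans hE))
        (Or.inl fun a ha => ⟨a, hA ha, by simp [mem_conjGraph]⟩) ?_).symm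
      intro b hb e he
      obtain ⟨-, a, ha, h⟩ := C.mem_src.1 he
      rw [mem_conjBy_mk]
      have hbe : (((l : P)⁻¹)⁻¹ * b * (l : P)⁻¹, (1 : P)⁻¹ * e * 1) ∈ C.grp x ↔
          (b, e) ∈ C.grp z := by
        rw [hmem]
        simp
      rw [hbe]
      constructor
      · intro h'
        obtain rfl := (C.isGraph_grp z).left_unique h h'
        exact ⟨a, ha, by simp [mem_conjGraph], h⟩
      · rintro ⟨b', _, h1, h2⟩
        obtain rfl : b = b' := by simpa [mem_conjGraph] using h1
        exact h2
    rw [e1, mul_smul, hf.comm (C.src_le _ _ _) (C.src_le _ _ _) (one_mem H),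
      ← hB.mid (C.src_le _ _ _) (C.src_le _ _ _) (one_mem H), e2, hB.left, pairTerm]
  · rintro x x' ⟨a, ha, h, hh, e⟩
    exact ⟨a, hA ha, h, hh, e⟩
  · intro x l
    refine ⟨l, l.2, 1, one_mem H, ?_⟩
    change ((l : P), (1 : P)) • ((l : P)⁻¹, (1 : P)) • x.1 = x.1
    rw [smul_smul]
    simp [← Prod.one_eq_mk]
  · intro x l l'
    constructor
    · rintro ⟨e, he, a, ha, b, hb, h1, h2⟩
      refine ⟨a, ha, e, C.src_le _ _ _ he, ?_⟩
      change (a, e) • ((l : P)⁻¹, (1 : P)) • x.1 = ((l' : P)⁻¹, (1 : P)) • x.1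
      have h3 : a = (l' : P)⁻¹ * b * l := by simpa [mem_conjGraph] using h2.symm
      have h4 : (b, e) • x.1 = x.1 := h1
      conv_rhs => rw [← h4]
      rw [smul_smul, smul_smul, h3]
      simp
    · rintro ⟨a, ha, h, hh, e⟩
      replace e : (a, h) • ((l : P)⁻¹, (1 : P)) • x.1 = ((l' : P)⁻¹, (1 : P)) • x.1 := e
      have h1 : (l' * a * (l : P)⁻¹, h) ∈ C.grp x := by
        have := congrArg (((l' : P), (1 : P)) • ·) e
        simpa [smul_smul, C.mem_grp, mul_assoc, ← Prod.one_eq_mk] using this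
      have hb : l' * a * (l : P)⁻¹ ∈ L := mul_mem (mul_mem l'.2 (hA ha)) (inv_mem l.2)
      refine ⟨h, C.mem_src.2 ⟨hh, _, hb, h1⟩, a, ha, _, hb, h1, ?_⟩
      rw [mem_conjGraph]
      group
  · rintro x z ⟨l, hl, h, hh, e⟩
    refine ⟨⟨l, hl⟩, 1, one_mem _, h⁻¹, inv_mem hh, ?_⟩
    change (1, h⁻¹) • ((l : P)⁻¹, (1 : P)) • x.1 = z.1
    rw [← e, smul_smul, smul_smul]
    simp [← Prod.one_eq_mk]

/-- Dual to the case of induction: now the restriction of `tIn` to `A` is split by the Mackey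
formula, and `l` corresponds to the point `l x`. -/
theorem pairComp_res (hB : IsBalanced H B) (hf : IsInnerHom R F H f) (hH : H ≤ S)
    {A L : Subgroup P} (hA : A ≤ L) (hL : L ≤ S) (m : N) :
    pairComp C B f A H (beta R F A L (conjGraph 1) • m) =
      beta R F A L (conjGraph 1) • pairComp C B f L H m := by
  have h1S := one_mem S
  have hloc := IsLocalGraph.of_conjGraph (F := F) (hA.trans hL) hL h1S
  have hmap := map_orbSum (C.rel L H) (pairTerm C B f L H m)
    (DistribSMul.toAddMonoidHom V (beta R F A L (conjGraph 1)))
  refine Eq.trans ?_ hmap.symm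
  refine (orbSum_fiber (s := C.rel L H) (Z := fun _ => L)
    (fun x x' h => pairTerm_rel hB hf hH (hA.trans hL) _ h)
    (fun x => dcSetoid A L (C.src L H x) (conjGraph 1) (C.grp x))
    (fun x l => C.move (hL l.2) h1S x) (fun x => x) ?_ ?_ ?_ ?_).trans ?_
  · rintro x x' ⟨a, ha, h, hh, e⟩
    exact ⟨a, hA ha, h, hh, e⟩
  · intro x l
    refine ⟨(l : P)⁻¹, inv_mem l.2, 1, one_mem H, ?_⟩
    change ((l : P)⁻¹, (1 : P)) • ((l : P), (1 : P)) • x.1 = x.1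
    rw [smul_smul]
    simp [← Prod.one_eq_mk]
  · intro x l l'
    constructor
    · rintro ⟨a, ha, e, he, b, hb, h1, h2⟩
      refine ⟨a, ha, e, C.src_le _ _ _ he, ?_⟩
      change (a, e) • ((l : P), (1 : P)) • x.1 = ((l' : P), (1 : P)) • x.1
      obtain rfl : a = b := by simpa [mem_conjGraph] using h1
      have h4 : ((l' : P)⁻¹ * a * l, e) • x.1 = x.1 := h2
      conv_rhs => rw [← h4]
      rw [smul_smul, smul_smul]
      simp [mul_assoc]
    · rintro ⟨a, ha, h, hh, e⟩
      replace e : (a, h) • ((l : P), (1 : P)) • x.1 = ((l' : P), (1 : P)) • x.1 := e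
      have h1 : ((l' : P)⁻¹ * a * l, h) ∈ C.grp x := by
        have := congrArg (((l' : P)⁻¹, (1 : P)) • ·) e
        simpa [smul_smul, C.mem_grp, mul_assoc, ← Prod.one_eq_mk] using this
      refine ⟨a, ha, h, C.mem_src.2 ⟨hh, _, mul_mem (mul_mem (inv_mem l'.2) (hA ha)) l.2, h1⟩,
        a, hA ha, by simp [mem_conjGraph], h1⟩
  · rintro x z ⟨l, hl, h, hh, e⟩
    refine ⟨⟨l⁻¹, inv_mem hl⟩, 1, one_mem _, h⁻¹, inv_mem hh, ?_⟩
    change (1, h⁻¹) • (l⁻¹, (1 : P)) • x.1 = z.1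
    rw [← e, smul_smul, smul_smul]
    simp [← Prod.one_eq_mk]
  · refine orbSum_congr fun x => ?_
    have hE : C.src L H x ≤ S := (C.src_le L H x).trans hH
    change _ = beta R F A L (conjGraph 1) • B (tIn R C L H x) (f (tOut R C L H x • m))
    rw [← hB.left, tIn, beta_mul_beta hloc (C.isLocalGraph x hL hE)]
    have h2 := map_orbSum (dcSetoid A L (C.src L H x) (conjGraph 1) (C.grp x))
      (fun l : L => beta R F A (C.src L H x) (mulRel L (conjGraph 1) l (C.grp x)))
      (B.flip (f (tOut R C L H x • m)))
    refine Eq.trans (orbSum_congr fun l => ?_) h2.symm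
    change _ = B (beta R F A (C.src L H x) _) _
    set z := C.move (hL l.2) h1S x with hz
    have hmem : ∀ {a b}, (a, b) ∈ C.grp z ↔ ((l : P)⁻¹ * a * l, b) ∈ C.grp x := by
      intro a b
      rw [hz, C.mem_grp_move]
      simp
    have hzx : C.src A H z ≤ C.src L H x := by
      intro e he
      obtain ⟨he, a, ha, h⟩ := C.mem_src.1 he
      exact C.mem_src.2 ⟨he, _, mul_mem (mul_mem (inv_mem l.2) (hA ha)) l.2, hmem.1 h⟩
    have e1 : beta R F A (C.src L H x) (mulRel L (conjGraph 1) l (C.grp x)) =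
        tIn R C A H z * beta R F (C.src A H z) (C.src L H x) (conjGraph 1) := by
      refine (beta_mul_beta_eq (C.isLocalGraph z (hA.trans hL) (hzx.trans hE))
        (.of_conjGraph (hzx.trans hE) hE h1S) (Or.inl fun e he => (C.mem_src.1 he).2) ?_).symm
      intro a ha e he
      rw [mem_mulRel]
      constructor
      · rintro ⟨b, hb, h1, h2⟩
        obtain rfl : a = b := by simpa [mem_conjGraph] using h1
        exact ⟨e, C.mem_src.2 ⟨C.src_le _ _ _ he, a, ha, hmem.2 h2⟩, hmem.2 h2,
          by simp [mem_conjGraph]⟩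
      · rintro ⟨e', he', h1, h2⟩
        obtain rfl : e' = e := by simpa [mem_conjGraph] using h2
        exact ⟨a, hA ha, by simp [mem_conjGraph], hmem.1 h1⟩
    have e2 : beta R F (C.src A H z) (C.src L H x) (conjGraph 1) * tOut R C L H x =
        tOut R C A H z * beta R F A L (conjGraph 1) := by
      have e3 : beta R F (C.src A H z) (C.src L H x) (conjGraph 1) * tOut R C L H x =
          beta R F (C.src A H z) L (op (C.grp x)) :=
        conj_mul_beta (C.isLocalGraph_op x hE hL) (fun e he => (C.mem_src.1 he).2) h1S
          (hzx.trans hE) (fun e he => by simpa using hzx he) (by simp)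
      rw [e3, ← beta_conjBy (one_mem _) l.2]
      refine (beta_mul_beta_eq (C.isLocalGraph_op z (hzx.trans hE) (hA.trans hL)) hloc
        (Or.inr fun a ha => ⟨a, hA ha, by simp [mem_conjGraph]⟩) ?_).symm
      intro e he b hb
      obtain ⟨-, a, ha, h⟩ := C.mem_src.1 he
      rw [mem_conjBy_mk]
      have hbe : ((1 : P)⁻¹ * e * 1, (l : P)⁻¹ * b * l) ∈ op (C.grp x) ↔ (b, e) ∈ C.grp z := by
        rw [hmem, mem_op]
        simp
      rw [hbe]
      constructor
      · intro h'
        obtain rfl := (C.isGraph_grp z).left_unique h h'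
        exact ⟨a, ha, h, by simp [mem_conjGraph]⟩
      · rintro ⟨b', _, h1, h2⟩
        obtain rfl : b' = b := by simpa [mem_conjGraph] using h2
        exact h1
    rw [e1, hB.mid (C.src_le _ _ _) (C.src_le _ _ _) (one_mem H),
      ← hf.comm (C.src_le _ _ _) (C.src_le _ _ _) (one_mem H), smul_smul, e2, pairTerm, mul_smul]

end MackeyAlgebra

/-! ### Transport of points along isomorphisms of `F` -/

namespace FusionSystem.CentricBiset

open GroupRel

variable {P : Type u} [Group P] [Finite P] {S : Subgroup P} {F : FusionSystem S}
  (C : F.CentricBiset)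

/-- The isomorphism with graph `D` takes the part of the graph of `y` over `H` to the part of the
graph of `x` over `H`. -/
structure Corr (D : Subgroup (P × P)) (H : Subgroup P) (x y : C.carrier) : Prop where
  centric : F.IsCentric (C.src (ran D) H x)
  iff : ∀ {a b}, (a, b) ∈ D → ∀ {e}, e ∈ H → ((a, e) ∈ C.grp x ↔ (b, e) ∈ C.grp y)

variable {C} {D : Subgroup (P × P)} {H : Subgroup P} {x y x' y' : C.carrier}

theorem isCentricGraph_of_src {K : Subgroup P} (h : F.IsCentric (C.src K H x)) :
    F.IsCentricGraph (C.grp x ⊓ K.prod H) := ⟨(C.isGraph_grp x).mono inf_le_left, h⟩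

theorem isCentric_src_of_rel {K : Subgroup P} (hK : K ≤ S) (hH : H ≤ S)
    (h : F.IsCentric (C.src K H x)) (hxy : C.rel K H x y) : F.IsCentric (C.src K H y) := by
  obtain ⟨k, hk, e, he, hy⟩ := hxy
  have h1 := ((isCentricGraph_of_src h).conjBy (hK hk) (hH he)).2
  refine h1.of_le ?_ ((C.src_le K H y).trans hH)
  intro b hb
  rw [mem_dom_conjBy] at hb
  obtain ⟨a, h2, ha, hb⟩ := mem_dom.1 hb
  have hb' : b ∈ H := by simpa [mul_assoc] using mul_mem (mul_mem he hb) (inv_mem he)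
  refine C.mem_src.2 ⟨hb', k * a * k⁻¹, mul_mem (mul_mem hk ha) (inv_mem hk), ?_⟩
  rw [C.mem_grp_of_smul hy]
  replace h2 : (a, e⁻¹ * b * e) ∈ C.grp x := h2
  convert h2 using 2
  group

theorem Corr.src_eq (h : C.Corr D H x y) : C.src (ran D) H x = C.src (dom D) H y := by
  ext e
  rw [C.mem_src, C.mem_src]
  refine and_congr_right fun he => ⟨?_, ?_⟩
  · rintro ⟨a, ha, hm⟩
    obtain ⟨b, hab⟩ := mem_ran.1 ha
    exact ⟨b, mem_dom_of hab, (h.iff hab he).1 hm⟩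
  · rintro ⟨b, hb, hm⟩
    obtain ⟨a, hab⟩ := mem_dom.1 hb
    exact ⟨a, mem_ran_of hab, (h.iff hab he).2 hm⟩

theorem Corr.op (h : C.Corr D H x y) : C.Corr (op D) H y x where
  centric := by
    rw [ran_op, ← h.src_eq]
    exact h.centric
  iff hab _ he := (h.iff hab he).symm

/-- The composite of the opposite of `D` with the part of the graph of `x` over `H`. -/
theorem isCentricGraph_comp (hD : F.IsGraph D) (h : F.IsCentric (C.src (ran D) H x)) :
    F.IsCentricGraph (comp (GroupRel.op D) (C.grp x ⊓ (ran D).prod H)) := by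
  have hX := isCentricGraph_of_src h
  refine ⟨hD.op.comp hX.1, ?_⟩
  have : dom (comp (GroupRel.op D) (C.grp x ⊓ (ran D).prod H)) = C.src (ran D) H x := by
    ext e
    rw [C.mem_src, mem_dom]
    constructor
    · rintro ⟨b, a, -, h1, h2, h3⟩
      exact ⟨h3, a, h2, h1⟩
    · rintro ⟨he, a, ha, h1⟩
      obtain ⟨b, hb⟩ := mem_ran.1 ha
      exact ⟨b, a, hb, h1, ha, he⟩
  rwa [this]

/-- The part of the graph of `x` over `H`, composed with the inverse of `D`, is a centric graph and
lies in the graph of some point `y`. What has to be excluded is that the graph of `y` is larger over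
`H`. -/
theorem exists_corr (hD : F.IsGraph D) (h : F.IsCentric (C.src (ran D) H x)) :
    ∃ y, C.Corr D H x y := by
  have hX := isCentricGraph_of_src h
  obtain ⟨y, hy, hle⟩ := C.exists_le (isCentricGraph_comp hD h)
  have h1 : ∀ {a b}, (a, b) ∈ D → ∀ {e}, e ∈ H → (a, e) ∈ C.grp x →
      (b, e) ∈ C.grp ⟨y, hy⟩ := fun {a b} hab {e} he hm =>
    hle ⟨a, hab, hm, mem_ran_of hab, he⟩
  refine ⟨⟨y, hy⟩, h, fun {a b} hab {e} he => ⟨h1 hab he, fun hm => ?_⟩⟩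
  -- The graph of `y` is carried back by `D` and placed in the graph of a point `x'`. Uniqueness
  -- gives `x' = z x` with `z` in `ran D`. A pair in the graph of `x'` over `ran D` is thereby
  -- conjugated into the graph of `x`, and since a graph is single-valued, the conjugation by `z`
  -- did not change it.
  let E := comp D (C.grp ⟨y, hy⟩ ⊓ (dom D).prod H)
  have hE : F.IsGraph E := hD.comp ((C.isGraph_grp ⟨y, hy⟩).mono inf_le_left)
  have hXE : C.grp x ⊓ (ran D).prod H ≤ E := by
    rintro ⟨a, e⟩ ⟨h2, ha, he⟩
    obtain ⟨b, hb⟩ := mem_ran.1 ha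
    exact ⟨b, hb, h1 hb he h2, mem_dom_of hb, he⟩
  obtain ⟨x', hx', hle'⟩ := C.exists_le (hX.of_le hXE hE)
  obtain ⟨z, hz, -, rfl⟩ := C.exists_smul hX x.2 hx' inf_le_left (hXE.trans hle')
  have hz' : z ∈ ran D := by
    obtain ⟨b, hb⟩ := mem_ran.1 hz
    exact hb.2.1
  have h2 : (a, e) ∈ C.grp ⟨(z, (1 : P)) • x.1, hx'⟩ := hle' ⟨b, hab, hm, mem_dom_of hab, he⟩
  have h3 := h2
  rw [C.mem_grp_of_smul (x := x) rfl] at h3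
  simp only [inv_one, one_mul, mul_one] at h3
  have h4 : (z⁻¹ * a * z, e) ∈ C.grp ⟨(z, (1 : P)) • x.1, hx'⟩ :=
    hle' (hXE ⟨h3, (ran D).mul_mem ((ran D).mul_mem ((ran D).inv_mem hz') (mem_ran_of hab)) hz', he⟩)
  rwa [(C.isGraph_grp _).left_unique h4 h2] at h3

theorem Corr.rel_right (hD : F.IsGraph D) (h : C.Corr D H x y) (h' : C.Corr D H x y') :
    C.rel (dom D) H y y' := by
  have key : ∀ {y}, C.Corr D H x y → comp (GroupRel.op D) (C.grp x ⊓ (ran D).prod H) ≤ C.grp y := by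
    rintro y h ⟨b, e⟩ ⟨a, hab, hm, -, he⟩
    exact (h.iff hab he).1 hm
  obtain ⟨z, hz, -, hz'⟩ := C.exists_smul (isCentricGraph_comp hD h.centric) y.2 y'.2 (key h) (key h')
  obtain ⟨e, a, hz, -⟩ := mem_ran.1 hz
  exact ⟨z, mem_dom_of hz, 1, one_mem H, hz'.symm⟩

theorem Corr.exists_rel (hD : F.IsGraph D) (hH : H ≤ S) (h : C.Corr D H x y)
    (hx : C.rel (ran D) H x x') : ∃ y', C.rel (dom D) H y y' ∧ C.Corr D H x' y' := by
  have hc := isCentric_src_of_rel hD.ran_le hH h.centric hx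
  obtain ⟨a, ha, e, he, hx⟩ := hx
  obtain ⟨b, hab⟩ := mem_ran.1 ha
  refine ⟨C.move (hD.mem_right hab) (hH he) y, ⟨b, mem_dom_of hab, e, he, rfl⟩, hc, ?_⟩
  intro a' b' hab' e' he'
  rw [C.mem_grp_of_smul hx, C.mem_grp_move]
  exact h.iff (mul_mem (mul_mem (inv_mem hab) hab') hab) (mul_mem (mul_mem (inv_mem he) he') he)

/-- Together with the existence of corresponding points this makes `Corr` a bijection between the
`ran D × H`-orbits and the `dom D × H`-orbits of points with centric source. -/
theorem Corr.rel_iff (hD : F.IsGraph D) (hH : H ≤ S) (h : C.Corr D H x y)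
    (h' : C.Corr D H x' y') : C.rel (ran D) H x x' ↔ C.rel (dom D) H y y' := by
  constructor
  · intro hx
    obtain ⟨y'', h1, h2⟩ := h.exists_rel hD hH hx
    exact (C.rel _ H).trans h1 (h2.rel_right hD h')
  · intro hy
    rw [← ran_op] at hy
    obtain ⟨x'', h1, h2⟩ := h.op.exists_rel hD.op hH hy
    rw [← dom_op]
    exact (C.rel _ H).trans h1 (h2.rel_right hD.op h'.op)

end FusionSystem.CentricBiset

/-! ### Relative traces on centric functors are linear -/

namespace MackeyAlgebra

open BisetSemiring GroupRel FusionSystem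

variable {P : Type u} [Group P] [Finite P] {S T : Subgroup P}
  {R : Type w} [CommRing R] {F : FusionSystem S} {C : F.CentricBiset}
  {M : Type v} [AddCommGroup M] [Module (MackeyAlgebra R F) M]
  {V N : Type*} [AddCommGroup V] [Module (MackeyAlgebra R F) V] [AddCommGroup N]
  [Module (MackeyAlgebra R F) N]
  {H : Subgroup P} {B : MackeyAlgebra R F →+ M →+ V} {f : N →+ M}

variable (R F M) in
/-- The subgroups that are not `F`-centric annihilate `M`. -/
def IsSupportedOnCentric : Prop :=
  ∀ K ≤ S, ¬ F.IsCentric K → ∀ m : M, beta R F K K (conjGraph 1) • m = 0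

theorem IsSupportedOnCentric.smul_eq_zero (hM : IsSupportedOnCentric R F M) {K L : Subgroup P}
    {D : Subgroup (P × P)} (hD : F.IsLocalGraph K L D) (hK : ¬ F.IsCentric K) (m : M) :
    beta R F K L D • m = 0 := by
  rw [← one_mul_beta hD, mul_smul, hM K hD.left hK]

/-- Here the centricity of the functor is indispensable. A point whose source is not centric
contributes zero, since `tOut` then maps into a value that vanishes; on the remaining orbits `Corr`
is a bijection that matches the terms. -/
theorem pairComp_iso (hM : IsSupportedOnCentric R F N) (hB : IsBalanced H B)
    (hf : IsInnerHom R F H f) (hH : H ≤ S) {D : Subgroup (P × P)} (hD : F.IsGraph D) (m : N) :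
    pairComp C B f (ran D) H (beta R F (ran D) (dom D) D • m) =
      beta R F (ran D) (dom D) D • pairComp C B f (dom D) H m := by
  have hA := hD.ran_le
  have hB' := hD.dom_le
  have hloc := IsLocalGraph.of_isGraph hD hA hB'
  have hmap := map_orbSum (C.rel (dom D) H) (pairTerm C B f (dom D) H m)
    (DistribSMul.toAddMonoidHom V (beta R F (ran D) (dom D) D))
  refine Eq.trans ?_ hmap.symm
  refine orbSum_eq_of_corr (fun x x' h => pairTerm_rel hB hf hH hA _ h)
    (fun x x' h => congrArg _ (pairTerm_rel hB hf hH hB' _ h)) (C.Corr D H) ?_ ?_ ?_ ?_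
  · intro x hx
    refine CentricBiset.exists_corr hD ?_
    by_contra hc
    refine hx ?_
    rw [pairTerm, tOut, hM.smul_eq_zero (C.isLocalGraph_op x ((C.src_le _ _ _).trans hH) hA) hc,
      map_zero, map_zero]
  · intro y hy
    have hc : F.IsCentric (C.src (dom D) H y) := by
      by_contra hc
      refine hy ?_
      rw [pairTerm, tOut, hM.smul_eq_zero (C.isLocalGraph_op y ((C.src_le _ _ _).trans hH) hB') hc,
        map_zero, map_zero, map_zero]
    rw [← ran_op] at hc
    obtain ⟨x, hx⟩ := CentricBiset.exists_corr hD.op hc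
    exact ⟨x, hx.op⟩
  · intro x y h
    change _ = beta R F (ran D) (dom D) D • pairTerm C B f (dom D) H m y
    have hE := h.src_eq
    have hES : C.src (dom D) H y ≤ S := (C.src_le _ _ _).trans hH
    rw [pairTerm, pairTerm, ← hB.left, smul_smul, tIn, tIn, tOut, tOut, hE]
    congr 3
    · refine (beta_mul_beta_eq hloc (C.isLocalGraph y hB' hES)
        (Or.inl fun b hb => ?_) ?_).symm
      · obtain ⟨a, hab⟩ := mem_dom.1 hb
        exact ⟨a, mem_ran_of hab, hab⟩
      · intro a ha e he
        have he := C.src_le _ _ _ he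
        constructor
        · intro h1
          obtain ⟨b, hab⟩ := mem_ran.1 ha
          exact ⟨b, mem_dom_of hab, hab, (h.iff hab he).1 h1⟩
        · rintro ⟨b, _, hab, h1⟩
          exact (h.iff hab he).2 h1
    · refine beta_mul_beta_eq (C.isLocalGraph_op x hES hA) hloc (Or.inr fun a ha => ?_) ?_
      · obtain ⟨b, hab⟩ := mem_ran.1 ha
        exact ⟨b, mem_dom_of hab, hab⟩
      · intro e he b hb
        have he := C.src_le _ _ _ he
        constructor
        · intro h1
          obtain ⟨a, hab⟩ := mem_dom.1 hb
          exact ⟨a, mem_ran_of hab, (h.iff hab he).2 h1, hab⟩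
        · rintro ⟨a, _, h1, hab⟩
          exact (h.iff hab he).1 h1
  · intro x y x' y' h h'
    exact h.rel_iff hD hH h'

/-- The sum over all subgroups and all orbits of points. -/
noncomputable def pairSum (C : F.CentricBiset) (B : MackeyAlgebra R F →+ M →+ V) (f : N →+ M)
    (H : Subgroup P) (m : N) : V :=
  ∑ K ∈ (Set.toFinite {K : Subgroup P | K ≤ S}).toFinset, pairComp C B f K H m

theorem pairComp_zero_of_forall {K : Subgroup P} {m : N}
    (h : ∀ x, pairTerm C B f K H m x = 0) : pairComp C B f K H m = 0 := by
  rw [pairComp, orbSum_congr h, orbSum_zero]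

theorem pairSum_beta_smul (hH : H ≤ S) {K L : Subgroup P} {D : Subgroup (P × P)}
    (hD : F.IsLocalGraph K L D) (m : N) :
    pairSum C B f H (beta R F K L D • m) = pairComp C B f K H (beta R F K L D • m) := by
  refine Finset.sum_eq_single_of_mem K (by simpa using hD.left) fun K' hK' hne => ?_
  refine pairComp_zero_of_forall fun x => ?_
  rw [pairTerm, smul_smul, tOut, beta_mul_beta_of_ne
    (C.isLocalGraph_op x ((C.src_le _ _ _).trans hH) (by simpa using hK')) hD hne, zero_smul,
    map_zero, map_zero]

theorem beta_smul_pairSum (hB : IsBalanced H B) (hH : H ≤ S) {K L : Subgroup P}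
    {D : Subgroup (P × P)} (hD : F.IsLocalGraph K L D) (m : N) :
    beta R F K L D • pairSum C B f H m = beta R F K L D • pairComp C B f L H m := by
  rw [pairSum, Finset.smul_sum]
  refine Finset.sum_eq_single_of_mem L (by simpa using hD.right) fun K' hK' hne => ?_
  have hmap := map_orbSum (C.rel K' H) (pairTerm C B f K' H m)
    (DistribSMul.toAddMonoidHom V (beta R F K L D))
  refine hmap.trans ((orbSum_congr fun x => ?_).trans (orbSum_zero _))
  change beta R F K L D • pairTerm C B f K' H m x = 0
  rw [pairTerm, ← hB.left, tIn, beta_mul_beta_of_ne hD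
    (C.isLocalGraph x (by simpa using hK') ((C.src_le _ _ _).trans hH)) (Ne.symm hne), map_zero]
  rfl

theorem beta_eq_mul_mul {K L : Subgroup P} {D : Subgroup (P × P)} (hD : F.IsLocalGraph K L D) :
    beta R F K L D = beta R F K (ran (D ⊓ K.prod L)) (conjGraph 1) *
      (beta R F (ran (D ⊓ K.prod L)) (dom (D ⊓ K.prod L)) (D ⊓ K.prod L) *
        beta R F (dom (D ⊓ K.prod L)) L (conjGraph 1)) := by
  have hdom : dom (D ⊓ K.prod L) ≤ L := fun b hb => by
    obtain ⟨a, ha⟩ := mem_dom.1 hb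
    exact ha.2.2
  have hran : ran (D ⊓ K.prod L) ≤ K := fun b hb => by
    obtain ⟨a, ha⟩ := mem_ran.1 hb
    exact ha.2.1
  have hl := IsLocalGraph.of_isGraph hD.graph (hran.trans hD.left) (hdom.trans hD.right)
  have h1 := one_mem S
  rw [beta_mul_beta_eq (D'' := D ⊓ K.prod L) hl (.of_conjGraph hl.right hD.right h1) (Or.inr
    fun b hb => ⟨b, hdom hb, by simp [mem_conjGraph]⟩), beta_mul_beta_eq (D'' := D)
    (.of_conjGraph hD.left hl.left h1) (.of_isGraph hD.graph hl.left hD.right) (Or.inl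
    fun a ha => ⟨a, hran ha, by simp [mem_conjGraph]⟩)]
  · intro k hk l hl
    constructor
    · intro h
      exact ⟨k, mem_ran_of (⟨h, hk, hl⟩ : (k, l) ∈ D ⊓ K.prod L), by simp [mem_conjGraph], h, hk, hl⟩
    · rintro ⟨k', -, h, h'⟩
      obtain rfl : k = k' := by simpa [mem_conjGraph] using h
      exact h'.1
  · intro k hk l hl
    constructor
    · intro h
      exact ⟨l, mem_dom_of h, h, by simp [mem_conjGraph]⟩
    · rintro ⟨l', -, h, h'⟩
      obtain rfl : l' = l := by simpa [mem_conjGraph] using h'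
      exact h

theorem pairSum_algebraMap_smul (hB : IsBalanced H B) (hf : IsInnerHom R F H f) (r : R) (m : N) :
    pairSum C B f H (algebraMap R (MackeyAlgebra R F) r • m) =
      algebraMap R (MackeyAlgebra R F) r • pairSum C B f H m := by
  rw [pairSum, pairSum, Finset.smul_sum]
  refine Finset.sum_congr rfl fun K _ => ?_
  refine Eq.trans ?_ (map_orbSum (C.rel K H) (pairTerm C B f K H m)
    (DistribSMul.toAddMonoidHom V (algebraMap R (MackeyAlgebra R F) r))).symm
  refine orbSum_congr fun x => ?_
  change _ = algebraMap R (MackeyAlgebra R F) r • pairTerm C B f K H m x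
  rw [pairTerm, pairTerm, smul_smul, ← Algebra.commutes, mul_smul, hf.smul, ← hB.smul,
    ← Algebra.commutes, hB.left]

theorem pairComp_add (K : Subgroup P) (m n : N) :
    pairComp C B f K H (m + n) = pairComp C B f K H m + pairComp C B f K H n := by
  rw [pairComp, pairComp, pairComp, ← orbSum_add]
  refine orbSum_congr fun x => ?_
  rw [pairTerm, pairTerm, pairTerm, smul_add, map_add, map_add]

theorem pairSum_add (m n : N) :
    pairSum C B f H (m + n) = pairSum C B f H m + pairSum C B f H n := by
  rw [pairSum, pairSum, pairSum, ← Finset.sum_add_distrib]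
  exact Finset.sum_congr rfl fun K _ => pairComp_add K m n

/-- A transitive biset over `F` factors as a restriction, an isomorphism and an induction, and the
three components of the trace have been treated separately. Each such factor sees a single component
of the sum over `K`. -/
theorem pairSum_smul (hM : IsSupportedOnCentric R F N) (hB : IsBalanced H B)
    (hf : IsInnerHom R F H f) (hH : H ≤ S) (a : MackeyAlgebra R F) (m : N) :
    pairSum C B f H (a • m) = a • pairSum C B f H m := by
  have key : ∀ {K L : Subgroup P} {D : Subgroup (P × P)}, F.IsLocalGraph K L D →
      (∀ m, pairComp C B f K H (beta R F K L D • m) = beta R F K L D • pairComp C B f L H m) →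
      ∀ m, pairSum C B f H (beta R F K L D • m) = beta R F K L D • pairSum C B f H m := by
    intro K L D hD h m
    rw [pairSum_beta_smul hH hD, beta_smul_pairSum hB hH hD, h]
  induction a using induction_beta generalizing m with
  | zero =>
    have h0 : pairSum C B f H (0 : N) = 0 := by
      have := pairSum_add (C := C) (B := B) (f := f) (H := H) (0 : N) 0
      rwa [add_zero, left_eq_add] at this
    rw [zero_smul, zero_smul, h0]
  | add a b ha hb => rw [add_smul, add_smul, pairSum_add, ha, hb]
  | smul_beta r K L D hD =>
    have hdom : dom (D ⊓ K.prod L) ≤ L := fun b hb => by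
      obtain ⟨a, ha⟩ := mem_dom.1 hb
      exact ha.2.2
    have hran : ran (D ⊓ K.prod L) ≤ K := fun b hb => by
      obtain ⟨a, ha⟩ := mem_ran.1 hb
      exact ha.2.1
    have h1 := one_mem S
    rw [Algebra.smul_def, mul_smul, mul_smul, pairSum_algebraMap_smul hB hf, beta_eq_mul_mul hD,
      mul_smul, mul_smul, mul_smul, mul_smul,
      key (.of_conjGraph hD.left (hran.trans hD.left) h1) (pairComp_ind hB hf hH hran hD.left),
      key (.of_isGraph hD.graph (hran.trans hD.left) (hdom.trans hD.right))
        (pairComp_iso hM hB hf hH hD.graph),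
      key (.of_conjGraph (hdom.trans hD.right) hD.right h1) (pairComp_res hB hf hH hdom hD.right)]

/-- The sum as a linear map. -/
noncomputable def pairMap (C : F.CentricBiset) (hM : IsSupportedOnCentric R F N)
    (hB : IsBalanced H B) (hf : IsInnerHom R F H f) (hH : H ≤ S) : N →ₗ[MackeyAlgebra R F] V where
  toFun := pairSum C B f H
  map_add' := pairSum_add
  map_smul' := pairSum_smul hM hB hf hH

/-- The pairing of the relative trace. -/
noncomputable def smulPairing (R : Type w) [CommRing R] (F : FusionSystem S) (M : Type v)
    [AddCommGroup M] [Module (MackeyAlgebra R F) M] : MackeyAlgebra R F →+ M →+ M :=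
  smulAddHom (MackeyAlgebra R F) M

theorem isBalanced_smulPairing (H : Subgroup P) : IsBalanced H (smulPairing R F M) :=
  ⟨fun c a m => mul_smul c a m, fun _ _ _ a m => mul_smul a _ m, fun _ a m => mul_smul a _ m⟩

/-- The relative trace of `f` from `H`. -/
noncomputable def relTrace (C : F.CentricBiset) (hM : IsSupportedOnCentric R F N)
    (hH : H ≤ S) (hf : IsInnerHom R F H f) : N →ₗ[MackeyAlgebra R F] M :=
  pairMap C hM (isBalanced_smulPairing H) hf hH

/-! ### Elementary tensors of induced modules -/

theorem incl_mul_incl_one {E : FusionSystem T} (h : E.IsSub F) (b : MackeyAlgebra R E) :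
    incl R h b * incl R h 1 = incl R h b := by rw [← map_mul, mul_one]

theorem incl_one_mul_incl {E : FusionSystem T} (h : E.IsSub F) (b : MackeyAlgebra R E) :
    incl R h 1 * incl R h b = incl R h b := by rw [← map_mul, one_mul]

theorem incl_algebraMap {E : FusionSystem T} (h : E.IsSub F) (r : R) :
    incl R h (algebraMap R _ r) = algebraMap R _ r * incl R h 1 := by
  rw [Algebra.algebraMap_eq_smul_one, incl_smul, Algebra.smul_def]

section tens

variable (R) {E : FusionSystem T} (h : E.IsSub F) (M)

/-- The element `1_{μ_R(E)} m` of the restriction. -/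
noncomputable def resOf (m : M) : Restriction R h M := ⟨incl R h 1 • m, m, rfl⟩

theorem subtype_resOf (m : M) : Restriction.subtype R h M (resOf R M h m) = incl R h 1 • m := rfl

/-- The element `a ⊗ m` of the module obtained by restriction and induction. -/
noncomputable def tensOf (a : MackeyAlgebra R F) (m : M) : Induction R h (Restriction R h M) :=
  Submodule.Quotient.mk
    ((⟨a * incl R h 1, Induction.mul_incl_mem R h a 1⟩ : Induction.leftIdeal R h) ⊗ₜ[ℤ]
      resOf R M h m)

/-- The biadditive map `(a, m) ↦ a ⊗ m`. -/
noncomputable def tens : MackeyAlgebra R F →+ M →+ Induction R h (Restriction R h M) :=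
  AddMonoidHom.mk' (fun a => AddMonoidHom.mk' (tensOf R M h a) (by
      intro m n
      have : resOf R M h (m + n) = resOf R M h m + resOf R M h n :=
        Restriction.subtype_injective R h M (by
          rw [map_add, subtype_resOf, subtype_resOf, subtype_resOf, smul_add])
      rw [tensOf, this, TensorProduct.tmul_add]
      rfl)) (by
    intro a b
    ext m
    have : (⟨(a + b) * incl R h 1, Induction.mul_incl_mem R h (a + b) 1⟩ :
        Induction.leftIdeal R h) = ⟨a * incl R h 1, Induction.mul_incl_mem R h a 1⟩ +
          ⟨b * incl R h 1, Induction.mul_incl_mem R h b 1⟩ := Subtype.ext (add_mul a b _)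
    change tensOf R M h (a + b) m = tensOf R M h a m + tensOf R M h b m
    rw [tensOf, this, TensorProduct.add_tmul]
    rfl)

variable {R M}

theorem tens_mul_incl (a : MackeyAlgebra R F) (b : MackeyAlgebra R E) (m : M) :
    tens R M h (a * incl R h b) m = tens R M h a (incl R h b • m) := by
  refine (Submodule.Quotient.eq _).2 (Submodule.subset_span ?_)
  refine ⟨⟨a * incl R h 1, Induction.mul_incl_mem R h a 1⟩, b, resOf R M h m, ?_⟩
  congr 2
  · refine Subtype.ext ?_
    change a * incl R h b * incl R h 1 = a * incl R h 1 * incl R h b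
    rw [mul_assoc, mul_assoc, incl_mul_incl_one, incl_one_mul_incl]
  · refine Restriction.subtype_injective R h M ?_
    rw [Restriction.subtype_smul, subtype_resOf, subtype_resOf, smul_smul, smul_smul,
      incl_mul_incl_one, incl_one_mul_incl]

theorem tens_mul_left (c a : MackeyAlgebra R F) (m : M) :
    tens R M h (c * a) m = c • tens R M h a m := by
  have : (⟨c * a * incl R h 1, Induction.mul_incl_mem R h (c * a) 1⟩ :
      Induction.leftIdeal R h) = c • ⟨a * incl R h 1, Induction.mul_incl_mem R h a 1⟩ :=
    Subtype.ext (mul_assoc _ _ _)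
  change tensOf R M h (c * a) m = c • tensOf R M h a m
  rw [tensOf, this, ← TensorProduct.smul_tmul']
  rfl

theorem tens_incl_one_smul (a : MackeyAlgebra R F) (m : M) :
    tens R M h a (incl R h 1 • m) = tens R M h a m := by
  rw [← tens_mul_incl]
  change tensOf R M h _ m = tensOf R M h a m
  rw [tensOf, tensOf]
  congr 3
  rw [mul_assoc, incl_mul_incl_one]

theorem tens_induction {p : Induction R h (Restriction R h M) → Prop} (zero : p 0)
    (add : ∀ y z, p y → p z → p (y + z)) (tens : ∀ a m, p (tens R M h a m)) (y) : p y := by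
  induction y using Submodule.Quotient.induction_on with
  | _ y =>
    induction y using TensorProduct.induction_on with
    | zero => exact zero
    | add y z hy hz => exact add _ _ hy hz
    | tmul y x =>
      obtain ⟨_, a, rfl⟩ := y
      obtain ⟨_, m, rfl⟩ := x
      exact tens a m

end tens

theorem beta_eq_incl (hH : H ≤ S) {K L : Subgroup P} {h : P} (hK : K ≤ H) (hL : L ≤ H)
    (hh : h ∈ H) : beta R F K L (conjGraph h) =
      incl R (F.inner_isSub hH) (beta R (inner H) K L (conjGraph h)) :=
  (incl_image _ (IsLocalGraph.of_conjGraph hK hL hh).tw_mem).symm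

theorem isBalanced_tens (hH : H ≤ S) : IsBalanced H (tens R M (F.inner_isSub hH)) where
  left := tens_mul_left _
  mid hK hL hh a m := by rw [beta_eq_incl hH hK hL hh, tens_mul_incl]
  smul r a m := by
    rw [← tens_incl_one_smul, ← tens_mul_incl, mul_assoc, ← incl_algebraMap, tens_mul_incl,
      incl_algebraMap, Algebra.commutes, mul_smul, tens_incl_one_smul]

theorem beta_mul_incl_one (hH : H ≤ S) {K L : Subgroup P} {D : Subgroup (P × P)}
    (hD : F.IsLocalGraph K L D) (hL : L ≤ H) :
    beta R F K L D * incl R (F.inner_isSub hH) 1 = beta R F K L D := by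
  rw [← beta_mul_one hD, beta_eq_incl hH hL hL (one_mem H), mul_assoc, incl_mul_incl_one]

theorem theta_tens (H : F.Centric) (a : MackeyAlgebra R F) (m : M) :
    theta R F M H (tens R M (F.inner_isSub H.2.1) a m) =
      a • incl R (F.inner_isSub H.2.1) 1 • m := by
  change (a * incl R (F.inner_isSub H.2.1) 1) • incl R (F.inner_isSub H.2.1) 1 • m = _
  rw [mul_smul, smul_smul (incl R (F.inner_isSub H.2.1) 1), incl_mul_incl_one]

/-- A trace from `H` lifts to `M_H`: in its definition the product `tIn • f (…)` is replaced by the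
tensor `tIn ⊗ f (…)`. The unit of `μ_R(𝓕_H(H))` that `θ_H` introduces is absorbed by `tIn`, whose
source is a subgroup of `H`. -/
theorem theta_pairMap (hM : IsSupportedOnCentric R F N) (H : F.Centric)
    (hf : IsInnerHom R F H.1 f) (m : N) :
    theta R F M H (pairMap C hM (isBalanced_tens H.2.1) hf H.2.1 m) =
      relTrace C hM H.2.1 hf m := by
  change theta R F M H (pairSum C _ f H.1 m) = pairSum C _ f H.1 m
  rw [pairSum, pairSum, map_sum]
  refine Finset.sum_congr rfl fun K hK => ?_
  rw [pairComp, map_orbSum]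
  refine orbSum_congr fun x => ?_
  rw [pairTerm, pairTerm, theta_tens, smul_smul, tIn, beta_mul_incl_one H.2.1
    (C.isLocalGraph x (by simpa using hK) ((C.src_le _ _ _).trans H.2.1)) (C.src_le _ _ _)]
  rfl

end MackeyAlgebra

/-! ### The projection of an induced module, and factorizations as traces -/

namespace FusionSystem.CentricBiset

open GroupRel

variable {P : Type u} [Group P] [Finite P] {S : Subgroup P} {F : FusionSystem S}

/-- A morphism that agrees on a centric subgroup with the conjugation by an element of `H` is the
conjugation by an element of `H`. -/
theorem exists_le_conjGraph (C : F.CentricBiset) {X D : Subgroup (P × P)}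
    (hX : F.IsCentricGraph X) (hXD : X ≤ D) (hD : F.IsGraph D) {H : Subgroup P} (hH : H ≤ S) {h : P}
    (hh : h ∈ H) (hXh : X ≤ conjGraph h) (hr : ran X ≤ H) : ∃ h' ∈ H, D ≤ conjGraph h' := by
  obtain ⟨x, hx, hxD⟩ := C.exists_le (hX.of_le hXD hD)
  have hG := F.isGraph_conjGraph le_rfl (hH hh)
  have hXG : X ≤ conjGraph h ⊓ Subgroup.prod ⊤ S := fun a ha => ⟨hXh ha, trivial, hX.1.mem_right ha⟩
  obtain ⟨y, hy, hyD⟩ := C.exists_le (hX.of_le hXG hG)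
  obtain ⟨z, hz, -, rfl⟩ := C.exists_smul hX hx hy (hXD.trans hxD) (hXG.trans hyD)
  refine ⟨z⁻¹ * h, mul_mem (inv_mem (hr hz)) hh, ?_⟩
  rintro ⟨a, b⟩ hab
  have h1 : (a, b) ∈ C.grp ⟨x, hx⟩ := hxD hab
  have h2 : (h * b * h⁻¹, b) ∈ C.grp ⟨(z, (1 : P)) • x, hy⟩ := hyD ⟨rfl, trivial, hD.mem_right hab⟩
  rw [C.mem_grp_of_smul (x := ⟨x, hx⟩) rfl] at h2
  simp only [inv_one, one_mul, mul_one] at h2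
  rw [mem_conjGraph, (C.isGraph_grp _).left_unique h1 h2]
  group

end FusionSystem.CentricBiset

namespace MackeyAlgebra

open BisetSemiring GroupRel FusionSystem

variable {P : Type u} [Group P] [Finite P] {S T : Subgroup P}
  {R : Type w} [CommRing R] {F : FusionSystem S}
  {M : Type v} [AddCommGroup M] [Module (MackeyAlgebra R F) M] {H : Subgroup P}

/-- The biset factors through the restriction to the domain of its graph, where the functor
vanishes. -/
theorem IsSupportedOnCentric.smul_eq_zero_of_dom (hM : IsSupportedOnCentric R F M)
    {K L : Subgroup P} {D : Subgroup (P × P)} (hD : F.IsLocalGraph K L D)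
    (hc : ¬ F.IsCentric (dom (D ⊓ K.prod L))) (m : M) : beta R F K L D • m = 0 := by
  have hdom : dom (D ⊓ K.prod L) ≤ L := fun b hb => by
    obtain ⟨a, ha⟩ := mem_dom.1 hb
    exact ha.2.2
  rw [beta_eq_mul_mul hD, mul_smul, mul_smul,
    hM.smul_eq_zero (.of_conjGraph (hdom.trans hD.right) hD.right (one_mem S)) hc, smul_zero,
    smul_zero]

/-- `D` is the graph of a morphism of `𝓕_H(H)`. -/
def IsKept (H K L : Subgroup P) (D : Subgroup (P × P)) : Prop :=
  K ≤ H ∧ L ≤ H ∧ ∃ h ∈ H, D ⊓ K.prod L ≤ conjGraph h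

theorem cutAlg_kept {K L : Subgroup P} {D : Subgroup (P × P)} (hD : F.IsLocalGraph K L D)
    (h : IsKept H K L D) : cutAlg R F H (beta R F K L D) = beta R F K L D := by
  obtain ⟨hK, hL, h, hh, hle⟩ := h
  exact cutAlg_beta hD hK hL hh hle

/-- In the algebra, `cutAlg` need not be linear over `𝓕_H(H)`: a graph that does not come from
`𝓕_H(H)` may have a restriction that does. By `exists_le_conjGraph` this happens only when the
restriction has a non-centric domain, and the corresponding bisets annihilate `M`. This is why both
sides are applied to `m`. -/
theorem cutAlg_beta_mul_conj (C : F.CentricBiset) (hM : IsSupportedOnCentric R F M) (hH : H ≤ S)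
    {K L L' J : Subgroup P} {D : Subgroup (P × P)} {h : P} (hD : F.IsLocalGraph K L D)
    (hL' : L' ≤ H) (hJ : J ≤ H) (hh : h ∈ H) (m : M) :
    cutAlg R F H (beta R F K L D * beta R F L' J (conjGraph h)) • m =
      cutAlg R F H (beta R F K L D) • beta R F L' J (conjGraph h) • m := by
  have hG : F.IsLocalGraph L' J (conjGraph h) :=
    .of_conjGraph (hL'.trans hH) (hJ.trans hH) (hH hh)
  by_cases hne : L = L'
  swap
  · rw [beta_mul_beta_of_ne hD hG hne, map_zero, zero_smul, smul_smul]
    by_cases hk : IsKept H K L D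
    · rw [cutAlg_kept hD hk, beta_mul_beta_of_ne hD hG hne, zero_smul]
    · rw [cutAlg_beta_of_not hD hk, zero_mul, zero_smul]
  subst hne
  rw [beta_mul_beta hD hG, map_orbSum]
  by_cases hk : IsKept H K L D
  · rw [cutAlg_kept hD hk, smul_smul, beta_mul_beta hD hG]
    congr 1
    refine orbSum_congr fun l => cutAlg_kept (hD.mulRel hG l.2) ?_
    obtain ⟨hK, -, h0, hh0, hle⟩ := hk
    refine ⟨hK, hJ, h0 * l * h, mul_mem (mul_mem hh0 (hL' l.2)) hh, ?_⟩
    rintro ⟨k, j⟩ ⟨⟨a, ha, h1, h2⟩, hk, -⟩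
    have h3 : k = h0 * a * h0⁻¹ := hle ⟨h1, hk, ha⟩
    have h4 : (l : P)⁻¹ * a * l = h * j * h⁻¹ := h2
    rw [mem_conjGraph, h3]
    calc h0 * a * h0⁻¹ = h0 * l * ((l : P)⁻¹ * a * l) * (l : P)⁻¹ * h0⁻¹ := by group
      _ = _ := by rw [h4]; group
  · rw [cutAlg_beta_of_not hD hk, zero_smul]
    have h0 := map_orbSum (dcSetoid K L J D (conjGraph h))
      (fun l : L => cutAlg R F H (beta R F K J (mulRel L D l (conjGraph h))))
      ((smulAddHom (MackeyAlgebra R F) M).flip m)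
    refine h0.trans ((orbSum_congr fun l => ?_).trans (orbSum_zero _))
    change cutAlg R F H (beta R F K J (mulRel L D l (conjGraph h))) • m = 0
    have hl := hD.mulRel hG l.2
    by_cases hk' : IsKept H K J (mulRel L D l (conjGraph h))
    swap
    · rw [cutAlg_beta_of_not hl hk', zero_smul]
    rw [cutAlg_kept hl hk']
    refine hM.smul_eq_zero_of_dom hl (fun hc => hk ?_) m
    obtain ⟨hK, -, h1, hh1, hle⟩ := hk'
    refine ⟨hK, hL', ?_⟩
    have hlh : l * h ∈ H := mul_mem (hL' l.2) hh
    have hX : F.IsCentricGraph (conjBy (1, l * h) (mulRel L D l (conjGraph h) ⊓ K.prod J)) :=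
      IsCentricGraph.conjBy ⟨hl.graph, hc⟩ (one_mem S) (hH hlh)
    refine C.exists_le_conjGraph hX ?_ hD.graph hH (mul_mem hh1 (inv_mem hlh)) ?_ ?_
    · rintro ⟨k, a⟩ hka
      rw [mem_conjBy_mk] at hka
      simp only [inv_one, one_mul, mul_one] at hka
      obtain ⟨⟨a', ha', h2, h3⟩, hk, -⟩ := hka
      have h4 : (l : P)⁻¹ * a' * l = h * ((l * h)⁻¹ * a * (l * h)) * h⁻¹ := h3
      have h5 : a' = a := by
        calc a' = l * ((l : P)⁻¹ * a' * l) * (l : P)⁻¹ := by group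
          _ = a := by rw [h4]; group
      subst h5
      exact ⟨h2, hk, ha'⟩
    · rintro ⟨k, a⟩ hka
      rw [mem_conjBy_mk] at hka
      have h2 := mem_conjGraph.1 (hle hka)
      rw [mem_conjGraph]
      simp only [inv_one, one_mul, mul_one] at h2
      rw [h2]
      group
    · intro k hk
      obtain ⟨a, hka⟩ := mem_ran.1 hk
      rw [mem_conjBy_mk] at hka
      simp only [inv_one, one_mul, mul_one] at hka
      exact hK hka.2.1

theorem cutAlg_conj_mul_beta (C : F.CentricBiset) (hM : IsSupportedOnCentric R F M) (hH : H ≤ S)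
    {K K' L J : Subgroup P} {D : Subgroup (P × P)} {h : P} (hD : F.IsLocalGraph K L D)
    (hK' : K' ≤ H) (hJ : J ≤ H) (hh : h ∈ H) (m : M) :
    cutAlg R F H (beta R F J K' (conjGraph h) * beta R F K L D) • m =
      beta R F J K' (conjGraph h) • cutAlg R F H (beta R F K L D) • m := by
  have hG : F.IsLocalGraph J K' (conjGraph h) :=
    .of_conjGraph (hJ.trans hH) (hK'.trans hH) (hH hh)
  by_cases hne : K' = K
  swap
  · rw [beta_mul_beta_of_ne hG hD hne, map_zero, zero_smul, smul_smul]
    by_cases hk : IsKept H K L D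
    · rw [cutAlg_kept hD hk, beta_mul_beta_of_ne hG hD hne, zero_smul]
    · rw [cutAlg_beta_of_not hD hk, mul_zero, zero_smul]
  subst hne
  rw [beta_mul_beta hG hD, map_orbSum]
  by_cases hk : IsKept H K' L D
  · rw [cutAlg_kept hD hk, smul_smul, beta_mul_beta hG hD]
    congr 1
    refine orbSum_congr fun k => cutAlg_kept (hG.mulRel hD k.2) ?_
    obtain ⟨-, hL, h0, hh0, hle⟩ := hk
    refine ⟨hJ, hL, h * k * h0, mul_mem (mul_mem hh (hK' k.2)) hh0, ?_⟩
    rintro ⟨j, l⟩ ⟨⟨a, ha, h1, h2⟩, -, hl⟩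
    have h3 : (k : P)⁻¹ * a * k = h0 * l * h0⁻¹ :=
      hle ⟨h2, K'.mul_mem (K'.mul_mem (K'.inv_mem k.2) ha) k.2, hl⟩
    have h4 : j = h * a * h⁻¹ := h1
    rw [mem_conjGraph, h4]
    calc h * a * h⁻¹ = h * k * ((k : P)⁻¹ * a * k) * (k : P)⁻¹ * h⁻¹ := by group
      _ = _ := by rw [h3]; group
  · rw [cutAlg_beta_of_not hD hk, zero_smul, smul_zero]
    have h0 := map_orbSum (dcSetoid J K' L (conjGraph h) D)
      (fun k : K' => cutAlg R F H (beta R F J L (mulRel K' (conjGraph h) k D)))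
      ((smulAddHom (MackeyAlgebra R F) M).flip m)
    refine h0.trans ((orbSum_congr fun k => ?_).trans (orbSum_zero _))
    change cutAlg R F H (beta R F J L (mulRel K' (conjGraph h) k D)) • m = 0
    have hl := hG.mulRel hD k.2
    by_cases hk' : IsKept H J L (mulRel K' (conjGraph h) k D)
    swap
    · rw [cutAlg_beta_of_not hl hk', zero_smul]
    rw [cutAlg_kept hl hk']
    refine hM.smul_eq_zero_of_dom hl (fun hc => hk ?_) m
    obtain ⟨-, hL, h1, hh1, hle⟩ := hk'
    refine ⟨hK', hL, ?_⟩
    have hhk : (h * k)⁻¹ ∈ H := inv_mem (mul_mem hh (hK' k.2))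
    have hX : F.IsCentricGraph
        (conjBy ((h * k)⁻¹, 1) (mulRel K' (conjGraph h) k D ⊓ J.prod L)) :=
      IsCentricGraph.conjBy ⟨hl.graph, hc⟩ (hH hhk) (one_mem S)
    have hle' : conjBy ((h * k)⁻¹, 1) (mulRel K' (conjGraph h) k D ⊓ J.prod L) ≤
        D ⊓ K'.prod L := by
      rintro ⟨b, l⟩ hbl
      rw [mem_conjBy_mk] at hbl
      simp only [inv_one, one_mul, mul_one, inv_inv] at hbl
      obtain ⟨⟨a, ha, h2, h3⟩, -, hl⟩ := hbl
      have h4 : h * k * b * (h * k)⁻¹ = h * a * h⁻¹ := h2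
      have h5 : b = (k : P)⁻¹ * a * k := by
        calc b = (h * k)⁻¹ * (h * k * b * (h * k)⁻¹) * (h * k) := by group
          _ = _ := by rw [h4]; group
      subst h5
      exact ⟨h3, K'.mul_mem (K'.mul_mem (K'.inv_mem k.2) ha) k.2, hl⟩
    refine C.exists_le_conjGraph hX hle' hD.graph hH (mul_mem hhk hh1) ?_ ?_
    · rintro ⟨b, l⟩ hbl
      rw [mem_conjBy_mk] at hbl
      have h2 := mem_conjGraph.1 (hle hbl)
      rw [mem_conjGraph]
      simp only [inv_one, one_mul, mul_one, inv_inv] at h2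
      calc b = (h * k)⁻¹ * (h * k * b * (h * k)⁻¹) * (h * k) := by group
        _ = _ := by rw [h2]; group
    · intro b hb
      obtain ⟨l, hbl⟩ := mem_ran.1 hb
      exact hK' (hle' hbl).2.1

theorem cutAlg_mul_conj (C : F.CentricBiset) (hM : IsSupportedOnCentric R F M) (hH : H ≤ S)
    (a : MackeyAlgebra R F) {L J : Subgroup P} {h : P} (hL : L ≤ H) (hJ : J ≤ H) (hh : h ∈ H)
    (m : M) : cutAlg R F H (a * beta R F L J (conjGraph h)) • m =
      cutAlg R F H a • beta R F L J (conjGraph h) • m := by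
  induction a using induction_beta with
  | zero => rw [zero_mul, map_zero, zero_smul, zero_smul]
  | add a b ha hb => rw [add_mul, map_add, map_add, add_smul, add_smul, ha, hb]
  | smul_beta r K L D hD =>
    rw [smul_mul_assoc, map_smul, map_smul, Algebra.smul_def, Algebra.smul_def, mul_smul, mul_smul,
      cutAlg_beta_mul_conj C hM hH hD hL hJ hh]

theorem cutAlg_conj_mul (C : F.CentricBiset) (hM : IsSupportedOnCentric R F M) (hH : H ≤ S)
    (a : MackeyAlgebra R F) {L J : Subgroup P} {h : P} (hL : L ≤ H) (hJ : J ≤ H) (hh : h ∈ H)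
    (m : M) : cutAlg R F H (beta R F L J (conjGraph h) * a) • m =
      beta R F L J (conjGraph h) • cutAlg R F H a • m := by
  induction a using induction_beta with
  | zero => rw [mul_zero, map_zero, zero_smul, smul_zero]
  | add a b ha hb => rw [mul_add, map_add, map_add, add_smul, add_smul, smul_add, ha, hb]
  | smul_beta r K L D hD =>
    rw [mul_smul_comm, map_smul, map_smul, Algebra.smul_def, Algebra.smul_def, mul_smul, mul_smul,
      cutAlg_conj_mul_beta C hM hH hD hJ hL hh, smul_smul (algebraMap R (MackeyAlgebra R F) r),
      Algebra.commutes, mul_smul]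

/-- The morphisms of `𝓕_H(H)` are conjugations with elements of `H`, so the image of its Mackey
algebra is generated by the bisets `conjGraph h`, and linearity over it can be tested on these. -/
theorem incl_induction (hH : H ≤ S) {p : MackeyAlgebra R F → Prop} (zero : p 0)
    (add : ∀ a b, p a → p b → p (a + b)) (mul : ∀ a b, p a → p b → p (a * b))
    (smul : ∀ (r : R) a, p a → p (r • a))
    (conj : ∀ K L h, K ≤ H → L ≤ H → h ∈ H → p (beta R F K L (conjGraph h)))
    (b : MackeyAlgebra R (inner H)) : p (incl R (F.inner_isSub hH) b) := by
  induction b using induction_beta with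
  | zero => rw [map_zero]; exact zero
  | add a b ha hb => rw [map_add]; exact add _ _ ha hb
  | smul_beta r K L D hD =>
    have hdom : dom (D ⊓ K.prod L) ≤ L := fun b hb => by
      obtain ⟨a, ha⟩ := mem_dom.1 hb
      exact ha.2.2
    have hran : ran (D ⊓ K.prod L) ≤ K := fun b hb => by
      obtain ⟨a, ha⟩ := mem_ran.1 hb
      exact ha.2.1
    have hr' := hran.trans hD.left
    have hd' := hdom.trans hD.right
    rw [incl_smul, beta_eq_mul_mul hD, map_mul, map_mul]
    refine smul _ _ (mul _ _ ?_ (mul _ _ ?_ ?_))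
    · rw [← beta_eq_incl hH hD.left hr' (one_mem H)]
      exact conj _ _ _ hD.left hr' (one_mem H)
    · obtain ⟨E, φ, ⟨-, -, h, hh, hφ⟩, hD'⟩ := hD.graph
      have hgr : ∀ {a b}, (a, b) ∈ D ⊓ K.prod L → a = h * b * h⁻¹ := by
        intro a b hab
        rw [hD'] at hab
        obtain ⟨hb, rfl⟩ := mem_twistedDiagonal.1 hab
        exact hφ _
      rw [beta_congr (D' := conjGraph h), ← beta_eq_incl hH hr' hd' hh]
      · exact conj _ _ _ hr' hd' hh
      · intro a ha b hb
        refine ⟨hgr, fun hab => ?_⟩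
        obtain ⟨a', ha'⟩ := mem_dom.1 hb
        rwa [mem_conjGraph.1 hab, ← hgr ha']
    · rw [← beta_eq_incl hH hd' hD.right (one_mem H)]
      exact conj _ _ _ hd' hD.right (one_mem H)

theorem cutAlg_mul_incl (C : F.CentricBiset) (hM : IsSupportedOnCentric R F M) (hH : H ≤ S)
    (a : MackeyAlgebra R F) (b : MackeyAlgebra R (inner H)) (m : M) :
    cutAlg R F H (a * incl R (F.inner_isSub hH) b) • m =
      cutAlg R F H a • incl R (F.inner_isSub hH) b • m := by
  refine incl_induction (p := fun b => ∀ a (m : M), cutAlg R F H (a * b) • m =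
    cutAlg R F H a • b • m) hH ?_ ?_ ?_ ?_ ?_ b a m
  · intro a m
    rw [mul_zero, map_zero, zero_smul, smul_zero]
  · intro b b' hb hb' a m
    rw [mul_add, map_add, add_smul, add_smul, smul_add, hb, hb']
  · intro b b' hb hb' a m
    rw [← mul_assoc, hb', hb, mul_smul]
  · intro r b hb a m
    rw [mul_smul_comm, map_smul, Algebra.smul_def, Algebra.smul_def, mul_smul, mul_smul, hb,
      smul_smul (algebraMap R (MackeyAlgebra R F) r), Algebra.commutes, mul_smul]
  · intro K L h hK hL hh a m
    exact cutAlg_mul_conj C hM hH a hK hL hh m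

theorem incl_one_eq_sum (hH : H ≤ S) : incl R (F.inner_isSub hH) 1 =
    ∑ K ∈ (Set.toFinite {K : Subgroup P | K ≤ H}).toFinset, beta R F K K (conjGraph 1) := by
  rw [one_eq_sum, map_sum]
  refine Finset.sum_congr rfl fun K hK => ?_
  replace hK : K ≤ H := by simpa using hK
  exact (beta_eq_incl hH hK hK (one_mem H)).symm

theorem beta_mul_incl_one_of_not (hH : H ≤ S) {K L : Subgroup P} {D : Subgroup (P × P)}
    (hD : F.IsLocalGraph K L D) (hL : ¬ L ≤ H) :
    beta R F K L D * incl R (F.inner_isSub hH) 1 = 0 := by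
  rw [incl_one_eq_sum hH, Finset.mul_sum]
  refine Finset.sum_eq_zero fun J hJ => ?_
  replace hJ : J ≤ H := by simpa using hJ
  refine beta_mul_beta_of_ne hD (.of_conjGraph (hJ.trans hH) (hJ.trans hH) (one_mem S)) ?_
  rintro rfl
  exact hL hJ

theorem cutAlg_mul_incl_one (hH : H ≤ S) (a : MackeyAlgebra R F) :
    cutAlg R F H a * incl R (F.inner_isSub hH) 1 = cutAlg R F H a := by
  induction a using induction_beta with
  | zero => rw [map_zero, zero_mul]
  | add a b ha hb => rw [map_add, add_mul, ha, hb]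
  | smul_beta r K L D hD =>
    rw [map_smul, smul_mul_assoc]
    by_cases hk : IsKept H K L D
    · rw [cutAlg_kept hD hk, beta_mul_incl_one hH hD hk.2.1]
    · rw [cutAlg_beta_of_not hD hk, zero_mul]

section proj

variable (C : F.CentricBiset) (hM : IsSupportedOnCentric R F M) (hH : H ≤ S)

/-- The map `y ⊗ x ↦ cut(y) x` before passage to the quotient. -/
noncomputable def projAux : Induction.leftIdeal R (F.inner_isSub hH) ⊗[ℤ]
    Restriction R (F.inner_isSub hH) M →+ M :=
  TensorProduct.liftAddHom (AddMonoidHom.mk' (fun y =>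
    ((smulAddHom (MackeyAlgebra R F) M) (cutAlg R F H y.1)).comp
      (Restriction.subtype R (F.inner_isSub hH) M)) (by
    intro y z
    ext x
    change cutAlg R F H (y.1 + z.1) • Restriction.subtype R (F.inner_isSub hH) M x = _
    rw [map_add, add_smul]
    rfl)) (by
    intro r y x
    change cutAlg R F H (r • y.1) • Restriction.subtype R (F.inner_isSub hH) M x =
      cutAlg R F H y.1 • Restriction.subtype R (F.inner_isSub hH) M (r • x)
    rw [map_zsmul, map_zsmul, smul_assoc, smul_comm])

/-- The projection of the restriction of an induced module to the module. -/
noncomputable def proj :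
    Induction R (F.inner_isSub hH) (Restriction R (F.inner_isSub hH) M) →+ M :=
  QuotientAddGroup.lift (Induction.relations R (F.inner_isSub hH)
    (Restriction R (F.inner_isSub hH) M)).toAddSubgroup (projAux hH) (by
    intro t ht
    -- The relations form a `μ_R(F)`-submodule, but `projAux` is only additive. The claim is
    -- strengthened to all left multiples so that the induction over the span goes through.
    have key : ∀ c : MackeyAlgebra R F, projAux hH (c • t) = 0 := by
      refine Submodule.span_induction (p := fun t _ => ∀ c : MackeyAlgebra R F,
        projAux hH (c • t) = 0) ?_ ?_ ?_ ?_ ht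
      · rintro _ ⟨y, a, x, rfl⟩ c
        rw [smul_sub, map_sub, sub_eq_zero]
        change cutAlg R F H (c * (y.1 * incl R (F.inner_isSub hH) a)) • Restriction.subtype R (F.inner_isSub hH) M x =
          cutAlg R F H (c * y.1) • incl R (F.inner_isSub hH) a • Restriction.subtype R (F.inner_isSub hH) M x
        rw [← mul_assoc, cutAlg_mul_incl C hM hH]
      · intro c
        rw [smul_zero, map_zero]
      · intro t t' _ _ h h' c
        rw [smul_add, map_add, h, h', add_zero]
      · intro b t _ h c
        rw [smul_smul]
        exact h _
    have := key 1
    rwa [one_smul] at this)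

theorem proj_tens (a : MackeyAlgebra R F) (m : M) :
    proj C hM hH (tens R M (F.inner_isSub hH) a m) = cutAlg R F H a • m := by
  change cutAlg R F H (a * incl R (F.inner_isSub hH) 1) • incl R (F.inner_isSub hH) 1 • m = _
  rw [cutAlg_mul_incl C hM hH, smul_smul, smul_smul, cutAlg_mul_incl_one hH,
    cutAlg_mul_incl_one hH]

theorem isInnerHom_proj : IsInnerHom R F H (proj C hM hH) where
  comm := by
    intro K L h hK hL hh y
    induction y using tens_induction with
    | zero => rw [smul_zero, map_zero, smul_zero]
    | add y z hy hz => rw [smul_add, map_add, map_add, smul_add, hy, hz]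
    | tens a m => rw [← tens_mul_left, proj_tens, proj_tens, cutAlg_conj_mul C hM hH a hK hL hh]
  smul := by
    intro r y
    induction y using tens_induction with
    | zero => rw [smul_zero, map_zero, smul_zero]
    | add y z hy hz => rw [smul_add, map_add, map_add, smul_add, hy, hz]
    | tens a m =>
      rw [← tens_mul_left, proj_tens, proj_tens, ← Algebra.smul_def, map_smul, Algebra.smul_def,
        mul_smul]

/-- If the product of the graphs of `x` and `D` contains a morphism of `𝓕_H(H)` on a centric
subgroup, then `x` is in the orbit of a point whose graph contains `D`. -/
theorem exists_smul_of_kept {K E : Subgroup P} {D : Subgroup (P × P)} (hD : F.IsGraph D)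
    (hdom : dom D = E) {x0 x : C.carrier} (hx0 : D ≤ C.grp x0)
    {k h : P} (hk : k ∈ K) (hKS : K ≤ S) (hH : H ≤ S) (hh : h ∈ H)
    (hX : F.IsCentric (dom (mulRel K (op (C.grp x)) k D ⊓ (C.src K H x).prod E)))
    (hle : mulRel K (op (C.grp x)) k D ⊓ (C.src K H x).prod E ≤ conjGraph h) :
    ∃ z e, (z, e) ∈ D ∧ (k * z, h) • x0.1 = x.1 := by
  set X := mulRel K (op (C.grp x)) k D ⊓ (C.src K H x).prod E with hXdef
  have hD1 : F.IsCentricGraph (D ⊓ Subgroup.prod ⊤ (dom X)) := by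
    refine ⟨hD.mono inf_le_left, ?_⟩
    convert hX using 1
    ext e
    rw [mem_dom]
    constructor
    · rintro ⟨a, -, -, he⟩
      exact he
    · intro he
      obtain ⟨e', he'⟩ := mem_dom.1 he
      have : e ∈ dom D := hdom ▸ he'.2.2
      obtain ⟨a, ha⟩ := mem_dom.1 this
      exact ⟨a, ha, trivial, he⟩
  have hle1 : D ⊓ Subgroup.prod ⊤ (dom X) ≤
      C.grp (C.move (inv_mem (hKS hk)) (inv_mem (hH hh)) x) := by
    rintro ⟨b, e0⟩ ⟨hb, -, he0⟩
    obtain ⟨e, he⟩ := mem_dom.1 he0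
    have h1 : e = h * e0 * h⁻¹ := hle he
    obtain ⟨⟨k0, hk0, h2, h3⟩, -, -⟩ := he
    have h4 : b = k⁻¹ * k0 * k := hD.left_unique hb h3
    rw [C.mem_grp_move, h4]
    replace h2 : (k0, e) ∈ C.grp x := h2
    rw [h1] at h2
    convert h2 using 2 <;> group
  obtain ⟨z, hz, -, hz'⟩ := C.exists_smul hD1 x0.2
    (C.move (inv_mem (hKS hk)) (inv_mem (hH hh)) x).2 (inf_le_left.trans hx0) hle1
  obtain ⟨e, he⟩ := mem_ran.1 hz
  refine ⟨z, e, he.1, ?_⟩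
  replace hz' : (k⁻¹, h⁻¹) • x.1 = (z, (1 : P)) • x0.1 := hz'
  have h5 := congrArg ((k, h) • ·) hz'
  simp only [smul_smul] at h5
  simpa [← Prod.one_eq_mk] using h5.symm

/-- The projection retains only those terms in which the point and `D` agree, up to an element of
`H`, on a centric subgroup. By uniqueness such a point lies in the orbit of a point whose graph
contains `D`, and in that orbit only the double coset of `1` survives. The one remaining term, `tIn`
followed by an inclusion, is the biset of `D` itself. -/
theorem pairSum_tens_proj_of_graph {K E : Subgroup P} {D : Subgroup (P × P)} (hD : F.IsGraph D)
    (hKS : K ≤ S) (hdom : dom D = E) (hran : ran D ≤ K) (hEH : E ≤ H) (hc : F.IsCentric E)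
    (n : M) :
    pairSum C (tens R M (F.inner_isSub hH)) (proj C hM hH) H
      (tens R M (F.inner_isSub hH) (beta R F K E D) n) =
        tens R M (F.inner_isSub hH) (beta R F K E D) n := by
  obtain ⟨x0, hx0, hle0⟩ := C.exists_le ⟨hD, hdom ▸ hc⟩
  set x : C.carrier := ⟨x0, hx0⟩ with hxdef
  have hle : D ≤ C.grp x := hle0
  have hloc : F.IsLocalGraph K E D := .of_isGraph hD hKS (hEH.trans hH)
  have hsum : pairSum C (tens R M (F.inner_isSub hH)) (proj C hM hH) H
      (tens R M (F.inner_isSub hH) (beta R F K E D) n) =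
      pairComp C (tens R M (F.inner_isSub hH)) (proj C hM hH) K H
        (tens R M (F.inner_isSub hH) (beta R F K E D) n) := by
    have := pairSum_beta_smul (C := C) (B := tens R M (F.inner_isSub hH)) (f := proj C hM hH) hH hloc
      (tens R M (F.inner_isSub hH) (beta R F E E (conjGraph 1)) n)
    rwa [← tens_mul_left, beta_mul_one hloc] at this
  have hterm : ∀ y, pairTerm C (tens R M (F.inner_isSub hH)) (proj C hM hH) K H
      (tens R M (F.inner_isSub hH) (beta R F K E D) n) y =
      tens R M (F.inner_isSub hH) (tIn R C K H y)
        (orbSum (dcSetoid (C.src K H y) K E (op (C.grp y)) D) fun k =>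
          cutAlg R F H (beta R F (C.src K H y) E (mulRel K (op (C.grp y)) k D)) • n) := by
    intro y
    rw [pairTerm, ← tens_mul_left, proj_tens, tOut,
      beta_mul_beta (C.isLocalGraph_op y ((C.src_le _ _ _).trans hH) hKS) hloc, map_orbSum]
    congr 1
    exact map_orbSum _ _ ((smulAddHom (MackeyAlgebra R F) M).flip n)
  have hne : ∀ y (k : K), cutAlg R F H (beta R F (C.src K H y) E
      (mulRel K (op (C.grp y)) k D)) • n ≠ 0 → ∃ h ∈ H, ∃ z e, (z, e) ∈ D ∧
        ((k : P) * z, h) • x.1 = y.1 := by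
    intro y k hk
    have hl := (C.isLocalGraph_op y ((C.src_le K H y).trans hH) hKS).mulRel hloc k.2
    by_cases hk' : IsKept H (C.src K H y) E (mulRel K (op (C.grp y)) k D)
    · rw [cutAlg_kept hl hk'] at hk
      have hX : F.IsCentric (dom (mulRel K (op (C.grp y)) k D ⊓ (C.src K H y).prod E)) := by
        by_contra hX
        exact hk (hM.smul_eq_zero_of_dom hl hX n)
      obtain ⟨-, -, h, hh, hle'⟩ := hk'
      exact ⟨h, hh, exists_smul_of_kept C hD hdom hle k.2 hKS hH hh hX hle'⟩
    · rw [cutAlg_beta_of_not hl hk', zero_smul] at hk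
      exact (hk rfl).elim
  have hES := (C.src_le K H x).trans hH
  rw [hsum, pairComp, orbSum_eq_single (fun _ _ h => pairTerm_rel (isBalanced_tens hH)
    (isInnerHom_proj C hM hH) hH hKS _ h) x, hterm, orbSum_eq_single (fun _ _ h => by
      rw [beta_mulRel_congr h]) 1]
  · have hEs : E ≤ C.src K H x := by
      intro e he
      have : e ∈ dom D := hdom.symm ▸ he
      obtain ⟨a, ha⟩ := mem_dom.1 this
      exact C.mem_src.2 ⟨hEH he, a, hran (mem_ran_of ha), hle ha⟩
    have h1 : beta R F (C.src K H x) E (mulRel K (op (C.grp x)) ((1 : K) : P) D) =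
        beta R F (C.src K H x) E (conjGraph 1) := by
      refine beta_congr fun e he e0 he0 => ?_
      have : e0 ∈ dom D := hdom.symm ▸ he0
      obtain ⟨a, ha⟩ := mem_dom.1 this
      rw [mem_mulRel, mem_conjGraph]
      simp only [OneMemClass.coe_one, inv_one, one_mul, mul_one]
      constructor
      · rintro ⟨k, hk, h2, h3⟩
        exact (C.isGraph_grp x).right_unique (mem_op.1 h2) (hle h3)
      · rintro rfl
        exact ⟨a, hran (mem_ran_of ha), hle ha, ha⟩
    rw [h1, cutAlg_beta (.of_conjGraph hES (hEH.trans hH) (one_mem S)) (C.src_le _ _ _) hEH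
      (one_mem H) inf_le_left, ← (isBalanced_tens hH).mid (C.src_le _ _ _) hEH (one_mem H), tIn,
      beta_mul_conj (D' := D) (C.isLocalGraph x hKS hES) (fun e he => (C.mem_src.1 he).2) (one_mem S)
        (hEH.trans hH)]
    · intro e he
      simpa using hEs he
    · intro k _ e he
      simp only [inv_one, one_mul, mul_one]
      constructor
      · intro h
        exact hle h
      · intro h
        have : e ∈ dom D := hdom.symm ▸ he
        obtain ⟨a, ha⟩ := mem_dom.1 this
        rwa [(C.isGraph_grp x).left_unique h (hle ha)]
  · intro k hk
    obtain ⟨h, hh, z, e, hze, hz⟩ := hne x k hk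
    have hkz : (k : P) * z ∈ K := mul_mem k.2 (hran (mem_ran_of hze))
    refine ⟨h, C.mem_src.2 ⟨hh, _, hkz, hz⟩, e, hdom ▸ mem_dom_of hze, _, hkz, hz, ?_⟩
    convert hze using 2
    simp
  · intro y hy
    rw [hterm] at hy
    by_contra hxy
    refine hy ?_
    rw [orbSum_congr (σ := fun _ => 0), orbSum_zero, map_zero]
    intro k
    by_contra hk
    obtain ⟨h, hh, z, e, hze, hz⟩ := hne y k hk
    exact hxy ⟨_, mul_mem k.2 (hran (mem_ran_of hze)), h, hh, hz⟩

/-- The identity of the induced module is thus the trace of its projection to `M`, as in the case of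
groups. Elementary tensors reduce to bisets of isomorphisms followed by inductions, moving the
restriction to the right factor; where the domain is not centric, the right factor vanishes. -/
theorem pairSum_tens_proj (y : Induction R (F.inner_isSub hH) (Restriction R (F.inner_isSub hH) M)) :
    pairSum C (tens R M (F.inner_isSub hH)) (proj C hM hH) H y = y := by
  have hzero : pairSum C (tens R M (F.inner_isSub hH)) (proj C hM hH) H 0 = 0 := by
    have := pairSum_add (C := C) (B := tens R M (F.inner_isSub hH)) (f := proj C hM hH) (H := H) 0 0
    rwa [add_zero, left_eq_add] at this
  induction y using tens_induction with
  | zero => exact hzero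
  | add y z hy hz => rw [pairSum_add, hy, hz]
  | tens a n =>
    induction a using induction_beta generalizing n with
    | zero => rw [map_zero]; exact hzero
    | add a b ha hb => rw [map_add, AddMonoidHom.add_apply, pairSum_add, ha, hb]
    | smul_beta r K L D hD =>
      rw [Algebra.smul_def, Algebra.commutes, (isBalanced_tens hH).smul]
      generalize algebraMap R (MackeyAlgebra R F) r • n = n
      by_cases hL : L ≤ H
      swap
      · rw [← tens_incl_one_smul, ← tens_mul_incl, beta_mul_incl_one_of_not hH hD hL, map_zero]
        exact hzero
      have hdom : dom (D ⊓ K.prod L) ≤ L := fun b hb => by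
        obtain ⟨a, ha⟩ := mem_dom.1 hb
        exact ha.2.2
      have hran : ran (D ⊓ K.prod L) ≤ K := fun b hb => by
        obtain ⟨a, ha⟩ := mem_ran.1 hb
        exact ha.2.1
      have hl : F.IsLocalGraph K (dom (D ⊓ K.prod L)) (D ⊓ K.prod L) :=
        .of_isGraph hD.graph hD.left (hdom.trans hD.right)
      have hfac : beta R F K L D = beta R F K (dom (D ⊓ K.prod L)) (D ⊓ K.prod L) *
          beta R F (dom (D ⊓ K.prod L)) L (conjGraph 1) := by
        refine (beta_mul_beta_eq hl (.of_conjGraph hl.right hD.right (one_mem S))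
          (Or.inr fun b hb => ⟨b, hdom hb, by simp [mem_conjGraph]⟩) ?_).symm
        intro k hk l hl
        constructor
        · intro h
          exact ⟨l, mem_dom_of (⟨h, hk, hl⟩ : (k, l) ∈ D ⊓ K.prod L), ⟨h, hk, hl⟩,
            by simp [mem_conjGraph]⟩
        · rintro ⟨l', -, h, h'⟩
          obtain rfl : l' = l := by simpa [mem_conjGraph] using h'
          exact h.1
      rw [hfac, (isBalanced_tens hH).mid (hdom.trans hL) hL (one_mem H)]
      generalize beta R F (dom (D ⊓ K.prod L)) L (conjGraph 1) • n = n
      by_cases hc : F.IsCentric (dom (D ⊓ K.prod L))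
      · exact pairSum_tens_proj_of_graph C hM hH hD.graph hD.left rfl hran (hdom.trans hL) hc n
      · rw [← beta_mul_one hl, (isBalanced_tens hH).mid (hdom.trans hL) (hdom.trans hL) (one_mem H),
          hM _ hl.right hc, map_zero]
        exact hzero

end proj

/-- Every endomorphism that factors through the induced module is a relative trace. -/
theorem exists_relTrace_eq (C : F.CentricBiset) (hM : IsSupportedOnCentric R F M) (H : F.Centric)
    {N : Type*} [AddCommGroup N] [Module (MackeyAlgebra R F) N] (hN : IsSupportedOnCentric R F N)
    (u : N →ₗ[MackeyAlgebra R F] IndRes R F M H) :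
    ∃ (f : N →+ M) (hf : IsInnerHom R F H.1 f), theta R F M H ∘ₗ u = relTrace C hN H.2.1 hf := by
  have hp := isInnerHom_proj C hM H.2.1
  -- The map whose trace is sought is `u` followed by the projection. Since `u` is linear it can be
  -- moved past `tOut`, and the identity of `M_H` being a trace then exhibits `u` as the lift of
  -- this trace.
  have hf : IsInnerHom R F H.1 ((proj C hM H.2.1).comp u.toAddMonoidHom) := by
    constructor
    · intro K L h hK hL hh m
      change proj C hM H.2.1 (u _) = _ • proj C hM H.2.1 (u m)
      rw [map_smul, hp.comm hK hL hh]
    · intro r m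
      change proj C hM H.2.1 (u _) = _ • proj C hM H.2.1 (u m)
      rw [map_smul, hp.smul]
  refine ⟨_, hf, ?_⟩
  ext m
  rw [← theta_pairMap, LinearMap.comp_apply]
  congr 1
  rw [← pairSum_tens_proj C hM H.2.1 (u m)]
  refine Finset.sum_congr rfl fun K _ => orbSum_congr fun x => ?_
  rw [pairTerm, ← map_smul]
  rfl

end MackeyAlgebra

namespace FusionSystem.CentricBiset

open GroupRel

variable {P : Type u} [Group P] {S : Subgroup P} {F : FusionSystem S} (C : F.CentricBiset)

/-- The largest subgroup of `K` to which the graph of the point `x` maps a subgroup of `H`. -/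
def dst (K H : Subgroup P) (x : C.carrier) : Subgroup P := ran (C.grp x ⊓ K.prod H)

theorem mem_dst {K H : Subgroup P} {x : C.carrier} {a : P} :
    a ∈ C.dst K H x ↔ a ∈ K ∧ ∃ e ∈ H, (a, e) ∈ C.grp x := by
  rw [dst, mem_ran]
  constructor
  · rintro ⟨e, h, ha, he⟩
    exact ⟨ha, e, he, h⟩
  · rintro ⟨ha, e, he, h⟩
    exact ⟨e, h, ha, he⟩

theorem dst_le (K H : Subgroup P) (x : C.carrier) : C.dst K H x ≤ K := fun _ h => (C.mem_dst.1 h).1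

theorem isConj_dst_src (K H : Subgroup P) (x : C.carrier) :
    F.IsConj (C.dst K H x) (C.src K H x) :=
  ((C.isGraph_grp x).mono inf_le_left : F.IsGraph (C.grp x ⊓ K.prod H)).isConj.symm

end FusionSystem.CentricBiset

namespace MackeyAlgebra

open BisetSemiring GroupRel FusionSystem

variable {P : Type u} [Group P] [Finite P] {S T : Subgroup P}
  {R : Type w} [CommRing R] {F : FusionSystem S}
  {M : Type v} [AddCommGroup M] [Module (MackeyAlgebra R F) M]
  {N : Type v} [AddCommGroup N] [Module (MackeyAlgebra R F) N]

/-! ### Morphisms that factor through induced modules -/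

variable (R F M) in
/-- The endomorphisms of `M` that factor through `θ_H`. -/
noncomputable def traces (H : F.Centric) :
    AddSubgroup (M →ₗ[MackeyAlgebra R F] M) :=
  (AddMonoidHom.mk' (fun u : M →ₗ[MackeyAlgebra R F] IndRes R F M H => theta R F M H ∘ₗ u)
    fun u v => LinearMap.comp_add u v _).range

open Classical in
-- The components of a section are maps `M → M_H`, finitely many since `X` is finite, and their
-- composites with `θ_H` add up to the identity. In this form relative projectivity becomes a
-- statement about products and sums of endomorphisms.
theorem isRelProjective_iff {X : Set F.Centric} : IsRelProjective R F M X ↔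
    LinearMap.id ∈ ⨆ H : X, traces R F M H.1 := by
  constructor
  · rintro ⟨u, hu⟩
    have : Fintype X := Fintype.ofFinite X
    have h : LinearMap.id = ∑ H : X, theta R F M H.1 ∘ₗ
        (DirectSum.component (MackeyAlgebra R F) X (fun H => IndRes R F M H.1) H ∘ₗ u) := by
      refine LinearMap.ext fun m => ?_
      conv_lhs => rw [← hu, LinearMap.comp_apply, ← DirectSum.sum_univ_of (u m)]
      rw [map_sum, LinearMap.sum_apply]
      refine Finset.sum_congr rfl fun H _ => ?_
      exact DirectSum.toModule_lof (MackeyAlgebra R F) H _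
    rw [h]
    exact sum_mem fun H _ => AddSubgroup.mem_iSup_of_mem H ⟨_, rfl⟩
  · intro h
    refine AddSubgroup.iSup_induction (fun H : X => traces R F M H.1)
      (C := fun φ => ∃ u : M →ₗ[MackeyAlgebra R F] (⨁ H : X, IndRes R F M H.1),
        thetaFamily R F M X ∘ₗ u = φ) h ?_ ?_ ?_
    · rintro H _ ⟨u, rfl⟩
      refine ⟨DirectSum.lof (MackeyAlgebra R F) X (fun H => IndRes R F M H.1) H ∘ₗ u, ?_⟩
      exact LinearMap.ext fun m => DirectSum.toModule_lof (MackeyAlgebra R F)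
        (φ := fun H : X => theta R F M H.1) H (u m)
    · exact ⟨0, LinearMap.comp_zero _⟩
    · rintro _ _ ⟨u, rfl⟩ ⟨u', rfl⟩
      exact ⟨u + u', LinearMap.comp_add _ _ _⟩

theorem relTrace_mem_traces (C : F.CentricBiset) (hM : IsSupportedOnCentric R F M) {H : F.Centric}
    {f : M →+ M} (hf : IsInnerHom R F H.1 f) : relTrace C hM H.2.1 hf ∈ traces R F M H :=
  ⟨_, LinearMap.ext fun m => theta_pairMap (C := C) hM H hf m⟩

/-- Linear maps commute with `tIn` and `tOut`, so `π ∘ Tr_H(f) ∘ ι` is the trace of `π ∘ f ∘ ι`.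
With a projection and an inclusion this transfers relative projectivity to direct summands. -/
theorem comp_relTrace_comp_mem (C : F.CentricBiset) (hM : IsSupportedOnCentric R F M)
    (hN : IsSupportedOnCentric R F N) {H : F.Centric} {φ : M →ₗ[MackeyAlgebra R F] M}
    (hφ : φ ∈ traces R F M H) (π : M →ₗ[MackeyAlgebra R F] N) (ι : N →ₗ[MackeyAlgebra R F] M) :
    π ∘ₗ φ ∘ₗ ι ∈ traces R F N H := by
  obtain ⟨u, rfl⟩ := hφ
  obtain ⟨f, hf, hu⟩ := exists_relTrace_eq C hM H hM u
  change π ∘ₗ (theta R F M H ∘ₗ u) ∘ₗ ι ∈ _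
  rw [hu]
  have hf' : IsInnerHom R F H.1 (π.toAddMonoidHom.comp (f.comp ι.toAddMonoidHom)) := by
    constructor
    · intro K L h hK hL hh m
      change π (f (ι _)) = _ • π (f (ι m))
      rw [map_smul, hf.comm hK hL hh, map_smul]
    · intro r m
      change π (f (ι _)) = _ • π (f (ι m))
      rw [map_smul, hf.smul, map_smul]
  convert relTrace_mem_traces C hN hf' using 1
  refine LinearMap.ext fun m => ?_
  change π (pairSum C (smulPairing R F M) f H.1 (ι m)) = pairSum C (smulPairing R F N) _ H.1 m
  rw [pairSum, pairSum, map_sum]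
  refine Finset.sum_congr rfl fun K _ => ?_
  rw [pairComp, pairComp, map_orbSum]
  refine orbSum_congr fun x => ?_
  change π (tIn R C K H.1 x • f (tOut R C K H.1 x • ι m)) =
    tIn R C K H.1 x • π (f (ι (tOut R C K H.1 x • m)))
  rw [π.map_smul, ι.map_smul]

/-- The transport of `g` along the graph of `y`, on the subgroups of `H`. -/
noncomputable def transport (C : F.CentricBiset) (H K : Subgroup P) (g : M →+ M) (y : C.carrier) :
    M →+ M :=
  ∑ E ∈ (Set.toFinite {E : Subgroup P | E ≤ C.dst H K y}).toFinset,
    (DistribSMul.toAddMonoidHom M (tIn R C E K y)).comp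
      (g.comp (DistribSMul.toAddMonoidHom M (tOut R C E K y)))

theorem transport_apply (C : F.CentricBiset) {H K : Subgroup P} (hH : H ≤ S) (hK : K ≤ S)
    (g : M →+ M) (y : C.carrier) {E L : Subgroup P} {D : Subgroup (P × P)}
    (hE : E ≤ C.dst H K y) (hD : F.IsLocalGraph E L D) (n : M) :
    transport (R := R) C H K g y (beta R F E L D • n) =
      tIn R C E K y • g (tOut R C E K y • beta R F E L D • n) := by
  rw [transport, AddMonoidHom.finsetSum_apply]
  refine Finset.sum_eq_single_of_mem E (by simpa using hE) fun E' hE' hne => ?_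
  have hE' : E' ≤ C.dst H K y := by simpa using hE'
  change tIn R C E' K y • g (tOut R C E' K y • beta R F E L D • n) = 0
  rw [smul_smul (tOut R C E' K y), tOut, beta_mul_beta_of_ne (C.isLocalGraph_op y
    ((C.src_le _ _ _).trans hK) ((hE'.trans (C.dst_le _ _ _)).trans hH)) hD hne, zero_smul,
    map_zero, smul_zero]

/-- The graph of `y` sends some `k` in `K` to `d`. It intertwines conjugation with `k`, with which
`g` commutes, and conjugation with `d`. -/
theorem isInnerHom_transport (C : F.CentricBiset) {H K : Subgroup P} (hH : H ≤ S) (hK : K ≤ S)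
    {g : M →+ M} (hg : IsInnerHom R F K g) (y : C.carrier) :
    IsInnerHom R F (C.dst H K y) (transport (R := R) C H K g y) := by
  have hdS : C.dst H K y ≤ S := (C.dst_le _ _ _).trans hH
  constructor
  · intro E E' d hE hE' hd m
    have hloc : F.IsLocalGraph E E' (conjGraph d) :=
      .of_conjGraph (hE.trans hdS) (hE'.trans hdS) (hdS hd)
    have hS : ∀ E, C.src E K y ≤ S := fun E => (C.src_le _ _ _).trans hK
    obtain ⟨-, k, hk, hdk⟩ := C.mem_dst.1 hd
    have hex : ∀ {E}, E ≤ C.dst H K y → ∀ e ∈ E, ∃ j ∈ C.src E K y, (e, j) ∈ C.grp y := by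
      intro E hE e he
      obtain ⟨-, j, hj, h⟩ := C.mem_dst.1 (hE he)
      exact ⟨j, C.mem_src.2 ⟨hj, e, he, h⟩, h⟩
    have hconj : ∀ {a b}, (a, k * b * k⁻¹) ∈ C.grp y ↔ (d⁻¹ * a * d, b) ∈ C.grp y := by
      intro a b
      constructor
      · intro h
        have := mul_mem (mul_mem (inv_mem hdk) h) hdk
        convert this using 1
        exact Prod.ext rfl (by change b = k⁻¹ * (k * b * k⁻¹) * k; group)
      · intro h
        have := mul_mem (mul_mem hdk h) (inv_mem hdk)
        convert this using 1
        exact Prod.ext (by change a = d * (d⁻¹ * a * d) * d⁻¹; group) rfl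
    have e1 : tOut R C E K y * beta R F E E' (conjGraph d) =
        beta R F (C.src E K y) (C.src E' K y) (conjGraph k) * tOut R C E' K y := by
      have h1 : beta R F (C.src E K y) (C.src E' K y) (conjGraph k) * tOut R C E' K y =
          beta R F (C.src E K y) E' (mulRel E (op (C.grp y)) 1 (conjGraph d)) := by
        refine beta_mul_beta_eq (.of_conjGraph (hS _) (hS _) (hK hk))
          (C.isLocalGraph_op y (hS _) (hE'.trans hdS))
          (Or.inr fun j hj => (C.mem_src.1 hj).2) ?_
        intro j hj e' he'
        rw [mem_mulRel]
        simp only [inv_one, one_mul, mul_one]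
        constructor
        · rintro ⟨e, he, h1, h2⟩
          obtain ⟨j', hj', h3⟩ := hex hE' e' he'
          refine ⟨j', hj', ?_, h3⟩
          rw [mem_conjGraph] at h2 ⊢
          replace h1 : (e, j) ∈ C.grp y := h1
          refine (C.isGraph_grp y).right_unique h1 (hconj.2 ?_)
          convert h3 using 2
          rw [h2]
          group
        · rintro ⟨j', hj', h1, h2⟩
          rw [mem_conjGraph] at h1
          replace h2 : (e', j') ∈ C.grp y := h2
          have h3 : (d * e' * d⁻¹, j) ∈ C.grp y := by
            rw [h1]
            refine hconj.2 ?_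
            convert h2 using 2
            group
          obtain ⟨-, e, he, h4⟩ := C.mem_src.1 hj
          exact ⟨_, he, h4, (C.isGraph_grp y).left_unique h4 h3⟩
      rw [h1]
      refine beta_mul_beta_eq (C.isLocalGraph_op y (hS _) (hE.trans hdS)) hloc (Or.inl fun e he => ?_)
        ?_
      · exact hex hE e he
      · intro j _ e' _
        rw [mem_mulRel]
        simp
    have e2 : tIn R C E K y * beta R F (C.src E K y) (C.src E' K y) (conjGraph k) =
        beta R F E E' (conjGraph d) * tIn R C E' K y := by
      have h1 : tIn R C E K y * beta R F (C.src E K y) (C.src E' K y) (conjGraph k) =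
          beta R F E (C.src E' K y) (mulRel E' (conjGraph d) 1 (C.grp y)) := by
        refine beta_mul_beta_eq (C.isLocalGraph y (hE.trans hdS) (hS _))
          (.of_conjGraph (hS _) (hS _) (hK hk)) (Or.inl fun j hj => (C.mem_src.1 hj).2) ?_
        intro e he j' hj'
        rw [mem_mulRel]
        simp only [inv_one, one_mul, mul_one]
        constructor
        · rintro ⟨e', he', h1, h2⟩
          refine ⟨k * j' * k⁻¹, ?_, ?_, rfl⟩
          · refine C.mem_src.2 ⟨mul_mem (mul_mem hk (C.src_le _ _ _ hj')) (inv_mem hk), e, he, ?_⟩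
            refine hconj.2 ?_
            convert h2 using 2
            rw [mem_conjGraph.1 h1]
            group
          · refine hconj.2 ?_
            convert h2 using 2
            rw [mem_conjGraph.1 h1]
            group
        · rintro ⟨j, hj, h1, h2⟩
          rw [mem_conjGraph] at h2
          rw [h2] at h1
          obtain ⟨-, e', he', h3⟩ := C.mem_src.1 hj'
          have h4 := (C.isGraph_grp y).left_unique (hconj.1 h1) h3
          refine ⟨e', he', ?_, h3⟩
          rw [mem_conjGraph, ← h4]
          group
      rw [h1]
      refine (beta_mul_beta_eq hloc (C.isLocalGraph y (hE'.trans hdS) (hS _))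
        (Or.inr fun e' he' => hex hE' e' he') ?_).symm
      intro e _ j _
      rw [mem_mulRel]
      simp
    have h3 : transport (R := R) C H K g y m = ∑ E ∈ (Set.toFinite {E : Subgroup P |
        E ≤ C.dst H K y}).toFinset, tIn R C E K y • g (tOut R C E K y • m) := by
      rw [transport, AddMonoidHom.finsetSum_apply]
      rfl
    rw [transport_apply C hH hK g y hE hloc, smul_smul (tOut R C E K y), e1, mul_smul,
      hg.comm (C.src_le _ _ _) (C.src_le _ _ _) hk, smul_smul, e2, mul_smul, h3, Finset.smul_sum]
    have hmem : E' ∈ (Set.toFinite {E : Subgroup P | E ≤ C.dst H K y}).toFinset := by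
      simpa using hE'
    symm
    refine Finset.sum_eq_single_of_mem E' hmem fun E'' hE'' hne => ?_
    have hE'' : E'' ≤ C.dst H K y := by simpa using hE''
    rw [smul_smul, tIn, beta_mul_beta_of_ne hloc
      (C.isLocalGraph y (hE''.trans hdS) (hS _)) (Ne.symm hne), zero_smul]
  · intro r m
    rw [transport, AddMonoidHom.finsetSum_apply, AddMonoidHom.finsetSum_apply, Finset.smul_sum]
    refine Finset.sum_congr rfl fun E _ => ?_
    change tIn R C E K y • g (tOut R C E K y • _ • m) = _ • tIn R C E K y • g (tOut R C E K y • m)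
    rw [smul_smul (tOut R C E K y), ← Algebra.commutes, mul_smul, hg.smul, smul_smul, smul_smul,
      Algebra.commutes]

theorem isInnerHom_comp_transport (C : F.CentricBiset) {H K : Subgroup P} (hH : H ≤ S) (hK : K ≤ S)
    {f g : M →+ M} (hf : IsInnerHom R F H f) (hg : IsInnerHom R F K g) (y : C.carrier) :
    IsInnerHom R F (C.dst H K y) (f.comp (transport (R := R) C H K g y)) := by
  have h := isInnerHom_transport C hH hK hg y (H := H)
  have hd := C.dst_le H K y
  constructor
  · intro E E' d hE hE' hd' m
    rw [AddMonoidHom.comp_apply, h.comm hE hE' hd', hf.comm (hE.trans hd) (hE'.trans hd) (hd hd')]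
    rfl
  · intro r m
    rw [AddMonoidHom.comp_apply, h.smul, hf.smul]
    rfl

/-- Both sides concern the same subgroup of `K`: the iterated source for `x` and `h y` equals the
one for `h⁻¹` applied on the right of `x` and `y`. After this identification (`hsrc`) the
conjugation with `h` is moved through `f` from one side to the other. -/
theorem pairTerm_mul (C : F.CentricBiset) {H K : Subgroup P} (hH : H ≤ S) (hK : K ≤ S)
    {f g : M →+ M} (hf : IsInnerHom R F H f) {L : Subgroup P} (hL : L ≤ S) (x y : C.carrier) (m : M)
    {h : P} (hh : h ∈ H) :
    tIn R C L H x • f (pairTerm C (smulPairing R F M) g (C.src L H x) K (tOut R C L H x • m)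
      (C.move (hH hh) (one_mem S) y)) =
    pairTerm C (smulPairing R F M) (f.comp (transport (R := R) C H K g y)) L (C.dst H K y) m
      (C.move (one_mem S) (hH (inv_mem hh)) x) := by
  set w := C.move (hH hh) (one_mem S) y with hw
  set v := C.move (one_mem S) (hH (inv_mem hh)) x with hv
  have hwm : ∀ {a b}, (a, b) ∈ C.grp w ↔ (h⁻¹ * a * h, b) ∈ C.grp y := by
    intro a b
    rw [hw, C.mem_grp_move]
    simp
  have hvm : ∀ {a b}, (a, b) ∈ C.grp v ↔ (a, h * b * h⁻¹) ∈ C.grp x := by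
    intro a b
    rw [hv, C.mem_grp_move]
    simp
  have hEx : C.src L H x ≤ H := C.src_le _ _ _
  have hEv : C.src L (C.dst H K y) v ≤ C.dst H K y := C.src_le _ _ _
  have hEvH : C.src L (C.dst H K y) v ≤ H := hEv.trans (C.dst_le _ _ _)
  have hEwS : C.src (C.src L H x) K w ≤ S := (C.src_le _ _ _).trans hK
  have hmemv : ∀ {d}, d ∈ C.src L (C.dst H K y) v ↔ d ∈ C.dst H K y ∧ h * d * h⁻¹ ∈ C.src L H x := by
    intro d
    rw [C.mem_src, C.mem_src]
    refine and_congr_right fun hd => ?_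
    simp only [hvm]
    exact (and_iff_right (mul_mem (mul_mem hh (C.dst_le _ _ _ hd)) (inv_mem hh))).symm
  have hsrc : C.src (C.src L H x) K w = C.src (C.src L (C.dst H K y) v) K y := by
    ext k
    rw [C.mem_src, C.mem_src]
    refine and_congr_right fun hk => ⟨?_, ?_⟩
    · rintro ⟨e, he, h1⟩
      rw [hwm] at h1
      refine ⟨_, hmemv.2 ⟨C.mem_dst.2 ⟨mul_mem (mul_mem (inv_mem hh) (hEx he)) hh, k, hk, h1⟩, ?_⟩,
        h1⟩
      convert he using 1
      group
    · rintro ⟨d, hd, h1⟩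
      refine ⟨_, (hmemv.1 hd).2, hwm.2 ?_⟩
      convert h1 using 2
      group
  have hex : ∀ d ∈ C.src L (C.dst H K y) v,
      ∃ k ∈ C.src (C.src L (C.dst H K y) v) K y, (d, k) ∈ C.grp y := by
    intro d hd
    obtain ⟨-, k, hk, h1⟩ := C.mem_dst.1 (hEv hd)
    exact ⟨k, C.mem_src.2 ⟨hk, d, hd, h1⟩, h1⟩
  have e1 : tIn R C (C.src L H x) K w = beta R F (C.src L H x) (C.src L (C.dst H K y) v)
      (conjGraph h) * tIn R C (C.src L (C.dst H K y) v) K y := by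
    rw [tIn, tIn, hsrc]
    rw [hsrc] at hEwS
    refine (beta_mul_beta_eq (.of_conjGraph (hEx.trans hH) (hEvH.trans hH) (hH hh))
      (C.isLocalGraph y (hEvH.trans hH) hEwS) (Or.inr hex) ?_).symm
    intro e he k hk
    rw [hwm]
    constructor
    · intro h1
      refine ⟨_, hmemv.2 ⟨C.mem_dst.2 ⟨mul_mem (mul_mem (inv_mem hh) (hEx he)) hh, k,
        C.src_le _ _ _ hk, h1⟩, ?_⟩, ?_, h1⟩
      · convert he using 1
        group
      · rw [mem_conjGraph]
        group
    · rintro ⟨d, -, h1, h2⟩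
      rw [mem_conjGraph.1 h1]
      convert h2 using 2
      group
  have e2 : tOut R C (C.src L H x) K w = tOut R C (C.src L (C.dst H K y) v) K y *
      beta R F (C.src L (C.dst H K y) v) (C.src L H x) (conjGraph h⁻¹) := by
    rw [tOut, tOut, hsrc]
    rw [hsrc] at hEwS
    refine (beta_mul_beta_eq (C.isLocalGraph_op y hEwS (hEvH.trans hH))
      (.of_conjGraph (hEvH.trans hH) (hEx.trans hH) (hH (inv_mem hh))) (Or.inl hex) ?_).symm
    intro k hk e he
    rw [mem_op, hwm]
    constructor
    · intro h1
      refine ⟨_, hmemv.2 ⟨C.mem_dst.2 ⟨mul_mem (mul_mem (inv_mem hh) (hEx he)) hh, k,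
        C.src_le _ _ _ hk, h1⟩, ?_⟩, h1, ?_⟩
      · convert he using 1
        group
      · rw [mem_conjGraph]
        group
    · rintro ⟨d, -, h1, h2⟩
      rw [mem_conjGraph, inv_inv] at h2
      rwa [← h2]
  have e3 : tIn R C L H x * beta R F (C.src L H x) (C.src L (C.dst H K y) v) (conjGraph h) =
      tIn R C L (C.dst H K y) v :=
    beta_mul_conj (C.isLocalGraph x hL (hEx.trans hH)) (fun e he => (C.mem_src.1 he).2) (hH hh)
      (hEvH.trans hH) (fun e he => (hmemv.1 he).2) fun _ _ _ _ => hvm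
  have e4 : beta R F (C.src L (C.dst H K y) v) (C.src L H x) (conjGraph h⁻¹) * tOut R C L H x =
      tOut R C L (C.dst H K y) v := by
    refine conj_mul_beta (C.isLocalGraph_op x (hEx.trans hH) hL)
      (fun e he => (C.mem_src.1 he).2) (hH (inv_mem hh)) (hEvH.trans hH) ?_ ?_
    · intro e he
      simpa using (hmemv.1 he).2
    · intro e _ k _
      rw [mem_op, mem_op, hvm, inv_inv]
  change tIn R C L H x • f (tIn R C (C.src L H x) K w • g (tOut R C (C.src L H x) K w •
    tOut R C L H x • m)) = tIn R C L (C.dst H K y) v •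
      f (transport (R := R) C H K g y (tOut R C L (C.dst H K y) v • m))
  have h5 : transport (R := R) C H K g y (tOut R C L (C.dst H K y) v • m) =
      tIn R C (C.src L (C.dst H K y) v) K y • g (tOut R C (C.src L (C.dst H K y) v) K y •
        tOut R C L (C.dst H K y) v • m) :=
    transport_apply C hH hK g y hEv (C.isLocalGraph_op v (hEvH.trans hH) hL) m
  rw [h5, e1, mul_smul, hf.comm hEx hEvH hh, smul_smul, e3, e2, mul_smul,
    smul_smul (beta R F _ _ _), e4]

/-- The Mackey formula for relative traces. -/
theorem relTrace_comp_relTrace (C : F.CentricBiset) (hM : IsSupportedOnCentric R F M)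
    {H K : Subgroup P} (hH : H ≤ S) (hK : K ≤ S) {f g : M →+ M} (hf : IsInnerHom R F H f)
    (hg : IsInnerHom R F K g) : relTrace C hM hH hf ∘ₗ relTrace C hM hK hg =
      orbSum (C.rel H K) fun y =>
        relTrace C hM ((C.dst_le H K y).trans hH) (isInnerHom_comp_transport C hH hK hf hg y) := by
  refine LinearMap.ext fun m => ?_
  have hev : ∀ (τ : C.carrier → (M →ₗ[MackeyAlgebra R F] M)) (r : Setoid C.carrier),
      orbSum r τ m = orbSum r fun y => τ y m := fun τ r => LinearMap.sum_apply _ _ _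
  rw [hev, LinearMap.comp_apply]
  change pairSum C (smulPairing R F M) f H (relTrace C hM hK hg m) = orbSum (C.rel H K) fun y =>
    pairSum C (smulPairing R F M) (f.comp (transport (R := R) C H K g y)) (C.dst H K y) m
  simp only [pairSum]
  rw [orbSum_finsetSum]
  refine Finset.sum_congr rfl fun L hL => ?_
  replace hL : L ≤ S := by simpa using hL
  -- For fixed `x` the orbits of `src L H x` and `K` are grouped by the `H × K`-orbits of points
  -- `y`; inside the orbit of `y` they are represented by the points `h y` with `h` in `H`.
  have h1 : ∀ x, pairTerm C (smulPairing R F M) f L H (relTrace C hM hK hg m) x =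
      orbSum (C.rel H K) fun y => orbSum ((C.rel (C.src L H x) K).comap
        fun h : H => C.move (hH h.2) (one_mem S) y) fun h : H =>
          pairTerm C (smulPairing R F M) (f.comp (transport (R := R) C H K g y)) L (C.dst H K y) m
            (C.move (one_mem S) (hH (inv_mem h.2)) x) := by
    intro x
    have hE := (C.src_le L H x).trans hH
    have h2 : tOut R C L H x • relTrace C hM hK hg m =
        pairComp C (smulPairing R F M) g (C.src L H x) K (tOut R C L H x • m) := by
      rw [← map_smul]
      exact pairSum_beta_smul hK (C.isLocalGraph_op x hE hL) m
    have h3 : pairComp C (smulPairing R F M) g (C.src L H x) K (tOut R C L H x • m) =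
        orbSum (C.rel H K) fun y => orbSum ((C.rel (C.src L H x) K).comap
          fun h : H => C.move (hH h.2) (one_mem S) y) fun h : H =>
            pairTerm C (smulPairing R F M) g (C.src L H x) K (tOut R C L H x • m)
              (C.move (hH h.2) (one_mem S) y) := by
      refine orbSum_fiber (Z := fun _ => H)
        (fun _ _ h => pairTerm_rel (isBalanced_smulPairing K) hg hK hE _ h) _
        (fun y h => C.move (hH h.2) (one_mem S) y) (fun y => y) ?_ ?_ (fun _ _ _ => Iff.rfl) ?_
      · rintro y y' ⟨e, he, k, hk, h⟩
        exact ⟨e, C.src_le _ _ _ he, k, hk, h⟩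
      · intro y h
        refine ⟨(h : P)⁻¹, inv_mem h.2, 1, one_mem K, ?_⟩
        change ((h : P)⁻¹, (1 : P)) • ((h : P), (1 : P)) • y.1 = y.1
        rw [smul_smul]
        simp [← Prod.one_eq_mk]
      · rintro y y' ⟨h, hh, k, hk, e⟩
        refine ⟨⟨h⁻¹, inv_mem hh⟩, 1, one_mem _, k⁻¹, inv_mem hk, ?_⟩
        change (1, k⁻¹) • (h⁻¹, (1 : P)) • y.1 = y'.1
        rw [← e, smul_smul, smul_smul]
        simp [← Prod.one_eq_mk]
    rw [pairTerm, h2, h3]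
    have h4 := map_orbSum (C.rel H K) (fun y => orbSum ((C.rel (C.src L H x) K).comap
          fun h : H => C.move (hH h.2) (one_mem S) y) fun h : H =>
            pairTerm C (smulPairing R F M) g (C.src L H x) K (tOut R C L H x • m)
              (C.move (hH h.2) (one_mem S) y)) ((smulPairing R F M (tIn R C L H x)).comp f)
    refine h4.trans (orbSum_congr fun y => ?_)
    refine (map_orbSum _ _ ((smulPairing R F M (tIn R C L H x)).comp f)).trans
      (orbSum_congr fun h => ?_)
    exact pairTerm_mul C hH hK hf hL x y m h.2
  rw [pairComp, orbSum_congr h1, orbSum_comm]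
  refine orbSum_congr fun y => ?_
  -- With the order of summation exchanged, `y` is fixed, and the pairs `(x, h)` enumerate the
  -- orbits of `L × dst H K y` through the points obtained from `x` by `h⁻¹` on the right.
  have hdS := (C.dst_le H K y).trans hH
  refine (orbSum_fiber (Z := fun _ => H) (fun _ _ h => pairTerm_rel (isBalanced_smulPairing _)
    (isInnerHom_comp_transport C hH hK hf hg y) hdS hL _ h) _
    (fun x h => C.move (one_mem S) (hH (inv_mem h.2)) x) (fun x => x) ?_ ?_ ?_ ?_).symm
  · rintro x x' ⟨l, hl, d, hd, e⟩
    exact ⟨l, hl, d, C.dst_le _ _ _ hd, e⟩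
  · intro x h
    refine ⟨1, one_mem L, h, h.2, ?_⟩
    change ((1 : P), (h : P)) • ((1 : P), (h : P)⁻¹) • x.1 = x.1
    rw [smul_smul]
    simp [← Prod.one_eq_mk]
  · intro x h h'
    constructor
    · rintro ⟨e, he, k, hk, h1⟩
      obtain ⟨heH, l, hl, hle⟩ := C.mem_src.1 he
      replace h1 : (e, k) • ((h : P), (1 : P)) • y.1 = ((h' : P), (1 : P)) • y.1 := h1
      have h2 : ((h' : P)⁻¹ * e * h, k) ∈ C.grp y := by
        have := congrArg (((h' : P)⁻¹, (1 : P)) • ·) h1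
        simpa [smul_smul, C.mem_grp, mul_assoc, ← Prod.one_eq_mk] using this
      refine ⟨l, hl, _, C.mem_dst.2 ⟨mul_mem (mul_mem (inv_mem h'.2) heH) h.2, k, hk, h2⟩, ?_⟩
      change (l, (h' : P)⁻¹ * e * h) • ((1 : P), (h : P)⁻¹) • x.1 = ((1 : P), (h' : P)⁻¹) • x.1
      have h3 : (l, e) • x.1 = x.1 := hle
      conv_rhs => rw [← h3]
      rw [smul_smul, smul_smul]
      simp
    · rintro ⟨l, hl, d, hd, h1⟩
      obtain ⟨hdH, k, hk, hdk⟩ := C.mem_dst.1 hd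
      replace h1 : (l, d) • ((1 : P), (h : P)⁻¹) • x.1 = ((1 : P), (h' : P)⁻¹) • x.1 := h1
      have h2 : (l, h' * d * (h : P)⁻¹) ∈ C.grp x := by
        have := congrArg (((1 : P), (h' : P)) • ·) h1
        simpa [smul_smul, C.mem_grp, mul_assoc, ← Prod.one_eq_mk] using this
      refine ⟨_, C.mem_src.2 ⟨mul_mem (mul_mem h'.2 hdH) (inv_mem h.2), l, hl, h2⟩, k, hk, ?_⟩
      change (h' * d * (h : P)⁻¹, k) • ((h : P), (1 : P)) • y.1 = ((h' : P), (1 : P)) • y.1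
      have h3 : (d, k) • y.1 = y.1 := hdk
      conv_rhs => rw [← h3]
      rw [smul_smul, smul_smul]
      simp
  · rintro x x' ⟨l, hl, h, hh, e⟩
    refine ⟨⟨h, hh⟩, l⁻¹, inv_mem hl, 1, one_mem _, ?_⟩
    change (l⁻¹, (1 : P)) • ((1 : P), h⁻¹) • x.1 = x'.1
    rw [← e, smul_smul, smul_smul]
    simp [← Prod.one_eq_mk]

theorem relTrace_eq_zero (C : F.CentricBiset) (hM : IsSupportedOnCentric R F M) {H : Subgroup P}
    (hH : H ≤ S) {f : M →+ M} (hf : IsInnerHom R F H f)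
    (h : ∀ E ≤ H, ∀ m : M, beta R F E E (conjGraph 1) • m = 0) :
    relTrace C hM hH hf = 0 := by
  refine LinearMap.ext fun m => Finset.sum_eq_zero fun K hK => pairComp_zero_of_forall fun x => ?_
  rw [pairTerm, tOut, ← one_mul_beta (C.isLocalGraph_op x ((C.src_le _ _ _).trans hH)
    (by simpa using hK)), mul_smul, h _ (C.src_le _ _ _), map_zero, map_zero]

/-- The identity, composed with itself, is a sum of products of a trace from `X` and a trace from
`Y`. The Mackey formula turns these into traces from subgroups `dst H K y`, which are contained in
`H` and `F`-isomorphic to subgroups of `K`. When centric they belong to both closed families;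
otherwise their traces vanish on a centric functor. -/
theorem isRelProjective_inter (C : F.CentricBiset) (hM : IsSupportedOnCentric R F M)
    {X Y : Set F.Centric} (hX : IsSubconjClosed F X) (hY : IsSubconjClosed F Y)
    (h : IsRelProjective R F M X) (h' : IsRelProjective R F M Y) :
    IsRelProjective R F M (X ∩ Y) := by
  rw [isRelProjective_iff] at h h' ⊢
  have key : ∀ φ ∈ ⨆ H : X, traces R F M H.1, ∀ ψ ∈ ⨆ H : Y, traces R F M H.1,
      φ ∘ₗ ψ ∈ ⨆ H : (X ∩ Y : Set F.Centric), traces R F M H.1 := by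
    intro φ hφ ψ hψ
    induction hφ using AddSubgroup.iSup_induction' with
    | h1 => rw [LinearMap.zero_comp]; exact zero_mem _
    | hadd φ φ' _ _ h h' => rw [LinearMap.add_comp]; exact add_mem h h'
    | hp H φ hφ =>
      induction hψ using AddSubgroup.iSup_induction' with
      | h1 => rw [LinearMap.comp_zero]; exact zero_mem _
      | hadd ψ ψ' _ _ h h' => rw [LinearMap.comp_add]; exact add_mem h h'
      | hp K ψ hψ =>
        obtain ⟨u, rfl⟩ := hφ
        obtain ⟨v, rfl⟩ := hψ
        obtain ⟨f, hf, hu⟩ := exists_relTrace_eq C hM H.1 hM u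
        obtain ⟨g, hg, hv⟩ := exists_relTrace_eq C hM K.1 hM v
        change (theta R F M H.1 ∘ₗ u) ∘ₗ (theta R F M K.1 ∘ₗ v) ∈ _
        rw [hu, hv, relTrace_comp_relTrace C hM H.1.2.1 K.1.2.1 hf hg]
        refine orbSum_mem _ _ _ fun y => ?_
        by_cases hc : F.IsCentric (C.dst H.1.1 K.1.1 y)
        · have h1 : (⟨_, hc⟩ : F.Centric) ∈ X := hX ⟨_, hc⟩ H.1 H.2
            ⟨_, C.dst_le _ _ _, isConj_refl F hc.1⟩
          have h2 : (⟨_, hc⟩ : F.Centric) ∈ Y := hY ⟨_, hc⟩ K.1 K.2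
            ⟨_, C.src_le _ _ _, C.isConj_dst_src _ _ _⟩
          exact AddSubgroup.mem_iSup_of_mem (⟨⟨_, hc⟩, h1, h2⟩ : (X ∩ Y : Set F.Centric))
            (relTrace_mem_traces C hM (H := ⟨_, hc⟩) _)
        · rw [relTrace_eq_zero C hM _ _ fun E hE => hM E
            (hE.trans ((C.dst_le _ _ _).trans H.1.2.1))
            fun h => hc (h.of_le hE ((C.dst_le _ _ _).trans H.1.2.1))]
          exact zero_mem _
  have := key _ h _ h'
  rwa [LinearMap.comp_id] at this

end MackeyAlgebra

/-! ### Counting the points that are defined on a given subgroup -/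

namespace FusionSystem.CentricBiset

open GroupRel

variable {P : Type u} [Group P] [Finite P] {S : Subgroup P} {F : FusionSystem S}
  (C : F.CentricBiset)

/-- The graph of `x` is defined on the whole of `D`. -/
def IsFull (D : Subgroup P) (x : C.carrier) : Prop := ∀ d ∈ D, ∃ s ∈ S, (d, s) ∈ C.grp x

theorem IsFull.of_rel {D : Subgroup P} {x y : C.carrier} (h : C.IsFull D x) (hxy : C.rel D S x y) :
    C.IsFull D y := by
  obtain ⟨k, hk, t, ht, e⟩ := hxy
  intro d hd
  obtain ⟨s, hs, h1⟩ := h (k⁻¹ * d * k) (mul_mem (mul_mem (inv_mem hk) hd) hk)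
  refine ⟨t * s * t⁻¹, mul_mem (mul_mem ht hs) (inv_mem ht), (C.mem_grp_of_smul e).2 ?_⟩
  convert h1 using 2
  group

theorem rel_mono {D D' H : Subgroup P} (h : D ≤ D') {x y : C.carrier} (hxy : C.rel D H x y) :
    C.rel D' H x y := by
  obtain ⟨k, hk, t, ht, e⟩ := hxy
  exact ⟨k, h hk, t, ht, e⟩

/-- When `(k, s)` fixes the point, the left action of `k` equals the right action of `s⁻¹`. So a `D
× S`-orbit of full points is a single right orbit. -/
theorem IsFull.rel_bot {D : Subgroup P} {x y : C.carrier} (h : C.IsFull D x)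
    (hxy : C.rel D S x y) : C.rel ⊥ S x y := by
  obtain ⟨k, hk, t, ht, e⟩ := hxy
  obtain ⟨s, hs, h1⟩ := h k hk
  refine ⟨1, one_mem _, t * s⁻¹, mul_mem ht (inv_mem hs), ?_⟩
  have h2 : (k, s) • x.1 = x.1 := h1
  conv_lhs => rw [← h2]
  rw [smul_smul, ← e]
  simp

/-- The left action on the right orbits. -/
@[reducible] def leftAction {D : Subgroup P} (hD : D ≤ S) : MulAction D (Quotient (C.rel ⊥ S)) where
  smul d := Quotient.map (C.move (hD d.2) (one_mem S)) (by
    rintro x y ⟨k, hk, t, ht, e⟩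
    obtain rfl := Subgroup.mem_bot.1 hk
    refine ⟨1, one_mem _, t, ht, ?_⟩
    change ((1 : P), t) • ((d : P), (1 : P)) • x.1 = ((d : P), (1 : P)) • y.1
    rw [← e, smul_smul, smul_smul]
    simp)
  one_smul := by
    rintro ⟨x⟩
    exact congrArg (Quotient.mk _) (Subtype.ext (one_smul (P × P) x.1))
  mul_smul := by
    rintro d d' ⟨x⟩
    refine congrArg (Quotient.mk _) (Subtype.ext ?_)
    change ((d * d' : P), (1 : P)) • x.1 = ((d : P), (1 : P)) • ((d' : P), (1 : P)) • x.1
    rw [smul_smul]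
    simp

/-- The number of right orbits that are fixed by `D`. -/
noncomputable def numFull (D : Subgroup P) : ℕ :=
  Nat.card {q : Quotient (C.rel ⊥ S) // C.IsFull D q.out}

/-- The `p`-group `D` acts on the right orbits of `S`, and the orbits it fixes are those of the
points that are full on `D`. The total number of right orbits does not involve `D`, so all `numFull
D` are congruent modulo `p`. -/
theorem numFull_modEq {p : ℕ} [Fact p.Prime] {D : Subgroup P} (hS : IsPGroup p S) (hD : D ≤ S) :
    Nat.card (Quotient (C.rel ⊥ S)) ≡ C.numFull D [MOD p] := by
  let _ := C.leftAction hD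
  have h := (hS.to_le hD).card_modEq_card_fixedPoints (Quotient (C.rel ⊥ S))
  convert h using 1
  refine Nat.card_congr (Equiv.subtypeEquivRight fun q => ?_)
  rw [MulAction.mem_fixedPoints]
  have hq : ∀ d : D, d • q = Quotient.mk _ (C.move (hD d.2) (one_mem S) q.out) := by
    intro d
    conv_lhs => rw [← Quotient.out_eq q]
    rfl
  have hmul : ∀ (d : D) (t : P), ((1 : P), t) • ((d : P), (1 : P)) • q.out.1 =
      ((d : P), t) • q.out.1 := by
    intro d t
    rw [smul_smul]
    simp
  constructor
  · intro h d
    obtain ⟨t, ht, h1⟩ := h d d.2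
    rw [hq]
    refine Eq.trans (Quotient.sound ⟨1, one_mem _, t, ht, ?_⟩) (Quotient.out_eq q)
    exact (hmul d t).trans h1
  · intro h d hd
    obtain ⟨k, hk, t, ht, h1⟩ := Quotient.exact
      ((hq ⟨d, hd⟩).symm.trans ((h ⟨d, hd⟩).trans (Quotient.out_eq q).symm))
    obtain rfl := Subgroup.mem_bot.1 hk
    exact ⟨t, ht, (hmul ⟨d, hd⟩ t).symm.trans h1⟩

/-- The number of right orbits fixed by `S` is the order of the group of outer automorphisms. -/
theorem numFull_top (C : F.CentricBiset) : C.numFull S =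
    ((MulAut.conj : S →* MulAut S).range.subgroupOf F.autTop).index := by
  have hα : ∀ q : {q : Quotient (C.rel ⊥ S) // C.IsFull S q.out},
      ∃ α : F.autTop, ∀ s : S, (((α : MulAut S) s : P), (s : P)) ∈ C.grp q.1.out := by
    intro q
    have hran : ran (C.grp q.1.out) = S := le_antisymm (C.isGraph_grp _).ran_le fun s hs => by
      obtain ⟨t, -, h⟩ := q.2 s hs
      exact mem_ran_of h
    have hdom : dom (C.grp q.1.out) = S := by
      refine Subgroup.eq_of_le_of_card_ge (C.isGraph_grp _).dom_le ?_
      rw [(C.isGraph_grp q.1.out).isConj.card_eq, hran]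
    obtain ⟨e, he, h⟩ := (C.isGraph_grp _).exists_mulEquiv hdom hran
    exact ⟨⟨e, he⟩, h⟩
  choose α hα using hα
  refine Nat.card_congr (Equiv.ofBijective (fun q => (α q : F.autTop ⧸ _)) ⟨?_, ?_⟩)
  · intro q q' h
    obtain ⟨t, ht⟩ := Subgroup.mem_subgroupOf.1 (QuotientGroup.eq.1 h)
    have h1 : ∀ s, (α q' : MulAut S) s = (α q : MulAut S) (t * s * t⁻¹) := by
      intro s
      have h2 : (α q' : MulAut S) = (α q : MulAut S) * MulAut.conj t := by
        rw [ht]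
        simp
      rw [h2]
      rfl
    -- The shift by `t` brings the point over `q` to one whose graph contains that of the point over
    -- `q'`. Uniqueness supplies a left factor `z`, and this factor becomes a right one because some
    -- `(z, b)` fixes `x`.
    set x := C.move (one_mem S) (inv_mem t.2) q.1.out with hx
    have hle : C.grp q'.1.out ≤ C.grp x := by
      rintro ⟨a, b⟩ hab
      have hb : b ∈ S := (C.isGraph_grp _).mem_right hab
      have ha : a = (α q' : MulAut S) ⟨b, hb⟩ := (C.isGraph_grp _).left_unique hab (hα q' ⟨b, hb⟩)
      rw [hx, C.mem_grp_move, ha, h1]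
      convert hα q (t * ⟨b, hb⟩ * t⁻¹) using 2 <;> simp
    have hdom : dom (C.grp q'.1.out) = S :=
      le_antisymm (C.isGraph_grp _).dom_le fun s hs => mem_dom_of (hα q' ⟨s, hs⟩)
    have hc : F.IsCentricGraph (C.grp q'.1.out) := ⟨C.isGraph_grp _, hdom.symm ▸ F.isCentric_top⟩
    obtain ⟨z, hz, -, e⟩ := C.exists_smul hc x.2 q'.1.out.2 hle le_rfl
    obtain ⟨b, hzb⟩ := mem_ran.1 hz
    have hb : b ∈ S := (C.isGraph_grp _).mem_right hzb
    have hzx : (z, b) • x.1 = x.1 := hle hzb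
    refine Subtype.ext ?_
    rw [← Quotient.out_eq q.1, ← Quotient.out_eq q'.1]
    refine Quotient.sound ⟨1, one_mem _, b⁻¹ * (t : P)⁻¹,
      mul_mem (inv_mem hb) (inv_mem t.2), ?_⟩
    have h3 : x.1 = ((1 : P), (t : P)⁻¹) • q.1.out.1 := rfl
    have h4 : ((1 : P), b⁻¹) • x.1 = (z, (1 : P)) • x.1 := by
      conv_lhs => rw [← hzx]
      rw [smul_smul]
      simp
    rw [e, ← h4, h3, smul_smul]
    simp
  · intro c
    obtain ⟨a, rfl⟩ := QuotientGroup.mk_surjective c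
    have hg := F.isGraph_of_hom (φ := (a : MulAut S).toMonoidHom) a.2
    have hmem : ∀ s : S, (((a : MulAut S) s : P), (s : P)) ∈
        BisetMatrix.twistedDiagonal (a : MulAut S).toMonoidHom :=
      fun s => mem_twistedDiagonal.2 ⟨s.2, rfl⟩
    have hdom : dom (BisetMatrix.twistedDiagonal (a : MulAut S).toMonoidHom) = S :=
      le_antisymm hg.dom_le fun s hs => mem_dom_of (hmem ⟨s, hs⟩)
    obtain ⟨x, hx, hle⟩ := C.exists_le (D := BisetMatrix.twistedDiagonal
      (a : MulAut S).toMonoidHom) ⟨hg, hdom.symm ▸ F.isCentric_top⟩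
    have hr : C.rel ⊥ S ⟨x, hx⟩ (Quotient.mk (C.rel ⊥ S) ⟨x, hx⟩).out :=
      (C.rel ⊥ S).symm (Quotient.mk_out _)
    have hf : C.IsFull S ⟨x, hx⟩ := by
      intro d hd
      refine ⟨(a : MulAut S).symm ⟨d, hd⟩, SetLike.coe_mem _, ?_⟩
      have := hle (hmem ((a : MulAut S).symm ⟨d, hd⟩))
      rwa [MulEquiv.apply_symm_apply] at this
    refine ⟨⟨Quotient.mk _ ⟨x, hx⟩, hf.of_rel C (C.rel_mono bot_le hr)⟩, ?_⟩
    refine QuotientGroup.eq.2 (Subgroup.mem_subgroupOf.2 ?_)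
    obtain ⟨k, hk, t, ht, e⟩ := hr
    obtain rfl := Subgroup.mem_bot.1 hk
    refine ⟨⟨t, ht⟩, MulEquiv.ext fun s => ?_⟩
    set q : {q : Quotient (C.rel ⊥ S) // C.IsFull S q.out} := ⟨Quotient.mk _ ⟨x, hx⟩, _⟩
    change _ = (α q : MulAut S).symm ((a : MulAut S) s)
    rw [MulEquiv.eq_symm_apply]
    refine Subtype.ext ((C.isGraph_grp q.1.out).left_unique (hα q _) ((C.mem_grp_of_smul e).2 ?_))
    convert hle (hmem s) using 2
    · rfl
    · group
    · rw [MulAut.conj_apply]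
      change t⁻¹ * (t * s * t⁻¹) * t = s
      group

/-- For `D = S` the number is the index of a Sylow `p`-subgroup of `Aut_F(S)`, by saturation; the
general case follows from the congruence. -/
theorem not_dvd_numFull {p : ℕ} [Fact p.Prime] {D : Subgroup P} (hS : IsPGroup p S)
    (hF : F.IsSaturated p) (hD : D ≤ S) : ¬ p ∣ C.numFull D := by
  obtain ⟨Q, hQ⟩ := hF.sylow
  have h : ¬ p ∣ C.numFull S := by
    rw [C.numFull_top, ← hQ]
    exact Q.not_dvd_index
  rwa [((C.numFull_modEq hS hD).symm.trans (C.numFull_modEq hS le_rfl)).dvd_iff dvd_rfl]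

open Classical in
theorem orbSum_isFull (D : Subgroup P) :
    orbSum (C.rel D S) (fun x => if C.IsFull D x then 1 else 0) = C.numFull D := by
  have h1 : orbSum (C.rel D S) (fun x => if C.IsFull D x then 1 else 0) =
      orbSum (C.rel ⊥ S) (fun x => if C.IsFull D x then 1 else 0) := by
    have hinv : ∀ x y, C.rel D S x y →
        (if C.IsFull D x then 1 else 0) = if C.IsFull D y then 1 else 0 := fun x y h => by
      have : C.IsFull D x ↔ C.IsFull D y :=
        ⟨fun h' => h'.of_rel C h, fun h' => h'.of_rel C ((C.rel D S).symm h)⟩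
      simp only [this]
    refine orbSum_eq_of_corr hinv (fun x y h => hinv x y (C.rel_mono bot_le h))
      (fun x y => x = y ∧ C.IsFull D x) ?_ ?_ ?_ ?_
    · intro x hx
      exact ⟨x, rfl, by_contra fun h => hx (if_neg h)⟩
    · intro x hx
      exact ⟨x, rfl, by_contra fun h => hx (if_neg h)⟩
    · rintro x _ ⟨rfl, -⟩
      rfl
    · rintro x _ x' _ ⟨rfl, h⟩ ⟨rfl, -⟩
      exact ⟨h.rel_bot C, C.rel_mono bot_le⟩
  rw [h1, orbSum, numFull]
  let _ := Fintype.ofFinite (Quotient (C.rel ⊥ S))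
  rw [Nat.card_eq_fintype_card, Fintype.card_subtype, Finset.card_filter]

end FusionSystem.CentricBiset

theorem IsPLocal.isUnit_natCast {p : ℕ} {R : Type w} [CommRing R] (hR : IsPLocal p R) {c : ℕ}
    (hc : ¬ p ∣ c) : IsUnit (c : R) := by
  induction c using induction_on_primes with
  | zero => exact absurd (dvd_zero p) hc
  | one => simp
  | prime_mul q a hq ih =>
    rw [Nat.cast_mul]
    exact (hR q hq fun h => hc (h ▸ dvd_mul_right q a)).mul (ih fun h => hc (h.mul_left q))

/-! ### Every centric functor is projective relative to `S` -/

namespace MackeyAlgebra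

open BisetSemiring GroupRel FusionSystem

variable {P : Type u} [Group P] [Finite P] {S T : Subgroup P}
  {R : Type w} [CommRing R] {F : FusionSystem S}
  {M : Type v} [AddCommGroup M] [Module (MackeyAlgebra R F) M]

/-- The two transports cancel and leave the restriction to `dst` followed by induction. -/
theorem tIn_mul_tOut (C : F.CentricBiset) {D H : Subgroup P} (hD : D ≤ S) (hH : H ≤ S)
    (x : C.carrier) : tIn R C D H x * tOut R C D H x =
      beta R F D (C.dst D H x) (conjGraph 1) * beta R F (C.dst D H x) D (conjGraph 1) := by
  have hE := (C.src_le D H x).trans hH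
  have hle := C.dst_le D H x
  have h1 : beta R F D (C.dst D H x) (conjGraph 1) * beta R F (C.dst D H x) D (conjGraph 1) =
      beta R F D D (conjGraph 1 ⊓ (C.dst D H x).prod ⊤) := by
    refine beta_mul_beta_eq (.of_conjGraph hD (hle.trans hD) (one_mem S))
      (.of_conjGraph (hle.trans hD) hD (one_mem S))
      (Or.inl fun l hl => ⟨l, hle hl, by simp [mem_conjGraph]⟩) ?_
    intro k _ j _
    rw [Subgroup.mem_inf, Subgroup.mem_prod]
    simp only [mem_conjGraph, one_mul, inv_one, mul_one, Subgroup.mem_top, and_true]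
    constructor
    · rintro ⟨rfl, h⟩
      exact ⟨k, h, rfl, rfl⟩
    · rintro ⟨l, h, rfl, rfl⟩
      exact ⟨rfl, h⟩
  rw [h1]
  refine beta_mul_beta_eq (C.isLocalGraph x hD hE) (C.isLocalGraph_op x hE hD)
    (Or.inl fun l hl => (C.mem_src.1 hl).2) ?_
  intro k hk j _
  rw [Subgroup.mem_inf, Subgroup.mem_prod]
  simp only [mem_conjGraph, one_mul, inv_one, mul_one, Subgroup.mem_top, and_true, mem_op]
  constructor
  · rintro ⟨rfl, h⟩
    obtain ⟨-, e, he, h⟩ := C.mem_dst.1 h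
    exact ⟨e, C.mem_src.2 ⟨he, k, hk, h⟩, h, h⟩
  · rintro ⟨e, he, h, h'⟩
    exact ⟨(C.isGraph_grp x).left_unique h h', C.mem_dst.2 ⟨hk, e, C.src_le _ _ _ he, h⟩⟩

theorem isInnerHom_id (H : Subgroup P) : IsInnerHom R F H (AddMonoidHom.id M) :=
  ⟨fun _ _ _ _ => rfl, fun _ _ => rfl⟩

open Classical in
/-- The relative trace of the identity map of `M` to `S` is surjective. -/
theorem relTrace_id_surjective {p : ℕ} [Fact p.Prime] (hS : IsPGroup p S) (hF : F.IsSaturated p)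
    (hR : IsPLocal p R) (C : F.CentricBiset) (hM : IsSupportedOnCentric R F M) :
    Function.Surjective (relTrace C hM le_rfl (isInnerHom_id (R := R) (F := F) (M := M) S)) := by
  set t := relTrace C hM le_rfl (isInnerHom_id (R := R) (F := F) (M := M) S) with ht
  have key : ∀ (n : ℕ) (D : Subgroup P), D ≤ S → Nat.card D = n → ∀ m : M,
      beta R F D D (conjGraph 1) • m ∈ LinearMap.range t := by
    intro n
    induction n using Nat.strong_induction_on with
    | _ n ih =>
    intro D hD hn m
    have hloc : F.IsLocalGraph D D (conjGraph 1) := .of_conjGraph hD hD (one_mem S)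
    set m' := beta R F D D (conjGraph 1) • m with hm'
    have hm'' : beta R F D D (conjGraph 1) • m' = m' := by
      rw [hm', smul_smul, beta_mul_one hloc]
    have h1 : t m' = orbSum (C.rel D S) fun x => (tIn R C D S x * tOut R C D S x) • m' := by
      refine (pairSum_beta_smul le_rfl hloc m).trans (orbSum_congr fun x => ?_)
      exact smul_smul _ _ _
    -- A point that is full on `D` contributes `m'` itself. Any other point contributes an element
    -- induced from a proper subgroup of `D`, which lies in the range by induction on the order.
    have h2 : ∀ x, (tIn R C D S x * tOut R C D S x) • m' -
        (if C.IsFull D x then 1 else 0 : ℕ) • m' ∈ LinearMap.range t := by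
      intro x
      rw [tIn_mul_tOut C hD le_rfl x]
      by_cases hx : C.IsFull D x
      · have h3 : C.dst D S x = D := le_antisymm (C.dst_le _ _ _) fun d hd =>
          C.mem_dst.2 ⟨hd, hx d hd⟩
        rw [h3, beta_mul_one hloc, hm'', if_pos hx, one_smul, sub_self]
        exact zero_mem _
      · rw [if_neg hx, zero_smul, sub_zero, mul_smul]
        refine Submodule.smul_mem _ _ ?_
        have hR := (C.dst_le D S x).trans hD
        rw [← one_mul_beta (.of_conjGraph hR hD (one_mem S)), mul_smul]
        refine ih _ ?_ _ hR rfl _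
        rw [← hn]
        refine lt_of_le_of_ne (Subgroup.card_le_of_le (C.dst_le _ _ _)) fun h => hx fun d hd => ?_
        rw [← Subgroup.eq_of_le_of_card_ge (C.dst_le D S x) h.ge] at hd
        exact (C.mem_dst.1 hd).2
    have h3 : t m' - C.numFull D • m' ∈ LinearMap.range t := by
      have h4 := map_orbSum (C.rel D S) (fun x => if C.IsFull D x then 1 else 0)
        ((smulAddHom ℕ M).flip m')
      rw [C.orbSum_isFull D] at h4
      have h5 : t m' = (orbSum (C.rel D S) fun x => ((tIn R C D S x * tOut R C D S x) • m' -
          (if C.IsFull D x then 1 else 0 : ℕ) • m')) + C.numFull D • m' := by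
        refine Eq.trans ?_ (congrArg _ h4.symm)
        rw [← orbSum_add, h1]
        exact orbSum_congr fun x => (sub_add_cancel _ _).symm
      rw [h5, add_sub_cancel_right]
      exact orbSum_mem _ _ _ h2
    have h4 : C.numFull D • m' ∈ LinearMap.range t := by
      have := sub_mem (LinearMap.mem_range_self t m') h3
      rwa [sub_sub_cancel] at this
    -- The range therefore contains `numFull D • m'`, and `numFull D`, being prime to `p`, is
    -- invertible in the `p`-local ring.
    have hu := (hR.isUnit_natCast (C.not_dvd_numFull hS hF hD)).map
      (algebraMap R (MackeyAlgebra R F))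
    rw [map_natCast] at hu
    rw [← Nat.cast_smul_eq_nsmul (MackeyAlgebra R F)] at h4
    exact (Submodule.smul_mem_iff_of_isUnit _ hu).1 h4
  intro m
  rw [← LinearMap.mem_range, ← one_smul (MackeyAlgebra R F) m, one_eq_sum, Finset.sum_smul]
  exact sum_mem fun K hK => key _ K (by simpa using hK) rfl m

theorem finite_base [Module.Finite (MackeyAlgebra R F) M] :
    @Module.Finite R M _ _ (Module.compHom M (algebraMap R (MackeyAlgebra R F))) := by
  let _ := Module.compHom M (algebraMap R (MackeyAlgebra R F))
  have : IsScalarTower R (MackeyAlgebra R F) M := .of_algebraMap_smul fun _ _ => rfl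
  exact .trans (MackeyAlgebra R F) M

/-- The trace of the identity from `S` is a surjective endomorphism of a module that is finite over
`R`, hence bijective. Its inverse corrects the lift of the trace to a section of `θ_S`. -/
theorem isRelProjective_univ {p : ℕ} [Fact p.Prime] (hS : IsPGroup p S) (hF : F.IsSaturated p)
    (hR : IsPLocal p R) (hM : IsSupportedOnCentric R F M) [Module.Finite (MackeyAlgebra R F) M] :
    IsRelProjective R F M Set.univ := by
  obtain ⟨C⟩ := nonempty_centricBiset hS hF
  have hs := relTrace_id_surjective hS hF hR C hM
  set t := relTrace C hM le_rfl (isInnerHom_id (R := R) (F := F) (M := M) S)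
  have hi : Function.Injective t := by
    let _ := Module.compHom M (algebraMap R (MackeyAlgebra R F))
    have : IsScalarTower R (MackeyAlgebra R F) M := .of_algebraMap_smul fun _ _ => rfl
    have : Module.Finite R M := finite_base
    exact OrzechProperty.injective_of_surjective_endomorphism (t.restrictScalars R) hs
  rw [isRelProjective_iff]
  refine AddSubgroup.mem_iSup_of_mem ⟨⟨S, F.isCentric_top⟩, trivial⟩ ?_
  obtain ⟨u, hu⟩ := relTrace_mem_traces C hM (H := ⟨S, F.isCentric_top⟩)
    (isInnerHom_id (R := R) (F := F) (M := M) S)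
  refine ⟨u ∘ₗ (LinearEquiv.ofBijective t ⟨hi, hs⟩).symm.toLinearMap, LinearMap.ext fun m => ?_⟩
  refine (LinearMap.congr_fun hu _).trans ?_
  exact (LinearEquiv.ofBijective t ⟨hi, hs⟩).apply_symm_apply m

end MackeyAlgebra

/-! ### Endomorphisms of indecomposable modules over a finite algebra over a complete local ring -/

/-- For a finite module over a Noetherian ring completion is the tensor product with the completed
ring, which here is `R` itself. -/
theorem isAdicComplete_of_finite {R B : Type w} [CommRing R] [IsNoetherianRing R] (I : Ideal R)
    [IsAdicComplete I R] [AddCommGroup B] [Module R B] [Module.Finite R B] :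
    IsAdicComplete I B := by
  rw [← AdicCompletion.of_bijective_iff]
  let e := (TensorProduct.lid R B).symm.trans
    (LinearEquiv.rTensor B (AdicCompletion.ofLinearEquiv I R))
  have h := (AdicCompletion.ofTensorProduct_bijective_of_finite_of_isNoetherian I B).comp
    e.bijective
  convert h using 1
  funext b
  have h1 : e b = (1 : AdicCompletion I R) ⊗ₜ[R] b := by
    change (AdicCompletion.ofLinearEquiv I R).rTensor B ((TensorProduct.lid R B).symm b) = _
    rw [TensorProduct.lid_symm_apply]
    rfl
  rw [Function.comp_apply, h1, AdicCompletion.ofTensorProduct_tmul, one_smul]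

/-- In a finite commutative algebra over a complete local ring, each element is topologically
nilpotent on one factor of a decomposition, and invertible on the other. -/
theorem exists_isIdempotentElem_pow {R B : Type w} [CommRing R] [IsNoetherianRing R]
    [IsLocalRing R] [IsAdicComplete (IsLocalRing.maximalIdeal R) R] [CommRing B] [Algebra R B]
    [Module.Finite R B] (x : B) : ∃ e : B, IsIdempotentElem e ∧ ∃ (n : ℕ) (y : B),
      x * y - e ∈ (IsLocalRing.maximalIdeal R).map (algebraMap R B) ∧
      x ^ n * (1 - e) ∈ (IsLocalRing.maximalIdeal R).map (algebraMap R B) := by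
  set J := (IsLocalRing.maximalIdeal R).map (algebraMap R B) with hJ
  have hB : IsAdicComplete J B := (IsAdicComplete.map_algebraMap_iff _ _).2
    (isAdicComplete_of_finite (IsLocalRing.maximalIdeal R))
  let _ : Field (R ⧸ IsLocalRing.maximalIdeal R) := Ideal.Quotient.field _
  have : Module.Finite (R ⧸ IsLocalRing.maximalIdeal R) (B ⧸ J) :=
    Module.Finite.of_restrictScalars_finite R _ _
  have : IsArtinianRing (B ⧸ J) := isArtinian_of_tower (R ⧸ IsLocalRing.maximalIdeal R)
    inferInstance
  -- In the Artinian ring `B ⧸ J` the powers of `x` stabilize up to multiples: `x ^ (n + 1) * y = x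
  -- ^ n` modulo `J`.
  obtain ⟨n, y, hy⟩ := IsArtinian.exists_pow_succ_smul_dvd (Ideal.Quotient.mk J x) (1 : B ⧸ J)
  obtain ⟨y, rfl⟩ := Ideal.Quotient.mk_surjective y
  set q := Ideal.Quotient.mk J
  have h1 : q x ^ n * (q x * q y) = q x ^ n := by
    simpa [smul_eq_mul, pow_succ, mul_assoc] using hy
  have h2 : ∀ k, q x ^ n * (q x * q y) ^ k = q x ^ n := by
    intro k
    induction k with
    | zero => rw [pow_zero, mul_one]
    | succ k ih => rw [pow_succ, ← mul_assoc, ih, h1]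
  -- The exponent `n + 1` makes `a` divisible by `x ^ n`, on which `x * y` acts as the identity
  -- modulo `J`, so that `a` is idempotent modulo `J`. It also makes `a` divisible by `x`, with the
  -- quotient `x ^ n * y ^ (n + 1)` used as witness below.
  set a := (x * y) ^ (n + 1) with ha
  have h3 : q x ^ n * q a = q x ^ n := by
    rw [ha, map_pow, map_mul, h2]
  have hc : q a = q x ^ n * (q x * q y ^ (n + 1)) := by
    rw [ha, map_pow, map_mul]
    ring
  have h4 : q a * q a = q a :=
    calc q a * q a = q a * (q x ^ n * (q x * q y ^ (n + 1))) := congrArg (q a * ·) hc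
      _ = q x ^ n * q a * (q x * q y ^ (n + 1)) := by ring
      _ = q a := by rw [h3, ← hc]
  have h5 : (Polynomial.X ^ 2 - Polynomial.X : Polynomial B).eval a ∈ J := by
    rw [← Ideal.Quotient.eq_zero_iff_mem]
    change q _ = 0
    rw [Polynomial.eval_sub, Polynomial.eval_pow, Polynomial.eval_X, pow_two, map_sub, map_mul, h4,
      sub_self]
  -- The derivative `2 * a - 1` has square `1` modulo `J`, so Hensel's lemma lifts `a` to an
  -- idempotent of `B`.
  have h6 : IsUnit (q ((Polynomial.X ^ 2 - Polynomial.X : Polynomial B).derivative.eval a)) := by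
    have : (Polynomial.X ^ 2 - Polynomial.X : Polynomial B).derivative.eval a = 2 * a - 1 := by
      simp [one_add_one_eq_two]
    rw [this, map_sub, map_mul, map_ofNat, map_one]
    refine IsUnit.of_mul_eq_one (2 * q a - 1) ?_
    linear_combination 4 * h4
  obtain ⟨e, he, hea⟩ := HenselianRing.is_henselian (I := J) _
    (Polynomial.monic_X_pow_sub (Polynomial.degree_X_le.trans_lt (by norm_num))) a h5 h6
  refine ⟨e, ?_, n, x ^ n * y ^ (n + 1), ?_, ?_⟩
  · have : e ^ 2 - e = 0 := by simpa using he
    rw [IsIdempotentElem, ← pow_two]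
    exact sub_eq_zero.1 this
  · have : x * (x ^ n * y ^ (n + 1)) - e = -(e - a) := by
      rw [ha]
      ring
    rw [this]
    exact neg_mem hea
  · rw [← Ideal.Quotient.eq_zero_iff_mem] at hea ⊢
    have : q e = q a := by
      rw [← sub_eq_zero, ← map_sub]
      exact hea
    change q (x ^ n * (1 - e)) = 0
    rw [map_mul, map_sub, map_one, map_pow, this, mul_sub, h3, mul_one, sub_self]

/-- The endomorphism ring of an indecomposable module is local. -/
theorem IsIndecomposableModule.isUnit_or_isUnit {R : Type w} [CommRing R] [IsNoetherianRing R]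
    [IsLocalRing R] [IsAdicComplete (IsLocalRing.maximalIdeal R) R] {A : Type*} [Ring A]
    [Algebra R A] {M : Type v} [AddCommGroup M] [Module A M] [Module R M] [IsScalarTower R A M]
    [Module.Finite R M] (hM : IsIndecomposableModule A M) (a : Module.End A M) :
    IsUnit a ∨ IsUnit (1 - a) := by
  have hcomm : SMulCommClass A R M := IsScalarTower.to_smulCommClass'
  -- The endomorphism is integral over `R`. The problem moves to the finite commutative algebra
  -- `R[X] / (p)`, which acts on `M` through `a`.
  obtain ⟨p, hp, hpa⟩ := LinearMap.exists_monic_and_aeval_eq_zero R (a.restrictScalars R)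
  have hpa' : Polynomial.aeval a p = 0 := by
    have h : ∀ f : Polynomial R, (Polynomial.aeval a f).restrictScalars R =
        Polynomial.aeval (a.restrictScalars R) f := by
      intro f
      refine LinearMap.ext fun m => ?_
      induction f using Polynomial.induction_on' with
      | add f g hf hg =>
        rw [map_add, map_add, LinearMap.add_apply, ← hf, ← hg]
        rfl
      | monomial n r =>
        rw [Polynomial.aeval_monomial, Polynomial.aeval_monomial, Module.End.mul_apply,
          Module.End.pow_apply]
        change r • (a ^ n) m = r • a^[n] m
        rw [Module.End.pow_apply]
    have h1 := h p
    rw [hpa] at h1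
    exact LinearMap.ext fun m => LinearMap.congr_fun h1 m
  let B := Polynomial R ⧸ Ideal.span {p}
  have : Module.Finite R B := hp.finite_quotient
  let φ : B →ₐ[R] Module.End A M := Ideal.Quotient.liftₐ (Ideal.span {p}) (Polynomial.aeval a) (by
    intro f hf
    obtain ⟨g, rfl⟩ := Ideal.mem_span_singleton'.1 hf
    rw [map_mul, hpa', mul_zero])
  set x : B := Ideal.Quotient.mk _ Polynomial.X with hx
  have hφx : φ x = a := by
    change Polynomial.aeval a Polynomial.X = a
    rw [Polynomial.aeval_X]
  set 𝔪 := IsLocalRing.maximalIdeal R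
  have hJ : ∀ b ∈ 𝔪.map (algebraMap R B), ∀ m : M, φ b m ∈ 𝔪 • (⊤ : Submodule R M) := by
    intro b hb
    refine Submodule.span_induction ?_ ?_ ?_ ?_ hb
    · rintro _ ⟨r, hr, rfl⟩ m
      rw [AlgHom.commutes]
      exact Submodule.smul_mem_smul hr trivial
    · intro m
      rw [map_zero]
      exact zero_mem _
    · intro b c _ _ h h' m
      rw [map_add]
      exact add_mem (h m) (h' m)
    · intro c b _ h m
      rw [smul_eq_mul, mul_comm, map_mul]
      exact h _
  -- By Nakayama's lemma an endomorphism with a right inverse modulo the maximal ideal is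
  -- surjective, hence invertible as `M` is finite over `R`.
  have hnak : ∀ b c : Module.End A M,
      (∀ m, b (c m) - m ∈ 𝔪 • (⊤ : Submodule R M)) → IsUnit b := by
    intro b c h
    have h1 : (⊤ : Submodule R M) ≤ LinearMap.range (b.restrictScalars R) := by
      refine Submodule.le_of_le_smul_of_le_jacobson_bot (I := 𝔪) Module.Finite.fg_top
        (IsLocalRing.maximalIdeal_le_jacobson _) fun m _ => ?_
      have : m = b (c m) - (b (c m) - m) := by abel
      rw [this]
      exact sub_mem (Submodule.mem_sup_left ⟨c m, rfl⟩) (Submodule.mem_sup_right (h m))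
    have hs : Function.Surjective (b.restrictScalars R) :=
      LinearMap.range_eq_top.1 (top_le_iff.1 h1)
    exact (Module.End.isUnit_iff b).2
      ⟨OrzechProperty.injective_of_surjective_endomorphism (b.restrictScalars R) hs, hs⟩
  -- Indecomposability makes the idempotent act as `0` or `1`. In the first case `a ^ n` vanishes
  -- modulo the maximal ideal and the geometric series inverts `1 - a` there; in the second case `y`
  -- provides an inverse of `a` there.
  obtain ⟨e, he, n, y, h1, h2⟩ := exists_isIdempotentElem_pow (R := R) x
  have hid : IsIdempotentElem (φ e) := he.map φ
  rcases hM.2 _ _ (LinearMap.IsIdempotentElem.isCompl hid) with h | h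
  · right
    have h0 : φ e = 0 := LinearMap.range_eq_bot.1 h
    refine hnak _ (∑ i ∈ Finset.range n, a ^ i) fun m => ?_
    have h3 : ((1 - a) * ∑ i ∈ Finset.range n, a ^ i) = 1 - a ^ n := mul_neg_geom_sum a n
    have h4 := hJ _ h2 m
    rw [map_mul, map_sub, map_one, h0, sub_zero, mul_one, map_pow, hφx] at h4
    have h5 : (1 - a) ((∑ i ∈ Finset.range n, a ^ i) m) - m = -((a ^ n) m) := by
      rw [← Module.End.mul_apply, h3]
      change m - (a ^ n) m - m = _
      abel
    rw [h5]
    exact neg_mem h4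
  · left
    have h0 : φ e = 1 := by
      refine LinearMap.ext fun m => LinearMap.ker_eq_bot.1 h ?_
      exact LinearMap.congr_fun hid m
    refine hnak _ (φ y) fun m => ?_
    have h4 := hJ _ h1 m
    rwa [map_sub, map_mul, h0, hφx] at h4

/-! ### Comparison of fusion systems, and subconjugacy -/

namespace FusionSystem

open GroupRel BisetMatrix

variable {P : Type u} [Group P] {S T : Subgroup P} {F : FusionSystem S} {G : FusionSystem T}

theorem IsConj.of_isSub {H K : Subgroup P} (h : F.IsConj H K) (hFG : F.IsSub G) : G.IsConj H K :=
  let ⟨φ, hφ, hb⟩ := h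
  ⟨φ, hFG H K hφ, hb⟩

/-- A subgroup has fewer conjugates in the smaller system, and centralizers are taken in the smaller
group `S`. Consequently a `G`-centric functor is `F`-centric and the theory of traces over `F`
applies to it. -/
theorem IsCentric.of_isSub {H : Subgroup P} (h : G.IsCentric H) (hFG : F.IsSub G) (hH : H ≤ S) :
    F.IsCentric H :=
  ⟨hH, fun K hK => (inf_le_inf_right _ hFG.le).trans (h.2 K (hK.of_isSub hFG))⟩

theorem IsConj.isSubconj {H K : Subgroup P} (h : F.IsConj H K) : F.IsSubconj H K :=
  ⟨K, le_rfl, h⟩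

theorem IsSubconj.trans {H K L : Subgroup P} (h : F.IsSubconj H K) (h' : F.IsSubconj K L) :
    F.IsSubconj H L := by
  obtain ⟨J, hJ, h1⟩ := h
  obtain ⟨J', hJ', φ, hφ, hb⟩ := h'
  have hD := F.isGraph_of_hom (hom_restrict hφ hJ)
  have hdom : dom (twistedDiagonal (φ.comp (Subgroup.inclusion hJ))) = J := by
    ext b
    rw [mem_dom]
    exact ⟨fun ⟨a, h⟩ => (mem_twistedDiagonal.1 h).1, fun h => ⟨_, mem_twistedDiagonal.2 ⟨h, rfl⟩⟩⟩
  refine ⟨_, fun a ha => ?_, h1.trans (hdom ▸ hD.isConj)⟩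
  obtain ⟨b, h⟩ := mem_ran.1 ha
  obtain ⟨hb, rfl⟩ := mem_twistedDiagonal.1 h
  exact hJ' (SetLike.coe_mem _)

theorem IsSubconj.card_le [Finite P] {H K : Subgroup P} (h : F.IsSubconj H K) :
    Nat.card H ≤ Nat.card K := by
  obtain ⟨J, hJ, h1⟩ := h
  rw [h1.card_eq]
  exact Subgroup.card_le_of_le hJ

theorem IsSubconj.isConj [Finite P] {H K : Subgroup P} (h : F.IsSubconj H K)
    (h' : F.IsSubconj K H) : F.IsConj H K := by
  obtain ⟨J, hJ, h1⟩ := h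
  rwa [Subgroup.eq_of_le_of_card_ge hJ (h1.card_eq ▸ h'.card_le)] at h1

end FusionSystem

/-! ### Defect sets and vertices -/

namespace MackeyAlgebra

open BisetSemiring GroupRel FusionSystem

variable {P : Type u} [Group P] [Finite P] {S T : Subgroup P}
  {R : Type w} [CommRing R] {F : FusionSystem S} {G : FusionSystem T}
  {M : Type v} [AddCommGroup M] [Module (MackeyAlgebra R F) M]
  {N : Type v} [AddCommGroup N] [Module (MackeyAlgebra R F) N] {p : ℕ} [Fact p.Prime]

theorem isSupportedOnCentric_of_isSub (hFG : F.IsSub G)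
    (hM : IsCentricMackeyFunctor R G F M) : IsSupportedOnCentric R F M := by
  intro K hK hc m
  rw [← idem_eq_beta hK]
  exact hM.centric K hK (fun h => hc (h.of_isSub hFG hK)) m

/-- The family of all centric subgroups qualifies, so by finiteness there is a minimal member; since
members can be intersected, it is contained in every other one. -/
theorem exists_least_isRelProjective (hS : IsPGroup p S) (hF : F.IsSaturated p)
    (hR : IsPLocal p R) (hM : IsSupportedOnCentric R F M) [Module.Finite (MackeyAlgebra R F) M] :
    ∃ X : Set F.Centric, IsLeast {Y | IsSubconjClosed F Y ∧ IsRelProjective R F M Y} X := by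
  obtain ⟨C⟩ := nonempty_centricBiset hS hF
  obtain ⟨X, hX⟩ := (Set.toFinite {Y | IsSubconjClosed F Y ∧ IsRelProjective R F M Y}).exists_minimal
    ⟨Set.univ, fun _ _ _ _ => trivial, isRelProjective_univ hS hF hR hM⟩
  refine ⟨X, hX.prop, fun Y hY => ?_⟩
  have h : X ∩ Y ∈ {Y | IsSubconjClosed F Y ∧ IsRelProjective R F M Y} :=
    ⟨fun H K hK h => ⟨hX.prop.1 H K hK.1 h, hY.1 H K hK.2 h⟩,
      isRelProjective_inter C hM hX.prop.1 hY.1 hX.prop.2 hY.2⟩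
  exact (hX.le_of_le h Set.inter_subset_left).trans Set.inter_subset_right

/-- A module that is projective relative to a family, with local endomorphism ring, is projective
relative to one member. -/
theorem exists_id_mem_traces [Nontrivial M]
    (hloc : ∀ a : Module.End (MackeyAlgebra R F) M, IsUnit a ∨ IsUnit (1 - a))
    {X : Set F.Centric} (hX : IsRelProjective R F M X) :
    ∃ H ∈ X, LinearMap.id ∈ traces R F M H := by
  have key : ∀ φ : Module.End (MackeyAlgebra R F) M, φ ∈ ⨆ H : X, traces R F M H.1 → IsUnit φ →
      ∃ H ∈ X, ∃ ψ ∈ traces R F M H, IsUnit (ψ : Module.End (MackeyAlgebra R F) M) := by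
    intro φ hφ
    induction hφ using AddSubgroup.iSup_induction' with
    | hp H φ hφ => exact fun hu => ⟨H.1, H.2, φ, hφ, hu⟩
    | h1 => exact fun hu => absurd hu not_isUnit_zero
    | hadd φ φ' _ _ h h' =>
      rintro ⟨w, hw⟩
      replace hw : (w : Module.End (MackeyAlgebra R F) M) = φ + φ' := hw
      rcases hloc (φ * ↑w⁻¹) with hu | hu
      · exact h ((Units.isUnit_mul_units _ _).1 hu)
      · refine h' ((Units.isUnit_mul_units φ' w⁻¹).1 ?_)
        convert hu using 1
        rw [eq_sub_iff_add_eq, ← add_mul, add_comm φ', ← hw, Units.mul_inv]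
  obtain ⟨H, hH, ψ, hψ, w, hw⟩ := key LinearMap.id (isRelProjective_iff.1 hX) isUnit_one
  refine ⟨H, hH, ?_⟩
  obtain ⟨u, hu⟩ := hψ
  refine ⟨u ∘ₗ (↑w⁻¹ : Module.End (MackeyAlgebra R F) M), ?_⟩
  change (theta R F M H ∘ₗ u) ∘ₗ (↑w⁻¹ : Module.End (MackeyAlgebra R F) M) = _
  replace hu : theta R F M H ∘ₗ u = (w : Module.End (MackeyAlgebra R F) M) := hu.trans hw.symm
  rw [hu]
  exact w.mul_inv

theorem isRelProjective_of_isSummand (C : F.CentricBiset) (hM : IsSupportedOnCentric R F M)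
    (hN : IsSupportedOnCentric R F N) (h : IsSummand (MackeyAlgebra R F) M N) {X : Set F.Centric}
    (hX : IsRelProjective R F N X) : IsRelProjective R F M X := by
  obtain ⟨M', L, hc, ⟨e⟩⟩ := h
  rw [isRelProjective_iff] at hX ⊢
  have key : ∀ φ ∈ ⨆ H : X, traces R F N H.1,
      (e.symm.toLinearMap ∘ₗ M'.projectionOnto L hc) ∘ₗ φ ∘ₗ (M'.subtype ∘ₗ e.toLinearMap) ∈
        ⨆ H : X, traces R F M H.1 := by
    intro φ hφ
    induction hφ using AddSubgroup.iSup_induction' with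
    | hp H φ hφ =>
      exact AddSubgroup.mem_iSup_of_mem H (comp_relTrace_comp_mem C hN hM hφ _ _)
    | h1 => rw [LinearMap.zero_comp, LinearMap.comp_zero]; exact zero_mem _
    | hadd φ φ' _ _ h h' => rw [LinearMap.add_comp, LinearMap.comp_add]; exact add_mem h h'
  convert key _ hX using 1
  refine LinearMap.ext fun m => ?_
  simp

/-- The relative trace of a subgroup that is not `G`-centric vanishes on a `G`-centric functor. -/
theorem isCentric_of_id_mem_traces (C : F.CentricBiset) (hFG : F.IsSub G)
    (hM : IsCentricMackeyFunctor R G F M) [Nontrivial M] {H : F.Centric}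
    (h : LinearMap.id ∈ traces R F M H) : G.IsCentric H.1 := by
  by_contra hc
  obtain ⟨u, hu⟩ := h
  obtain ⟨f, hf, hf'⟩ := exists_relTrace_eq C (isSupportedOnCentric_of_isSub hFG hM) H
    (isSupportedOnCentric_of_isSub hFG hM) u
  have h0 : (LinearMap.id : M →ₗ[MackeyAlgebra R F] M) = 0 := by
    rw [← hu]
    refine hf'.trans (relTrace_eq_zero C _ _ _ fun E hE m => ?_)
    rw [← idem_eq_beta (hE.trans H.2.1)]
    exact hM.centric E _ (fun h => hc (h.of_le hE (H.2.1.trans hFG.le))) m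
  obtain ⟨m, hm⟩ := exists_ne (0 : M)
  exact hm (LinearMap.congr_fun h0 m)

end MackeyAlgebra

open MackeyAlgebra FusionSystem in
theorem mainTheorem7 {p : ℕ} [Fact p.Prime] {P : Type u} [Group P] [Finite P] {S : Subgroup P}
    (hS : IsPGroup p S) (F : FusionSystem S) (hF : F.IsSaturated p)
    {R : Type w} [CommRing R] (hR : IsPLocal p R) :
    (∀ (M : Type v) [AddCommGroup M] [Module (MackeyAlgebra R F) M],
      IsCentricMackeyFunctor R F F M → ∃! X : Set F.Centric, IsDefectSet R F M X) ∧
    (∀ [IsDomain R] [IsPrincipalIdealRing R] [IsLocalRing R]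
      [IsAdicComplete (IsLocalRing.maximalIdeal R) R]
      {T : Subgroup P} (_hT : IsPGroup p T) (G : FusionSystem T) (_hG : G.IsSaturated p)
      (_hFG : F.IsSub G)
      (M : Type v) [AddCommGroup M] [Module (MackeyAlgebra R F) M],
      IsCentricMackeyFunctor R G F M → IsIndecomposableModule (MackeyAlgebra R F) M →
        AdmitsVertex R F M ∧ (∃ V : F.Centric, IsVertex R F M V) ∧
        ∀ V : F.Centric, IsVertex R F M V →
          G.IsCentric V.1 ∧
          ∀ (N : Type v) [AddCommGroup N] [Module (MackeyAlgebra R F) N],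
            IsCentricMackeyFunctor R F F N → IsSummand (MackeyAlgebra R F) M N →
              ∀ X : Set F.Centric, IsDefectSet R F N X → V ∈ X) := by
  have hFF : F.IsSub F := fun _ _ => subset_rfl
  constructor
  · intro M _ _ hM
    have := hM.finite
    obtain ⟨X, hX⟩ := exists_least_isRelProjective hS hF hR (isSupportedOnCentric_of_isSub hFF hM)
    exact ⟨X, hX.minimal, fun Y hY => hY.eq_of_le hX.1 (hX.2 hY.prop) |>.symm⟩
  · intro _ _ _ _ T _ G _ hFG M _ _ hM hind
    obtain ⟨C⟩ := nonempty_centricBiset hS hF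
    have := hM.finite
    have := hind.1
    have hsupp := isSupportedOnCentric_of_isSub hFG hM
    obtain ⟨X, hX⟩ := exists_least_isRelProjective hS hF hR hsupp
    have hdef : ∀ {Y}, IsDefectSet R F M Y → Y = X := fun hY =>
      hY.eq_of_le hX.1 (hX.2 hY.prop) |>.symm
    have hloc : ∀ a : Module.End (MackeyAlgebra R F) M, IsUnit a ∨ IsUnit (1 - a) := by
      let _ := Module.compHom M (algebraMap R (MackeyAlgebra R F))
      have : IsScalarTower R (MackeyAlgebra R F) M := .of_algebraMap_smul fun _ _ => rfl
      have : Module.Finite R M := finite_base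
      exact hind.isUnit_or_isUnit (R := R)
    obtain ⟨H, hHX, hH⟩ := exists_id_mem_traces hloc hX.1.2
    -- The centric subgroups that are `F`-subconjugate to `H` form a closed family, and `M` is
    -- projective relative to it because it contains `H`. The least family `X` is contained in it,
    -- so the maximal elements of `X` are exactly the conjugates of `H`.
    have hle : ∀ K ∈ X, F.IsSubconj K.1 H.1 := by
      refine fun K hK => hX.2 (show {K : F.Centric | F.IsSubconj K.1 H.1} ∈ _ from
        ⟨fun _ _ h h' => h'.trans h, isRelProjective_iff.2 ?_⟩) hK
      exact AddSubgroup.mem_iSup_of_mem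
        (⟨H, (isConj_refl F H.2.1).isSubconj⟩ : {K : F.Centric | F.IsSubconj K.1 H.1}) hH
    have hgrp : ∀ V : F.Centric, IsDefectGroup R F M V ↔ F.IsConj V.1 H.1 := by
      intro V
      constructor
      · rintro ⟨Y, hY, hVY, hV⟩
        obtain rfl := hdef hY
        exact (hle V hVY).isConj (hV H hHX (hle V hVY))
      · intro hV
        exact ⟨X, hX.minimal, hX.1.1 V H hHX hV.isSubconj,
          fun W hW _ => (hle W hW).trans hV.symm.isSubconj⟩
    have hvert : AdmitsVertex R F M := ⟨⟨H, (hgrp H).2 (isConj_refl F H.2.1)⟩, fun V W hV hW =>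
      ((hgrp V).1 hV).trans ((hgrp W).1 hW).symm⟩
    refine ⟨hvert, ?_, ?_⟩
    · obtain ⟨V, hV, hn⟩ := F.exists_isFullyNormalized H.2.1
      exact ⟨⟨V, H.2.isConj hV⟩, hvert, (hgrp ⟨V, H.2.isConj hV⟩).2 hV.symm, hn⟩
    · rintro V ⟨-, hV, -⟩
      have hVH := (hgrp V).1 hV
      -- The `G`-centricity of `H` is known because the identity is a trace from `H`; it passes to
      -- `V`, which is conjugate to `H` in `F` and so in `G`.
      refine ⟨(isCentric_of_id_mem_traces C hFG hM hH).isConj (hVH.symm.of_isSub hFG), ?_⟩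
      intro N _ _ hN hMN Y hY
      have hY' : IsRelProjective R F M Y :=
        isRelProjective_of_isSummand C hsupp (isSupportedOnCentric_of_isSub hFF hN) hMN hY.prop.2
      -- `M` inherits projectivity relative to the defect set of `N`, and this closed family
      -- contains the least one for `M`.
      exact hX.2 ⟨hY.prop.1, hY'⟩ (hX.1.1 V H hHX hVH.isSubconj)
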